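/- Let $T$ be a finite tree with $p\ge 2$ vertices and root $v_0$; write $d(v)$ for the degree of $v$, let all edges have the same length $l>0$ and be directed away from $v_0$, and let a real potential $q_e\in L^2(0,l)$ be given on every edge $e$. (The potentials need not be equal or symmetric; equal potentials with $q(l-x)=q(x)$ are a special case.) On each edge consider $-y_e''+q_ey_e=\lambda y_e$ ($y_e'$ absolutely continuous, the equation almost everywhere). The Neumann problem imposes the standard conditions at every vertex: continuity, and the Kirchhoff condition that the derivative at the end of the incoming edge equals the sum of the derivatives at the beginning of the outgoing edges (at $v_0$: the sum of the outgoing derivatives is $0$; at a pendant vertex: the derivative is $0$). The Dirichlet problem imposes $y_e(0)=0$ on all edges at $v_0$ and the standard conditions at all other vertices. Spectra are taken over $\mathbb C$ and counted with multiplicity. Let $D$ be the diagonal matrix of degrees, $A$ the adjacency matrix, $\psi(z)=\det(-zD+A)$, and $\hat\psi(z)=\det(-z\hat D+\hat A)$ where $\hat D,\hat A$ arise from $D,A$ by deleting the row and column of $v_0$. For the neighbours $w_1,\dots,w_{d(v_0)}$ of $v_0$ let $T_i$ be the subtree formed by $v_0$, the edge $v_0w_i$ and the branch hanging at $w_i$,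 let $p_i$ be its number of vertices, and let $\hat\psi_i(z)=\det(-z\hat D_i+\hat A_i)$, where $\hat D_i,\hat A_i$ are the blocks of $\hat D,\hat A$ belonging to the vertices of $T_i$ other than $v_0$. Then $\hat\psi=\prod_i\hat\psi_i\ne0$. **Theorem 4.1.** (a) All eigenvalues of both problems are real and of finite multiplicity. The Neumann spectrum is the union of $2p-3$ sequences $(\lambda^{(i)}_k)_{k\ge1}$ for which there are constants $-1=\alpha_1\le\alpha_2\le\dots\le\alpha_p=1$ with, as $k\to\infty$, $$\sqrt{\lambda^{(1)}_k}=\frac{\pi(k-1)}l+O\Big(\frac1k\Big),\qquad \sqrt{\lambda^{(i)}_k}=\frac{2\pi(k-1)}l+\frac1l\arccos\alpha_i+O\Big(\frac1k\Big),$$ $$\sqrt{\lambda^{(i+p-2)}_k}=\frac{2\pi k}l-\frac1l\arccos\alpha_i+O\Big(\frac1k\Big)\qquad(2\le i\le p-1).$$ For every such splitting, $\alpha_1,\dots,\alpha_p$ are the zeros of $\psi$ with multiplicities. (b) The Dirichlet spectrum is the union over $i=1,\dots,d(v_0)$ of the Dirichlet spectra of the $T_i$, and the latter is the union of $2(p_i-1)$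 sequences $(\nu^{(i)}_{k,j})_{k\ge1}$ for which there are constants $\beta_{i,j}\in[-1,1]$, $1\le j\le p_i-1$, with $$\sqrt{\nu^{(i)}_{k,j}}=\frac{2\pi(k-1)}l+\frac1l\arccos\beta_{i,j}+O\Big(\frac1k\Big),\qquad \sqrt{\nu^{(i)}_{k,j+p_i-1}}=\frac{2\pi k}l-\frac1l\arccos\beta_{i,j}+O\Big(\frac1k\Big).$$ For every such splitting of the Dirichlet spectrum of $T_i$, the $\beta_{i,j}$ are the zeros of $\hat\psi_i$ with multiplicities. (c) For all splittings of the Neumann and of the Dirichlet spectrum of $T$ into sequences with these asymptotics, $$\frac{\psi(z)}{\hat\psi(z)}=d(v_0)\,\frac{\prod_{i=1}^p(-z+\alpha_i)}{\prod_{i=1}^{d(v_0)}\prod_{j=1}^{p_i-1}(-z+\beta_{i,j})}$$ as rational functions. (d) The two spectra together with $d(v_0)$ determine the ratio: if another rooted tree with at least two vertices, with the same edge length $l$, real $L^2$ potentials and the same degree of the root, has the same Neumann spectrum and the same Dirichlet spectrum, then it has the same ratio $\psi/\hat\psi$. (e) The ratio is expanded into the branched continued fraction of the tree, $$\frac{\psi(z)}{\hat\psi(z)}=-d(v_0)z+\sum_{v\text{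 child of }v_0}\frac1{Q_v(z)},\qquad Q_v(z)=d(v)z-\sum_{u\text{ child of }v}\frac1{Q_u(z)},$$ with no denominator identically zero; and this expansion, as a formal expression up to the order of the summands, determines the rooted tree up to isomorphism. (It is not claimed that a rational function has only one expansion of this kind.) -/

import Mathlib

open Set Filter MeasureTheory Polynomial
open scoped Topology

universe u w

namespace QuantumTree

noncomputable section

section Tree

variable {V : Type u} [Fintype V] [DecidableEq V]
variable (G : SimpleGraph V) [DecidableRel G.Adj] (r : V)

/-- `u` is a child of `v`: in the tree `G` rooted at `r`, the edge `{v, u}`, directed away from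
the root, goes from `v` to `u`. -/
def IsChild (v u : V) : Prop := G.Adj v u ∧ G.dist r u = G.dist r v + 1

/-- The edges of the tree `G`, each with its direction away from the root `r`. The edge starts
(`x = 0`) at `e.1.fst` and ends (`x = l`) at `e.1.snd`. -/
abbrev Edge := {d : G.Dart // G.dist r d.snd = G.dist r d.fst + 1}

open Classical in
/-- For a neighbour `w` of the root `r`: the vertices other than the root of the subtree that hangs
at the root by the edge `{r, w}`, i.e. the vertices which can be joined to `w` avoiding `r`. -/
def branch (w : V) : Finset V :=
  Finset.univ.filter fun v => ∃ p : G.Walk w v, r ∉ p.support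

/-- The matrix `-z D + A` (`D` the diagonal matrix of degrees, `A` the adjacency matrix). -/
def pencil : Matrix V V ℝ[X] :=
  -((X : ℝ[X]) • G.degMatrix ℝ[X]) + G.adjMatrix ℝ[X]

/-- `ψ(z) = det (-z D + A)`. -/
def psi : ℝ[X] := (pencil G).det

/-- `ψ̂(z) = det (-z D̂ + Â)`: the row and the column of the root are deleted, the other vertices
keep their degree in the whole tree. -/
def psiHat : ℝ[X] :=
  ((pencil G).submatrix (Subtype.val : {v : V // v ≠ r} → V) Subtype.val).det

/-- The factor of `ψ̂` that belongs to the branch at the neighbour `w` of the root. The degrees are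
those in the subtree that contains the root, and not in the branch itself. -/
def psiHatBranch (w : V) : ℝ[X] :=
  ((pencil G).submatrix (Subtype.val : {v : V // v ∈ branch G r w} → V) Subtype.val).det

end Tree

/-! ### The boundary value problems -/

section Spectral

/-- `y` solves `-y'' + q y = z y` on `[0, l]`, with derivative `dy`: `y` is continuously
differentiable up to the end points, `y'` is absolutely continuous, and the equation holds
almost everywhere. -/
structure IsSolution (l : ℝ) (q : ℝ → ℝ) (z : ℂ) (y dy : ℝ → ℂ) : Prop where
  hasDeriv : ∀ x ∈ Icc 0 l, HasDerivWithinAt y (dy x) (Icc 0 l) x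
  absCont : AbsolutelyContinuousOnInterval dy 0 l
  equation : ∀ᵐ x ∂(volume.restrict (Ioo 0 l)), HasDerivAt dy (((q x : ℂ) - z) * y x) x

theorem IsSolution.zero (l : ℝ) (q : ℝ → ℝ) (z : ℂ) : IsSolution l q z 0 0 where
  hasDeriv x _ := hasDerivWithinAt_const x _ (0 : ℂ)
  absCont := by
    have h : LipschitzOnWith 0 (0 : ℝ → ℂ) (uIcc 0 l) := (LipschitzWith.const 0).lipschitzOnWith
    exact h.absolutelyContinuousOnInterval
  equation := Eventually.of_forall fun x => by
    have h := hasDerivAt_const x (0 : ℂ)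
    rw [show ((q x : ℂ) - z) * (0 : ℝ → ℂ) x = 0 from mul_zero _]
    exact h

theorem IsSolution.add {l : ℝ} {q : ℝ → ℝ} {z : ℂ} {y dy y' dy' : ℝ → ℂ}
    (h : IsSolution l q z y dy) (h' : IsSolution l q z y' dy') :
    IsSolution l q z (y + y') (dy + dy') where
  hasDeriv x hx := (h.hasDeriv x hx).add (h'.hasDeriv x hx)
  absCont := h.absCont.add h'.absCont
  equation := by
    filter_upwards [h.equation, h'.equation] with x hx hx'
    have := hx.add hx'
    rwa [← mul_add] at this

theorem IsSolution.smul {l : ℝ} {q : ℝ → ℝ} {z : ℂ} {y dy : ℝ → ℂ} (c : ℂ)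
    (h : IsSolution l q z y dy) : IsSolution l q z (c • y) (c • dy) where
  hasDeriv x hx := (h.hasDeriv x hx).const_smul c
  absCont := h.absCont.const_smul c
  equation := by
    filter_upwards [h.equation] with x hx
    have := hx.const_smul c
    rwa [smul_eq_mul, mul_left_comm] at this

variable {V : Type u} [Fintype V] [DecidableEq V]
variable (G : SimpleGraph V) [DecidableRel G.Adj] (r : V)

/-- The Kirchhoff condition at `v`: the sum of the derivatives at the end of the incoming edges (at
most one in a tree) is the sum of the derivatives at the beginning of the outgoing edges. At a
pendant vertex this is the Neumann condition. -/
def Kirchhoff (l : ℝ) (dy : Edge G r → ℝ → ℂ) (v : V) : Prop :=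
  ∑ e : Edge G r with e.1.snd = v, dy e l = ∑ e : Edge G r with e.1.fst = v, dy e 0

/-- The conditions common to both problems: a solution on every edge (a function on `[0, l]`, kept
as a function on `ℝ` which vanishes outside `[0, l]`), and, at every vertex other than the root,
continuity and the Kirchhoff condition. -/
structure IsInnerSolution (l : ℝ) (q : Edge G r → ℝ → ℝ) (z : ℂ)
    (y dy : Edge G r → ℝ → ℂ) : Prop where
  support : ∀ e, ∀ x ∉ Icc 0 l, y e x = 0
  solution : ∀ e, IsSolution l (q e) z (y e) (dy e)
  continuity : ∀ e f : Edge G r, e.1.snd = f.1.fst → y e l = y f 0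
  kirchhoff : ∀ v, v ≠ r → Kirchhoff G r l dy v

theorem Kirchhoff.add {l : ℝ} {dy dy' : Edge G r → ℝ → ℂ} {v : V}
    (h : Kirchhoff G r l dy v) (h' : Kirchhoff G r l dy' v) : Kirchhoff G r l (dy + dy') v := by
  unfold Kirchhoff at *
  simp only [Pi.add_apply, Finset.sum_add_distrib, h, h']

theorem Kirchhoff.smul {l : ℝ} {dy : Edge G r → ℝ → ℂ} {v : V} (c : ℂ)
    (h : Kirchhoff G r l dy v) : Kirchhoff G r l (c • dy) v := by
  unfold Kirchhoff at *
  simp only [Pi.smul_apply, ← Finset.smul_sum, h]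

theorem IsInnerSolution.zero (l : ℝ) (q : Edge G r → ℝ → ℝ) (z : ℂ) :
    IsInnerSolution G r l q z 0 0 where
  support _ _ _ := rfl
  solution e := IsSolution.zero l (q e) z
  continuity _ _ _ := rfl
  kirchhoff v _ := by simp [Kirchhoff]

theorem IsInnerSolution.add {l : ℝ} {q : Edge G r → ℝ → ℝ} {z : ℂ}
    {y dy y' dy' : Edge G r → ℝ → ℂ} (h : IsInnerSolution G r l q z y dy)
    (h' : IsInnerSolution G r l q z y' dy') :
    IsInnerSolution G r l q z (y + y') (dy + dy') where
  support e x hx := by simp [h.support e x hx, h'.support e x hx]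
  solution e := (h.solution e).add (h'.solution e)
  continuity e f hef := by simp [h.continuity e f hef, h'.continuity e f hef]
  kirchhoff v hv := (h.kirchhoff v hv).add G r (h'.kirchhoff v hv)

theorem IsInnerSolution.smul {l : ℝ} {q : Edge G r → ℝ → ℝ} {z : ℂ}
    {y dy : Edge G r → ℝ → ℂ} (c : ℂ) (h : IsInnerSolution G r l q z y dy) :
    IsInnerSolution G r l q z (c • y) (c • dy) where
  support e x hx := by simp [h.support e x hx]
  solution e := (h.solution e).smul c
  continuity e f hef := by simp [h.continuity e f hef]
  kirchhoff v hv := (h.kirchhoff v hv).smul G r c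

/-- The space of solutions of the Neumann problem with spectral parameter `z`: standard conditions
(continuity and Kirchhoff) also at the root. -/
def neumannSpace (l : ℝ) (q : Edge G r → ℝ → ℝ) (z : ℂ) :
    Submodule ℂ (Edge G r → ℝ → ℂ) where
  carrier := {y | ∃ dy, IsInnerSolution G r l q z y dy ∧
    (∀ e f : Edge G r, e.1.fst = r → f.1.fst = r → y e 0 = y f 0) ∧ Kirchhoff G r l dy r}
  zero_mem' := ⟨0, .zero G r l q z, fun _ _ _ _ => rfl, by simp [Kirchhoff]⟩
  add_mem' := by
    rintro y y' ⟨dy, h1, h2, h3⟩ ⟨dy', h1', h2', h3'⟩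
    exact ⟨dy + dy', h1.add G r h1', fun e f he hf => by simp [h2 e f he hf, h2' e f he hf],
      h3.add G r h3'⟩
  smul_mem' := by
    rintro c y ⟨dy, h1, h2, h3⟩
    exact ⟨c • dy, h1.smul G r c, fun e f he hf => by simp [h2 e f he hf], h3.smul G r c⟩

/-- The space of solutions of the Dirichlet problem with spectral parameter `z`: the Dirichlet
condition at the root, standard conditions at all other vertices. -/
def dirichletSpace (l : ℝ) (q : Edge G r → ℝ → ℝ) (z : ℂ) :
    Submodule ℂ (Edge G r → ℝ → ℂ) where
  carrier := {y | ∃ dy, IsInnerSolution G r l q z y dy ∧ ∀ e : Edge G r, e.1.fst = r → y e 0 = 0}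
  zero_mem' := ⟨0, .zero G r l q z, fun _ _ => rfl⟩
  add_mem' := by
    rintro y y' ⟨dy, h1, h2⟩ ⟨dy', h1', h2'⟩
    exact ⟨dy + dy', h1.add G r h1', fun e he => by simp [h2 e he, h2' e he]⟩
  smul_mem' := by
    rintro c y ⟨dy, h1, h2⟩
    exact ⟨c • dy, h1.smul G r c, fun e he => by simp [h2 e he]⟩

/-- The same for the Dirichlet problem on the subtree at the neighbour `w` of the root, which
consists of the root, the edge `{r, w}` and the branch at `w`; functions on this subtree are
extended by zero to the edges outside it. -/
def dirichletBranchSpace (l : ℝ) (q : Edge G r → ℝ → ℝ) (w : V) (z : ℂ) :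
    Submodule ℂ (Edge G r → ℝ → ℂ) :=
  dirichletSpace G r l q z ⊓
    { carrier := {y | ∀ e : Edge G r, e.1.snd ∉ branch G r w → y e = 0}
      zero_mem' := fun _ _ => rfl
      add_mem' := fun h h' e he => by simp [h e he, h' e he]
      smul_mem' := fun c _ h e he => by simp [h e he] }

/-- The real numbers `f i`, `i ∈ S`, are the spectrum of the problem with the solution spaces
`E z`, `z ∈ ℂ`: a complex number `z` occurs among them as often as the (finite) dimension of `E z`
tells. In particular all eigenvalues are real. -/
def ListsSpectrum {ι F : Type*} [AddCommGroup F] [Module ℂ F] (E : ℂ → Submodule ℂ F)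
    (S : Set ι) (f : ι → ℝ) : Prop :=
  ∀ z : ℂ, Module.Finite ℂ (E z) ∧
    {i | i ∈ S ∧ (f i : ℂ) = z}.encard = (Module.finrank ℂ (E z) : ℕ∞)

end Spectral

/-! ### Asymptotics -/

section Asymptotics

/-- `√(s k) = a k + O(1 / k)` as `k → ∞`. -/
def SqrtAsymp (s a : ℕ → ℝ) : Prop :=
  (fun k => Real.sqrt (s k) - a k) =O[atTop] fun k => 1 / (k : ℝ)

/-- Indices `(i, k)`, `1 ≤ i ≤ 2p - 3`, `k ≥ 1`, of the `2p - 3` subsequences of the Neumann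
spectrum of a tree with `p` vertices. -/
def neumannIndex (p : ℕ) : Set (ℕ × ℕ) := {x | 1 ≤ x.1 ∧ x.1 ≤ 2 * p - 3 ∧ 1 ≤ x.2}

/-- The asymptotics of the subsequences `lam i` of the Neumann spectrum, with constants
`-1 = α 1 ≤ α 2 ≤ … ≤ α p = 1`. Here `p` is the number of vertices, `2 ≤ p`. -/
structure NeumannAsymptotics (p : ℕ) (l : ℝ) (α : ℕ → ℝ) (lam : ℕ → ℕ → ℝ) : Prop where
  first : α 1 = -1
  last : α p = 1
  mono : MonotoneOn α (Icc 1 p)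
  base : SqrtAsymp (lam 1) fun k => Real.pi * ((k : ℝ) - 1) / l
  plus : ∀ i, 2 ≤ i → i ≤ p - 1 →
    SqrtAsymp (lam i) fun k => 2 * Real.pi * ((k : ℝ) - 1) / l + 1 / l * Real.arccos (α i)
  minus : ∀ i, 2 ≤ i → i ≤ p - 1 →
    SqrtAsymp (lam (i + (p - 2))) fun k => 2 * Real.pi * (k : ℝ) / l - 1 / l * Real.arccos (α i)

/-- Indices `(j, k)`, `1 ≤ j ≤ 2m`, `k ≥ 1`, of the subsequences of the Dirichlet spectrum of a
subtree with `m` vertices besides the root. -/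
def branchIndex (m : ℕ) : Set (ℕ × ℕ) := {x | 1 ≤ x.1 ∧ x.1 ≤ 2 * m ∧ 1 ≤ x.2}

/-- The asymptotics of the subsequences `nu j` of the Dirichlet spectrum of a subtree with `m`
vertices besides the root. -/
structure DirichletAsymptotics (m : ℕ) (l : ℝ) (β : ℕ → ℝ) (nu : ℕ → ℕ → ℝ) : Prop where
  range : ∀ j, 1 ≤ j → j ≤ m → β j ∈ Icc (-1) 1
  plus : ∀ j, 1 ≤ j → j ≤ m →
    SqrtAsymp (nu j) fun k => 2 * Real.pi * ((k : ℝ) - 1) / l + 1 / l * Real.arccos (β j)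
  minus : ∀ j, 1 ≤ j → j ≤ m →
    SqrtAsymp (nu (j + m)) fun k => 2 * Real.pi * (k : ℝ) / l - 1 / l * Real.arccos (β j)

/-- Indices `(w, j, k)` of the Dirichlet spectrum of the whole tree: `w` runs through the
neighbours of the root, `(j, k)` through the indices for the subtree at `w`. -/
def dirichletIndex {V : Type u} [Fintype V] [DecidableEq V] (G : SimpleGraph V)
    [DecidableRel G.Adj] (r : V) : Set (V × ℕ × ℕ) :=
  {x | x.1 ∈ G.neighborFinset r ∧ x.2 ∈ branchIndex (branch G r x.1).card}

end Asymptotics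

/-! ### The ratio and its branched continued fraction -/

section Fractions

/-- `ψ / ψ̂` as a rational function. -/
def ratio {V : Type u} [Fintype V] [DecidableEq V] (G : SimpleGraph V) [DecidableRel G.Adj]
    (r : V) : RatFunc ℝ :=
  algebraMap ℝ[X] (RatFunc ℝ) (psi G) / algebraMap ℝ[X] (RatFunc ℝ) (psiHat G r)

/-- Formal finite branched continued fractions
`m z - ∑ i < n, 1 / (m_i z - ∑ …)`: a coefficient `m` and `n` denominators of the same kind. -/
inductive BranchedFraction : Type
  | node (m n : ℕ) (t : Fin n → BranchedFraction) : BranchedFraction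

/-- The rational function `m z - ∑ i < n, 1 / (value of the i-th denominator)`. -/
def BranchedFraction.value : BranchedFraction → RatFunc ℝ
  | .node m n t => (m : RatFunc ℝ) * RatFunc.X - ∑ i : Fin n, 1 / (t i).value

/-- No denominator of the branched continued fraction is the zero function. -/
def BranchedFraction.Proper : BranchedFraction → Prop
  | .node _ _ t => ∀ i, (t i).value ≠ 0 ∧ (t i).Proper

/-- The branched continued fraction has the shape of the part of the tree `G` (rooted at `r`) that
consists of the vertex `v` and its descendants: the coefficient of `z` is the degree of the vertex
in `G`, and the denominators correspond one-to-one to the children. -/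
inductive HasShape {V : Type u} [Fintype V] (G : SimpleGraph V) [DecidableRel G.Adj] (r : V) :
    V → BranchedFraction → Prop
  | node (v : V) (n : ℕ) (e : Fin n ≃ {x : V // IsChild G r v x}) (t : Fin n → BranchedFraction)
      (h : ∀ i, HasShape G r (e i) (t i)) : HasShape G r v (.node (G.degree v) n t)

end Fractions

end

end QuantumTree

open QuantumTree

/-! The proof is an oscillation theory on the tree, followed by a comparison with the zero
potential, where the problem becomes linear algebra.

Phases. On an edge a real solution is y = R sin θ, y' = -κ R cos θ, and θ satisfies a first order
equation (`IsAngle`); `edgeMap` carries θ from x = l to x = 0. At a vertex, the slopes y'/y at the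
beginning of the outgoing edges add up, and `angleSum` adds them together with the numbers of half
turns. Starting with π/2 at the vertices without children, one gets a phase at every vertex and a
top phase for the Neumann problem and for each branch. It increases with the spectral parameter;
when d > 0 edges below one vertex carry solutions vanishing at their upper ends, the vertex phase
gains d - 1 extra half turns. Hence the integer `eigenCount` jumps by the sum of these d - 1, plus
one if the top condition holds (`eigenCount_jump`). The same number is the dimension of the solution
space (`finrank_treeSolutions`), because the amplitudes satisfy one relation at each such vertex.
The Lagrange identity excludes nonreal eigenvalues. So `eigenCount` counts the eigenvalues below the
parameter, with multiplicity.

Comparison. The count does not depend on the scale κ (`sameSlope_edgeMap`, `sameSlope_angleSum`).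
For the parameter ρ² and κ = ρ, an edge shifts the phase by ρ l up to C/ρ, so the counts for q and
for the zero potential enclose each other, and the square roots of the n-th eigenvalues differ by
O(1/ρ) (`sqrt_eigenvalues_close`).

Zero potential. If sin (ρ l) ≠ 0, a solution is given by its vertex values, and the eigenfunctions
are the kernel of -zD + A at z = cos (ρ l); the pencil is symmetric with D > 0, so its dimension is
the order of the root. If sin (ρ l) = 0, the phases give multiplicity 1 for the Neumann problem and
0 for a branch. The roots are located by the elimination -zD + A = Uᵀ diag(-Q) U from the leaves
(`det_evalPencil`): |Q v| ≥ 1 away from the root when |z| ≥ 1, and ±1 are simple roots of ψ. This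
yields the listings.

Uniqueness. For large K, the number of √x l near 2πK + φ depends only on the spectrum and determines
the constants (`HasModes`, `modeCount_injective`). Hence every splitting shows the roots of ψ and
ψ̂, and so the ratio.

Continued fraction. The same elimination gives ψ/ψ̂ = -Q r, and the recursion of Q is the branched
fraction. Matching the children of matching vertices, from the root downwards, recovers the tree. -/

namespace QuantumTree

noncomputable section

/-! ### Absolutely continuous functions and integrating factors. -/

section Calculus

/-- A Lipschitz function of an absolutely continuous function is absolutely continuous. -/
theorem absolutelyContinuous_lipschitz_comp {X Y : Type*} [PseudoMetricSpace X]
    [PseudoMetricSpace Y] {φ : X → Y} {s : Set X} {K : NNReal} (hφ : LipschitzOnWith K φ s)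
    {f : ℝ → X} {a b : ℝ} (hf : AbsolutelyContinuousOnInterval f a b)
    (hs : MapsTo f (uIcc a b) s) : AbsolutelyContinuousOnInterval (fun x => φ (f x)) a b := by
  rw [absolutelyContinuousOnInterval_iff] at hf ⊢
  intro ε hε
  obtain ⟨δ, hδ, h⟩ := hf (ε / (K + 1)) (by positivity)
  refine ⟨δ, hδ, fun E hE hlt => ?_⟩
  have h1 := h E hE hlt
  calc ∑ i ∈ Finset.range E.1, dist (φ (f (E.2 i).1)) (φ (f (E.2 i).2))
      ≤ ∑ i ∈ Finset.range E.1, K * dist (f (E.2 i).1) (f (E.2 i).2) := by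
        refine Finset.sum_le_sum fun i hi => hφ.dist_le_mul _ (hs (hE.1 i hi).1) _ (hs (hE.1 i hi).2)
    _ = K * ∑ i ∈ Finset.range E.1, dist (f (E.2 i).1) (f (E.2 i).2) := by rw [Finset.mul_sum]
    _ ≤ (K + 1) * ∑ i ∈ Finset.range E.1, dist (f (E.2 i).1) (f (E.2 i).2) := by
        gcongr; linarith
    _ < (K + 1) * (ε / (K + 1)) := by gcongr
    _ = ε := by field_simp

/-- A continuously differentiable function of a real absolutely continuous function is absolutely
continuous. -/
theorem absolutelyContinuous_contDiff_comp {φ : ℝ → ℝ} (hφ : ContDiff ℝ 1 φ)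
    {f : ℝ → ℝ} {a b : ℝ} (hf : AbsolutelyContinuousOnInterval f a b) :
    AbsolutelyContinuousOnInterval (fun x => φ (f x)) a b := by
  obtain ⟨C, hC⟩ := hf.exists_bound
  obtain ⟨K, hK⟩ := hφ.contDiffOn.exists_lipschitzOnWith (s := Icc (-C) C) (by decide)
    (convex_Icc _ _) isCompact_Icc
  exact absolutelyContinuous_lipschitz_comp hK hf fun x hx => abs_le.mp (hC x hx)

theorem ae_uIcc_iff_restrict_Ioo {a b : ℝ} (hab : a ≤ b) {p : ℝ → Prop} :
    (∀ᵐ x, x ∈ uIcc a b → p x) ↔ ∀ᵐ x ∂(volume.restrict (Ioo a b)), p x := by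
  rw [uIcc_of_le hab, ← ae_restrict_iff' measurableSet_Icc]
  rw [Measure.restrict_congr_set Ioo_ae_eq_Icc]

/-- An absolutely continuous real function whose derivative is known almost everywhere. -/
theorem integral_eq_sub_of_absolutelyContinuous {f f' : ℝ → ℝ} {a b : ℝ} (hab : a ≤ b)
    (hf : AbsolutelyContinuousOnInterval f a b)
    (hd : ∀ᵐ x ∂(volume.restrict (Ioo a b)), HasDerivAt f (f' x) x) :
    ∫ x in a..b, f' x = f b - f a := by
  rw [← hf.integral_deriv_eq_sub]
  rw [← ae_uIcc_iff_restrict_Ioo hab] at hd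
  refine intervalIntegral.integral_congr_ae ?_
  filter_upwards [hd] with x hx hx'
  exact (hx (uIoc_subset_uIcc hx')).deriv.symm

/-- The primitive of an integrable function. -/
theorem ae_hasDerivAt_primitive {g : ℝ → ℝ} {a b c : ℝ} (hab : a ≤ b)
    (hg : IntervalIntegrable g volume a b) (hc : c ∈ Icc a b) :
    ∀ᵐ x ∂(volume.restrict (Ioo a b)), HasDerivAt (fun x => ∫ t in c..x, g t) (g x) x := by
  rw [← ae_uIcc_iff_restrict_Ioo hab]
  filter_upwards [hg.ae_hasDerivAt_integral] with x hx hx'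
  exact hx hx' c (by rwa [uIcc_of_le hab])

/-- Integrating factor: a perturbation of a linear first order differential equation. -/
theorem exists_integrating_factor {δ g h : ℝ → ℝ} {a b : ℝ} (hab : a ≤ b)
    (hδ : AbsolutelyContinuousOnInterval δ a b)
    (hg : IntervalIntegrable g volume a b) (hh : IntervalIntegrable h volume a b)
    (hd : ∀ᵐ x ∂(volume.restrict (Ioo a b)), ∃ d, HasDerivAt δ d x ∧ |d - h x| ≤ g x * |δ x|) :
    ∃ w : ℝ → ℝ, ContinuousOn w (Icc a b) ∧
      (∀ x ∈ Icc a b, Real.exp (-∫ x in a..b, |g x|) ≤ w x ∧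
        w x ≤ Real.exp (∫ x in a..b, |g x|)) ∧
      δ b * w b - δ a = ∫ x in a..b, h x * w x := by
  -- The rate for which δ' = k δ + h almost everywhere, with |k| ≤ |g|; the weight will be exp (-∫
  -- k). Where δ vanishes the hypothesis forces δ' = h, so the value 0 of the division by zero is
  -- the right one.
  set k : ℝ → ℝ := fun x => (deriv δ x - h x) / δ x with hk
  have hIoc : uIoc a b = Ioc a b := uIoc_of_le hab
  have hkm : AEStronglyMeasurable k (volume.restrict (Ioc a b)) := by
    have h1 := hδ.intervalIntegrable_deriv.aestronglyMeasurable
    have h2 := hh.aestronglyMeasurable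
    have h3 : AEStronglyMeasurable δ (volume.restrict (Ioc a b)) := by
      refine ContinuousOn.aestronglyMeasurable ?_ measurableSet_Ioc
      exact hδ.continuousOn.mono (by rw [uIcc_of_le hab]; exact Ioc_subset_Icc_self)
    exact ((h1.sub h2).aemeasurable.div h3.aemeasurable).aestronglyMeasurable
  have hkb : ∀ᵐ x ∂(volume.restrict (Ioo a b)), HasDerivAt δ (k x * δ x + h x) x ∧ |k x| ≤ |g x| := by
    filter_upwards [hd] with x hx
    obtain ⟨d, hd1, hd2⟩ := hx
    have hdd : deriv δ x = d := hd1.deriv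
    by_cases h0 : δ x = 0
    · have : d = h x := by
        rw [h0, abs_zero, mul_zero] at hd2
        have := abs_nonpos_iff.mp hd2
        linarith
      simp only [hk, h0, div_zero, mul_zero, zero_add, abs_zero, abs_nonneg, and_true]
      rwa [← this]
    · constructor
      · simp only [hk, hdd]
        rw [div_mul_cancel₀ _ h0, sub_add_cancel]
        exact hd1
      · simp only [hk, hdd]
        rw [abs_div, div_le_iff₀ (abs_pos.mpr h0)]
        exact hd2.trans (by gcongr; exact le_abs_self _)
  have hki : IntervalIntegrable k volume a b := by
    rw [intervalIntegrable_iff_integrableOn_Ioc_of_le hab] at hg ⊢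
    refine Integrable.mono hg.norm hkm ?_
    rw [Measure.restrict_congr_set Ioo_ae_eq_Ioc.symm]
    filter_upwards [hkb] with x hx
    rw [norm_norm]
    exact hx.2
  set W : ℝ → ℝ := fun x => ∫ t in a..x, k t
  have hW : AbsolutelyContinuousOnInterval W a b :=
    hki.absolutelyContinuousOnInterval_intervalIntegral left_mem_uIcc
  have hWb : ∀ x ∈ Icc a b, |W x| ≤ ∫ x in a..b, |g x| := by
    intro x hx
    calc |W x| ≤ ∫ t in a..x, |k t| := intervalIntegral.abs_integral_le_integral_abs hx.1
      _ ≤ ∫ t in a..b, |k t| := by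
        refine intervalIntegral.integral_mono_interval le_rfl hx.1 hx.2 ?_ hki.abs
        exact Eventually.of_forall fun x => abs_nonneg _
      _ ≤ ∫ t in a..b, |g t| := by
        refine intervalIntegral.integral_mono_ae_restrict hab hki.abs hg.abs ?_
        rw [Measure.restrict_congr_set Ioo_ae_eq_Icc.symm]
        filter_upwards [hkb] with x hx using hx.2
  set w : ℝ → ℝ := fun x => Real.exp (-W x)
  have hw : AbsolutelyContinuousOnInterval w a b :=
    absolutelyContinuous_contDiff_comp (φ := fun x => Real.exp (-x)) (by fun_prop) hW
  refine ⟨w, by simpa [uIcc_of_le hab] using hw.continuousOn, ?_, ?_⟩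
  · intro x hx
    have := abs_le.mp (hWb x hx)
    constructor <;> apply Real.exp_le_exp.mpr <;> linarith
  · have key := integral_eq_sub_of_absolutelyContinuous (f := fun x => δ x * w x)
      (f' := fun x => h x * w x) hab (hδ.mul hw) ?_
    · rw [key]; simp [w, W]
    · filter_upwards [hkb, ae_hasDerivAt_primitive hab hki (left_mem_Icc.mpr hab)] with x hx hx'
      have h1 := hx.1.mul (hx'.neg.exp)
      have h2 : (k x * δ x + h x) * Real.exp (-W x) + δ x * (Real.exp (-W x) * -k x) =
        h x * w x := by simp only [w]; ring
      exact h1.congr_deriv h2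

theorem integral_weight_bounds {h w : ℝ → ℝ} {a b c : ℝ} (hab : a ≤ b)
    (hh : IntervalIntegrable h volume a b) (hw : ContinuousOn w (Icc a b))
    (h0 : ∀ᵐ x ∂(volume.restrict (Ioo a b)), 0 ≤ h x)
    (hb : ∀ x ∈ Icc a b, w x ≤ c) :
    ∫ x in a..b, h x * w x ≤ c * ∫ x in a..b, h x := by
  rw [← intervalIntegral.integral_const_mul]
  refine intervalIntegral.integral_mono_ae_restrict hab
    (hh.mul_continuousOn (by rwa [uIcc_of_le hab])) (hh.const_mul c) ?_
  have h0' : ∀ᵐ x ∂(volume.restrict (Icc a b)), 0 ≤ h x := by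
    rwa [Measure.restrict_congr_set Ioo_ae_eq_Icc.symm]
  filter_upwards [h0', ae_restrict_mem measurableSet_Icc] with x hx hx'
  rw [mul_comm]
  exact mul_le_mul_of_nonneg_right (hb x hx') hx

end Calculus

/-! ### The phase equation: existence, uniqueness, monotonicity. -/

section Angle

/-- `θ` is a phase of the differential equation: an absolutely continuous solution of
`θ' = -(A cos² θ + B sin² θ)` on `[0, l]`. -/
structure IsAngle (l A : ℝ) (B θ : ℝ → ℝ) : Prop where
  absCont : AbsolutelyContinuousOnInterval θ 0 l
  equation : ∀ᵐ x ∂(volume.restrict (Ioo 0 l)),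
    HasDerivAt θ (-(A * Real.cos (θ x) ^ 2 + B x * Real.sin (θ x) ^ 2)) x

theorem abs_sin_sq_sub_le (a b : ℝ) : |Real.sin a ^ 2 - Real.sin b ^ 2| ≤ |a - b| := by
  have h : Real.sin a ^ 2 - Real.sin b ^ 2 = Real.sin (a + b) * Real.sin (a - b) := by
    rw [Real.sin_add, Real.sin_sub]
    have h1 := Real.sin_sq_add_cos_sq a
    have h2 := Real.sin_sq_add_cos_sq b
    linear_combination Real.sin b ^ 2 * h1 - Real.sin a ^ 2 * h2
  rw [h, abs_mul]
  calc |Real.sin (a + b)| * |Real.sin (a - b)| ≤ 1 * |a - b| :=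
        mul_le_mul (Real.abs_sin_le_one _) Real.abs_sin_le_abs (abs_nonneg _) zero_le_one
    _ = |a - b| := one_mul _

theorem integral_exp_weight_le {M x l : ℝ} (hM : 0 < M) :
    ∫ t in x..l, Real.exp (-(2 * M * (t - x))) ≤ 1 / (2 * M) := by
  have h : ∫ t in x..l, Real.exp (-(2 * M * (t - x))) =
      -Real.exp (-(2 * M * (l - x))) / (2 * M) - -Real.exp (-(2 * M * (x - x))) / (2 * M) := by
    refine intervalIntegral.integral_eq_sub_of_hasDerivAt (f := fun t =>
      -Real.exp (-(2 * M * (t - x))) / (2 * M)) (fun t _ => ?_)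
      (Continuous.intervalIntegrable (by fun_prop) _ _)
    have := ((((hasDerivAt_id t).sub_const x).const_mul (2 * M)).neg.exp.neg).div_const (2 * M)
    convert! this using 1
    simp
    field_simp
  rw [h]
  simp only [sub_self, mul_zero, neg_zero, Real.exp_zero]
  have := Real.exp_pos (-(2 * M * (l - x)))
  rw [div_sub_div_same, div_le_div_iff_of_pos_right (by positivity)]
  linarith

/-- Picard iteration, backwards from l. In the plain sup norm the map need not be a contraction;
with θ t = exp (M (l - t)) f t and the sup norm of f, an exponentially weighted norm, it has
Lipschitz constant 1/2. -/
theorem exists_integral_angle {l A θl : ℝ} (hl : 0 ≤ l) {g : ℝ → ℝ}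
    (hg : IntervalIntegrable g volume 0 l) (hg2 : IntervalIntegrable (fun x => g x ^ 2) volume 0 l) :
    ∃ θ : ℝ → ℝ, Continuous θ ∧
      ∀ x ∈ Icc 0 l, θ x = θl + ∫ t in x..l, (A + g t * Real.sin (θ t) ^ 2) := by
  -- This bound makes the first of the two terms in the contraction estimate at most 1/4.
  obtain ⟨M, hMpos, hM⟩ : ∃ M : ℝ, 0 < M ∧ ∀ x ∈ Icc 0 l, ∫ t in x..l, g t ^ 2 ≤ M / 2 := by
    refine ⟨2 * (∫ t in 0..l, g t ^ 2) + 1, ?_, fun x hx => ?_⟩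
    · have := intervalIntegral.integral_nonneg_of_forall (f := fun t => g t ^ 2) (μ := volume) hl
        fun t => sq_nonneg (g t)
      linarith
    · have : ∫ t in x..l, g t ^ 2 ≤ ∫ t in 0..l, g t ^ 2 :=
        intervalIntegral.integral_mono_interval hx.1 hx.2 le_rfl
          (Eventually.of_forall fun t => sq_nonneg (g t)) hg2
      linarith
  have hsub : ∀ x ∈ Icc 0 l, uIcc x l ⊆ uIcc 0 l := fun x hx => by
    rw [uIcc_of_le hx.2, uIcc_of_le hl]; exact Icc_subset_Icc_left hx.1
  let e : C(Icc (0 : ℝ) l, ℝ) → ℝ → ℝ := fun f t => Real.exp (M * (l - t)) * IccExtend hl f t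
  have hec : ∀ f, Continuous (e f) := fun f => by
    have : Continuous (IccExtend hl f) := f.continuous.Icc_extend'
    fun_prop
  have hint : ∀ f, IntervalIntegrable (fun t => A + g t * Real.sin (e f t) ^ 2) volume 0 l :=
    fun f => intervalIntegrable_const.add (hg.mul_continuousOn
      ((Real.continuous_sin.comp (hec f)).pow 2).continuousOn)
  have hcont : ∀ f, ContinuousOn (fun x => ∫ t in x..l, (A + g t * Real.sin (e f t) ^ 2))
      (Icc 0 l) := fun f => by
    have := intervalIntegral.continuousOn_primitive_interval_left (μ := volume) (a := 0) (b := l)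
      (f := fun t => A + g t * Real.sin (e f t) ^ 2) (by
        rw [uIcc_of_le hl, integrableOn_Icc_iff_integrableOn_Ioc]
        exact (intervalIntegrable_iff_integrableOn_Ioc_of_le hl).mp (hint f))
    rwa [uIcc_of_le hl] at this
  let T : C(Icc (0 : ℝ) l, ℝ) → C(Icc (0 : ℝ) l, ℝ) := fun f =>
    ⟨fun x => Real.exp (-(M * (l - x))) * (θl + ∫ t in (x : ℝ)..l, (A + g t * Real.sin (e f t) ^ 2)),
      by
        have := continuousOn_iff_continuous_domRestrict.mp (hcont f)
        have h2 : Continuous fun x : Icc (0 : ℝ) l =>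
          ∫ t in (x : ℝ)..l, (A + g t * Real.sin (e f t) ^ 2) := this
        fun_prop⟩
  have hT : ContractingWith (1 / 2) T := by
    refine ⟨by rw [← NNReal.coe_lt_coe]; norm_num, LipschitzWith.of_dist_le_mul fun f f' => ?_⟩
    rw [ContinuousMap.dist_le (by positivity)]
    intro x
    obtain ⟨x, hx⟩ := x
    have hs : uIcc x l ⊆ uIcc 0 l := hsub x hx
    rw [Real.dist_eq]
    have h1 : T f ⟨x, hx⟩ - T f' ⟨x, hx⟩ = Real.exp (-(M * (l - x))) *
        ∫ t in x..l, g t * (Real.sin (e f t) ^ 2 - Real.sin (e f' t) ^ 2) := by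
      have : ∫ t in x..l, g t * (Real.sin (e f t) ^ 2 - Real.sin (e f' t) ^ 2) =
          (∫ t in x..l, (A + g t * Real.sin (e f t) ^ 2)) -
            ∫ t in x..l, (A + g t * Real.sin (e f' t) ^ 2) := by
        rw [← intervalIntegral.integral_sub ((hint f).mono_set hs) ((hint f').mono_set hs)]
        congr 1; ext t; ring
      rw [this]
      change Real.exp (-(M * (l - x))) * (θl + ∫ t in x..l, (A + g t * Real.sin (e f t) ^ 2)) -
        Real.exp (-(M * (l - x))) * (θl + ∫ t in x..l, (A + g t * Real.sin (e f' t) ^ 2)) = _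
      ring
    rw [h1, ← intervalIntegral.integral_const_mul]
    set D := dist f f'
    have hexp : IntervalIntegrable (fun t => Real.exp (-(2 * M * (t - x)))) volume x l :=
      Continuous.intervalIntegrable (by fun_prop) _ _
    have hb : ∀ t ∈ Ioc x l, ‖Real.exp (-(M * (l - x))) *
        (g t * (Real.sin (e f t) ^ 2 - Real.sin (e f' t) ^ 2))‖ ≤
        D * ((1 / (2 * M)) * g t ^ 2 + M / 2 * Real.exp (-(2 * M * (t - x)))) := by
      intro t ht
      have h2 : |Real.sin (e f t) ^ 2 - Real.sin (e f' t) ^ 2| ≤ Real.exp (M * (l - t)) * D := by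
        refine (abs_sin_sq_sub_le _ _).trans ?_
        have : e f t - e f' t = Real.exp (M * (l - t)) * (IccExtend hl f t - IccExtend hl f' t) := by
          simp only [e]; ring
        rw [this, abs_mul, Real.abs_exp]
        gcongr
        exact ContinuousMap.dist_apply_le_dist (f := f) (g := f') (projIcc 0 l hl t)
      set E := Real.exp (-(M * (t - x)))
      have h3 : Real.exp (-(M * (l - x))) * Real.exp (M * (l - t)) = E := by
        rw [← Real.exp_add]; congr 1; ring
      have h4 : Real.exp (-(2 * M * (t - x))) = E ^ 2 := by
        rw [← Real.exp_nat_mul]; congr 1; push_cast; ring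
      rw [Real.norm_eq_abs, abs_mul, abs_mul, Real.abs_exp, h4]
      calc Real.exp (-(M * (l - x))) * (|g t| * |Real.sin (e f t) ^ 2 - Real.sin (e f' t) ^ 2|)
          ≤ Real.exp (-(M * (l - x))) * (|g t| * (Real.exp (M * (l - t)) * D)) := by gcongr
        _ = D * (|g t| * E) := by rw [← h3]; ring
        _ ≤ D * ((1 / (2 * M)) * g t ^ 2 + M / 2 * E ^ 2) := by
          have hD : 0 ≤ D := dist_nonneg
          refine mul_le_mul_of_nonneg_left ?_ hD
          -- Young's inequality |g| E ≤ g² / (2 M) + M E² / 2. After integration each term is at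
          -- most 1/4, the first by the choice of `M`, the second by `integral_exp_weight_le`.
          have h5 : 0 ≤ (|g t| - M * E) ^ 2 / (2 * M) := by positivity
          have h6 : (|g t| - M * E) ^ 2 / (2 * M) =
            (1 / (2 * M)) * |g t| ^ 2 + M / 2 * E ^ 2 - |g t| * E := by field_simp; ring
          rw [← sq_abs (g t)]
          linarith
    have h7 := intervalIntegral.norm_integral_le_of_norm_le hx.2
      (Eventually.of_forall hb) ((((hg2.mono_set hs).const_mul (1 / (2 * M))).add
        (hexp.const_mul (M / 2))).const_mul D)
    refine h7.trans ?_
    rw [intervalIntegral.integral_const_mul, intervalIntegral.integral_add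
      ((hg2.mono_set hs).const_mul _) (hexp.const_mul _), intervalIntegral.integral_const_mul,
      intervalIntegral.integral_const_mul]
    have h8 := hM x hx
    have h9 := integral_exp_weight_le (x := x) (l := l) hMpos
    have h10 : (1 / (2 * M)) * ∫ t in x..l, g t ^ 2 ≤ 1 / 4 := by
      calc (1 / (2 * M)) * ∫ t in x..l, g t ^ 2 ≤ (1 / (2 * M)) * (M / 2) := by gcongr
        _ = 1 / 4 := by field_simp; norm_num
    have h11 : M / 2 * ∫ t in x..l, Real.exp (-(2 * M * (t - x))) ≤ 1 / 4 := by
      calc _ ≤ M / 2 * (1 / (2 * M)) := by gcongr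
        _ = 1 / 4 := by field_simp; norm_num
    have hD : 0 ≤ D := dist_nonneg
    push_cast
    nlinarith
  have : Nonempty (Icc (0 : ℝ) l) := ⟨⟨0, left_mem_Icc.mpr hl⟩⟩
  set f := hT.fixedPoint T
  have hf : T f = f := hT.fixedPoint_isFixedPt
  refine ⟨e f, hec f, fun x hx => ?_⟩
  have h1 : e f x = Real.exp (M * (l - x)) * f ⟨x, hx⟩ := by
    simp only [e, IccExtend_of_mem hl f hx]
  have h2 : f ⟨x, hx⟩ = T f ⟨x, hx⟩ := by rw [hf]
  rw [h1, h2]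
  change Real.exp (M * (l - x)) * (Real.exp (-(M * (l - x))) *
    (θl + ∫ t in x..l, (A + g t * Real.sin (e f t) ^ 2))) = _
  rw [← mul_assoc, ← Real.exp_add, add_neg_cancel, Real.exp_zero, one_mul]

theorem AbsolutelyContinuousOnInterval.congr' {f g : ℝ → ℝ} {a b : ℝ}
    (hf : AbsolutelyContinuousOnInterval f a b) (h : EqOn f g (uIcc a b)) :
    AbsolutelyContinuousOnInterval g a b := by
  rw [absolutelyContinuousOnInterval_iff] at hf ⊢
  intro ε hε
  obtain ⟨δ, hδ, hd⟩ := hf ε hε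
  refine ⟨δ, hδ, fun E hE hlt => ?_⟩
  have h1 := hd E hE hlt
  rwa [Finset.sum_congr rfl fun i hi => by rw [h (hE.1 i hi).1, h (hE.1 i hi).2]] at h1

/-- Since cos² = 1 - sin², the phase equation reads θ' = -(A + (B - A) sin² θ), which is the
integral equation above with g = B - A. -/
theorem exists_isAngle {l A : ℝ} (hl : 0 ≤ l) {B : ℝ → ℝ}
    (hB : MemLp B 2 (volume.restrict (Ioo 0 l))) (θl : ℝ) :
    ∃ θ, IsAngle l A B θ ∧ θ l = θl ∧ Continuous θ := by
  have hfin : IsFiniteMeasure (volume.restrict (Ioo 0 l)) := inferInstance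
  have hg : MemLp (fun x => B x - A) 2 (volume.restrict (Ioo 0 l)) := hB.sub (memLp_const A)
  have hi : ∀ f : ℝ → ℝ, Integrable f (volume.restrict (Ioo 0 l)) → IntervalIntegrable f volume 0 l :=
    fun f hf => by
      rw [intervalIntegrable_iff_integrableOn_Ioo_of_le hl]; exact hf
  have hg1 := hi _ (hg.integrable (by norm_num))
  have hg2 := hi _ hg.integrable_sq
  obtain ⟨θ, hθc, hθ⟩ := exists_integral_angle (A := A) (θl := θl) hl hg1 hg2
  set F : ℝ → ℝ := fun t => A + (B t - A) * Real.sin (θ t) ^ 2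
  have hF : IntervalIntegrable F volume 0 l := intervalIntegrable_const.add (hg1.mul_continuousOn
      ((Real.continuous_sin.comp hθc).pow 2).continuousOn)
  have hr : l ∈ uIcc 0 l := right_mem_uIcc
  refine ⟨θ, ⟨?_, ?_⟩, ?_, hθc⟩
  · have h1 : AbsolutelyContinuousOnInterval (fun x => ∫ t in l..x, F t) 0 l :=
      hF.absolutelyContinuousOnInterval_intervalIntegral hr
    have h2 : AbsolutelyContinuousOnInterval (fun _ : ℝ => θl) 0 l :=
      (LipschitzWith.const θl).lipschitzOnWith.absolutelyContinuousOnInterval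
    refine AbsolutelyContinuousOnInterval.congr' (h2.sub h1) fun x hx => ?_
    rw [uIcc_of_le hl] at hx
    rw [hθ x hx, intervalIntegral.integral_symm l x, ← sub_eq_add_neg]
    rfl
  · filter_upwards [ae_hasDerivAt_primitive hl hF (right_mem_Icc.mpr hl),
      ae_restrict_mem measurableSet_Ioo] with x hx hx'
    have h1 := (hx.const_sub θl)
    have h2 : HasDerivAt θ (-F x) x := by
      refine h1.congr_of_eventuallyEq ?_
      filter_upwards [Icc_mem_nhds hx'.1 hx'.2] with y hy
      rw [hθ y hy, intervalIntegral.integral_symm l y, ← sub_eq_add_neg]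
    convert h2 using 1
    simp only [F]
    rw [Real.cos_sq']; ring
  · rw [hθ l ⟨hl, le_rfl⟩]; simp

variable {l A : ℝ} {B B' θ θ' : ℝ → ℝ}

theorem IsAngle.add_pi (h : IsAngle l A B θ) (k : ℤ) : IsAngle l A B fun x => θ x + k * Real.pi where
  absCont := h.absCont.add
    ((LipschitzWith.const (k * Real.pi)).lipschitzOnWith.absolutelyContinuousOnInterval)
  equation := by
    filter_upwards [h.equation] with x hx
    have h1 : Real.cos (θ x + k * Real.pi) ^ 2 = Real.cos (θ x) ^ 2 := by
      rw [Real.cos_add_int_mul_pi, mul_pow]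
      rcases Int.even_or_odd k with hk | hk <;> simp [hk.neg_one_zpow]
    have h2 : Real.sin (θ x + k * Real.pi) ^ 2 = Real.sin (θ x) ^ 2 := by
      rw [Real.sin_add_int_mul_pi, mul_pow]
      rcases Int.even_or_odd k with hk | hk <;> simp [hk.neg_one_zpow]
    rw [h1, h2]
    exact hx.add_const _

/-- If sin θ vanished throughout, so would its derivative -A cos³ θ, although cos² θ = 1. This makes
the coefficient of β in `IsAngle.compare` strictly positive, hence phases strictly monotone in the
spectral parameter. -/
theorem IsAngle.exists_sin_ne_zero (hl : 0 < l) (hA : 0 < A) (h : IsAngle l A B θ) :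
    ∃ x ∈ Icc 0 l, Real.sin (θ x) ≠ 0 := by
  by_contra! hs
  have : (ae (volume.restrict (Ioo 0 l))).NeBot := by
    rw [ae_neBot, Ne, Measure.restrict_eq_zero]; simp [hl]
  obtain ⟨x, hx, hxm⟩ := (h.equation.and (ae_restrict_mem measurableSet_Ioo)).exists
  have h1 := hx.sin
  have h2 : HasDerivAt (fun x => Real.sin (θ x)) 0 x := by
    refine (hasDerivAt_const x (0 : ℝ)).congr_of_eventuallyEq ?_
    filter_upwards [Icc_mem_nhds hxm.1 hxm.2] with y hy using hs y hy
  have h3 := h1.unique h2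
  have h4 := hs x ⟨hxm.1.le, hxm.2.le⟩
  have h5 := Real.sin_sq_add_cos_sq (θ x)
  rw [h4] at h3 h5
  have h6 : Real.cos (θ x) ^ 2 = 1 := by linarith
  rw [h6] at h3
  have : Real.cos (θ x) ≠ 0 := fun h => by simp [h] at h6
  have h7 : A = 0 := by
    rcases mul_eq_zero.mp h3 with h | h
    · exact absurd h this
    · simpa using h
  exact hA.ne' h7

/-- Comparison of the phases for two values of the spectral parameter. -/
theorem IsAngle.compare (hl : 0 < l) (hA : 0 < A) (hB : IntervalIntegrable B volume 0 l) {β : ℝ}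
    (h : IsAngle l A B θ) (h' : IsAngle l A (fun x => B x + β) θ') :
    ∃ c p : ℝ, Real.exp (-∫ x in 0..l, |B x - A|) ≤ c ∧ c ≤ Real.exp (∫ x in 0..l, |B x - A|) ∧
      0 < p ∧ p ≤ Real.exp (∫ x in 0..l, |B x - A|) * l ∧
      θ' 0 - θ 0 = c * (θ' l - θ l) + β * p := by
  have hc' : ContinuousOn θ' (Icc 0 l) := by
    simpa [uIcc_of_le hl.le] using h'.absCont.continuousOn
  have hsc : ContinuousOn (fun x => Real.sin (θ' x) ^ 2) (Icc 0 l) :=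
    (Real.continuous_sin.comp_continuousOn hc').pow 2
  have hsi : IntervalIntegrable (fun x => Real.sin (θ' x) ^ 2) volume 0 l :=
    ContinuousOn.intervalIntegrable (by rwa [uIcc_of_le hl.le])
  -- As sin² is 1-Lipschitz, the difference of the phases satisfies a linear equation with rate
  -- bounded by |B - A|; the parameter β enters as the source -β sin² θ'.
  obtain ⟨w, hw, hwb, hwe⟩ := exists_integrating_factor (δ := fun x => θ' x - θ x)
    (g := fun x => |B x - A|) (h := fun x => -(β * Real.sin (θ' x) ^ 2)) hl.le
    (h'.absCont.sub h.absCont) (hB.sub intervalIntegrable_const).abs (hsi.const_mul β).neg (by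
      filter_upwards [h.equation, h'.equation] with x hx hx'
      refine ⟨_, hx'.sub hx, ?_⟩
      have : (-(A * Real.cos (θ' x) ^ 2 + (B x + β) * Real.sin (θ' x) ^ 2) -
          -(A * Real.cos (θ x) ^ 2 + B x * Real.sin (θ x) ^ 2) - -(β * Real.sin (θ' x) ^ 2)) =
          -((B x - A) * (Real.sin (θ' x) ^ 2 - Real.sin (θ x) ^ 2)) := by
        rw [Real.cos_sq', Real.cos_sq']; ring
      rw [this, abs_neg, abs_mul]
      exact mul_le_mul_of_nonneg_left (abs_sin_sq_sub_le _ _) (abs_nonneg _))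
  simp only [abs_abs] at hwb
  have hwl := hwb l ⟨hl.le, le_rfl⟩
  refine ⟨w l, ∫ x in 0..l, Real.sin (θ' x) ^ 2 * w x, hwl.1, hwl.2, ?_, ?_, ?_⟩
  · obtain ⟨x, hx, hx'⟩ := h'.exists_sin_ne_zero hl hA
    refine intervalIntegral.integral_pos hl (hsc.mul hw) (fun y hy => ?_) ⟨x, hx, ?_⟩
    · exact mul_nonneg (sq_nonneg _)
        ((Real.exp_pos _).le.trans (hwb y (Ioc_subset_Icc_self hy)).1)
    · exact mul_pos (by positivity) ((Real.exp_pos _).trans_le (hwb x hx).1)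
  · have h1 := integral_weight_bounds hl.le hsi hw
      (Eventually.of_forall fun x => sq_nonneg _) fun x hx => (hwb x hx).2
    refine h1.trans ?_
    have h2 : ∫ x in 0..l, Real.sin (θ' x) ^ 2 ≤ ∫ x in 0..l, (1 : ℝ) :=
      intervalIntegral.integral_mono_on hl.le hsi intervalIntegrable_const
        fun x _ => Real.sin_sq_le_one _
    have h3 : ∫ x in 0..l, (1 : ℝ) = l := by simp
    rw [h3] at h2
    gcongr
  · have : ∫ x in 0..l, -(β * Real.sin (θ' x) ^ 2) * w x =
        -(β * ∫ x in 0..l, Real.sin (θ' x) ^ 2 * w x) := by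
      rw [← intervalIntegral.integral_const_mul, ← intervalIntegral.integral_neg]
      congr 1; ext x; ring
    rw [this] at hwe
    linarith

/-- At phase zero the velocity is -A, whatever B is. So θ satisfies a linear equation with the
source -A, and the integrating factor gives θ 0 = θ l · w l + A ∫ w. -/
theorem IsAngle.pos (hl : 0 < l) (hA : 0 < A) (hB : IntervalIntegrable B volume 0 l)
    (h : IsAngle l A B θ) (h0 : 0 ≤ θ l) : 0 < θ 0 := by
  obtain ⟨w, hw, hwb, hwe⟩ := exists_integrating_factor (δ := θ)
    (g := fun x => |B x - A|) (h := fun _ => -A) hl.le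
    h.absCont (hB.sub intervalIntegrable_const).abs intervalIntegrable_const (by
      filter_upwards [h.equation] with x hx
      refine ⟨_, hx, ?_⟩
      have : (-(A * Real.cos (θ x) ^ 2 + B x * Real.sin (θ x) ^ 2) - -A) =
          -((B x - A) * Real.sin (θ x) ^ 2) := by
        rw [Real.cos_sq']; ring
      rw [this, abs_neg, abs_mul]
      exact mul_le_mul_of_nonneg_left (by simpa using abs_sin_sq_sub_le (θ x) 0) (abs_nonneg _))
  have h1 : 0 < ∫ x in 0..l, w x :=
    intervalIntegral.integral_pos hl hw
      (fun x hx => (Real.exp_pos _).le.trans (hwb x (Ioc_subset_Icc_self hx)).1)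
      ⟨0, ⟨le_rfl, hl.le⟩, (Real.exp_pos _).trans_le (hwb 0 ⟨le_rfl, hl.le⟩).1⟩
  rw [intervalIntegral.integral_const_mul] at hwe
  have h2 : 0 ≤ θ l * w l :=
    mul_nonneg h0 ((Real.exp_pos _).le.trans (hwb l ⟨hl.le, le_rfl⟩).1)
  nlinarith [mul_pos hA h1]

theorem IsAngle.unique (hl : 0 < l) (hA : 0 < A) (hB : IntervalIntegrable B volume 0 l)
    (h : IsAngle l A B θ) (h' : IsAngle l A B θ') (he : θ l = θ' l) : θ 0 = θ' 0 := by
  obtain ⟨c, p, -, -, -, -, hcp⟩ := h.compare (β := 0) hl hA hB (by simpa using h')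
  rw [he] at hcp
  linarith

end Angle

/-! ### Solutions of the equation on one edge and their phases. -/

section EdgeSolutions

variable {l : ℝ} {q : ℝ → ℝ}

theorem intervalIntegrable_of_memLp (hl : 0 ≤ l) (hq : MemLp q 2 (volume.restrict (Ioo 0 l))) :
    IntervalIntegrable q volume 0 l := by
  rw [intervalIntegrable_iff_integrableOn_Ioo_of_le hl]
  exact hq.integrable (by norm_num)

/-- A function with a continuous derivative almost everywhere, if absolutely continuous, has this
derivative everywhere. -/
theorem hasDerivWithinAt_of_ae {f f' : ℝ → ℝ} {a b : ℝ} (hab : a ≤ b)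
    (hf : AbsolutelyContinuousOnInterval f a b) (hc : ContinuousOn f' (Icc a b))
    (hd : ∀ᵐ x ∂(volume.restrict (Ioo a b)), HasDerivAt f (f' x) x) :
    ∀ x ∈ Icc a b, HasDerivWithinAt f (f' x) (Icc a b) x := by
  intro x hx
  have hi : ∀ y ∈ Icc a b, f y = f a + ∫ t in a..y, f' t := fun y hy => by
    have h1 := integral_eq_sub_of_absolutelyContinuous (f := f) (f' := f') hy.1
      (hf.mono (by rw [uIcc_of_le hy.1, uIcc_of_le hab]; exact Icc_subset_Icc_right hy.2))
      (ae_restrict_of_ae_restrict_of_subset (Ioo_subset_Ioo_right hy.2) hd)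
    rw [h1]; ring
  have hfact : Fact (x ∈ Icc a b) := ⟨hx⟩
  have h2 : HasDerivWithinAt (fun u => ∫ t in a..u, f' t) (f' x) (Icc a b) x := by
    refine intervalIntegral.integral_hasDerivWithinAt_right
      (ContinuousOn.intervalIntegrable (hc.mono ?_)) (t := Icc a b)
      (hc.stronglyMeasurableAtFilter_nhdsWithin measurableSet_Icc x) (hc x hx)
    rw [uIcc_of_le hx.1]; exact Icc_subset_Icc_right hx.2
  exact (h2.const_add (f a)).congr (fun y hy => hi y hy) (hi x hx)

theorem IsSolution.continuousOn_deriv (hl : 0 ≤ l) {z : ℂ} {y dy : ℝ → ℂ}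
    (h : IsSolution l q z y dy) : ContinuousOn dy (Icc 0 l) := by
  simpa [uIcc_of_le hl] using h.absCont.continuousOn

theorem IsSolution.continuousOn {z : ℂ} {y dy : ℝ → ℂ}
    (h : IsSolution l q z y dy) : ContinuousOn y (Icc 0 l) :=
  fun x hx => (h.hasDeriv x hx).continuousWithinAt

theorem IsSolution.absCont_self (hl : 0 ≤ l) {z : ℂ} {y dy : ℝ → ℂ}
    (h : IsSolution l q z y dy) : AbsolutelyContinuousOnInterval y 0 l := by
  obtain ⟨C, hC⟩ := isCompact_Icc.exists_bound_of_continuousOn (h.continuousOn_deriv hl)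
  have h1 : LipschitzOnWith (Real.toNNReal C) y (Icc 0 l) :=
    (convex_Icc 0 l).lipschitzOnWith_of_nnnorm_hasDerivWithin_le h.hasDeriv fun x hx => by
      rw [← NNReal.coe_le_coe, coe_nnnorm]
      exact (hC x hx).trans (Real.le_coe_toNNReal C)
  exact LipschitzOnWith.absolutelyContinuousOnInterval (by rwa [uIcc_of_le hl])

theorem absCont_normSq {f : ℝ → ℂ} {a b : ℝ} (hf : AbsolutelyContinuousOnInterval f a b) :
    AbsolutelyContinuousOnInterval (fun x => Complex.normSq (f x)) a b := by
  have h1 : AbsolutelyContinuousOnInterval (fun x => (f x).re) a b :=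
    absolutelyContinuous_lipschitz_comp (s := univ) (K := 1)
      (LipschitzWith.lipschitzOnWith (LipschitzWith.of_dist_le_mul fun x y => by
        rw [Real.dist_eq, ← Complex.sub_re, NNReal.coe_one, one_mul, Complex.dist_eq]
        exact Complex.abs_re_le_norm _)) hf (mapsTo_univ _ _)
  have h2 : AbsolutelyContinuousOnInterval (fun x => (f x).im) a b :=
    absolutelyContinuous_lipschitz_comp (s := univ) (K := 1)
      (LipschitzWith.lipschitzOnWith (LipschitzWith.of_dist_le_mul fun x y => by
        rw [Real.dist_eq, ← Complex.sub_im, NNReal.coe_one, one_mul, Complex.dist_eq]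
        exact Complex.abs_im_le_norm _)) hf (mapsTo_univ _ _)
  have := (h1.mul h1).add (h2.mul h2)
  exact this

theorem hasDerivAt_normSq {f : ℝ → ℂ} {f' : ℂ} {x : ℝ} (h : HasDerivAt f f' x) :
    HasDerivAt (fun x => Complex.normSq (f x)) (2 * (starRingEnd ℂ (f x) * f').re) x := by
  have h1 : HasDerivAt (fun x => (f x).re) f'.re x := by
    exact Complex.reCLM.hasFDerivAt.comp_hasDerivAt x h
  have h2 : HasDerivAt (fun x => (f x).im) f'.im x := by
    exact Complex.imCLM.hasFDerivAt.comp_hasDerivAt x h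
  have h3 := (h1.mul h1).add (h2.mul h2)
  refine h3.congr_deriv ?_
  simp [Complex.mul_re]; ring

/-- A solution with zero Cauchy data at `l` vanishes. -/
theorem IsSolution.eq_zero (hl : 0 ≤ l) (hq : MemLp q 2 (volume.restrict (Ioo 0 l))) {z : ℂ}
    {y dy : ℝ → ℂ} (h : IsSolution l q z y dy) (h0 : y l = 0) (h1 : dy l = 0) :
    ∀ x ∈ Icc 0 l, y x = 0 ∧ dy x = 0 := by
  intro x hx
  have hsub : uIcc x l ⊆ uIcc 0 l := by
    rw [uIcc_of_le hx.2, uIcc_of_le hl]; exact Icc_subset_Icc_left hx.1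
  have hqi := (intervalIntegrable_of_memLp hl hq).mono_set hsub
  -- The energy satisfies |N'| ≤ (1 + |q| + |z|) N; with zero source the integrating factor makes N
  -- x a multiple of N l.
  set N : ℝ → ℝ := fun x => Complex.normSq (y x) + Complex.normSq (dy x)
  have hN : AbsolutelyContinuousOnInterval N x l :=
    ((absCont_normSq (h.absCont_self hl)).add (absCont_normSq h.absCont)).mono hsub
  have hss : Ioo x l ⊆ Ioo 0 l := Ioo_subset_Ioo_left hx.1
  obtain ⟨w, -, -, hw⟩ := exists_integrating_factor (δ := N)
    (g := fun x => 1 + (|q x| + ‖z‖)) (h := fun _ => 0) hx.2 hN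
    (intervalIntegrable_const.add (hqi.abs.add intervalIntegrable_const))
    intervalIntegrable_const (by
      filter_upwards [ae_restrict_of_ae_restrict_of_subset hss h.equation,
        ae_restrict_mem measurableSet_Ioo] with t ht htm
      have htm' := hss htm
      have hy := (h.hasDeriv t ⟨htm'.1.le, htm'.2.le⟩).hasDerivAt (Icc_mem_nhds htm'.1 htm'.2)
      refine ⟨_, (hasDerivAt_normSq hy).add (hasDerivAt_normSq ht), ?_⟩
      have hNt : N t = ‖y t‖ ^ 2 + ‖dy t‖ ^ 2 := by simp [N, Complex.normSq_eq_norm_sq]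
      rw [sub_zero, hNt, abs_of_nonneg (by positivity : (0:ℝ) ≤ ‖y t‖ ^ 2 + ‖dy t‖ ^ 2)]
      set a := ‖y t‖
      set b := ‖dy t‖
      have e1 : |(starRingEnd ℂ (y t) * dy t).re| ≤ a * b := by
        refine (Complex.abs_re_le_norm _).trans ?_
        rw [norm_mul, Complex.norm_conj]
      have e2 : |(starRingEnd ℂ (dy t) * (((q t : ℂ) - z) * y t)).re| ≤ b * ((|q t| + ‖z‖) * a) := by
        refine (Complex.abs_re_le_norm _).trans ?_
        rw [norm_mul, norm_mul, Complex.norm_conj]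
        gcongr
        refine (norm_sub_le _ _).trans ?_
        rw [Complex.norm_real, Real.norm_eq_abs]
      have ha : 0 ≤ a := norm_nonneg _
      have hb : 0 ≤ b := norm_nonneg _
      have hc : 0 ≤ |q t| + ‖z‖ := by positivity
      rw [← mul_add, abs_mul, abs_two]
      calc _ ≤ 2 * (a * b + b * ((|q t| + ‖z‖) * a)) := by
            gcongr
            exact (abs_add_le _ _).trans (add_le_add e1 e2)
        _ = (1 + (|q t| + ‖z‖)) * (2 * a * b) := by ring
        _ ≤ (1 + (|q t| + ‖z‖)) * (a ^ 2 + b ^ 2) := by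
            gcongr
            nlinarith [sq_nonneg (a - b)])
  have hNl : N l = 0 := by simp [N, h0, h1]
  have hNx : N x = 0 := by
    simp only [zero_mul, intervalIntegral.integral_zero, hNl] at hw
    linarith
  have h2 := Complex.normSq_nonneg (y x)
  have h3 := Complex.normSq_nonneg (dy x)
  exact ⟨Complex.normSq_eq_zero.mp (by simp only [N] at hNx; linarith),
    Complex.normSq_eq_zero.mp (by simp only [N] at hNx; linarith)⟩

theorem IsSolution.sub {z : ℂ} {y dy y' dy' : ℝ → ℂ}
    (h : IsSolution l q z y dy) (h' : IsSolution l q z y' dy') :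
    IsSolution l q z (y - y') (dy - dy') := by
  have := h.add (h'.smul (-1))
  simpa [sub_eq_add_neg] using this

theorem IsSolution.eqOn (hl : 0 ≤ l) (hq : MemLp q 2 (volume.restrict (Ioo 0 l))) {z : ℂ}
    {y dy y' dy' : ℝ → ℂ} (h : IsSolution l q z y dy) (h' : IsSolution l q z y' dy')
    (h0 : y l = y' l) (h1 : dy l = dy' l) :
    ∀ x ∈ Icc 0 l, y x = y' x ∧ dy x = dy' x := fun x hx => by
  have := (h.sub h').eq_zero hl hq (by simp [h0]) (by simp [h1]) x hx
  simpa [sub_eq_zero] using this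

theorem absCont_ofReal {f : ℝ → ℝ} {a b : ℝ} (hf : AbsolutelyContinuousOnInterval f a b) :
    AbsolutelyContinuousOnInterval (fun x => (f x : ℂ)) a b :=
  absolutelyContinuous_lipschitz_comp (s := univ) (K := 1)
    (Complex.isometry_ofReal.lipschitz.lipschitzOnWith) hf (mapsTo_univ _ _)

/-- The solution with a given phase. -/
theorem IsAngle.exists_isSolution (hl : 0 ≤ l) (hq : MemLp q 2 (volume.restrict (Ioo 0 l)))
    {κ lam : ℝ} (hκ : 0 < κ) {θ : ℝ → ℝ} (h : IsAngle l κ (fun x => (lam - q x) / κ) θ) :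
    ∃ R : ℝ → ℝ, R l = 1 ∧ (∀ x, 0 < R x) ∧ IsSolution l q lam
      (fun x => ((R x * Real.sin (θ x) : ℝ) : ℂ)) (fun x => ((-(κ * R x * Real.cos (θ x)) : ℝ) : ℂ)) := by
  have hqi := intervalIntegrable_of_memLp hl hq
  have hθc : ContinuousOn θ (uIcc 0 l) := h.absCont.continuousOn
  -- The Prüfer substitution forces R' / R to be this function; integrating it from l normalizes R l
  -- = 1.
  set k : ℝ → ℝ := fun x => ((lam - q x) / κ - κ) * (Real.sin (θ x) * Real.cos (θ x))
  have hk : IntervalIntegrable k volume 0 l :=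
    ((((intervalIntegrable_const.sub hqi).div_const κ).sub intervalIntegrable_const)).mul_continuousOn
      ((Real.continuous_sin.comp_continuousOn hθc).mul (Real.continuous_cos.comp_continuousOn hθc))
  set W : ℝ → ℝ := fun x => ∫ t in l..x, k t
  have hW : AbsolutelyContinuousOnInterval W 0 l :=
    hk.absolutelyContinuousOnInterval_intervalIntegral right_mem_uIcc
  set R : ℝ → ℝ := fun x => Real.exp (W x)
  have hR : AbsolutelyContinuousOnInterval R 0 l :=
    absolutelyContinuous_contDiff_comp Real.contDiff_exp hW
  have hs : AbsolutelyContinuousOnInterval (fun x => Real.sin (θ x)) 0 l :=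
    absolutelyContinuous_contDiff_comp Real.contDiff_sin h.absCont
  have hc : AbsolutelyContinuousOnInterval (fun x => Real.cos (θ x)) 0 l :=
    absolutelyContinuous_contDiff_comp Real.contDiff_cos h.absCont
  have hRd := ae_hasDerivAt_primitive hl hk (right_mem_Icc.mpr hl)
  have hy : AbsolutelyContinuousOnInterval (fun x => R x * Real.sin (θ x)) 0 l := hR.mul hs
  have hdy : AbsolutelyContinuousOnInterval (fun x => -(κ * R x * Real.cos (θ x))) 0 l := by
    have := ((hR.mul hc).const_mul κ).neg
    convert! this using 2
    simp [mul_assoc]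
  have hder := hasDerivWithinAt_of_ae hl hy (by simpa [uIcc_of_le hl] using hdy.continuousOn) (by
    filter_upwards [h.equation, hRd] with x hx hx'
    refine (hx'.exp.mul hx.sin).congr_deriv ?_
    have := Real.sin_sq_add_cos_sq (θ x)
    simp only [k, R, W]
    have e : Real.cos (θ x) ^ 2 = 1 - Real.sin (θ x) ^ 2 := by linarith
    linear_combination (-Real.exp (∫ t in l..x, k t) * κ * Real.cos (θ x)) * this)
  refine ⟨R, by simp [R, W], fun x => Real.exp_pos _, fun x hx => ?_, absCont_ofReal hdy, ?_⟩
  · exact (hder x hx).ofReal_comp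
  · filter_upwards [h.equation, hRd] with x hx hx'
    have h1 := (((hx'.exp.const_mul κ).mul hx.cos).neg)
    have h2 : HasDerivAt (fun x => -(κ * R x * Real.cos (θ x)))
        ((q x - lam) * (R x * Real.sin (θ x))) x := by
      refine h1.congr_deriv ?_
      have := Real.sin_sq_add_cos_sq (θ x)
      simp only [k, R, W]
      field_simp
      linear_combination (-(lam - q x) * Real.sin (θ x)) * this
    have h3 := h2.ofReal_comp
    refine h3.congr_deriv ?_
    push_cast
    ring

end EdgeSolutions

/-! ### Transfer of the phase along an edge, in different scales. -/

section EdgeMap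

/-- The angles `θ` and `φ` represent the same slope in the scales `1` and `κ`. -/
def SameSlope (κ θ φ : ℝ) : Prop :=
  (∃ c, 0 < c ∧ Real.sin φ = c * Real.sin θ ∧ κ * Real.cos φ = c * Real.cos θ) ∧
    |φ - θ| < Real.pi / 2

/-- Transfer of the phase along an edge, from the end `x = l` to the beginning `x = 0`. -/
def edgeMap (l A : ℝ) (B : ℝ → ℝ) (t : ℝ) : ℝ :=
  open Classical in
  if h : ∃ θ : ℝ → ℝ, IsAngle l A B θ ∧ θ l = t then h.choose 0 else 0

variable {l A : ℝ} {B θ : ℝ → ℝ}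

theorem edgeMap_eq (hl : 0 < l) (hA : 0 < A) (hB : MemLp B 2 (volume.restrict (Ioo 0 l)))
    (h : IsAngle l A B θ) : edgeMap l A B (θ l) = θ 0 := by
  have hex : ∃ θ' : ℝ → ℝ, IsAngle l A B θ' ∧ θ' l = θ l := ⟨θ, h, rfl⟩
  rw [edgeMap, dif_pos hex]
  exact hex.choose_spec.1.unique hl hA (intervalIntegrable_of_memLp hl.le hB) h hex.choose_spec.2

theorem exists_angle_edgeMap (hl : 0 < l) (hA : 0 < A)
    (hB : MemLp B 2 (volume.restrict (Ioo 0 l))) (t : ℝ) :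
    ∃ θ, IsAngle l A B θ ∧ θ l = t ∧ θ 0 = edgeMap l A B t := by
  obtain ⟨θ, h, h1, -⟩ := exists_isAngle (A := A) hl.le hB t
  exact ⟨θ, h, h1, by rw [← edgeMap_eq hl hA hB h, h1]⟩

theorem edgeMap_add_pi (hl : 0 < l) (hA : 0 < A)
    (hB : MemLp B 2 (volume.restrict (Ioo 0 l))) (t : ℝ) (k : ℤ) :
    edgeMap l A B (t + k * Real.pi) = edgeMap l A B t + k * Real.pi := by
  obtain ⟨θ, h, h1, h2⟩ := exists_angle_edgeMap hl hA hB t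
  have := edgeMap_eq hl hA hB (h.add_pi k)
  simp only [h1, h2] at this
  exact this

/-- The constants do not depend on t, t' and β, so this one estimate gives monotonicity and
Lipschitz continuity in the angle, and strict monotonicity and continuity in the parameter. -/
theorem edgeMap_compare (hl : 0 < l) (hA : 0 < A) (hB : MemLp B 2 (volume.restrict (Ioo 0 l))) :
    ∃ c₀ C, 0 < c₀ ∧ ∀ t t' β : ℝ, ∃ c p, c₀ ≤ c ∧ c ≤ C ∧ 0 < p ∧ p ≤ C * l ∧
      edgeMap l A (fun x => B x + β) t' - edgeMap l A B t = c * (t' - t) + β * p := by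
  refine ⟨_, Real.exp (∫ x in 0..l, |B x - A|), Real.exp_pos (-∫ x in 0..l, |B x - A|), fun t t' β => ?_⟩
  have hB' : MemLp (fun x => B x + β) 2 (volume.restrict (Ioo 0 l)) := hB.add (memLp_const β)
  obtain ⟨θ, h, h1, h2⟩ := exists_angle_edgeMap hl hA hB t
  obtain ⟨θ', h', h1', h2'⟩ := exists_angle_edgeMap hl hA hB' t'
  have := h.compare hl hA (intervalIntegrable_of_memLp hl.le hB) h'
  rwa [h1, h2, h1', h2'] at this

theorem edgeMap_pos (hl : 0 < l) (hA : 0 < A) (hB : MemLp B 2 (volume.restrict (Ioo 0 l)))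
    {t : ℝ} (ht : 0 ≤ t) : 0 < edgeMap l A B t := by
  obtain ⟨θ, h, h1, h2⟩ := exists_angle_edgeMap hl hA hB t
  rw [← h2]
  exact h.pos hl hA (intervalIntegrable_of_memLp hl.le hB) (h1 ▸ ht)

variable {q : ℝ → ℝ}

theorem memLp_potential (hq : MemLp q 2 (volume.restrict (Ioo 0 l))) (lam κ : ℝ) :
    MemLp (fun x => (lam - q x) / κ) 2 (volume.restrict (Ioo 0 l)) := by
  have := ((memLp_const lam).sub hq).const_mul κ⁻¹
  simpa [div_eq_inv_mul] using this

/-- Solutions in terms of the transfer of the phase. -/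
theorem exists_isSolution_edgeMap (hl : 0 < l) (hq : MemLp q 2 (volume.restrict (Ioo 0 l)))
    {κ lam : ℝ} (hκ : 0 < κ) (t : ℝ) :
    ∃ y dy : ℝ → ℂ, IsSolution l q lam y dy ∧ y l = Real.sin t ∧ dy l = -(κ * Real.cos t) ∧
      ∃ c : ℝ, 0 < c ∧ y 0 = c * Real.sin (edgeMap l κ (fun x => (lam - q x) / κ) t) ∧
        dy 0 = -(c * (κ * Real.cos (edgeMap l κ (fun x => (lam - q x) / κ) t))) := by
  obtain ⟨θ, h, h1, h2⟩ := exists_angle_edgeMap hl hκ (memLp_potential hq lam κ) t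
  obtain ⟨R, hR1, hR, hs⟩ := h.exists_isSolution hl.le hq hκ
  refine ⟨_, _, hs, ?_, ?_, R 0, hR 0, ?_, ?_⟩
  · simp [hR1, h1]
  · simp [hR1, h1]
  · simp [h2]
  · rw [← h2]; push_cast; ring

/-- Both phases belong to one solution up to a positive factor, so their slopes agree along the
whole edge. This proportionality forces cos (φ - θ) > 0; by continuity |φ - θ| never reaches π/2,
and no half turn is gained or lost by the change of scale. -/
theorem sameSlope_edgeMap (hl : 0 < l) (hq : MemLp q 2 (volume.restrict (Ioo 0 l)))
    {κ lam t s : ℝ} (hκ : 0 < κ) (hts : SameSlope κ t s) :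
    SameSlope κ (edgeMap l 1 (fun x => lam - q x) t)
      (edgeMap l κ (fun x => (lam - q x) / κ) s) := by
  have hq1 := memLp_potential hq lam 1
  obtain ⟨θ, h, h1, h2⟩ := exists_angle_edgeMap hl one_pos hq1 t
  obtain ⟨φ, h', h1', h2'⟩ := exists_angle_edgeMap hl hκ (memLp_potential hq lam κ) s
  obtain ⟨R, hR1, hR, hs⟩ := h.exists_isSolution hl.le hq one_pos
  obtain ⟨R', hR1', hR', hs'⟩ := h'.exists_isSolution hl.le hq hκ
  obtain ⟨⟨c, hc, hc1, hc2⟩, hd⟩ := hts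
  have hun := hs'.eqOn hl.le hq (hs.smul (c : ℂ))
    (by simp only [Pi.smul_apply, smul_eq_mul, hR1, hR1', h1, h1', hc1]; push_cast; ring)
    (by
      simp only [Pi.smul_apply, smul_eq_mul, hR1, hR1', h1, h1']
      norm_cast
      linear_combination -hc2)
  have hratio : ∀ x ∈ Icc 0 l, ∃ d, 0 < d ∧ Real.sin (φ x) = d * Real.sin (θ x) ∧
      κ * Real.cos (φ x) = d * Real.cos (θ x) := by
    intro x hx
    obtain ⟨e1, e2⟩ := hun x hx
    simp only [Pi.smul_apply, smul_eq_mul] at e1 e2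
    norm_cast at e1 e2
    refine ⟨c * R x / R' x, div_pos (mul_pos hc (hR x)) (hR' x), ?_, ?_⟩
    · have := (hR' x).ne'
      field_simp
      linarith
    · have := (hR' x).ne'
      field_simp
      linarith
  have hcos : ∀ x ∈ Icc 0 l, 0 < Real.cos (φ x - θ x) := by
    intro x hx
    obtain ⟨d, hd, d1, d2⟩ := hratio x hx
    have d3 : Real.cos (φ x) = d * Real.cos (θ x) / κ := by field_simp; linarith
    rw [Real.cos_sub, d1, d3]
    have h5 := Real.sin_sq_add_cos_sq (θ x)
    have : d * Real.cos (θ x) / κ * Real.cos (θ x) + d * Real.sin (θ x) * Real.sin (θ x) =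
      d * (Real.cos (θ x) ^ 2 / κ + Real.sin (θ x) ^ 2) := by ring
    rw [this]
    refine mul_pos hd ?_
    rcases eq_or_ne (Real.sin (θ x)) 0 with h0 | h0
    · have : Real.cos (θ x) ^ 2 = 1 := by rw [h0] at h5; linarith
      rw [this]; positivity
    · positivity
  have e1 : edgeMap l 1 (fun x => lam - q x) t = θ 0 := by rw [h2]; simp
  rw [e1, ← h2']
  refine ⟨hratio 0 ⟨le_rfl, hl.le⟩, ?_⟩
  by_contra! hcon
  have hcont : ContinuousOn (fun x => |φ x - θ x|) (Icc 0 l) := by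
    have a1 := h.absCont.continuousOn
    have a2 := h'.absCont.continuousOn
    rw [uIcc_of_le hl.le] at a1 a2
    exact (a2.sub a1).abs
  obtain ⟨x, hx, hx'⟩ := intermediate_value_Icc' hl.le hcont (show Real.pi / 2 ∈ _ from
    ⟨by rw [h1, h1']; exact hd.le, hcon⟩)
  have := hcos x hx
  rw [← Real.cos_abs] at this
  simp only at hx'
  rw [hx', Real.cos_pi_div_two] at this
  exact lt_irrefl _ this

/-- High energy: in the scale `ρ`, the phase advances by nearly `ρ l`. -/
theorem edgeMap_high (hl : 0 < l) (hq : MemLp q 2 (volume.restrict (Ioo 0 l)))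
    {ρ : ℝ} (hρ : 0 < ρ) (t : ℝ) :
    |edgeMap l ρ (fun x => (ρ ^ 2 - q x) / ρ) t - (t + ρ * l)| ≤ (∫ x in 0..l, |q x|) / ρ := by
  obtain ⟨θ, h, h1, h2⟩ := exists_angle_edgeMap hl hρ (memLp_potential hq (ρ ^ 2) ρ) t
  have hqi := intervalIntegrable_of_memLp hl.le hq
  have hθc : ContinuousOn θ (uIcc 0 l) := h.absCont.continuousOn
  have hi : IntervalIntegrable (fun x => q x * (Real.sin (θ x) ^ 2 / ρ)) volume 0 l :=
    hqi.mul_continuousOn (((Real.continuous_sin.comp_continuousOn hθc).pow 2).div_const ρ)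
  -- In the scale ρ the phase equation is θ' = q sin² θ / ρ - ρ: a rotation of constant speed with a
  -- perturbation of size |q| / ρ.
  have key := integral_eq_sub_of_absolutelyContinuous (f' := fun x =>
    q x * (Real.sin (θ x) ^ 2 / ρ) - ρ) hl.le h.absCont (by
      filter_upwards [h.equation] with x hx
      refine hx.congr_deriv ?_
      rw [Real.cos_sq']
      field_simp
      ring)
  rw [intervalIntegral.integral_sub hi intervalIntegrable_const,
    intervalIntegral.integral_const, smul_eq_mul, h1, h2] at key
  have e : edgeMap l ρ (fun x => (ρ ^ 2 - q x) / ρ) t - (t + ρ * l) =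
      -∫ x in 0..l, q x * (Real.sin (θ x) ^ 2 / ρ) := by linarith
  rw [e, abs_neg, ← intervalIntegral.integral_div]
  refine (intervalIntegral.abs_integral_le_integral_abs hl.le).trans ?_
  refine intervalIntegral.integral_mono_on hl.le hi.abs (hqi.abs.div_const ρ) fun x _ => ?_
  rw [abs_mul, abs_div, abs_of_pos hρ, abs_of_nonneg (sq_nonneg (Real.sin (θ x))), ← mul_div_assoc]
  gcongr
  exact mul_le_of_le_one_right (abs_nonneg _) (Real.sin_sq_le_one _)

/-- Low energy: an angle in `[0, π / 2]` is transferred to one which is at most `π / 2`. -/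
theorem edgeMap_low (hl : 0 < l) (hq : MemLp q 2 (volume.restrict (Ioo 0 l))) :
    ∃ κ₀ : ℝ, ∀ κ, κ₀ < κ → 0 < κ → ∀ t ≤ Real.pi / 2,
      edgeMap l κ (fun x => (-κ ^ 2 - q x) / κ) t ≤ Real.pi / 2 := by
  have hqi := intervalIntegrable_of_memLp hl.le hq
  set Q := ∫ x in 0..l, |q x|
  have hpi := Real.pi_pos
  -- The first bound makes the contribution of q to the phase at most π/16; the second gives κ l >
  -- 2, enough to beat the slope of the barrier below.
  refine ⟨max (16 * Q / Real.pi) (2 / l), fun κ hκ₀ hκ t ht => ?_⟩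
  have hk1 : Q / κ ≤ Real.pi / 16 := by
    have := (le_max_left _ _).trans_lt hκ₀
    rw [div_lt_iff₀ hpi] at this
    rw [div_le_div_iff₀ hκ (by norm_num)]
    linarith
  have hk2 : 2 < κ * l := by
    have := (le_max_right _ _).trans_lt hκ₀
    rwa [div_lt_iff₀ hl] at this
  obtain ⟨θ, h, h1, h2⟩ := exists_angle_edgeMap hl hκ (memLp_potential hq (-κ ^ 2) κ) t
  have hθc : ContinuousOn θ (Icc 0 l) := by simpa [uIcc_of_le hl.le] using h.absCont.continuousOn
  set k : ℝ → ℝ := fun x => q x * (Real.sin (θ x) ^ 2 / κ)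
  have hi : IntervalIntegrable k volume 0 l := by
    refine hqi.mul_continuousOn ?_
    rw [uIcc_of_le hl.le]
    exact ((Real.continuous_sin.comp_continuousOn hθc).pow 2).div_const κ
  -- Freed from the contribution of q, the phase has the continuous derivative -κ cos (2 θ), so that
  -- a barrier argument applies.
  set φ : ℝ → ℝ := fun x => θ x - ∫ t in l..x, k t
  have hkb : ∀ x ∈ Icc 0 l, |∫ t in l..x, k t| ≤ Q / κ := by
    intro x hx
    have hsub : uIcc x l ⊆ uIcc 0 l := by
      rw [uIcc_of_le hx.2, uIcc_of_le hl.le]; exact Icc_subset_Icc_left hx.1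
    rw [intervalIntegral.integral_symm, abs_neg]
    calc |∫ t in x..l, k t| ≤ ∫ t in x..l, |k t| :=
          intervalIntegral.abs_integral_le_integral_abs hx.2
      _ ≤ ∫ t in 0..l, |k t| := intervalIntegral.integral_mono_interval hx.1 hx.2 le_rfl
          (Eventually.of_forall fun x => abs_nonneg _) hi.abs
      _ ≤ ∫ t in 0..l, |q t| / κ := by
          refine intervalIntegral.integral_mono_on hl.le hi.abs (hqi.abs.div_const κ) fun x _ => ?_
          simp only [k]
          rw [abs_mul, abs_div, abs_of_pos hκ, abs_of_nonneg (sq_nonneg (Real.sin (θ x))), ← mul_div_assoc]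
          gcongr
          exact mul_le_of_le_one_right (abs_nonneg _) (Real.sin_sq_le_one _)
      _ = Q / κ := intervalIntegral.integral_div _ _
  have hφd := hasDerivWithinAt_of_ae (f := φ) (f' := fun x => -(κ * Real.cos (2 * θ x))) hl.le
    (h.absCont.sub (hi.absolutelyContinuousOnInterval_intervalIntegral right_mem_uIcc))
    ((Real.continuous_cos.comp_continuousOn (hθc.const_mul 2)).const_mul κ).neg (by
      filter_upwards [h.equation, ae_hasDerivAt_primitive hl.le hi (right_mem_Icc.mpr hl.le)]
        with x hx hx'
      refine (hx.sub hx').congr_deriv ?_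
      simp only [k]
      rw [Real.cos_two_mul, Real.sin_sq]
      field_simp
      ring)
  have hmaps : MapsTo (fun s => l - s) (Icc 0 l) (Icc 0 l) := fun s hs =>
    ⟨by linarith [hs.2], by linarith [hs.1]⟩
  have hfd : ∀ s ∈ Icc 0 l, HasDerivWithinAt (fun s => φ (l - s)) (κ * Real.cos (2 * θ (l - s)))
      (Icc 0 l) s := by
    intro s hs
    have e1 := (hφd (l - s) (hmaps hs)).scomp s
      ((hasDerivAt_id s).const_sub l).hasDerivWithinAt hmaps
    refine e1.congr_deriv ?_
    simp
  -- In s = l - x the barrier sinks from π/2 to 3π/8. At a contact θ is within 3π/16 of π/2, so cos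
  -- (2 θ) ≤ -0.28 and the phase falls faster than the barrier. The final margin π/8 absorbs the
  -- π/16 due to q.
  have hbar := image_le_of_deriv_right_lt_deriv_boundary (f := fun s => φ (l - s)) (a := 0) (b := l)
    (f' := fun s => κ * Real.cos (2 * θ (l - s)))
    (B := fun s => Real.pi / 2 - Real.pi / 8 * (s / l)) (B' := fun _ => -(Real.pi / 8 * (1 / l)))
    (fun s hs => (hfd s hs).continuousWithinAt)
    (fun s hs => (hfd s ⟨hs.1, hs.2.le⟩).mono_of_mem_nhdsWithin
      (Icc_mem_nhdsGE_of_mem hs)) (by simp [φ, h1, ht])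
    (fun s => (((hasDerivAt_id s).div_const l).const_mul _).const_sub _)
    (fun s hs he => by
      have hs' : s ∈ Icc 0 l := ⟨hs.1, hs.2.le⟩
      have hb := abs_le.mp (hkb (l - s) (hmaps hs'))
      have hsl : 0 ≤ s / l ∧ s / l ≤ 1 := ⟨by have := hs.1; positivity, by
        rw [div_le_one hl]; exact hs.2.le⟩
      simp only [φ] at he
      set τ := θ (l - s)
      have hτ : |Real.pi - 2 * τ| ≤ 3 * Real.pi / 8 := by
        rw [abs_le]
        constructor <;> nlinarith
      have hc1 : Real.cos (2 * τ) = -Real.cos (Real.pi - 2 * τ) := by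
        rw [Real.cos_pi_sub, neg_neg]
      have hc2 := Real.one_sub_sq_div_two_le_cos (x := Real.pi - 2 * τ)
      have hc3 : (Real.pi - 2 * τ) ^ 2 ≤ (1.2) ^ 2 := by
        rw [← sq_abs]
        have : |Real.pi - 2 * τ| ≤ 1.2 := hτ.trans (by linarith [Real.pi_lt_d2])
        gcongr
      have hc4 : Real.cos (2 * τ) ≤ -0.28 := by rw [hc1]; linarith
      have hc5 : Real.pi / 8 * (1 / l) < κ * 0.28 := by
        rw [mul_one_div, div_lt_iff₀ hl]
        nlinarith [Real.pi_lt_d2]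
      nlinarith)
  have h3 := hbar ⟨hl.le, le_rfl⟩
  simp only [sub_self, div_self hl.ne', φ, mul_one] at h3
  have h4 := abs_le.mp (hkb 0 ⟨le_rfl, hl.le⟩)
  rw [← h2]
  linarith

end EdgeMap

/-! ### Addition of phases at a vertex. -/

section AngleSum

/-- The integer `n` with `n π < θ ≤ (n + 1) π`. -/
def phaseCount (θ : ℝ) : ℤ := ⌈θ / Real.pi⌉ - 1

/-- The slope `y' / y` of a function with the phase `θ`. -/
def slopeOf (θ : ℝ) : ℝ := -(Real.cos θ / Real.sin θ)

theorem phaseCount_lt (θ : ℝ) : phaseCount θ * Real.pi < θ := by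
  have h := Int.ceil_lt_add_one (θ / Real.pi)
  have h2 : ((phaseCount θ : ℤ) : ℝ) < θ / Real.pi := by
    simp only [phaseCount]; push_cast; linarith
  rwa [lt_div_iff₀ Real.pi_pos] at h2

theorem le_phaseCount (θ : ℝ) : θ ≤ phaseCount θ * Real.pi + Real.pi := by
  have h := Int.le_ceil (θ / Real.pi)
  rw [div_le_iff₀ Real.pi_pos] at h
  simp only [phaseCount]; push_cast; linarith

theorem phaseCount_eq {θ : ℝ} {n : ℤ} (h1 : n * Real.pi < θ) (h2 : θ ≤ n * Real.pi + Real.pi) :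
    phaseCount θ = n := by
  have hp := Real.pi_pos
  have : ⌈θ / Real.pi⌉ = n + 1 := by
    rw [Int.ceil_eq_iff]
    constructor
    · rw [lt_div_iff₀ hp]; push_cast; linarith
    · rw [div_le_iff₀ hp]; push_cast; linarith
  simp [phaseCount, this]

theorem phaseCount_mono : Monotone phaseCount := fun a b h => by
  have : ⌈a / Real.pi⌉ ≤ ⌈b / Real.pi⌉ := Int.ceil_mono (by have := Real.pi_pos; gcongr)
  simp only [phaseCount]; omega

theorem sin_eq_zero_iff_phaseCount {θ : ℝ} :
    Real.sin θ = 0 ↔ θ = phaseCount θ * Real.pi + Real.pi := by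
  constructor
  · intro h
    obtain ⟨k, hk⟩ := Real.sin_eq_zero_iff.mp h
    have : phaseCount θ = k - 1 := phaseCount_eq (by push_cast; rw [← hk]; linarith [Real.pi_pos])
      (by push_cast; rw [← hk]; linarith)
    rw [this, ← hk]; push_cast; ring
  · intro h
    rw [h, ← add_one_mul]
    exact_mod_cast Real.sin_int_mul_pi (phaseCount θ + 1)

/-- Between consecutive multiples of π the slope increases from -∞ to ∞. So a phase amounts to a
count together with a slope, the right end of the interval standing for the infinite slope. -/
theorem arctan_slopeOf {θ : ℝ} (h : Real.sin θ ≠ 0) :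
    Real.arctan (slopeOf θ) = θ - phaseCount θ * Real.pi - Real.pi / 2 := by
  set x := θ - phaseCount θ * Real.pi - Real.pi / 2
  have h1 := phaseCount_lt θ
  have h2 : θ < phaseCount θ * Real.pi + Real.pi :=
    lt_of_le_of_ne (le_phaseCount θ) fun h' => h (sin_eq_zero_iff_phaseCount.mpr h')
  have h3 : slopeOf θ = Real.tan x := by
    rw [Real.tan_eq_sin_div_cos]
    simp only [x]
    rw [Real.sin_sub_pi_div_two, Real.cos_sub_pi_div_two, Real.sin_sub_int_mul_pi,
      Real.cos_sub_int_mul_pi, slopeOf]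
    rcases Int.even_or_odd (phaseCount θ) with hk | hk <;> simp [hk.neg_one_zpow, neg_div, div_neg]
  rw [h3, Real.arctan_tan] <;> simp only [x] <;> linarith

theorem eq_angle_of_sin_ne_zero {θ : ℝ} (h : Real.sin θ ≠ 0) :
    θ = phaseCount θ * Real.pi + (Real.pi / 2 + Real.arctan (slopeOf θ)) := by
  rw [arctan_slopeOf h]; ring

variable {ι : Type*} (s : Finset ι) (ω ω' : ι → ℝ)

open Classical in
/-- The phase at a vertex in terms of the phases at the beginning of the outgoing edges: the
numbers of zeros and the slopes are added. -/
def angleSum : ℝ :=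
  ((∑ i ∈ s, phaseCount (ω i) : ℤ) : ℝ) * Real.pi +
    if ∃ i ∈ s, Real.sin (ω i) = 0 then Real.pi
    else Real.pi / 2 + Real.arctan (∑ i ∈ s, slopeOf (ω i))

variable {s ω ω'}

theorem angleSum_of_exists (h : ∃ i ∈ s, Real.sin (ω i) = 0) :
    angleSum s ω = ((∑ i ∈ s, phaseCount (ω i) : ℤ) : ℝ) * Real.pi + Real.pi := by
  rw [angleSum, if_pos h]

theorem angleSum_of_forall (h : ∀ i ∈ s, Real.sin (ω i) ≠ 0) :
    angleSum s ω = ((∑ i ∈ s, phaseCount (ω i) : ℤ) : ℝ) * Real.pi +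
      (Real.pi / 2 + Real.arctan (∑ i ∈ s, slopeOf (ω i))) := by
  rw [angleSum, if_neg (by push Not; exact h)]

theorem phaseCount_angleSum : phaseCount (angleSum s ω) = ∑ i ∈ s, phaseCount (ω i) := by
  have hp := Real.pi_pos
  by_cases h : ∃ i ∈ s, Real.sin (ω i) = 0
  · rw [angleSum_of_exists h]
    exact phaseCount_eq (by linarith) le_rfl
  · push Not at h
    rw [angleSum_of_forall h]
    have h1 := Real.neg_pi_div_two_lt_arctan (∑ i ∈ s, slopeOf (ω i))
    have h2 := Real.arctan_lt_pi_div_two (∑ i ∈ s, slopeOf (ω i))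
    exact phaseCount_eq (by linarith) (by linarith)

theorem sin_angleSum_eq_zero_iff : Real.sin (angleSum s ω) = 0 ↔ ∃ i ∈ s, Real.sin (ω i) = 0 := by
  rw [sin_eq_zero_iff_phaseCount, phaseCount_angleSum]
  constructor
  · intro h
    by_contra! h'
    rw [angleSum_of_forall h'] at h
    have h2 := Real.arctan_lt_pi_div_two (∑ i ∈ s, slopeOf (ω i))
    linarith
  · exact angleSum_of_exists

theorem slopeOf_angleSum (h : ∀ i ∈ s, Real.sin (ω i) ≠ 0) :
    slopeOf (angleSum s ω) = ∑ i ∈ s, slopeOf (ω i) := by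
  have h0 : Real.sin (angleSum s ω) ≠ 0 := by
    rw [Ne, sin_angleSum_eq_zero_iff]; push Not; exact h
  apply Real.arctan_injective
  rw [arctan_slopeOf h0, phaseCount_angleSum, angleSum_of_forall h]
  ring

theorem slopeOf_lt {a b : ℝ} (hn : phaseCount a = phaseCount b) (ha : Real.sin a ≠ 0)
    (hb : Real.sin b ≠ 0) (h : a < b) : slopeOf a < slopeOf b := by
  rw [← Real.arctan_strictMono.lt_iff_lt, arctan_slopeOf ha, arctan_slopeOf hb, hn]
  linarith

theorem sin_ne_zero_of_lt {a b : ℝ} (hn : phaseCount a = phaseCount b) (h : a < b) :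
    Real.sin a ≠ 0 := by
  rw [Ne, sin_eq_zero_iff_phaseCount, hn]
  have := le_phaseCount b
  intro h'; linarith

theorem sum_phaseCount_le (h : ∀ i ∈ s, ω i ≤ ω' i) :
    ∑ i ∈ s, phaseCount (ω i) ≤ ∑ i ∈ s, phaseCount (ω' i) :=
  Finset.sum_le_sum fun i hi => phaseCount_mono (h i hi)

theorem angleSum_lt_of_count_lt
    (hlt : ∑ i ∈ s, phaseCount (ω i) < ∑ i ∈ s, phaseCount (ω' i)) :
    angleSum s ω < angleSum s ω' := by
  have h1 := le_phaseCount (angleSum s ω)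
  have h2 := phaseCount_lt (angleSum s ω')
  rw [phaseCount_angleSum] at h1 h2
  have h3 : ((∑ i ∈ s, phaseCount (ω i) : ℤ) : ℝ) + 1 ≤ ((∑ i ∈ s, phaseCount (ω' i) : ℤ) : ℝ) := by
    exact_mod_cast hlt
  nlinarith [Real.pi_pos]

/-- If the total count grows, the two values lie in different intervals of length π. Otherwise all
counts agree: then a vanishing sine among the larger phases gives the top value of the common
interval, and without one the slopes are compared term by term. -/
theorem angleSum_le (h : ∀ i ∈ s, ω i ≤ ω' i) : angleSum s ω ≤ angleSum s ω' := by
  rcases (sum_phaseCount_le h).lt_or_eq with hlt | heq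
  · exact (angleSum_lt_of_count_lt hlt).le
  · have hn := (Finset.sum_eq_sum_iff_of_le fun i hi => phaseCount_mono (h i hi)).mp heq
    by_cases hb : ∃ i ∈ s, Real.sin (ω' i) = 0
    · rw [angleSum_of_exists hb, ← heq]
      have := le_phaseCount (angleSum s ω)
      rwa [phaseCount_angleSum] at this
    · push Not at hb
      have ha : ∀ i ∈ s, Real.sin (ω i) ≠ 0 := fun i hi => by
        rcases (h i hi).lt_or_eq with h' | h'
        · exact sin_ne_zero_of_lt (hn i hi) h'
        · rw [h']; exact hb i hi
      rw [angleSum_of_forall ha, angleSum_of_forall hb, heq]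
      gcongr with i hi
      rcases (h i hi).lt_or_eq with h' | h'
      · exact (slopeOf_lt (hn i hi) (ha i hi) (hb i hi) h').le
      · rw [h']

theorem angleSum_lt (hs : s.Nonempty) (h : ∀ i ∈ s, ω i < ω' i) :
    angleSum s ω < angleSum s ω' := by
  rcases (sum_phaseCount_le fun i hi => (h i hi).le).lt_or_eq with hlt | heq
  · exact angleSum_lt_of_count_lt hlt
  · have hn := (Finset.sum_eq_sum_iff_of_le fun i hi => phaseCount_mono (h i hi).le).mp heq
    have ha : ∀ i ∈ s, Real.sin (ω i) ≠ 0 := fun i hi => sin_ne_zero_of_lt (hn i hi) (h i hi)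
    by_cases hb : ∃ i ∈ s, Real.sin (ω' i) = 0
    · rw [angleSum_of_exists hb, angleSum_of_forall ha, heq]
      have := Real.arctan_lt_pi_div_two (∑ i ∈ s, slopeOf (ω i))
      linarith
    · push Not at hb
      rw [angleSum_of_forall ha, angleSum_of_forall hb, heq]
      have : ∑ i ∈ s, slopeOf (ω i) < ∑ i ∈ s, slopeOf (ω' i) :=
        Finset.sum_lt_sum_of_nonempty hs fun i hi =>
          slopeOf_lt (hn i hi) (ha i hi) (hb i hi) (h i hi)
      have := Real.arctan_strictMono this
      linarith

theorem abs_arctan_sub_lt {κ m : ℝ} (hκ : 0 < κ) :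
    |Real.arctan (m / κ) - Real.arctan m| < Real.pi / 2 := by
  have h1 := Real.arctan_lt_pi_div_two m
  have h2 := Real.arctan_lt_pi_div_two (m / κ)
  have h3 := Real.neg_pi_div_two_lt_arctan m
  have h4 := Real.neg_pi_div_two_lt_arctan (m / κ)
  rw [abs_lt]
  rcases le_total 0 m with h | h
  · have h5 : 0 ≤ Real.arctan m := Real.arctan_nonneg.mpr h
    have h6 : 0 ≤ Real.arctan (m / κ) := Real.arctan_nonneg.mpr (by positivity)
    constructor <;> linarith
  · have h5 : Real.arctan m ≤ 0 := by simpa using Real.arctan_mono h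
    have h6 : Real.arctan (m / κ) ≤ 0 := by
      simpa using Real.arctan_mono (div_nonpos_of_nonpos_of_nonneg h hκ.le)
    constructor <;> linarith

theorem SameSlope.sin_eq_zero_iff {κ θ φ : ℝ} (h : SameSlope κ θ φ) :
    Real.sin φ = 0 ↔ Real.sin θ = 0 := by
  obtain ⟨⟨c, hc, h1, -⟩, -⟩ := h
  rw [h1, mul_eq_zero, or_iff_right hc.ne']

theorem SameSlope.slopeOf_eq {κ θ φ : ℝ} (hκ : 0 < κ) (h : SameSlope κ θ φ) :
    slopeOf φ = slopeOf θ / κ := by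
  obtain ⟨⟨c, hc, h1, h2⟩, -⟩ := h
  have : Real.cos φ = c * Real.cos θ / κ := by field_simp; linarith
  rw [slopeOf, slopeOf, h1, this]
  rcases eq_or_ne (Real.sin θ) 0 with h0 | h0
  · simp [h0]
  · field_simp

/-- The phases differ by less than π/2, and so do the arctangents of the slopes, which have the same
sign. Hence π times the difference of the counts is less than π. -/
theorem SameSlope.phaseCount_eq {κ θ φ : ℝ} (hκ : 0 < κ) (h : SameSlope κ θ φ) :
    phaseCount φ = phaseCount θ := by
  have hz := h.sin_eq_zero_iff
  have hsl := h.slopeOf_eq hκ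
  have hd := h.2
  have hp := Real.pi_pos
  have key : |((phaseCount φ - phaseCount θ : ℤ) : ℝ) * Real.pi| < Real.pi := by
    by_cases h0 : Real.sin θ = 0
    · have e1 := sin_eq_zero_iff_phaseCount.mp h0
      have e2 := sin_eq_zero_iff_phaseCount.mp (hz.mpr h0)
      have : ((phaseCount φ - phaseCount θ : ℤ) : ℝ) * Real.pi = φ - θ := by
        push_cast; linarith
      rw [this]; linarith
    · have e1 := arctan_slopeOf h0
      have e2 := arctan_slopeOf (mt hz.mp h0)
      rw [hsl] at e2
      have e3 := abs_arctan_sub_lt (m := slopeOf θ) hκ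
      have : ((phaseCount φ - phaseCount θ : ℤ) : ℝ) * Real.pi =
          (φ - θ) - (Real.arctan (slopeOf θ / κ) - Real.arctan (slopeOf θ)) := by
        push_cast; linarith
      rw [this]
      exact (abs_sub _ _).trans_lt (by linarith)
  rw [abs_mul, abs_of_pos hp, ← Int.cast_abs] at key
  have : ((|phaseCount φ - phaseCount θ| : ℤ) : ℝ) < 1 := by
    by_contra! hcon
    nlinarith
  have h1 : |phaseCount φ - phaseCount θ| < 1 := by exact_mod_cast this
  rw [Int.abs_lt_one_iff] at h1
  omega

theorem sin_cos_of_angle {θ : ℝ} (h : Real.sin θ ≠ 0) :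
    ∃ c : ℝ, 0 < c ∧ Real.sin θ = (-1) ^ phaseCount θ * c ∧
      Real.cos θ = -((-1) ^ phaseCount θ * (c * slopeOf θ)) := by
  have h1 : Real.sin θ = (-1) ^ phaseCount θ * Real.cos (Real.arctan (slopeOf θ)) := by
    conv_lhs => rw [eq_angle_of_sin_ne_zero h]
    rw [add_comm, Real.sin_add_int_mul_pi, add_comm, Real.sin_add_pi_div_two]
  refine ⟨Real.cos (Real.arctan (slopeOf θ)), Real.cos_arctan_pos _, h1, ?_⟩
  have h2 : (-1 : ℝ) ^ phaseCount θ * (Real.cos (Real.arctan (slopeOf θ)) * slopeOf θ) =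
    Real.sin θ * slopeOf θ := by rw [h1]; ring
  rw [h2, slopeOf]
  field_simp

theorem sameSlope_of_phaseCount {κ θ φ : ℝ} (hκ : 0 < κ) (hn : phaseCount φ = phaseCount θ)
    (h0 : Real.sin φ = 0 ↔ Real.sin θ = 0)
    (hs : Real.sin θ ≠ 0 → slopeOf φ = slopeOf θ / κ) : SameSlope κ θ φ := by
  by_cases h : Real.sin θ = 0
  · have e1 := sin_eq_zero_iff_phaseCount.mp h
    have e2 := sin_eq_zero_iff_phaseCount.mp (h0.mpr h)
    have : φ = θ := by rw [e1, e2, hn]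
    refine ⟨⟨κ, hκ, by rw [h0.mpr h, h, mul_zero], by rw [this]⟩, ?_⟩
    rw [this, sub_self, abs_zero]; linarith [Real.pi_pos]
  · have h' := mt h0.mp h
    obtain ⟨c, hc, c1, c2⟩ := sin_cos_of_angle h
    obtain ⟨d, hd, d1, d2⟩ := sin_cos_of_angle h'
    have hs' := hs h
    refine ⟨⟨d / c, div_pos hd hc, ?_, ?_⟩, ?_⟩
    · rw [c1, d1, hn]; field_simp
    · rw [c2, d2, hn, hs']; field_simp
    · have e1 := arctan_slopeOf h
      have e2 := arctan_slopeOf h'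
      have e3 := abs_arctan_sub_lt (m := slopeOf θ) hκ
      rw [hs', hn] at e2
      have : φ - θ = Real.arctan (slopeOf θ / κ) - Real.arctan (slopeOf θ) := by linarith
      rwa [this]

/-- Addition of slopes commutes with division by κ, and counts and zeros do not see the scale; so a
change of scale passes through the vertices. -/
theorem sameSlope_angleSum {κ : ℝ} (hκ : 0 < κ) (h : ∀ i ∈ s, SameSlope κ (ω i) (ω' i)) :
    SameSlope κ (angleSum s ω) (angleSum s ω') := by
  refine sameSlope_of_phaseCount hκ ?_ ?_ fun h0 => ?_
  · rw [phaseCount_angleSum, phaseCount_angleSum]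
    exact Finset.sum_congr rfl fun i hi => (h i hi).phaseCount_eq hκ
  · rw [sin_angleSum_eq_zero_iff, sin_angleSum_eq_zero_iff]
    exact exists_congr fun i => and_congr_right fun hi => (h i hi).sin_eq_zero_iff
  · rw [Ne, sin_angleSum_eq_zero_iff] at h0
    push Not at h0
    rw [slopeOf_angleSum h0, slopeOf_angleSum fun i hi => mt (h i hi).sin_eq_zero_iff.mp (h0 i hi),
      Finset.sum_div]
    exact Finset.sum_congr rfl fun i hi => (h i hi).slopeOf_eq hκ

theorem sin_add_int_mul_pi_eq_zero {θ : ℝ} {k : ℤ} :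
    Real.sin (θ + k * Real.pi) = 0 ↔ Real.sin θ = 0 := by
  rw [Real.sin_add_int_mul_pi, mul_eq_zero, or_iff_right (zpow_ne_zero _ (by norm_num))]

theorem phaseCount_add_int_mul_pi {θ : ℝ} {k : ℤ} :
    phaseCount (θ + k * Real.pi) = phaseCount θ + k := by
  have h1 := phaseCount_lt θ
  have h2 := le_phaseCount θ
  exact phaseCount_eq (by push_cast; linarith) (by push_cast; linarith)

theorem slopeOf_add_int_mul_pi {θ : ℝ} {k : ℤ} : slopeOf (θ + k * Real.pi) = slopeOf θ := by
  rw [slopeOf, slopeOf, Real.sin_add_int_mul_pi, Real.cos_add_int_mul_pi,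
    mul_div_mul_left _ _ (zpow_ne_zero _ (by norm_num))]

theorem angleSum_add_int_mul_pi (k : ι → ℤ) :
    angleSum s (fun i => ω i + k i * Real.pi) = angleSum s ω + ((∑ i ∈ s, k i : ℤ) : ℝ) * Real.pi := by
  simp only [angleSum, sin_add_int_mul_pi_eq_zero, phaseCount_add_int_mul_pi,
    slopeOf_add_int_mul_pi, Finset.sum_add_distrib]
  push_cast
  ring

end AngleSum

/-! ### One-sided limits of sums of phases. -/

section AngleLimits

theorem tendsto_slopeOf_left {a : ℝ} (h : Real.sin a = 0) : Tendsto slopeOf (𝓝[<] a) atTop := by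
  obtain ⟨k, rfl⟩ := Real.sin_eq_zero_iff.mp h
  have h1 : Tendsto (fun θ : ℝ => θ - k * Real.pi + Real.pi / 2) (𝓝[<] (k * Real.pi))
      (𝓝[<] (Real.pi / 2)) := by
    refine tendsto_nhdsWithin_iff.mpr ⟨?_, ?_⟩
    · have : Tendsto (fun θ : ℝ => θ - k * Real.pi + Real.pi / 2) (𝓝 (k * Real.pi))
          (𝓝 (k * Real.pi - k * Real.pi + Real.pi / 2)) := by
        apply Continuous.tendsto; fun_prop
      simpa using this.mono_left nhdsWithin_le_nhds
    · filter_upwards [self_mem_nhdsWithin] with θ hθ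
      simp only [mem_Iio] at hθ ⊢; linarith
  refine (Real.tendsto_tan_pi_div_two.comp h1).congr fun θ => ?_
  rw [Function.comp, Real.tan_eq_sin_div_cos, Real.sin_add_pi_div_two, Real.cos_add_pi_div_two,
    slopeOf, Real.sin_sub_int_mul_pi, Real.cos_sub_int_mul_pi, div_neg,
    mul_div_mul_left _ _ (zpow_ne_zero _ (by norm_num))]

theorem tendsto_slopeOf_right {a : ℝ} (h : Real.sin a = 0) : Tendsto slopeOf (𝓝[>] a) atBot := by
  have h1 : Tendsto (fun θ : ℝ => -θ) (𝓝[>] a) (𝓝[<] (-a)) := by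
    exact tendsto_neg_nhdsGT
  have h2 := (tendsto_slopeOf_left (a := -a) (by rw [Real.sin_neg, h, neg_zero])).comp h1
  refine (tendsto_neg_atTop_atBot.comp h2).congr fun θ => ?_
  simp [slopeOf, div_neg]

theorem continuousAt_slopeOf {a : ℝ} (h : Real.sin a ≠ 0) : ContinuousAt slopeOf a :=
  (Real.continuous_cos.continuousAt.div Real.continuous_sin.continuousAt h).neg

/-- The intervals of `phaseCount` are closed on the right, which makes the count left continuous; on
the right it gains one exactly at the multiples of π. -/
theorem eventually_left_phaseCount (a : ℝ) :
    ∀ᶠ θ in 𝓝[<] a, phaseCount θ = phaseCount a ∧ Real.sin θ ≠ 0 := by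
  filter_upwards [Ioo_mem_nhdsLT (phaseCount_lt a)] with θ hθ
  have h1 := le_phaseCount a
  have h2 : phaseCount θ = phaseCount a := phaseCount_eq hθ.1 (by linarith [hθ.2])
  exact ⟨h2, sin_ne_zero_of_lt h2 hθ.2⟩

theorem eventually_right_phaseCount (a : ℝ) :
    ∀ᶠ θ in 𝓝[>] a, phaseCount θ = phaseCount a + (if Real.sin a = 0 then 1 else 0) ∧
      Real.sin θ ≠ 0 := by
  have hp := Real.pi_pos
  have key : ∀ (n : ℤ) (θ : ℝ), n * Real.pi < θ → θ < n * Real.pi + Real.pi →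
      phaseCount θ = n ∧ Real.sin θ ≠ 0 := fun n θ h1 h2 => by
    have h3 := phaseCount_eq h1 h2.le
    refine ⟨h3, fun h => ?_⟩
    rw [sin_eq_zero_iff_phaseCount, h3] at h
    linarith
  split_ifs with h
  · have h1 := sin_eq_zero_iff_phaseCount.mp h
    filter_upwards [Ioo_mem_nhdsGT (show a < a + Real.pi by linarith)] with θ hθ
    refine key _ θ ?_ ?_
    · push_cast; linarith [hθ.1]
    · push_cast; linarith [hθ.2]
  · have h1 : a < phaseCount a * Real.pi + Real.pi :=
      lt_of_le_of_ne (le_phaseCount a) fun h' => h (sin_eq_zero_iff_phaseCount.mpr h')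
    filter_upwards [Ioo_mem_nhdsGT h1] with θ hθ
    rw [add_zero]
    exact key _ θ ((phaseCount_lt a).trans hθ.1) hθ.2

variable {ι α : Type*} {L : Filter α}

theorem tendsto_sum_atTop_of {s : Finset ι} {f : ι → α → ℝ} {p : ι → Prop}
    (h1 : ∀ i ∈ s, p i → Tendsto (f i) L atTop)
    (h2 : ∀ i ∈ s, ¬p i → ∃ c, Tendsto (f i) L (𝓝 c)) (h3 : ∃ i ∈ s, p i) :
    Tendsto (fun x => ∑ i ∈ s, f i x) L atTop := by
  classical
  obtain ⟨j, hj, hpj⟩ := h3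
  have hb : ∀ i ∈ s, ∃ C : ℝ, ∀ᶠ x in L, C ≤ f i x := fun i hi => by
    by_cases hp : p i
    · exact ⟨0, (h1 i hi hp).eventually_ge_atTop 0⟩
    · obtain ⟨c, hc⟩ := h2 i hi hp
      exact ⟨c - 1, (hc.eventually_const_lt (by linarith : c - 1 < c)).mono fun x hx => hx.le⟩
  choose! C hC using hb
  have h4 : ∀ᶠ x in L, ∑ i ∈ s.erase j, C i ≤ ∑ i ∈ s.erase j, f i x := by
    have : ∀ᶠ x in L, ∀ i ∈ s.erase j, C i ≤ f i x :=
      (Finset.eventually_all _).mpr fun i hi => hC i (Finset.mem_of_mem_erase hi)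
    filter_upwards [this] with x hx using Finset.sum_le_sum hx
  refine (tendsto_atTop_add_right_of_le' L _ (h1 j hj hpj) h4).congr fun x => ?_
  exact Finset.add_sum_erase s (fun i => f i x) hj

variable {s : Finset ι} {ω : ι → α → ℝ} {a : ι → ℝ}

/-- From the left the counts are constant, and the slopes at limits with zero sine tend to +∞. The
arctangent then tends to π/2, in accordance with the value π in the definition. -/
theorem tendsto_angleSum_left (h : ∀ i ∈ s, Tendsto (ω i) L (𝓝[<] (a i))) :
    Tendsto (fun x => angleSum s fun i => ω i x) L (𝓝 (angleSum s a)) := by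
  have hev : ∀ᶠ x in L, ∀ i ∈ s, phaseCount (ω i x) = phaseCount (a i) ∧ Real.sin (ω i x) ≠ 0 :=
    (Finset.eventually_all _).mpr fun i hi => (h i hi).eventually (eventually_left_phaseCount (a i))
  have hform : ∀ᶠ x in L, ((∑ i ∈ s, phaseCount (a i) : ℤ) : ℝ) * Real.pi +
      (Real.pi / 2 + Real.arctan (∑ i ∈ s, slopeOf (ω i x))) = angleSum s fun i => ω i x := by
    filter_upwards [hev] with x hx
    rw [angleSum_of_forall fun i hi => (hx i hi).2,
      Finset.sum_congr rfl fun i hi => (hx i hi).1]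
  refine Tendsto.congr' hform ?_
  have hcont : ∀ i ∈ s, Real.sin (a i) ≠ 0 →
      Tendsto (fun x => slopeOf (ω i x)) L (𝓝 (slopeOf (a i))) := fun i hi h0 =>
    (continuousAt_slopeOf h0).tendsto.comp ((h i hi).mono_right nhdsWithin_le_nhds)
  by_cases hb : ∃ i ∈ s, Real.sin (a i) = 0
  · rw [angleSum_of_exists hb]
    have h1 : Tendsto (fun x => ∑ i ∈ s, slopeOf (ω i x)) L atTop :=
      tendsto_sum_atTop_of (p := fun i => Real.sin (a i) = 0)
        (fun i hi h0 => (tendsto_slopeOf_left h0).comp (h i hi))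
        (fun i hi h0 => ⟨_, hcont i hi h0⟩) hb
    have h2 := (tendsto_nhds_of_tendsto_nhdsWithin Real.tendsto_arctan_atTop).comp h1
    have h3 := (h2.const_add (Real.pi / 2)).const_add
      (((∑ i ∈ s, phaseCount (a i) : ℤ) : ℝ) * Real.pi)
    rw [add_halves] at h3
    exact h3
  · push Not at hb
    rw [angleSum_of_forall hb]
    have h1 := tendsto_finsetSum s fun i hi => hcont i hi (hb i hi)
    exact ((Real.continuous_arctan.tendsto _).comp h1).const_add _ |>.const_add _

-- Each of the d terms with zero sine completes a half turn while its slope restarts at -∞, which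
-- sends the arctangent from its top value π/2 to -π/2: the net gain is d - 1 half turns. For d = 0
-- the sum is continuous, in accordance with the truncated subtraction.
open Classical in
theorem tendsto_angleSum_right (h : ∀ i ∈ s, Tendsto (ω i) L (𝓝[>] (a i))) :
    Tendsto (fun x => angleSum s fun i => ω i x) L
      (𝓝 (angleSum s a + (({i ∈ s | Real.sin (a i) = 0}.card - 1 : ℕ) : ℝ) * Real.pi)) ∧
    ∀ᶠ x in L, angleSum s a + (({i ∈ s | Real.sin (a i) = 0}.card - 1 : ℕ) : ℝ) * Real.pi ≤
        angleSum s (fun i => ω i x) ∧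
      (s.Nonempty → angleSum s a + (({i ∈ s | Real.sin (a i) = 0}.card - 1 : ℕ) : ℝ) * Real.pi <
        angleSum s (fun i => ω i x)) := by
  set d := {i ∈ s | Real.sin (a i) = 0}.card with hd
  have hev : ∀ᶠ x in L, ∀ i ∈ s, phaseCount (ω i x) =
      phaseCount (a i) + (if Real.sin (a i) = 0 then 1 else 0) ∧ Real.sin (ω i x) ≠ 0 :=
    (Finset.eventually_all _).mpr fun i hi => (h i hi).eventually (eventually_right_phaseCount (a i))
  have hsum : ∑ i ∈ s, (phaseCount (a i) + (if Real.sin (a i) = 0 then 1 else 0) : ℤ) =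
      ∑ i ∈ s, phaseCount (a i) + d := by
    rw [Finset.sum_add_distrib, hd, Finset.card_filter]
    push_cast
    rfl
  have hform : ∀ᶠ x in L, (((∑ i ∈ s, phaseCount (a i) + d : ℤ)) : ℝ) * Real.pi +
      (Real.pi / 2 + Real.arctan (∑ i ∈ s, slopeOf (ω i x))) = angleSum s fun i => ω i x := by
    filter_upwards [hev] with x hx
    rw [angleSum_of_forall fun i hi => (hx i hi).2,
      Finset.sum_congr rfl fun i hi => (hx i hi).1, hsum]
  have hcont : ∀ i ∈ s, Real.sin (a i) ≠ 0 →
      Tendsto (fun x => slopeOf (ω i x)) L (𝓝 (slopeOf (a i))) := fun i hi h0 =>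
    (continuousAt_slopeOf h0).tendsto.comp ((h i hi).mono_right nhdsWithin_le_nhds)
  by_cases hb : ∃ i ∈ s, Real.sin (a i) = 0
  · have hdpos : 1 ≤ d := by
      obtain ⟨i, hi, h0⟩ := hb
      exact Finset.card_pos.mpr ⟨i, Finset.mem_filter.mpr ⟨hi, h0⟩⟩
    have hval : angleSum s a + ((d - 1 : ℕ) : ℝ) * Real.pi =
        ((∑ i ∈ s, phaseCount (a i) + d : ℤ) : ℝ) * Real.pi := by
      rw [angleSum_of_exists hb]
      push_cast [Nat.cast_sub hdpos]
      ring
    rw [hval]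
    refine ⟨Tendsto.congr' hform ?_, ?_⟩
    · have h1 : Tendsto (fun x => ∑ i ∈ s, -slopeOf (ω i x)) L atTop :=
        tendsto_sum_atTop_of (p := fun i => Real.sin (a i) = 0)
          (fun i hi h0 => tendsto_neg_atBot_atTop.comp ((tendsto_slopeOf_right h0).comp (h i hi)))
          (fun i hi h0 => ⟨_, (hcont i hi h0).neg⟩) hb
      have h1' : Tendsto (fun x => ∑ i ∈ s, slopeOf (ω i x)) L atBot := by
        refine (tendsto_neg_atTop_atBot.comp h1).congr fun x => ?_
        simp
      have h2 := (tendsto_nhds_of_tendsto_nhdsWithin Real.tendsto_arctan_atBot).comp h1'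
      have h3 := (h2.const_add (Real.pi / 2)).const_add
        (((∑ i ∈ s, phaseCount (a i) + d : ℤ) : ℝ) * Real.pi)
      rw [add_neg_cancel, add_zero] at h3
      exact h3
    · filter_upwards [hform] with x hx
      have := Real.neg_pi_div_two_lt_arctan (∑ i ∈ s, slopeOf (ω i x))
      exact ⟨by rw [← hx]; linarith, fun _ => by rw [← hx]; linarith⟩
  · push Not at hb
    have hd0 : d = 0 := by
      rw [hd, Finset.card_eq_zero, Finset.filter_eq_empty_iff]
      exact fun i hi => hb i hi
    simp only [hd0, Nat.zero_sub, Nat.cast_zero, zero_mul, add_zero]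
    simp only [hd0, Nat.cast_zero, add_zero] at hform
    refine ⟨Tendsto.congr' hform ?_, ?_⟩
    · rw [angleSum_of_forall hb]
      have h1 := tendsto_finsetSum s fun i hi => hcont i hi (hb i hi)
      exact ((Real.continuous_arctan.tendsto _).comp h1).const_add _ |>.const_add _
    · have hgt : ∀ᶠ x in L, ∀ i ∈ s, a i < ω i x :=
        (Finset.eventually_all _).mpr fun i hi => (h i hi).eventually self_mem_nhdsWithin
      filter_upwards [hgt] with x hx
      exact ⟨angleSum_le fun i hi => (hx i hi).le, fun hs => angleSum_lt hs hx⟩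

end AngleLimits

/-! ### Parents, children, induction and branches in a rooted tree. -/

section TreeCombinatorics

set_option linter.unusedSectionVars false

variable {V : Type u} [Fintype V] [DecidableEq V]
variable {G : SimpleGraph V} [DecidableRel G.Adj] {r : V}

theorem edge_snd_ne_root (e : Edge G r) : e.1.snd ≠ r := fun h => by
  have := e.2
  rw [h, SimpleGraph.dist_self] at this
  omega

theorem exists_edge_to (hG : G.IsTree) {u : V} (hu : u ≠ r) : ∃ e : Edge G r, e.1.snd = u := by
  obtain ⟨p, hp⟩ := hG.connected.exists_walk_length_eq_dist u r
  cases p with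
  | nil => exact absurd rfl hu
  | @cons _ v _ h p' =>
    have h1 := SimpleGraph.dist_le p'
    have h2 := hG.dist_eq_dist_add_one_of_adj r h
    rw [SimpleGraph.Walk.length_cons, SimpleGraph.dist_comm] at hp
    rw [SimpleGraph.dist_comm] at h1
    exact ⟨⟨⟨(v, u), h.symm⟩, by simp only; omega⟩, rfl⟩

theorem adj_of_fst_eq (e : Edge G r) {v : V} (h : e.1.fst = v) : G.Adj v e.1.snd := by
  subst h; exact e.1.adj

/-- The path from the root to u is unique, and the upper end of an edge to u, being nearer to the
root, must lie on it. This yields the uniqueness of parents. -/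
theorem edge_fst_eq_penultimate (hG : G.IsTree) (e : Edge G r) {u : V} (hu : e.1.snd = u)
    {p : G.Walk r u} (hp : p.IsPath) : e.1.fst = p.penultimate := by
  subst hu
  refine hG.isAcyclic.eq_penultimate_of_adj_end hp e.1.adj.symm ?_
  obtain ⟨q, hq, hql⟩ := hG.connected.exists_path_of_dist r e.1.fst
  refine hG.isAcyclic.mem_support_of_ne_mem_support_of_adj_of_isPath hp hq e.1.adj.symm fun hm => ?_
  have h1 := SimpleGraph.dist_le (q.takeUntil _ hm)
  have h2 := q.length_takeUntil_le_length hm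
  have h3 := e.2
  omega

theorem edge_snd_injective (hG : G.IsTree) : Function.Injective fun e : Edge G r => e.1.snd := by
  intro e f h
  obtain ⟨p, hp, -⟩ := hG.connected.exists_path_of_dist r e.1.snd
  refine Subtype.ext (SimpleGraph.Dart.ext _ _ (Prod.ext ?_ h))
  exact (edge_fst_eq_penultimate hG e rfl hp).trans (edge_fst_eq_penultimate hG f h.symm hp).symm

theorem adj_iff_edge (hG : G.IsTree) {u v : V} : G.Adj u v ↔
    (∃ e : Edge G r, e.1.fst = u ∧ e.1.snd = v) ∨ ∃ e : Edge G r, e.1.fst = v ∧ e.1.snd = u := by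
  constructor
  · intro h
    rcases hG.dist_eq_dist_add_one_of_adj r h with h1 | h1
    · exact Or.inr ⟨⟨⟨(v, u), h.symm⟩, h1⟩, rfl, rfl⟩
    · exact Or.inl ⟨⟨⟨(u, v), h⟩, h1⟩, rfl, rfl⟩
  · rintro (⟨e, rfl, rfl⟩ | ⟨e, rfl, rfl⟩)
    · exact e.1.adj
    · exact e.1.adj.symm

/-- A set of vertices which contains the children of its elements. -/
def DescClosed (G : SimpleGraph V) [DecidableRel G.Adj] (r : V) (S : Finset V) : Prop :=
  ∀ e : Edge G r, e.1.fst ∈ S → e.1.snd ∈ S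

theorem sum_vertices (hG : G.IsTree) {M : Type*} [AddCommMonoid M] (S : Finset V) (f : V → M) :
    ∑ v ∈ S, f v = (if r ∈ S then f r else 0) + ∑ e : Edge G r with e.1.snd ∈ S, f e.1.snd := by
  have h1 : ∑ e : Edge G r with e.1.snd ∈ S, f e.1.snd = ∑ v ∈ S.erase r, f v := by
    refine Finset.sum_bij (fun e _ => e.1.snd) ?_ ?_ ?_ ?_
    · intro e he
      exact Finset.mem_erase.mpr ⟨edge_snd_ne_root e, (Finset.mem_filter.mp he).2⟩
    · intro e _ f _ h; exact edge_snd_injective hG h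
    · intro v hv
      obtain ⟨hv1, hv2⟩ := Finset.mem_erase.mp hv
      obtain ⟨e, rfl⟩ := exists_edge_to hG hv1
      exact ⟨e, by simp [hv2], rfl⟩
    · intros; rfl
  rw [h1]
  split_ifs with h
  · exact (Finset.add_sum_erase S f h).symm
  · rw [Finset.erase_eq_of_notMem h, zero_add]

theorem sum_neighbors (hG : G.IsTree) {M : Type*} [AddCommMonoid M] (v : V) (f : V → M) :
    ∑ u ∈ G.neighborFinset v, f u =
      ∑ e : Edge G r with e.1.fst = v, f e.1.snd + ∑ e : Edge G r with e.1.snd = v, f e.1.fst := by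
  have h1 : G.neighborFinset v = ({e : Edge G r | e.1.fst = v} : Finset _).image (fun e => e.1.snd) ∪
      ({e : Edge G r | e.1.snd = v} : Finset _).image (fun e => e.1.fst) := by
    ext u
    simp only [SimpleGraph.mem_neighborFinset, Finset.mem_union, Finset.mem_image,
      Finset.mem_filter, Finset.mem_univ, true_and]
    rw [adj_iff_edge hG (r := r)]
    constructor
    · rintro (⟨e, h1, h2⟩ | ⟨e, h1, h2⟩)
      · exact Or.inl ⟨e, h1, h2⟩
      · exact Or.inr ⟨e, h2, h1⟩
    · rintro (⟨e, h1, h2⟩ | ⟨e, h1, h2⟩)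
      · exact Or.inl ⟨e, h1, h2⟩
      · exact Or.inr ⟨e, h2, h1⟩
  rw [h1, Finset.sum_union, Finset.sum_image, Finset.sum_image]
  · intro e he f hf _
    exact edge_snd_injective hG ((Finset.mem_filter.mp he).2.trans (Finset.mem_filter.mp hf).2.symm)
  · intro e _ f _ h; exact edge_snd_injective hG h
  · rw [Finset.disjoint_left]
    rintro u hu hu'
    simp only [Finset.mem_image, Finset.mem_filter, Finset.mem_univ, true_and] at hu hu'
    obtain ⟨e, he1, he2⟩ := hu
    obtain ⟨f, hf1, hf2⟩ := hu'
    have h1 := e.2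
    have h2 := f.2
    rw [he1, he2] at h1
    rw [hf1, hf2] at h2
    omega

/-- Induction from the leaves upwards, by descending distance from the root, which is bounded by the
number of vertices. It serves for everything that depends only on the descendants of a vertex. -/
theorem tree_induction (hG : G.IsTree) {P : V → Prop}
    (h : ∀ v, (∀ e : Edge G r, e.1.fst = v → P e.1.snd) → P v) (v : V) : P v := by
  have hb : ∀ v, G.dist r v < Fintype.card V := fun v => by
    obtain ⟨p, hp, hl⟩ := hG.connected.exists_path_of_dist r v
    rw [← hl]; exact hp.length_lt
  induction hn : Fintype.card V - G.dist r v using Nat.strong_induction_on generalizing v with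
  | _ n ih =>
    refine h v fun e he => ih _ ?_ _ rfl
    have h1 := e.2
    have h2 := hb e.1.snd
    rw [he] at h1
    omega

theorem root_induction (hG : G.IsTree) {P : V → Prop} (hr : P r)
    (h : ∀ e : Edge G r, P e.1.fst → P e.1.snd) (v : V) : P v := by
  induction hn : G.dist r v using Nat.strong_induction_on generalizing v with
  | _ n ih =>
    by_cases hv : v = r
    · rwa [hv]
    · obtain ⟨e, rfl⟩ := exists_edge_to hG hv
      exact h e (ih _ (by rw [← hn, e.2]; omega) _ rfl)

/-- Well-founded recursion along the child relation. By `hF` only the values at the children matter,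
so `default` at all other edges does no harm. -/
theorem exists_tree_recursion (hG : G.IsTree) {X : Type*} [Inhabited X]
    (F : V → (Edge G r → X) → X)
    (hF : ∀ v g g', (∀ e : Edge G r, e.1.fst = v → g e = g' e) → F v g = F v g') :
    ∃ θ : V → X, ∀ v, θ v = F v fun e => θ e.1.snd := by
  classical
  let R : V → V → Prop := fun u v => ∃ e : Edge G r, e.1.fst = v ∧ e.1.snd = u
  have hwf : WellFounded R := ⟨fun v => tree_induction hG (P := Acc R)
    (fun v ih => ⟨_, fun u hu => by obtain ⟨e, h1, rfl⟩ := hu; exact ih e h1⟩) v⟩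
  let Φ : ∀ v, (∀ u, R u v → X) → X := fun v ih =>
    F v fun e => if h : e.1.fst = v then ih e.1.snd ⟨e, h, rfl⟩ else default
  refine ⟨hwf.fix Φ, fun v => ?_⟩
  rw [hwf.fix_eq]
  refine hF v _ _ fun e he => ?_
  rw [dif_pos he]

/-- Top-down recursion: values are chosen from the root to the leaves. -/
theorem exists_root_recursion (hG : G.IsTree) {X : Type*} (x₀ : X) (F : Edge G r → X → X) :
    ∃ θ : V → X, θ r = x₀ ∧ ∀ e : Edge G r, θ e.1.snd = F e (θ e.1.fst) := by
  classical
  let R : V → V → Prop := fun u v => ∃ e : Edge G r, e.1.fst = u ∧ e.1.snd = v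
  have hwf : WellFounded R := ⟨fun v => root_induction hG (P := Acc R)
    ⟨_, fun u hu => by obtain ⟨e, -, h2⟩ := hu; exact absurd h2 (edge_snd_ne_root e)⟩
    (fun e ih => ⟨_, fun u hu => by
      obtain ⟨f, h1, h2⟩ := hu
      rw [← h1, edge_snd_injective hG h2]; exact ih⟩) v⟩
  let Φ : ∀ v, (∀ u, R u v → X) → X := fun v ih =>
    if h : ∃ e : Edge G r, e.1.snd = v then
      F h.choose (ih h.choose.1.fst ⟨h.choose, rfl, h.choose_spec⟩) else x₀
  refine ⟨hwf.fix Φ, ?_, fun e => ?_⟩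
  · rw [hwf.fix_eq]
    exact dif_neg fun ⟨e, he⟩ => edge_snd_ne_root e he
  · rw [hwf.fix_eq]
    have h : ∃ f : Edge G r, f.1.snd = e.1.snd := ⟨e, rfl⟩
    have h2 : h.choose = e := edge_snd_injective hG h.choose_spec
    simp only [Φ, dif_pos h]
    rw [h2]

theorem mem_branch {w v : V} : v ∈ branch G r w ↔ ∃ p : G.Walk w v, r ∉ p.support := by
  simp [branch]

theorem mem_branch_self {w : V} (h : w ≠ r) : w ∈ branch G r w :=
  mem_branch.mpr ⟨.nil, by simpa using h.symm⟩

theorem root_notMem_branch {w : V} : r ∉ branch G r w := fun h => by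
  obtain ⟨p, hp⟩ := mem_branch.mp h
  exact hp p.end_mem_support

theorem branch_adj {w u v : V} (hu : u ∈ branch G r w) (h : G.Adj u v) (hv : v ≠ r) :
    v ∈ branch G r w := by
  obtain ⟨p, hp⟩ := mem_branch.mp hu
  refine mem_branch.mpr ⟨p.concat h, ?_⟩
  rw [SimpleGraph.Walk.support_concat]
  simp [hp, hv.symm]

theorem descClosed_branch (w : V) : DescClosed G r (branch G r w) := fun e he =>
  branch_adj he e.1.adj (edge_snd_ne_root e)

theorem fst_mem_branch {w : V} {e : Edge G r} (h : e.1.snd ∈ branch G r w) (hr : e.1.fst ≠ r) :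
    e.1.fst ∈ branch G r w :=
  branch_adj h e.1.adj.symm hr

/-- The edge from r to v and the way through w that avoids r afterwards are two paths between the
same vertices; in a tree they coincide, so the second has length one. -/
theorem eq_of_mem_branch_of_adj (hG : G.IsTree) {w v : V} (hw : G.Adj r w) (hv : G.Adj r v)
    (h : v ∈ branch G r w) : v = w := by
  classical
  obtain ⟨p, hp⟩ := mem_branch.mp h
  have h1 : r ∉ p.bypass.support := fun h' => hp (p.support_bypass_subset_support h')
  have h2 : (SimpleGraph.Walk.cons hw p.bypass).IsPath := p.bypass_isPath.cons h1
  have h3 := (hG.isAcyclic.subsingleton_path r v).elim ⟨_, h2⟩ (.singleton hv)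
  have h4 := congrArg (fun q : G.Path r v => q.1.length) h3
  simp only [SimpleGraph.Walk.length_cons, SimpleGraph.Path.singleton_coe,
    SimpleGraph.Walk.length_nil] at h4
  exact (SimpleGraph.Walk.eq_of_length_eq_zero (p := p.bypass) (by omega)).symm

theorem edge_fst_root_mem_branch (hG : G.IsTree) {w : V} (hw : G.Adj r w) {e : Edge G r}
    (he : e.1.fst = r) : e.1.snd ∈ branch G r w ↔ e.1.snd = w := by
  constructor
  · exact eq_of_mem_branch_of_adj hG hw (adj_of_fst_eq e he)
  · intro h; rw [h]; exact mem_branch_self hw.ne'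

theorem exists_branch (hG : G.IsTree) {v : V} (hv : v ≠ r) :
    ∃! w, w ∈ G.neighborFinset r ∧ v ∈ branch G r w := by
  revert hv
  refine root_induction hG (P := fun v => v ≠ r → ∃! w, w ∈ G.neighborFinset r ∧ v ∈ branch G r w)
    (fun h => absurd rfl h) (fun e ih _ => ?_) v
  by_cases he : e.1.fst = r
  · have ha : G.Adj r e.1.snd := adj_of_fst_eq e he
    refine ⟨e.1.snd, ⟨by simpa using ha, mem_branch_self ha.ne'⟩, fun w hw => ?_⟩
    exact ((edge_fst_root_mem_branch hG (by simpa using hw.1) he).mp hw.2).symm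
  · obtain ⟨w, ⟨hw1, hw2⟩, hu⟩ := ih he
    exact ⟨w, ⟨hw1, descClosed_branch w e hw2⟩, fun w' hw' => hu w' ⟨hw'.1, fst_mem_branch hw'.2 he⟩⟩

theorem prod_branches (hG : G.IsTree) {M : Type*} [CommMonoid M] (f : V → M) :
    ∏ v ∈ Finset.univ.erase r, f v = ∏ w ∈ G.neighborFinset r, ∏ v ∈ branch G r w, f v := by
  rw [← Finset.prod_biUnion]
  · congr 1
    ext v
    simp only [Finset.mem_erase, Finset.mem_univ, and_true, Finset.mem_biUnion]
    constructor
    · intro hv; obtain ⟨w, hw, -⟩ := exists_branch hG hv; exact ⟨w, hw⟩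
    · rintro ⟨w, -, hw⟩ rfl; exact root_notMem_branch hw
  · intro w hw w' hw' hne
    refine Finset.disjoint_left.mpr fun v hv hv' => hne ?_
    have hvr : v ≠ r := fun h => root_notMem_branch (h ▸ hv)
    exact (exists_branch hG hvr).unique ⟨by simpa using hw, hv⟩ ⟨by simpa using hw', hv'⟩

end TreeCombinatorics

/-! ### From counting functions to eigenvalues, and jumps of phases. -/

section Counting

/-- The values of the generalized inverse of a counting function, repeated according to the
jumps. -/
theorem exists_enumeration {N : ℝ → ℤ} {d : ℝ → ℕ} (hmono : Monotone N)
    (hleft : ∀ μ, ∀ᶠ x in 𝓝[<] μ, N x = N μ) (hright : ∀ μ, ∀ᶠ x in 𝓝[>] μ, N x = N μ + d μ)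
    (hzero : ∃ x, N x = 0) (hpos : ∀ x, 0 ≤ N x) (hunb : ∀ n : ℕ, ∃ x, (n : ℤ) < N x) :
    ∃ a : ℕ → ℝ, (∀ (n : ℕ) x, N x ≤ n ↔ x ≤ a n) ∧ ∀ μ, {n | a n = μ}.encard = d μ := by
  have hne : ∀ n : ℕ, {x | N x ≤ n}.Nonempty := fun n => by
    obtain ⟨x, hx⟩ := hzero
    exact ⟨x, by simp [hx]⟩
  have hbdd : ∀ n : ℕ, BddAbove {x | N x ≤ n} := fun n => by
    obtain ⟨x, hx⟩ := hunb n
    refine ⟨x, fun y hy => ?_⟩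
    by_contra! h
    exact absurd (hx.trans_le (hmono h.le)) (not_lt.mpr hy)
  -- Left continuity puts the supremum into the set, which gives the equivalence `hiff`.
  set a : ℕ → ℝ := fun n => sSup {x | N x ≤ n}
  have hiff : ∀ (n : ℕ) x, N x ≤ n ↔ x ≤ a n := by
    intro n x
    refine ⟨fun h => le_csSup (hbdd n) h, fun h => (hmono h).trans ?_⟩
    obtain ⟨y, hy, hy'⟩ := ((hleft (a n)).and self_mem_nhdsWithin).exists
    obtain ⟨z, hz, hyz⟩ := exists_lt_of_lt_csSup (hne n) hy'
    rw [← hy]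
    exact (hmono hyz.le).trans hz
  refine ⟨a, hiff, fun μ => ?_⟩
  -- The indices below N μ belong to smaller values, and those from the right limit N μ + d μ on to
  -- larger ones.
  have hset : {n | a n = μ} = (Finset.Ico (N μ).toNat ((N μ).toNat + d μ) : Set ℕ) := by
    ext n
    have h0 := hpos μ
    simp only [mem_ofPred_eq, Finset.coe_Ico, mem_Ico]
    constructor
    · intro h
      have h1 : N μ ≤ n := (hiff n μ).mpr h.ge
      refine ⟨by omega, ?_⟩
      by_contra! hcon
      obtain ⟨y, hy, hy'⟩ := ((hright μ).and self_mem_nhdsWithin).exists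
      have : y ≤ a n := (hiff n y).mp (by rw [hy]; omega)
      rw [h] at this
      exact absurd hy' (not_lt.mpr this)
    · rintro ⟨h1, h2⟩
      have h3 : μ ≤ a n := (hiff n μ).mp (by omega)
      by_contra hcon
      have h4 : μ < a n := lt_of_le_of_ne h3 (Ne.symm hcon)
      obtain ⟨y, hy, hy'⟩ := ((hright μ).and (Ioo_mem_nhdsGT h4)).exists
      have := (hiff n y).mpr hy'.2.le
      omega
  rw [hset, Set.encard_coe_eq_coe_finsetCard, Nat.card_Ico]
  simp

/-- Limits of a phase at `μ` from the left and from the right. -/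
def HasJump (f : ℝ → ℝ) (μ : ℝ) (J : ℕ) : Prop :=
  Tendsto f (𝓝[<] μ) (𝓝[≤] (f μ)) ∧ Tendsto f (𝓝[>] μ) (𝓝[≥] (f μ + J * Real.pi))

/-- The same with strict monotonicity. -/
def HasStrictJump (f : ℝ → ℝ) (μ : ℝ) (J : ℕ) : Prop :=
  Tendsto f (𝓝[<] μ) (𝓝[<] (f μ)) ∧ Tendsto f (𝓝[>] μ) (𝓝[>] (f μ + J * Real.pi))

theorem HasStrictJump.add_const {f : ℝ → ℝ} {μ : ℝ} {J : ℕ} (h : HasStrictJump f μ J) (c : ℝ) :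
    HasStrictJump (fun x => f x + c) μ J := by
  constructor
  · refine tendsto_nhdsWithin_iff.mpr ⟨(h.1.mono_right nhdsWithin_le_nhds).add_const c, ?_⟩
    filter_upwards [h.1.eventually self_mem_nhdsWithin] with x hx
    simp only [mem_Iio] at hx ⊢; linarith
  · refine tendsto_nhdsWithin_iff.mpr ⟨?_, ?_⟩
    · have := (h.2.mono_right nhdsWithin_le_nhds).add_const c
      rwa [add_right_comm] at this
    · filter_upwards [h.2.eventually self_mem_nhdsWithin] with x hx
      simp only [mem_Ioi] at hx ⊢; linarith

theorem HasStrictJump.phaseCount_left {f : ℝ → ℝ} {μ : ℝ} {J : ℕ} (h : HasStrictJump f μ J) :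
    ∀ᶠ x in 𝓝[<] μ, phaseCount (f x) = phaseCount (f μ) :=
  (h.1.eventually (eventually_left_phaseCount (f μ))).mono fun _ hx => hx.1

-- Immediately to the right the phase is strictly above f μ + J π, which completes one further half
-- turn if f μ is a multiple of π.
open Classical in
theorem HasStrictJump.phaseCount_right {f : ℝ → ℝ} {μ : ℝ} {J : ℕ} (h : HasStrictJump f μ J) :
    ∀ᶠ x in 𝓝[>] μ, phaseCount (f x) =
      phaseCount (f μ) + (J + (if Real.sin (f μ) = 0 then 1 else 0) : ℕ) := by
  filter_upwards [h.2.eventually (eventually_right_phaseCount (f μ + J * Real.pi))] with x hx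
  have h1 := hx.1
  have h2 : phaseCount (f μ + J * Real.pi) = phaseCount (f μ) + J := by
    exact_mod_cast phaseCount_add_int_mul_pi (θ := f μ) (k := J)
  have h3 : Real.sin (f μ + J * Real.pi) = 0 ↔ Real.sin (f μ) = 0 := by
    exact_mod_cast sin_add_int_mul_pi_eq_zero (θ := f μ) (k := J)
  simp only [h3] at h1
  rw [h1, h2]
  split_ifs <;> push_cast <;> ring

-- The jumps of the terms add up, and the terms with zero sine contribute their number minus one. An
-- empty sum, as at a pendant vertex below the root, is constant, whence strictness only for
-- nonempty sums.
open Classical in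
theorem hasJump_angleSum {ι : Type*} {s : Finset ι} {ω : ι → ℝ → ℝ} {μ : ℝ} {J : ι → ℕ}
    (h : ∀ i ∈ s, HasStrictJump (ω i) μ (J i)) :
    HasJump (fun x => angleSum s fun i => ω i x) μ
        (∑ i ∈ s, J i + ({i ∈ s | Real.sin (ω i μ) = 0}.card - 1)) ∧
      (s.Nonempty → HasStrictJump (fun x => angleSum s fun i => ω i x) μ
        (∑ i ∈ s, J i + ({i ∈ s | Real.sin (ω i μ) = 0}.card - 1))) := by
  have hl := tendsto_angleSum_left fun i hi => (h i hi).1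
  have hlt : ∀ᶠ x in 𝓝[<] μ, ∀ i ∈ s, ω i x < ω i μ :=
    (Finset.eventually_all _).mpr fun i hi => (h i hi).1.eventually self_mem_nhdsWithin
  obtain ⟨hr, hre⟩ := tendsto_angleSum_right fun i hi => (h i hi).2
  have e1 : ∀ i, Real.sin (ω i μ + J i * Real.pi) = 0 ↔ Real.sin (ω i μ) = 0 := fun i => by
    exact_mod_cast sin_add_int_mul_pi_eq_zero (θ := ω i μ) (k := J i)
  have e2 : angleSum s (fun i => ω i μ + J i * Real.pi) =
      angleSum s (fun i => ω i μ) + ((∑ i ∈ s, J i : ℕ) : ℝ) * Real.pi := by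
    exact_mod_cast angleSum_add_int_mul_pi (s := s) (ω := fun i => ω i μ) (fun i => (J i : ℤ))
  simp only [e1, e2] at hr hre
  have e3 : angleSum s (fun i => ω i μ) + ((∑ i ∈ s, J i : ℕ) : ℝ) * Real.pi +
      (({i ∈ s | Real.sin (ω i μ) = 0}.card - 1 : ℕ) : ℝ) * Real.pi =
      angleSum s (fun i => ω i μ) +
        ((∑ i ∈ s, J i + ({i ∈ s | Real.sin (ω i μ) = 0}.card - 1) : ℕ) : ℝ) * Real.pi := by
    push_cast; ring
  rw [e3] at hr hre
  refine ⟨⟨tendsto_nhdsWithin_iff.mpr ⟨hl, ?_⟩, tendsto_nhdsWithin_iff.mpr ⟨hr, ?_⟩⟩,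
    fun hs => ⟨tendsto_nhdsWithin_iff.mpr ⟨hl, ?_⟩, tendsto_nhdsWithin_iff.mpr ⟨hr, ?_⟩⟩⟩
  · filter_upwards [hlt] with x hx using angleSum_le fun i hi => (hx i hi).le
  · filter_upwards [hre] with x hx using hx.1
  · filter_upwards [hlt] with x hx using angleSum_lt hs hx
  · filter_upwards [hre] with x hx using hx.2 hs

theorem edgeMap_compare_spectral {l : ℝ} (hl : 0 < l) {q : ℝ → ℝ}
    (hq : MemLp q 2 (volume.restrict (Ioo 0 l))) (μ : ℝ) :
    ∃ c₀ C, 0 < c₀ ∧ ∀ t t' x : ℝ, ∃ c p, c₀ ≤ c ∧ c ≤ C ∧ 0 < p ∧ p ≤ C * l ∧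
      edgeMap l 1 (fun y => x - q y) t' - edgeMap l 1 (fun y => μ - q y) t =
        c * (t' - t) + (x - μ) * p := by
  have h1 : MemLp (fun y => μ - q y) 2 (volume.restrict (Ioo 0 l)) := (memLp_const μ).sub hq
  obtain ⟨c₀, C, hc, h⟩ := edgeMap_compare hl one_pos h1
  refine ⟨c₀, C, hc, fun t t' x => ?_⟩
  obtain ⟨c, p, h⟩ := h t t' (x - μ)
  refine ⟨c, p, ?_⟩
  have e : (fun y => μ - q y + (x - μ)) = fun y => x - q y := by ext y; ring
  rwa [e] at h

theorem edgeMap_spectral_le {l : ℝ} (hl : 0 < l) {q : ℝ → ℝ}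
    (hq : MemLp q 2 (volume.restrict (Ioo 0 l))) {μ x t t' : ℝ} (hx : μ ≤ x) (ht : t ≤ t') :
    edgeMap l 1 (fun y => μ - q y) t ≤ edgeMap l 1 (fun y => x - q y) t' := by
  obtain ⟨c₀, C, hc₀, h⟩ := edgeMap_compare_spectral hl hq μ
  obtain ⟨c, p, h1, h2, h3, h4, h5⟩ := h t t' x
  have := mul_nonneg (hc₀.le.trans h1) (sub_nonneg.mpr ht)
  have := mul_nonneg (sub_nonneg.mpr hx) h3.le
  linarith

/-- The transfer is strictly monotone in the spectral parameter, which makes a weak jump strict, and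
it commutes with adding multiples of π, which preserves the size of the jump. -/
theorem HasJump.edgeMap {l : ℝ} (hl : 0 < l) {q : ℝ → ℝ}
    (hq : MemLp q 2 (volume.restrict (Ioo 0 l))) {f : ℝ → ℝ} {μ : ℝ} {J : ℕ}
    (h : HasJump f μ J) :
    HasStrictJump (fun x => QuantumTree.edgeMap l 1 (fun y => x - q y) (f x)) μ J := by
  obtain ⟨c₀, C, hc₀, H⟩ := edgeMap_compare_spectral hl hq μ
  have hlim : ∀ (L : Filter ℝ) (b : ℝ), L ≤ 𝓝 μ → Tendsto f L (𝓝 b) →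
      Tendsto (fun x => QuantumTree.edgeMap l 1 (fun y => x - q y) (f x)) L
        (𝓝 (QuantumTree.edgeMap l 1 (fun y => μ - q y) b)) := by
    intro L b hL hf
    rw [tendsto_iff_dist_tendsto_zero]
    have h1 : Tendsto (fun x => C * |f x - b| + |x - μ| * (C * l)) L (𝓝 (C * 0 + 0 * (C * l))) := by
      have hx : Tendsto (fun x => |x - μ|) L (𝓝 0) := by
        have : Tendsto (fun x : ℝ => |x - μ|) (𝓝 μ) (𝓝 |μ - μ|) := by
          apply Continuous.tendsto; fun_prop
        simpa using this.mono_left hL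
      have hy : Tendsto (fun x => |f x - b|) L (𝓝 0) := by
        have := (hf.sub_const b).abs
        simpa using this
      exact (hy.const_mul C).add (hx.mul_const (C * l))
    rw [mul_zero, zero_mul, add_zero] at h1
    refine squeeze_zero (fun x => dist_nonneg) (fun x => ?_) h1
    obtain ⟨c, p, a1, a2, a3, a4, a5⟩ := H b (f x) x
    rw [Real.dist_eq, a5]
    refine (abs_add_le _ _).trans ?_
    rw [abs_mul, abs_mul, abs_of_pos (hc₀.trans_le a1), abs_of_pos a3]
    gcongr
  constructor
  · refine tendsto_nhdsWithin_iff.mpr ⟨hlim _ _ nhdsWithin_le_nhds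
      (h.1.mono_right nhdsWithin_le_nhds), ?_⟩
    filter_upwards [h.1.eventually self_mem_nhdsWithin, self_mem_nhdsWithin] with x hx hx'
    obtain ⟨c, p, a1, a2, a3, a4, a5⟩ := H (f μ) (f x) x
    simp only [mem_Iio] at hx hx' ⊢
    have b1 := mul_nonneg (hc₀.le.trans a1) (sub_nonneg.mpr hx)
    have b2 := mul_pos (sub_pos.mpr hx') a3
    linarith
  · have e : QuantumTree.edgeMap l 1 (fun y => μ - q y) (f μ) + J * Real.pi =
        QuantumTree.edgeMap l 1 (fun y => μ - q y) (f μ + J * Real.pi) := by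
      have := edgeMap_add_pi hl one_pos ((memLp_const μ).sub hq) (f μ) J
      exact_mod_cast this.symm
    rw [e]
    refine tendsto_nhdsWithin_iff.mpr ⟨hlim _ _ nhdsWithin_le_nhds
      (h.2.mono_right nhdsWithin_le_nhds), ?_⟩
    filter_upwards [h.2.eventually self_mem_nhdsWithin, self_mem_nhdsWithin] with x hx hx'
    obtain ⟨c, p, a1, a2, a3, a4, a5⟩ := H (f μ + J * Real.pi) (f x) x
    simp only [mem_Ioi] at hx hx' ⊢
    have b1 := mul_nonneg (hc₀.le.trans a1) (sub_nonneg.mpr hx)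
    have b2 := mul_pos (sub_pos.mpr hx') a3
    linarith

end Counting

/-! ### Phases at all vertices for given transfer maps. -/

section VertexPhases

variable {V : Type u} [Fintype V] [DecidableEq V]
variable {G : SimpleGraph V} [DecidableRel G.Adj] {r : V}

/-- `θ v` is the phase at the vertex `v` of the part of the tree which consists of the descendants
of `v`; `E e` is the transfer of the phase along the edge `e`. -/
def IsVertexPhase (E : Edge G r → ℝ → ℝ) (θ : V → ℝ) : Prop :=
  ∀ v, θ v = angleSum {e : Edge G r | e.1.fst = v} fun e => E e (θ e.1.snd)

theorem exists_isVertexPhase (hG : G.IsTree) (E : Edge G r → ℝ → ℝ) : ∃ θ, IsVertexPhase E θ := by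
  obtain ⟨θ, hθ⟩ := exists_tree_recursion hG (r := r) (X := ℝ)
    (fun v g => angleSum {e : Edge G r | e.1.fst = v} fun e => E e (g e)) (by
      intro v g g' h
      have : ∀ e ∈ ({e : Edge G r | e.1.fst = v} : Finset _), g e = g' e :=
        fun e he => h e (Finset.mem_filter.mp he).2
      apply le_antisymm
      · exact angleSum_le fun e he => by rw [this e he]
      · exact angleSum_le fun e he => by rw [this e he])
  exact ⟨θ, hθ⟩

variable {E E' : Edge G r → ℝ → ℝ} {θ θ' : V → ℝ}

theorem IsVertexPhase.le (hG : G.IsTree) (h : IsVertexPhase E θ) (h' : IsVertexPhase E' θ')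
    (hE : ∀ e t t', t ≤ t' → E e t ≤ E' e t') (v : V) : θ v ≤ θ' v := by
  refine tree_induction hG (r := r) (P := fun v => θ v ≤ θ' v) (fun v ih => ?_) v
  rw [h v, h' v]
  exact angleSum_le fun e he => hE e _ _ (ih e (Finset.mem_filter.mp he).2)

theorem IsVertexPhase.sameSlope (hG : G.IsTree) {κ : ℝ} (hκ : 0 < κ) (h : IsVertexPhase E θ)
    (h' : IsVertexPhase E' θ') (hE : ∀ e t t', SameSlope κ t t' → SameSlope κ (E e t) (E' e t'))
    (v : V) : SameSlope κ (θ v) (θ' v) := by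
  refine tree_induction hG (r := r) (P := fun v => SameSlope κ (θ v) (θ' v)) (fun v ih => ?_) v
  rw [h v, h' v]
  exact sameSlope_angleSum hκ fun e he => hE e _ _ (ih e (Finset.mem_filter.mp he).2)

theorem phaseCount_nonneg_iff {t : ℝ} : 0 ≤ phaseCount t ↔ 0 < t := by
  have hp := Real.pi_pos
  constructor
  · intro h
    have h1 := phaseCount_lt t
    have h2 : (0 : ℝ) ≤ phaseCount t := by exact_mod_cast h
    nlinarith
  · intro h
    have h1 := le_phaseCount t
    have h2 : (0 : ℝ) < phaseCount t + 1 := by nlinarith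
    have : (0 : ℤ) < phaseCount t + 1 := by exact_mod_cast h2
    omega

/-- Positivity of a phase is nonnegativity of its count, and counts add up at a vertex. -/
theorem IsVertexPhase.pos (hG : G.IsTree) (h : IsVertexPhase E θ)
    (hE : ∀ e t, 0 ≤ t → 0 < E e t) (v : V) : 0 < θ v := by
  refine tree_induction hG (r := r) (P := fun v => 0 < θ v) (fun v ih => ?_) v
  rw [h v, ← phaseCount_nonneg_iff, phaseCount_angleSum]
  refine Finset.sum_nonneg fun e he => ?_
  rw [phaseCount_nonneg_iff]
  exact hE e _ (ih e (Finset.mem_filter.mp he).2).le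

theorem angleSum_le_pi_div_two {ι : Type*} {s : Finset ι} {ω : ι → ℝ}
    (h : ∀ i ∈ s, ω i ≤ Real.pi / 2) : angleSum s ω ≤ Real.pi / 2 := by
  refine (angleSum_le h).trans ?_
  have hp := Real.pi_pos
  have h1 : phaseCount (Real.pi / 2) = 0 := phaseCount_eq (by simp; linarith) (by simp; linarith)
  rw [angleSum_of_forall (by simp)]
  simp [h1, slopeOf]

theorem IsVertexPhase.le_pi_div_two (hG : G.IsTree) (h : IsVertexPhase E θ)
    (hE : ∀ e t, t ≤ Real.pi / 2 → E e t ≤ Real.pi / 2) (v : V) : θ v ≤ Real.pi / 2 := by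
  refine tree_induction hG (r := r) (P := fun v => θ v ≤ Real.pi / 2) (fun v ih => ?_) v
  rw [h v]
  exact angleSum_le_pi_div_two fun e he => hE e _ (ih e (Finset.mem_filter.mp he).2)

end VertexPhases

/-! ### The counting function, its jumps and its high-energy behaviour. -/

section Phases

set_option linter.unusedSectionVars false

variable {V : Type u} [Fintype V] [DecidableEq V]
variable {G : SimpleGraph V} [DecidableRel G.Adj] {r : V}

/-- The transfer of the phase along the edges for the spectral parameter `lam`. -/
def transfer (l : ℝ) (q : Edge G r → ℝ → ℝ) (lam : ℝ) (e : Edge G r) (t : ℝ) : ℝ :=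
  edgeMap l 1 (fun x => lam - q e x) t

/-- The phases at the vertices for given transfer maps. -/
def phase (hG : G.IsTree) (E : Edge G r → ℝ → ℝ) : V → ℝ := (exists_isVertexPhase hG E).choose

theorem isVertexPhase_phase (hG : G.IsTree) (E : Edge G r → ℝ → ℝ) :
    IsVertexPhase E (phase hG E) := (exists_isVertexPhase hG E).choose_spec

/-- The phase whose count is the counting function of a problem: the Neumann problem (`none`), or
the Dirichlet problem on a subtree, which is specified by its top edge. -/
def topPhase (hG : G.IsTree) (E : Edge G r → ℝ → ℝ) : Option (Edge G r) → ℝ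
  | none => phase hG E r + Real.pi / 2
  | some e => E e (phase hG E e.1.snd)

/-- The upper vertex of the edge or the root. -/
def topVertex : Option (Edge G r) → V
  | none => r
  | some e => e.1.snd

theorem topPhase_le (hG : G.IsTree) {E E' : Edge G r → ℝ → ℝ}
    (h : ∀ e t t', t ≤ t' → E e t ≤ E' e t') (τ : Option (Edge G r)) :
    topPhase hG E τ ≤ topPhase hG E' τ := by
  have := IsVertexPhase.le hG (isVertexPhase_phase hG E) (isVertexPhase_phase hG E') h
  cases τ with
  | none => exact add_le_add_left (this r) _
  | some e => exact h e _ _ (this _)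

/-- A quarter turn exchanges sine and cosine and thereby inverts the scale. It turns the Neumann
condition at the root, a vanishing cosine, into a vanishing sine. -/
theorem SameSlope.add_pi_div_two {κ θ φ : ℝ} (hκ : 0 < κ) (h : SameSlope κ θ φ) :
    SameSlope κ⁻¹ (θ + Real.pi / 2) (φ + Real.pi / 2) := by
  obtain ⟨⟨c, hc, h1, h2⟩, h3⟩ := h
  refine ⟨⟨c / κ, by positivity, ?_, ?_⟩, by simpa using h3⟩
  · rw [Real.sin_add_pi_div_two, Real.sin_add_pi_div_two]
    field_simp; linarith
  · rw [Real.cos_add_pi_div_two, Real.cos_add_pi_div_two, h1]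
    field_simp

theorem exists_sameSlope_topPhase (hG : G.IsTree) {κ : ℝ} (hκ : 0 < κ) {E E' : Edge G r → ℝ → ℝ}
    (h : ∀ e t t', SameSlope κ t t' → SameSlope κ (E e t) (E' e t')) (τ : Option (Edge G r)) :
    ∃ κ', 0 < κ' ∧ SameSlope κ' (topPhase hG E τ) (topPhase hG E' τ) := by
  have := IsVertexPhase.sameSlope hG hκ (isVertexPhase_phase hG E) (isVertexPhase_phase hG E') h
  cases τ with
  | none => exact ⟨κ⁻¹, inv_pos.mpr hκ, (this r).add_pi_div_two hκ⟩
  | some e => exact ⟨κ, hκ, h e _ _ (this _)⟩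

theorem topPhase_pos (hG : G.IsTree) {E : Edge G r → ℝ → ℝ} (h : ∀ e t, 0 ≤ t → 0 < E e t)
    (τ : Option (Edge G r)) : 0 < topPhase hG E τ := by
  have := IsVertexPhase.pos hG (isVertexPhase_phase hG E) h
  have hp := Real.pi_pos
  cases τ with
  | none => exact add_pos (this r) (by positivity)
  | some e => exact h e _ (this _).le

theorem topPhase_le_pi (hG : G.IsTree) {E : Edge G r → ℝ → ℝ}
    (h : ∀ e t, t ≤ Real.pi / 2 → E e t ≤ Real.pi / 2) (τ : Option (Edge G r)) :
    topPhase hG E τ ≤ Real.pi := by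
  have := IsVertexPhase.le_pi_div_two hG (isVertexPhase_phase hG E) h
  have hp := Real.pi_pos
  cases τ with
  | none => have := this r; simp only [topPhase]; linarith
  | some e => have := h e _ (this e.1.snd); simp only [topPhase]; linarith

/-- The counting function of the eigenvalues. -/
def eigenCount (hG : G.IsTree) (l : ℝ) (q : Edge G r → ℝ → ℝ) (τ : Option (Edge G r)) (lam : ℝ) :
    ℤ :=
  phaseCount (topPhase hG (transfer l q lam) τ)

/-- The phase for the spectral parameter `lam` at the upper end of an edge. -/
def edgePhase (hG : G.IsTree) (l : ℝ) (q : Edge G r → ℝ → ℝ) (lam : ℝ) (e : Edge G r) : ℝ :=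
  transfer l q lam e (phase hG (transfer l q lam) e.1.snd)

open Classical in
/-- The edges below a vertex on which the solutions vanish at the upper end. -/
def blocked (hG : G.IsTree) (l : ℝ) (q : Edge G r → ℝ → ℝ) (lam : ℝ) (v : V) :
    Finset (Edge G r) :=
  {e | e.1.fst = v ∧ Real.sin (edgePhase hG l q lam e) = 0}

open Classical in
/-- The multiplicity of `lam` as an eigenvalue. -/
def eigenMult (hG : G.IsTree) (l : ℝ) (q : Edge G r → ℝ → ℝ) (S : Finset V)
    (τ : Option (Edge G r)) (lam : ℝ) : ℕ :=
  ∑ v ∈ S, ((blocked hG l q lam v).card - 1) +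
    if Real.sin (topPhase hG (transfer l q lam) τ) = 0 then 1 else 0

variable {l : ℝ} {q : Edge G r → ℝ → ℝ}

theorem transfer_le (hl : 0 < l) (hq : ∀ e, MemLp (q e) 2 (volume.restrict (Ioo 0 l)))
    {x x' : ℝ} (hx : x ≤ x') (e : Edge G r) (t t' : ℝ) (ht : t ≤ t') :
    transfer l q x e t ≤ transfer l q x' e t' :=
  edgeMap_spectral_le hl (hq e) hx ht

theorem transfer_pos (hl : 0 < l) (hq : ∀ e, MemLp (q e) 2 (volume.restrict (Ioo 0 l)))
    (x : ℝ) (e : Edge G r) (t : ℝ) (ht : 0 ≤ t) : 0 < transfer l q x e t :=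
  edgeMap_pos hl one_pos ((memLp_const x).sub (hq e)) ht

/-- From the leaves upwards, jumps obey the recursion of `hasJump_angleSum`, and each edge makes
them strict. At a vertex without children the phase does not depend on the parameter, so strictness
at a vertex requires an outgoing edge. -/
theorem exists_jumps (hG : G.IsTree) (hl : 0 < l)
    (hq : ∀ e, MemLp (q e) 2 (volume.restrict (Ioo 0 l))) (μ : ℝ) :
    ∃ J : V → ℕ, (∀ v, J v = ∑ e : Edge G r with e.1.fst = v, J e.1.snd +
        ((blocked hG l q μ v).card - 1)) ∧
      (∀ e, HasStrictJump (fun x => edgePhase hG l q x e) μ (J e.1.snd)) ∧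
      ∀ v, (∃ e : Edge G r, e.1.fst = v) →
        HasStrictJump (fun x => phase hG (transfer l q x) v) μ (J v) := by
  classical
  obtain ⟨J, hJ⟩ := exists_tree_recursion hG (r := r) (X := ℕ)
    (fun v g => ∑ e : Edge G r with e.1.fst = v, g e + ((blocked hG l q μ v).card - 1)) (by
      intro v g g' h
      congr 1
      exact Finset.sum_congr rfl fun e he => h e (Finset.mem_filter.mp he).2)
  have hb : ∀ v, blocked hG l q μ v =
      {e ∈ ({e : Edge G r | e.1.fst = v} : Finset _) | Real.sin (edgePhase hG l q μ e) = 0} := by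
    intro v; ext e; simp [blocked]
  have hphase : ∀ v, (fun x => phase hG (transfer l q x) v) = fun x =>
      angleSum {e : Edge G r | e.1.fst = v} fun e => edgePhase hG l q x e := fun v =>
    funext fun x => isVertexPhase_phase hG (transfer l q x) v
  have key : ∀ v, HasJump (fun x => phase hG (transfer l q x) v) μ (J v) := by
    refine tree_induction hG (r := r) fun v ih => ?_
    have := (hasJump_angleSum (s := {e : Edge G r | e.1.fst = v})
      (ω := fun e x => edgePhase hG l q x e) (J := fun e => J e.1.snd) (μ := μ) fun e he =>
      (ih e (Finset.mem_filter.mp he).2).edgeMap hl (hq e)).1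
    rw [hphase, hJ, hb]
    convert this
  have key' : ∀ e, HasStrictJump (fun x => edgePhase hG l q x e) μ (J e.1.snd) := fun e =>
    (key e.1.snd).edgeMap hl (hq e)
  refine ⟨J, hJ, key', fun v hv => ?_⟩
  obtain ⟨e, he⟩ := hv
  have := (hasJump_angleSum (s := {e : Edge G r | e.1.fst = v})
      (ω := fun e x => edgePhase hG l q x e) (J := fun e => J e.1.snd) (μ := μ) fun e _ =>
      key' e).2 ⟨e, by simpa using he⟩
  rw [hphase, hJ, hb]
  convert this

/-- `S` is the set of the descendants of the root or of the lower vertex of the edge. -/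
def IsDescendants (S : Finset V) (τ : Option (Edge G r)) : Prop :=
  DescClosed G r S ∧ (r ∈ S ↔ τ = none) ∧
    ∀ e : Edge G r, (e.1.snd ∈ S ∧ e.1.fst ∉ S) ↔ τ = some e

/-- The recursion telescopes: summed over S, the values of J at all vertices with a parent in S
cancel, and only the top vertex is left. -/
theorem sum_jumps (hG : G.IsTree) {S : Finset V} {τ : Option (Edge G r)} (hS : IsDescendants S τ)
    {J b : V → ℕ} (hJ : ∀ v, J v = ∑ e : Edge G r with e.1.fst = v, J e.1.snd + b v) :
    ∑ v ∈ S, b v = J (topVertex τ) := by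
  classical
  have h1 := sum_vertices hG (r := r) S J
  have h2 : ∑ v ∈ S, J v = ∑ e : Edge G r with e.1.fst ∈ S, J e.1.snd + ∑ v ∈ S, b v := by
    rw [Finset.sum_congr rfl fun v _ => hJ v, Finset.sum_add_distrib]
    congr 1
    rw [← Finset.sum_fiberwise_of_maps_to (s := ({e : Edge G r | e.1.fst ∈ S} : Finset _)) (t := S)
      (g := fun e => e.1.fst) (by simp)]
    refine Finset.sum_congr rfl fun v hv => Finset.sum_congr ?_ fun _ _ => rfl
    ext e
    simp only [Finset.mem_filter, Finset.mem_univ, true_and]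
    exact ⟨fun h => ⟨h ▸ hv, h⟩, fun h => h.2⟩
  have h3 : ∑ e : Edge G r with e.1.snd ∈ S, J e.1.snd =
      ∑ e : Edge G r with e.1.fst ∈ S, J e.1.snd + ∑ e : Edge G r with τ = some e, J e.1.snd := by
    rw [← Finset.sum_union]
    · refine Finset.sum_congr ?_ fun _ _ => rfl
      ext e
      have h4 := hS.2.2 e
      have h5 := hS.1 e
      simp only [Finset.mem_union, Finset.mem_filter, Finset.mem_univ, true_and]
      tauto
    · rw [Finset.disjoint_left]
      intro e he he'
      have := (hS.2.2 e).mpr (by simpa using he')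
      exact this.2 (by simpa using he)
  have h4 : (if r ∈ S then J r else 0) + ∑ e : Edge G r with τ = some e, J e.1.snd =
      J (topVertex τ) := by
    cases τ with
    | none => rw [if_pos (hS.2.1.mpr rfl)]; simp [topVertex]
    | some e =>
      rw [if_neg fun h => by simpa using hS.2.1.mp h]
      simp only [Option.some.injEq, topVertex, zero_add]
      rw [Finset.filter_eq]
      simp
  omega

/-- The telescoped jumps at the vertices give the first term of `eigenMult`; the last one arises
when the top phase itself is a multiple of π. -/
theorem eigenCount_jump (hG : G.IsTree) (hr : ∃ e : Edge G r, e.1.fst = r) (hl : 0 < l)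
    (hq : ∀ e, MemLp (q e) 2 (volume.restrict (Ioo 0 l)))
    {S : Finset V} {τ : Option (Edge G r)} (hS : IsDescendants S τ) (μ : ℝ) :
    (∀ᶠ x in 𝓝[<] μ, eigenCount hG l q τ x = eigenCount hG l q τ μ) ∧
    ∀ᶠ x in 𝓝[>] μ, eigenCount hG l q τ x = eigenCount hG l q τ μ + eigenMult hG l q S τ μ := by
  obtain ⟨J, hJ, hJe, hJv⟩ := exists_jumps hG hl hq μ
  have h1 : HasStrictJump (fun x => topPhase hG (transfer l q x) τ) μ (J (topVertex τ)) := by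
    cases τ with
    | none => exact (hJv r hr).add_const _
    | some e => exact hJe e
  refine ⟨h1.phaseCount_left, ?_⟩
  have h2 := h1.phaseCount_right
  rw [← sum_jumps hG hS hJ] at h2
  exact h2

theorem eigenCount_mono (hG : G.IsTree) (hl : 0 < l)
    (hq : ∀ e, MemLp (q e) 2 (volume.restrict (Ioo 0 l))) (τ : Option (Edge G r)) :
    Monotone (eigenCount hG l q τ) := fun _ _ h =>
  phaseCount_mono (topPhase_le hG (fun e _ _ => transfer_le hl hq h e _ _) τ)

theorem eigenCount_nonneg (hG : G.IsTree) (hl : 0 < l)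
    (hq : ∀ e, MemLp (q e) 2 (volume.restrict (Ioo 0 l))) (τ : Option (Edge G r)) (x : ℝ) :
    0 ≤ eigenCount hG l q τ x :=
  phaseCount_nonneg_iff.mpr (topPhase_pos hG (fun e t => transfer_pos hl hq x e t) τ)

/-- The count may be computed in every scale; κ can therefore be adapted to the energy. -/
theorem phaseCount_topPhase_scaled (hG : G.IsTree) (hl : 0 < l)
    (hq : ∀ e, MemLp (q e) 2 (volume.restrict (Ioo 0 l))) (τ : Option (Edge G r)) (lam : ℝ) {κ : ℝ}
    (hκ : 0 < κ) : phaseCount (topPhase hG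
      (fun e t => edgeMap l κ (fun x => (lam - q e x) / κ) t) τ) = eigenCount hG l q τ lam := by
  obtain ⟨κ', hκ', h⟩ := exists_sameSlope_topPhase hG hκ (E := transfer l q lam)
    (E' := fun e t => edgeMap l κ (fun x => (lam - q e x) / κ) t)
    (fun e t t' ht => sameSlope_edgeMap hl (hq e) hκ ht) τ
  exact h.phaseCount_eq hκ'

/-- For the parameter -κ² with κ large, the phases in the scale κ stay at most π/2 on all edges and
at all vertices (`edgeMap_low`), so nothing is counted. -/
theorem eigenCount_eq_zero (hG : G.IsTree) (hl : 0 < l)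
    (hq : ∀ e, MemLp (q e) 2 (volume.restrict (Ioo 0 l))) (τ : Option (Edge G r)) :
    ∃ x, eigenCount hG l q τ x = 0 := by
  choose κ₀ hκ₀ using fun e => edgeMap_low hl (hq e)
  obtain ⟨M, hM⟩ := (Finset.univ.image κ₀).bddAbove
  set κ := max M 0 + 1
  have hκ : 0 < κ := by positivity
  have hκe : ∀ e, κ₀ e < κ := fun e => by
    have h1 : κ₀ e ≤ M := hM (by simp)
    have := le_max_left M 0
    linarith
  refine ⟨-κ ^ 2, le_antisymm ?_ (eigenCount_nonneg hG hl hq τ _)⟩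
  rw [← phaseCount_topPhase_scaled hG hl hq τ _ hκ]
  have h2 := topPhase_le_pi hG (E := fun e t => edgeMap l κ (fun x => (-κ ^ 2 - q e x) / κ) t)
    (fun e t ht => hκ₀ e κ (hκe e) hκ t ht) τ
  have h3 : phaseCount Real.pi = 0 := phaseCount_eq (by simp [Real.pi_pos]) (by simp)
  exact (phaseCount_mono h2).trans h3.le

/-- The counting function of the problem in which every edge shifts the phase by `s`. -/
def shiftCount (hG : G.IsTree) (τ : Option (Edge G r)) (s : ℝ) : ℤ :=
  phaseCount (topPhase hG (fun _ t => t + s) τ)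

theorem shiftCount_unbounded (hG : G.IsTree) (hr : ∃ e : Edge G r, e.1.fst = r)
    (τ : Option (Edge G r)) (n : ℕ) : ∃ s₀, ∀ s, s₀ ≤ s → (n : ℤ) < shiftCount hG τ s := by
  have hp := Real.pi_pos
  -- All vertex phases are positive, so after such a shift each edge has a count above n.
  refine ⟨(n + 2) * Real.pi, fun s hs => ?_⟩
  have hs0 : 0 < s := lt_of_lt_of_le (by positivity) hs
  set E : Edge G r → ℝ → ℝ := fun _ t => t + s
  have h1 := IsVertexPhase.pos hG (isVertexPhase_phase hG E)
    (fun e t ht => add_pos_of_nonneg_of_pos ht hs0)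
  have h2 : ∀ e : Edge G r, (n + 1 : ℤ) ≤ phaseCount (E e (phase hG E e.1.snd)) := by
    intro e
    have h3 := le_phaseCount (E e (phase hG E e.1.snd))
    have h4 := h1 e.1.snd
    have h5 : ((n : ℝ) + 1) * Real.pi < (phaseCount (E e (phase hG E e.1.snd)) + 1) * Real.pi := by
      have : E e (phase hG E e.1.snd) = phase hG E e.1.snd + s := rfl
      nlinarith
    have h6 : ((n : ℝ) + 1) < (phaseCount (E e (phase hG E e.1.snd)) + 1) :=
      lt_of_mul_lt_mul_right h5 hp.le
    have : ((n : ℤ) + 1) < (phaseCount (E e (phase hG E e.1.snd)) + 1) := by exact_mod_cast h6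
    omega
  cases τ with
  | some e => exact lt_of_lt_of_le (by omega) (h2 e)
  | none =>
    obtain ⟨e, he⟩ := hr
    have h3 : phaseCount (phase hG E r) ≤ shiftCount hG none s :=
      phaseCount_mono (show phase hG E r ≤ phase hG E r + Real.pi / 2 by linarith)
    refine lt_of_lt_of_le ?_ h3
    rw [isVertexPhase_phase hG E r, phaseCount_angleSum]
    refine lt_of_lt_of_le ?_ (Finset.single_le_sum (f := fun e => phaseCount (E e (phase hG E e.1.snd)))
      (fun e _ => by have := h2 e; omega) (show e ∈ _ by simpa using he))
    have := h2 e
    omega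

/-- In the scale ρ every edge shifts the phase by ρ l up to C/ρ (`edgeMap_high`), and the top phase
is monotone in the transfer maps. -/
theorem eigenCount_sandwich (hG : G.IsTree) (hl : 0 < l)
    (hq : ∀ e, MemLp (q e) 2 (volume.restrict (Ioo 0 l))) (τ : Option (Edge G r)) {C : ℝ}
    (hC : ∀ e, ∫ x in 0..l, |q e x| ≤ C) {ρ : ℝ} (hρ : 0 < ρ) :
    shiftCount hG τ (ρ * l - C / ρ) ≤ eigenCount hG l q τ (ρ ^ 2) ∧
      eigenCount hG l q τ (ρ ^ 2) ≤ shiftCount hG τ (ρ * l + C / ρ) := by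
  rw [← phaseCount_topPhase_scaled hG hl hq τ _ hρ]
  have h : ∀ e t, |edgeMap l ρ (fun x => (ρ ^ 2 - q e x) / ρ) t - (t + ρ * l)| ≤ C / ρ :=
    fun e t => (edgeMap_high hl (hq e) hρ t).trans (by gcongr; exact hC e)
  constructor
  · refine phaseCount_mono (topPhase_le hG (fun e t t' ht => ?_) τ)
    have := (abs_le.mp (h e t')).1
    linarith
  · refine phaseCount_mono (topPhase_le hG (fun e t t' ht => ?_) τ)
    have := (abs_le.mp (h e t)).2
    linarith

theorem exists_integral_bound (q : Edge G r → ℝ → ℝ) (l : ℝ) :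
    ∃ C, 0 ≤ C ∧ ∀ e, ∫ x in 0..l, |q e x| ≤ C := by
  obtain ⟨M, hM⟩ := (Finset.univ.image fun e => ∫ x in 0..l, |q e x|).bddAbove
  exact ⟨max M 0, le_max_right _ _, fun e => (hM (by simp)).trans (le_max_left _ _)⟩

theorem eigenCount_zero_potential (hG : G.IsTree) (hl : 0 < l) (τ : Option (Edge G r)) {ρ : ℝ}
    (hρ : 0 < ρ) :
    eigenCount hG l (fun _ _ => 0) τ (ρ ^ 2) = shiftCount hG τ (ρ * l) := by
  have := eigenCount_sandwich (q := fun (_ : Edge G r) _ => 0) hG hl (fun e => memLp_const 0) τ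
    (C := 0) (fun e => by simp) hρ
  simp only [zero_div, sub_zero, add_zero] at this
  exact le_antisymm this.2 this.1

theorem eigenCount_unbounded (hG : G.IsTree) (hr : ∃ e : Edge G r, e.1.fst = r) (hl : 0 < l)
    (hq : ∀ e, MemLp (q e) 2 (volume.restrict (Ioo 0 l))) (τ : Option (Edge G r)) (n : ℕ) :
    ∃ x, (n : ℤ) < eigenCount hG l q τ x := by
  obtain ⟨C, hC0, hC⟩ := exists_integral_bound q l
  obtain ⟨s₀, hs⟩ := shiftCount_unbounded hG hr τ n
  set ρ := max 1 ((s₀ + C) / l)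
  have h1 : 1 ≤ ρ := le_max_left _ _
  refine ⟨ρ ^ 2, (hs _ ?_).trans_le (eigenCount_sandwich hG hl hq τ hC (by linarith)).1⟩
  have h2 : (s₀ + C) ≤ ρ * l := (div_le_iff₀ hl).mp (le_max_right _ _)
  have h3 : C / ρ ≤ C := div_le_self hC0 h1
  linarith

/-- The eigenvalues in increasing order. -/
theorem exists_eigenvalues (hG : G.IsTree) (hr : ∃ e : Edge G r, e.1.fst = r) (hl : 0 < l)
    (hq : ∀ e, MemLp (q e) 2 (volume.restrict (Ioo 0 l)))
    {S : Finset V} {τ : Option (Edge G r)} (hS : IsDescendants S τ) :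
    ∃ a : ℕ → ℝ, (∀ (n : ℕ) x, eigenCount hG l q τ x ≤ n ↔ x ≤ a n) ∧
      ∀ μ, {n | a n = μ}.encard = eigenMult hG l q S τ μ :=
  exists_enumeration (eigenCount_mono hG hl hq τ) (fun μ => (eigenCount_jump hG hr hl hq hS μ).1)
    (fun μ => (eigenCount_jump hG hr hl hq hS μ).2) (eigenCount_eq_zero hG hl hq τ)
    (eigenCount_nonneg hG hl hq τ) (eigenCount_unbounded hG hr hl hq τ)

end Phases

/-! ### The linear relations between amplitudes and their dimension. -/

section Amplitudes

set_option linter.unusedSectionVars false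

variable {V : Type u} [Fintype V] [DecidableEq V]
variable {G : SimpleGraph V} [DecidableRel G.Adj] {r : V}

/-- At a vertex with the phase `angleSum s ω`, continuity and the Kirchhoff condition. -/
theorem exists_amplitude {ι : Type*} {s : Finset ι} {ω : ι → ℝ} {τ : ι → ℂ} {A B : ℂ}
    (h1 : ∀ i ∈ s, τ i * Real.sin (ω i) = A) (h2 : ∑ i ∈ s, τ i * Real.cos (ω i) = B) :
    ∃ t : ℂ, A = t * Real.sin (angleSum s ω) ∧ B = t * Real.cos (angleSum s ω) := by
  by_cases h : ∀ i ∈ s, Real.sin (ω i) ≠ 0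
  · have h0 : Real.sin (angleSum s ω) ≠ 0 := fun h' => by
      obtain ⟨i, hi, hi'⟩ := sin_angleSum_eq_zero_iff.mp h'
      exact h i hi hi'
    have h3 := slopeOf_angleSum h
    have h0' : (Real.sin (angleSum s ω) : ℂ) ≠ 0 := by exact_mod_cast h0
    refine ⟨A / Real.sin (angleSum s ω), by field_simp, ?_⟩
    have h4 : ((Real.cos (angleSum s ω) : ℂ) / Real.sin (angleSum s ω)) =
        ∑ i ∈ s, (Real.cos (ω i) : ℂ) / Real.sin (ω i) := by
      simp only [slopeOf, Finset.sum_neg_distrib, neg_inj] at h3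
      exact_mod_cast h3
    rw [div_mul_eq_mul_div, mul_div_assoc, h4, ← h2, Finset.mul_sum]
    refine Finset.sum_congr rfl fun i hi => ?_
    have : (Real.sin (ω i) : ℂ) ≠ 0 := by exact_mod_cast h i hi
    rw [← h1 i hi]
    field_simp
  · push Not at h
    obtain ⟨i, hi, hi'⟩ := h
    have h0 : Real.sin (angleSum s ω) = 0 := sin_angleSum_eq_zero_iff.mpr ⟨i, hi, hi'⟩
    have h0' : (Real.cos (angleSum s ω) : ℂ) ≠ 0 := by
      intro hc
      have hc' : Real.cos (angleSum s ω) = 0 := by exact_mod_cast hc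
      have := Real.sin_sq_add_cos_sq (angleSum s ω)
      rw [h0, hc'] at this
      norm_num at this
    refine ⟨B / Real.cos (angleSum s ω), ?_, by field_simp⟩
    rw [h0, ← h1 i hi, hi']
    simp

variable (ω c : Edge G r → ℝ) (θ : V → ℝ)

/-- The relations between the amplitudes `t` at a vertex and at its children. -/
def AmplitudeRelation (t : V → ℂ) (v : V) : Prop :=
  (∀ e : Edge G r, e.1.fst = v → t e.1.snd * c e * Real.sin (ω e) = t v * Real.sin (θ v)) ∧
    ∑ e : Edge G r with e.1.fst = v, t e.1.snd * c e * Real.cos (ω e) = t v * Real.cos (θ v)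

/-- The space of the amplitudes of the solutions on the part `S` of the tree. -/
def amplitudeSpace (S : Finset V) : Submodule ℂ (V → ℂ) where
  carrier := {t | (∀ v ∉ S, t v = 0) ∧ (∀ v ∈ S, AmplitudeRelation ω c θ t v) ∧
    (r ∈ S → t r * Real.cos (θ r) = 0) ∧
    ∀ e : Edge G r, e.1.fst ∉ S → t e.1.snd * Real.sin (ω e) = 0}
  zero_mem' := by simp [AmplitudeRelation]
  add_mem' := by
    rintro t t' ⟨h1, h2, h3, h4⟩ ⟨h1', h2', h3', h4'⟩
    refine ⟨fun v hv => by simp [h1 v hv, h1' v hv], fun v hv => ⟨fun e he => ?_, ?_⟩,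
      fun h => ?_, fun e he => ?_⟩
    · have a := (h2 v hv).1 e he
      have b := (h2' v hv).1 e he
      simp only [Pi.add_apply]; linear_combination a + b
    · have a := (h2 v hv).2
      have b := (h2' v hv).2
      simp only [Pi.add_apply, add_mul, Finset.sum_add_distrib, a, b]
    · simp only [Pi.add_apply, add_mul, h3 h, h3' h, add_zero]
    · simp only [Pi.add_apply, add_mul, h4 e he, h4' e he, add_zero]
  smul_mem' := by
    rintro k t ⟨h1, h2, h3, h4⟩
    refine ⟨fun v hv => by simp [h1 v hv], fun v hv => ⟨fun e he => ?_, ?_⟩,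
      fun h => ?_, fun e he => ?_⟩
    · have a := (h2 v hv).1 e he
      simp only [Pi.smul_apply, smul_eq_mul]; linear_combination k * a
    · have a := (h2 v hv).2
      simp only [Pi.smul_apply, smul_eq_mul, mul_assoc] at a ⊢
      rw [← a, Finset.mul_sum]
    · simp only [Pi.smul_apply, smul_eq_mul, mul_assoc, h3 h, mul_zero]
    · simp only [Pi.smul_apply, smul_eq_mul, mul_assoc, h4 e he, mul_zero]

open Classical in
/-- The number of the independent amplitudes. -/
def amplitudeCount (S : Finset V) : ℕ :=
  ∑ v ∈ S, (({e : Edge G r | e.1.fst = v ∧ Real.sin (ω e) = 0} : Finset _).card - 1) +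
    ((if r ∈ S ∧ Real.cos (θ r) = 0 then 1 else 0) +
      ({e : Edge G r | e.1.snd ∈ S ∧ e.1.fst ∉ S ∧ Real.sin (ω e) = 0} : Finset _).card)

theorem cos_ne_zero_of_sin {x : ℝ} (h : Real.sin x = 0) : (Real.cos x : ℂ) ≠ 0 := by
  intro hc
  have hc' : Real.cos x = 0 := by exact_mod_cast hc
  have := Real.sin_sq_add_cos_sq x
  rw [h, hc'] at this
  norm_num at this

/-- One of the blocked edges at each vertex with blocked edges. -/
theorem exists_distinguished : ∃ D : Edge G r → Prop, (∀ e, D e → Real.sin (ω e) = 0) ∧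
    (∀ e f : Edge G r, e.1.fst = f.1.fst → D e → D f → e = f) ∧
    ∀ e : Edge G r, Real.sin (ω e) = 0 → ∃ f : Edge G r, f.1.fst = e.1.fst ∧ D f := by
  classical
  have : ∀ v, ∃ f : Option (Edge G r), (∀ e ∈ f, e.1.fst = v ∧ Real.sin (ω e) = 0) ∧
      ∀ e : Edge G r, e.1.fst = v → Real.sin (ω e) = 0 → f.isSome := by
    intro v
    by_cases h : ∃ e : Edge G r, e.1.fst = v ∧ Real.sin (ω e) = 0
    · obtain ⟨e, he⟩ := h
      exact ⟨some e, by rintro _ ⟨⟩; exact he, by simp⟩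
    · exact ⟨none, by simp, fun e h1 h2 => absurd ⟨e, h1, h2⟩ h⟩
  choose f hf using this
  refine ⟨fun e => e ∈ f e.1.fst, fun e he => ((hf _).1 e he).2, fun e e' h he he' => ?_,
    fun e he => ?_⟩
  · simp only [← h] at he'
    exact Option.mem_unique he he'
  · obtain ⟨e', he'⟩ := Option.isSome_iff_exists.mp ((hf e.1.fst).2 e rfl he)
    have h1 := ((hf e.1.fst).1 e' he').1
    exact ⟨e', h1, show e' ∈ f e'.1.fst by rw [h1]; exact he'⟩

/-- The vertices whose amplitudes can be chosen. -/
def freeVertices (D : Edge G r → Prop) (S : Finset V) : Finset V :=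
  open Classical in {u ∈ S | (u = r ∧ Real.cos (θ r) = 0) ∨
    ∃ e : Edge G r, e.1.snd = u ∧ Real.sin (ω e) = 0 ∧ (e.1.fst ∈ S → ¬D e)}

variable {ω c θ} {D : Edge G r → Prop} {S : Finset V}

theorem root_mem_freeVertices : r ∈ freeVertices ω θ D S ↔ r ∈ S ∧ Real.cos (θ r) = 0 := by
  classical
  simp only [freeVertices, Finset.mem_filter, true_and]
  refine and_congr_right fun _ => or_iff_left ?_
  rintro ⟨e, he, -⟩
  exact edge_snd_ne_root e he

theorem edge_mem_freeVertices (hG : G.IsTree) (e : Edge G r) :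
    e.1.snd ∈ freeVertices ω θ D S ↔
      e.1.snd ∈ S ∧ Real.sin (ω e) = 0 ∧ (e.1.fst ∈ S → ¬D e) := by
  classical
  simp only [freeVertices, Finset.mem_filter]
  refine and_congr_right fun _ => ?_
  constructor
  · rintro (⟨h, -⟩ | ⟨f, hf, hf'⟩)
    · exact absurd h (edge_snd_ne_root e)
    · rwa [edge_snd_injective hG hf] at hf'
  · intro h; exact Or.inr ⟨e, rfl, h⟩

theorem freeVertices_subset : freeVertices ω θ D S ⊆ S := by
  classical
  exact Finset.filter_subset _ _

/-- Descending from the root, every amplitude vanishes: below an edge with nonzero sine by the sine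
relation, below a distinguished edge by the cosine relation, where it is the only remaining term,
and below the other blocked edges by assumption. -/
theorem eq_zero_of_freeVertices (hG : G.IsTree) (hc : ∀ e, 0 < c e)
    (hD2 : ∀ e f : Edge G r, e.1.fst = f.1.fst → D e → D f → e = f)
    (hS : DescClosed G r S)
    {t : V → ℂ} (ht : t ∈ amplitudeSpace ω c θ S) (ht' : ∀ v ∈ freeVertices ω θ D S, t v = 0) :
    t = 0 := by
  have hc' : ∀ e, (c e : ℂ) ≠ 0 := fun e => by exact_mod_cast (hc e).ne'
  have hFr := root_mem_freeVertices (ω := ω) (θ := θ) (D := D) (S := S)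
  have hFe := edge_mem_freeVertices (ω := ω) (θ := θ) (D := D) (S := S) hG
  obtain ⟨h1, h2, h3, h4⟩ := ht
  refine funext fun v => ?_
  refine root_induction hG (r := r) (P := fun v => t v = 0) ?_ (fun e ih => ?_) v
  · by_cases hrS : r ∈ S
    · by_cases hcos : Real.cos (θ r) = 0
      · exact ht' r (hFr.mpr ⟨hrS, hcos⟩)
      · exact (mul_eq_zero.mp (h3 hrS)).resolve_right (by exact_mod_cast hcos)
    · exact h1 r hrS
  · by_cases huS : e.1.snd ∈ S
    swap
    · exact h1 _ huS
    by_cases hsin : Real.sin (ω e) = 0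
    · by_cases hv : e.1.fst ∈ S ∧ D e
      · obtain ⟨hv, hDe⟩ := hv
        have h5 := (h2 _ hv).2
        rw [ih, zero_mul, Finset.sum_eq_single e] at h5
        · exact (mul_eq_zero.mp ((mul_eq_zero.mp h5).resolve_right
            (cos_ne_zero_of_sin hsin))).resolve_right (hc' e)
        · intro f hf hfe
          have hf := (Finset.mem_filter.mp hf).2
          have hfS : f.1.snd ∈ S := hS f (by rw [hf]; exact hv)
          suffices t f.1.snd = 0 by rw [this]; simp
          by_cases hsf : Real.sin (ω f) = 0
          · refine ht' _ ((hFe f).mpr ⟨hfS, hsf, fun _ hDf => hfe (hD2 f e hf hDf hDe)⟩)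
          · have h6 := (h2 _ hv).1 f hf
            have : (Real.sin (ω f) : ℂ) ≠ 0 := by exact_mod_cast hsf
            rw [ih, zero_mul] at h6
            exact (mul_eq_zero.mp ((mul_eq_zero.mp h6).resolve_right this)).resolve_right (hc' f)
        · simp
      · refine ht' _ ((hFe e).mpr ⟨huS, hsin, ?_⟩)
        tauto
    · have hs' : (Real.sin (ω e) : ℂ) ≠ 0 := by exact_mod_cast hsin
      by_cases hv : e.1.fst ∈ S
      · have h6 := (h2 _ hv).1 e rfl
        rw [ih, zero_mul] at h6
        exact (mul_eq_zero.mp ((mul_eq_zero.mp h6).resolve_right hs')).resolve_right (hc' e)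
      · exact (mul_eq_zero.mp (h4 e hv)).resolve_right hs'

/-- The same descent read as a construction: the amplitudes at the free vertices can be prescribed,
and the relations yield the others. -/
theorem exists_amplitudes (hG : G.IsTree) (hc : ∀ e, 0 < c e)
    (hD1 : ∀ e, D e → Real.sin (ω e) = 0)
    (hD2 : ∀ e f : Edge G r, e.1.fst = f.1.fst → D e → D f → e = f)
    (hS : DescClosed G r S)
    (hD3 : ∀ e : Edge G r, Real.sin (ω e) = 0 → ∃ f : Edge G r, f.1.fst = e.1.fst ∧ D f)
    (hθ : ∀ v, θ v = angleSum {e : Edge G r | e.1.fst = v} ω)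
    {g' : V → ℂ} (hg0 : ∀ v ∉ freeVertices ω θ D S, g' v = 0) :
    ∃ t ∈ amplitudeSpace ω c θ S, ∀ v ∈ freeVertices ω θ D S, t v = g' v := by
  classical
  have hc' : ∀ e, (c e : ℂ) ≠ 0 := fun e => by exact_mod_cast (hc e).ne'
  have hFr := root_mem_freeVertices (ω := ω) (θ := θ) (D := D) (S := S)
  have hFe := edge_mem_freeVertices (ω := ω) (θ := θ) (D := D) (S := S) hG
  have hblock : ∀ e : Edge G r, Real.sin (ω e) = 0 → Real.sin (θ e.1.fst) = 0 := fun e he => by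
    rw [hθ, sin_angleSum_eq_zero_iff]
    exact ⟨e, by simp, he⟩
  -- Inside S and off the free vertices, a blocked edge is the distinguished one, and its amplitude
  -- is solved from the cosine relation; an unblocked edge is solved from the sine relation. The sum
  -- may use g' instead of t, because the siblings of a distinguished edge are free or have zero
  -- amplitude (`hother`).
  obtain ⟨t, htr, hte⟩ := exists_root_recursion hG (r := r) (g' r) (fun e x =>
    if e.1.snd ∈ S ∧ e.1.fst ∈ S ∧ e.1.snd ∉ freeVertices ω θ D S then
      if Real.sin (ω e) = 0 then
        (x * Real.cos (θ e.1.fst) - ∑ f : Edge G r with f.1.fst = e.1.fst ∧ f ≠ e,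
          g' f.1.snd * c f * Real.cos (ω f)) / (c e * Real.cos (ω e))
      else x * Real.sin (θ e.1.fst) / (c e * Real.sin (ω e))
    else g' e.1.snd)
  have htF : ∀ v ∈ freeVertices ω θ D S, t v = g' v := by
    intro v hv
    by_cases hvr : v = r
    · rw [hvr, htr]
    · obtain ⟨e, rfl⟩ := exists_edge_to hG hvr
      rw [hte, if_neg fun h => h.2.2 hv]
  have hFS : ∀ v ∈ freeVertices ω θ D S, v ∈ S := fun v hv => (Finset.mem_filter.mp hv).1
  have hmem : t ∈ amplitudeSpace ω c θ S := by
    refine ⟨fun v hv => ?_, fun v hv => ?_, fun hrS => ?_, fun e he => ?_⟩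
    · by_cases hvr : v = r
      · rw [hvr] at hv ⊢
        rw [htr, hg0 r fun h => hv (hFS r h)]
      · obtain ⟨e, rfl⟩ := exists_edge_to hG hvr
        rw [hte, if_neg fun h => hv h.1, hg0 _ fun h => hv (hFS _ h)]
    · have hun : ∀ e : Edge G r, e.1.fst = v → Real.sin (ω e) ≠ 0 →
          t e.1.snd * (c e * Real.sin (ω e)) = t v * Real.sin (θ v) := by
        rintro e rfl hs
        have hs' : (Real.sin (ω e) : ℂ) ≠ 0 := by exact_mod_cast hs
        have := hc' e
        rw [hte, if_pos ⟨hS e hv, hv, fun h => hs ((hFe e).mp h).2.1⟩, if_neg hs]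
        field_simp
      constructor
      · intro e he
        by_cases hs : Real.sin (ω e) = 0
        · rw [hs, ← he, hblock e hs]; simp
        · rw [mul_assoc]; exact hun e he hs
      · by_cases hb : ∃ e : Edge G r, e.1.fst = v ∧ Real.sin (ω e) = 0
        · obtain ⟨e₀, he₀, hs₀⟩ := hb
          obtain ⟨e, he, hDe⟩ := hD3 e₀ hs₀
          rw [he₀] at he
          have hs := hD1 e hDe
          have hθ0 : Real.sin (θ v) = 0 := by rw [← he]; exact hblock e hs
          have hother : ∀ f : Edge G r, f.1.fst = v → f ≠ e → t f.1.snd = g' f.1.snd := by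
            intro f hf hfe
            by_cases hsf : Real.sin (ω f) = 0
            · refine htF _ ((hFe f).mpr ⟨hS f (by rw [hf]; exact hv), hsf, fun _ hDf =>
                hfe (hD2 f e (hf.trans he.symm) hDf hDe)⟩)
            · have h7 := hun f hf hsf
              rw [hg0 _ fun h => hsf ((hFe f).mp h).2.1]
              have : (Real.sin (ω f) : ℂ) ≠ 0 := by exact_mod_cast hsf
              rw [hθ0, Complex.ofReal_zero, mul_zero] at h7
              exact (mul_eq_zero.mp h7).resolve_right (mul_ne_zero (hc' f) this)
          have h8 := hte e
          rw [if_pos ⟨hS e (by rw [he]; exact hv), by rw [he]; exact hv,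
            fun h => ((hFe e).mp h).2.2 (by rw [he]; exact hv) hDe⟩, if_pos hs, he] at h8
          have hcos := cos_ne_zero_of_sin hs
          have := hc' e
          rw [← Finset.add_sum_erase _ _ (show e ∈ _ by simpa using he), h8]
          have h9 : ∑ f ∈ ({e : Edge G r | e.1.fst = v} : Finset _).erase e,
              t f.1.snd * c f * Real.cos (ω f) =
              ∑ f : Edge G r with f.1.fst = v ∧ f ≠ e, g' f.1.snd * c f * Real.cos (ω f) := by
            refine Finset.sum_congr ?_ fun f hf => ?_
            · ext f; simp [and_comm]
            · simp only [Finset.mem_filter, Finset.mem_univ, true_and] at hf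
              rw [hother f hf.1 hf.2]
          rw [h9]
          field_simp
          ring
        · push Not at hb
          obtain ⟨x, hx1, hx2⟩ := exists_amplitude (s := {e : Edge G r | e.1.fst = v}) (ω := ω)
            (τ := fun e => t e.1.snd * c e) (A := t v * Real.sin (θ v))
            (fun e he => by
              have he := (Finset.mem_filter.mp he).2
              rw [mul_assoc]; exact hun e he (hb e he)) rfl
          rw [hx2, ← hθ]
          have : (Real.sin (θ v) : ℂ) ≠ 0 := by
            rw [hθ]
            intro h
            have h' : Real.sin (angleSum {e : Edge G r | e.1.fst = v} ω) = 0 := by exact_mod_cast h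
            obtain ⟨e, he, he'⟩ := sin_angleSum_eq_zero_iff.mp h'
            exact hb e (Finset.mem_filter.mp he).2 he'
          rw [← hθ] at hx1
          rw [mul_right_cancel₀ this hx1]
    · by_cases hcos : Real.cos (θ r) = 0
      · rw [hcos]; simp
      · rw [htr, hg0 r fun h => hcos (hFr.mp h).2, zero_mul]
    · rw [hte, if_neg fun h => he h.2.1]
      by_cases hs : Real.sin (ω e) = 0
      · rw [hs]; simp
      · rw [hg0 _ fun h => hs ((hFe e).mp h).2.1, zero_mul]
  exact ⟨t, hmem, htF⟩

/-- Among the blocked edges at a vertex of S all but the distinguished one have a free lower end;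
truncated subtraction covers the vertices without blocked edges. An edge that enters S from outside
has a free lower end whenever it is blocked. -/
theorem card_freeVertices (hG : G.IsTree)
    (hD1 : ∀ e, D e → Real.sin (ω e) = 0)
    (hD2 : ∀ e f : Edge G r, e.1.fst = f.1.fst → D e → D f → e = f)
    (hD3 : ∀ e : Edge G r, Real.sin (ω e) = 0 → ∃ f : Edge G r, f.1.fst = e.1.fst ∧ D f)
    (hS : DescClosed G r S) : (freeVertices ω θ D S).card = amplitudeCount ω θ S := by
  classical
  have hFr := root_mem_freeVertices (ω := ω) (θ := θ) (D := D) (S := S)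
  have hFe := edge_mem_freeVertices (ω := ω) (θ := θ) (D := D) (S := S) hG
  have h1 : (freeVertices ω θ D S).card = ∑ v ∈ S, if v ∈ freeVertices ω θ D S then 1 else 0 := by
    rw [← Finset.sum_filter, ← Finset.card_eq_sum_ones]
    congr 1
    ext v
    simp only [Finset.mem_filter]
    exact ⟨fun h => ⟨freeVertices_subset h, h⟩, fun h => h.2⟩
  rw [h1, sum_vertices hG (r := r) S]
  have h2 : (if r ∈ S then (if r ∈ freeVertices ω θ D S then 1 else 0) else 0) =
      if r ∈ S ∧ Real.cos (θ r) = 0 then 1 else 0 := by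
    simp only [hFr]
    split_ifs <;> tauto
  have h3 : ∑ e : Edge G r with e.1.snd ∈ S, (if e.1.snd ∈ freeVertices ω θ D S then 1 else 0) =
      ∑ v ∈ S, (({e : Edge G r | e.1.fst = v ∧ Real.sin (ω e) = 0} : Finset _).card - 1) +
      ({e : Edge G r | e.1.snd ∈ S ∧ e.1.fst ∉ S ∧ Real.sin (ω e) = 0} : Finset _).card := by
    rw [← Finset.sum_filter, ← Finset.card_eq_sum_ones, Finset.filter_filter,
      ← Finset.card_filter_add_card_filter_not (fun e : Edge G r => e.1.fst ∈ S)]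
    congr 1
    · rw [Finset.filter_filter, Finset.card_eq_sum_card_fiberwise (f := fun e => e.1.fst) (t := S)]
      · refine Finset.sum_congr rfl fun v hv => ?_
        by_cases hb : ∃ e : Edge G r, e.1.fst = v ∧ Real.sin (ω e) = 0
        · obtain ⟨e₀, he₀, hs₀⟩ := hb
          obtain ⟨e, he, hDe⟩ := hD3 e₀ hs₀
          rw [he₀] at he
          have hs := hD1 e hDe
          rw [← Finset.card_erase_of_mem (a := e) (by simp [he, hs])]
          congr 1
          ext f
          simp only [Finset.mem_filter, Finset.mem_univ, true_and, Finset.mem_erase, hFe]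
          constructor
          · rintro ⟨⟨⟨hfS, -, hsf, hDf⟩, hfv⟩, rfl⟩
            exact ⟨fun h => hDf hfv (h ▸ hDe), rfl, hsf⟩
          · rintro ⟨hfe, rfl, hsf⟩
            exact ⟨⟨⟨hS f hv, hS f hv, hsf, fun _ hDf => hfe (hD2 f e he.symm hDf hDe)⟩, hv⟩, rfl⟩
        · push Not at hb
          rw [Finset.card_eq_zero.mpr, Finset.card_eq_zero.mpr]
          · exact Finset.filter_eq_empty_iff.mpr fun e _ h => hb e h.1 h.2
          · rw [Finset.filter_eq_empty_iff]
            intro e he h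
            simp only [Finset.mem_filter, Finset.mem_univ, true_and, hFe] at he
            exact hb e h he.1.2.2.1
      · intro e he
        simp only [Finset.coe_filter, Finset.mem_univ, true_and, mem_ofPred_eq] at he
        exact he.2
    · rw [Finset.filter_filter]
      congr 1
      ext e
      simp only [Finset.mem_filter, Finset.mem_univ, true_and, hFe]
      tauto
  rw [h2, h3, amplitudeCount]
  ring

/-- Restriction to the free vertices is an isomorphism onto all functions on them. -/
theorem finrank_amplitudeSpace (hG : G.IsTree) (hc : ∀ e, 0 < c e)
    (hθ : ∀ v, θ v = angleSum {e : Edge G r | e.1.fst = v} ω) (hS : DescClosed G r S) :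
    Module.Finite ℂ (amplitudeSpace ω c θ S) ∧
      Module.finrank ℂ (amplitudeSpace ω c θ S) = amplitudeCount ω θ S := by
  classical
  obtain ⟨D, hD1, hD2, hD3⟩ := exists_distinguished ω
  let R : amplitudeSpace ω c θ S →ₗ[ℂ] (freeVertices ω θ D S → ℂ) :=
    (LinearMap.funLeft ℂ ℂ (Subtype.val : freeVertices ω θ D S → V)).comp
      (amplitudeSpace ω c θ S).subtype
  have hinj : Function.Injective R := by
    rw [← LinearMap.ker_eq_bot, LinearMap.ker_eq_bot']
    rintro ⟨t, ht⟩ h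
    exact Subtype.ext (eq_zero_of_freeVertices hG hc hD2 hS ht
      fun v hv => congrFun h ⟨v, hv⟩)
  have hsurj : Function.Surjective R := by
    intro g
    obtain ⟨t, ht, h⟩ := exists_amplitudes hG hc hD1 hD2 hS hD3 hθ
      (g' := fun v => if h : v ∈ freeVertices ω θ D S then g ⟨v, h⟩ else 0)
      (fun v hv => by simp [hv])
    refine ⟨⟨t, ht⟩, funext fun v => ?_⟩
    change t v = g v
    rw [h v v.2]
    simp
  let L := LinearEquiv.ofBijective R ⟨hinj, hsurj⟩
  refine ⟨Module.Finite.equiv L.symm, ?_⟩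
  rw [L.finrank_eq, Module.finrank_fintype_fun_eq_card, Fintype.card_coe]
  exact card_freeVertices hG hD1 hD2 hD3 hS

end Amplitudes

/-! ### The Lagrange identity on an edge. -/

section SolutionLemmas

variable {l : ℝ} {q : ℝ → ℝ} {z : ℂ} {y y' dy : ℝ → ℂ}

theorem IsSolution.congr (h : IsSolution l q z y dy) (hy : ∀ x ∈ Icc 0 l, y' x = y x) :
    IsSolution l q z y' dy where
  hasDeriv x hx := (h.hasDeriv x hx).congr hy (hy x hx)
  absCont := h.absCont
  equation := by
    filter_upwards [h.equation, ae_restrict_mem measurableSet_Ioo] with x hx hx'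
    rwa [hy x (Ioo_subset_Icc_self hx')]

theorem IsSolution.deriv_eq_zero (hl : 0 < l) (h : IsSolution l q z y dy)
    (hy : ∀ x ∈ Icc 0 l, y x = 0) : ∀ x ∈ Icc 0 l, dy x = 0 := fun x hx => by
  have h1 : HasDerivWithinAt y 0 (Icc 0 l) x :=
    (hasDerivWithinAt_const x _ (0 : ℂ)).congr hy (hy x hx)
  exact (uniqueDiffOn_Icc hl x hx).eq_deriv _ (h.hasDeriv x hx) h1

/-- The Lagrange identity for a solution and its complex conjugate. -/
theorem IsSolution.lagrange (hl : 0 ≤ l) (h : IsSolution l q z y dy) :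
    z.im * ∫ x in 0..l, Complex.normSq (y x) =
      (starRingEnd ℂ (y 0) * dy 0).im - (starRingEnd ℂ (y l) * dy l).im := by
  have hre : ∀ {f : ℝ → ℂ}, AbsolutelyContinuousOnInterval f 0 l →
      AbsolutelyContinuousOnInterval (fun x => (f x).re) 0 l := fun hf =>
    absolutelyContinuous_lipschitz_comp (s := univ) (K := 1)
      (LipschitzWith.lipschitzOnWith (LipschitzWith.of_dist_le_mul fun x y => by
        rw [Real.dist_eq, ← Complex.sub_re, NNReal.coe_one, one_mul, Complex.dist_eq]
        exact Complex.abs_re_le_norm _)) hf (mapsTo_univ _ _)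
  have him : ∀ {f : ℝ → ℂ}, AbsolutelyContinuousOnInterval f 0 l →
      AbsolutelyContinuousOnInterval (fun x => (f x).im) 0 l := fun hf =>
    absolutelyContinuous_lipschitz_comp (s := univ) (K := 1)
      (LipschitzWith.lipschitzOnWith (LipschitzWith.of_dist_le_mul fun x y => by
        rw [Real.dist_eq, ← Complex.sub_im, NNReal.coe_one, one_mul, Complex.dist_eq]
        exact Complex.abs_im_le_norm _)) hf (mapsTo_univ _ _)
  have hy := h.absCont_self hl
  have hW := ((hre hy).mul (him h.absCont)).sub ((him hy).mul (hre h.absCont))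
  have key := integral_eq_sub_of_absolutelyContinuous
    (f' := fun x => -z.im * Complex.normSq (y x)) hl hW (by
      filter_upwards [h.equation, ae_restrict_mem measurableSet_Ioo] with x hx hx'
      have h0 : HasDerivAt y (dy x) x :=
        (h.hasDeriv x (Ioo_subset_Icc_self hx')).hasDerivAt (Icc_mem_nhds hx'.1 hx'.2)
      have a1 : HasDerivAt (fun x => (y x).re) (dy x).re x :=
        Complex.reCLM.hasFDerivAt.comp_hasDerivAt x h0
      have a2 : HasDerivAt (fun x => (y x).im) (dy x).im x :=
        Complex.imCLM.hasFDerivAt.comp_hasDerivAt x h0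
      have a3 : HasDerivAt (fun x => (dy x).re) (((q x : ℂ) - z) * y x).re x :=
        Complex.reCLM.hasFDerivAt.comp_hasDerivAt x hx
      have a4 : HasDerivAt (fun x => (dy x).im) (((q x : ℂ) - z) * y x).im x :=
        Complex.imCLM.hasFDerivAt.comp_hasDerivAt x hx
      refine ((a1.mul a4).sub (a2.mul a3)).congr_deriv ?_
      simp [Complex.normSq_apply]; ring)
  rw [intervalIntegral.integral_const_mul] at key
  simp only [Complex.mul_im, Complex.conj_re, Complex.conj_im, Pi.sub_apply, Pi.mul_apply] at key ⊢
  linarith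

theorem IsSolution.eq_zero_of_integral (hl : 0 < l) (h : IsSolution l q z y dy)
    (h0 : ∫ x in 0..l, Complex.normSq (y x) = 0) : ∀ x ∈ Icc 0 l, y x = 0 := by
  have hc : ContinuousOn (fun x => Complex.normSq (y x)) (Icc 0 l) :=
    Complex.continuous_normSq.comp_continuousOn h.continuousOn
  by_contra! hne
  obtain ⟨x, hx, hyx⟩ := hne
  have := intervalIntegral.integral_pos hl hc (fun x _ => Complex.normSq_nonneg _)
    ⟨x, hx, Complex.normSq_pos.mpr hyx⟩
  linarith

end SolutionLemmas

/-! ### The three problems in one form; real spectrum and dimensions. -/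

section TreeSolutions

set_option linter.unusedSectionVars false

variable {V : Type u} [Fintype V] [DecidableEq V]
variable {G : SimpleGraph V} [DecidableRel G.Adj] {r : V}

/-- The solutions on the part of the tree which belongs to the set `S` of vertices: zero on the
other edges and at the other vertices, standard conditions at the vertices of `S`. -/
def IsTreeSolution (l : ℝ) (q : Edge G r → ℝ → ℝ) (S : Finset V) (z : ℂ)
    (y : Edge G r → ℝ → ℂ) : Prop :=
  ∃ (dy : Edge G r → ℝ → ℂ) (a : V → ℂ), (∀ e, ∀ x ∉ Icc 0 l, y e x = 0) ∧
    (∀ e, IsSolution l (q e) z (y e) (dy e)) ∧ (∀ v ∉ S, a v = 0) ∧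
    (∀ e : Edge G r, e.1.snd ∉ S → y e = 0) ∧
    (∀ e : Edge G r, y e 0 = a e.1.fst ∧ y e l = a e.1.snd) ∧ ∀ v ∈ S, Kirchhoff G r l dy v

theorem exists_vertexValues (hG : G.IsTree) {l : ℝ} {y : Edge G r → ℝ → ℂ} {a₀ : ℂ}
    (hc : ∀ e f : Edge G r, e.1.snd = f.1.fst → y e l = y f 0)
    (hr : ∀ e : Edge G r, e.1.fst = r → y e 0 = a₀) :
    ∃ a : V → ℂ, a r = a₀ ∧ ∀ e : Edge G r, y e 0 = a e.1.fst ∧ y e l = a e.1.snd := by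
  obtain ⟨a, ha, hae⟩ := exists_root_recursion hG a₀ (fun (e : Edge G r) _ => y e l)
  refine ⟨a, ha, fun e => ⟨?_, (hae e).symm⟩⟩
  by_cases h : e.1.fst = r
  · rw [hr e h, h, ha]
  · obtain ⟨f, hf⟩ := exists_edge_to hG h
    rw [← hc f e hf, ← hf, hae]

theorem mem_neumannSpace_iff (hG : G.IsTree) {l : ℝ} {q : Edge G r → ℝ → ℝ} {z : ℂ}
    {y : Edge G r → ℝ → ℂ} :
    y ∈ neumannSpace G r l q z ↔ IsTreeSolution l q Finset.univ z y := by
  constructor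
  · rintro ⟨dy, h, h1, h2⟩
    obtain ⟨a₀, ha₀⟩ : ∃ a₀, ∀ e : Edge G r, e.1.fst = r → y e 0 = a₀ := by
      by_cases he : ∃ e : Edge G r, e.1.fst = r
      · obtain ⟨e, he⟩ := he
        exact ⟨y e 0, fun f hf => h1 f e hf he⟩
      · exact ⟨0, fun e h => absurd ⟨e, h⟩ he⟩
    obtain ⟨a, -, ha⟩ := exists_vertexValues hG h.continuity ha₀
    refine ⟨dy, a, h.support, h.solution, by simp, by simp, ha, fun v _ => ?_⟩
    by_cases hv : v = r
    · rw [hv]; exact h2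
    · exact h.kirchhoff v hv
  · rintro ⟨dy, a, h1, h2, -, -, h3, h4⟩
    exact ⟨dy, ⟨h1, h2, fun e f h => by rw [(h3 e).2, (h3 f).1, h], fun v _ => h4 v (by simp)⟩,
      fun e f he hf => by rw [(h3 e).1, (h3 f).1, he, hf], h4 r (by simp)⟩

theorem mem_dirichletSpace_iff (hG : G.IsTree) {l : ℝ} {q : Edge G r → ℝ → ℝ} {z : ℂ}
    {y : Edge G r → ℝ → ℂ} :
    y ∈ dirichletSpace G r l q z ↔ IsTreeSolution l q (Finset.univ.erase r) z y := by
  constructor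
  · rintro ⟨dy, h, h1⟩
    obtain ⟨a, har, ha⟩ := exists_vertexValues hG h.continuity h1
    refine ⟨dy, a, h.support, h.solution, fun v hv => ?_, fun e he => ?_, ha, fun v hv => ?_⟩
    · rw [show v = r by simpa using hv, har]
    · exact absurd (by simpa using he) (edge_snd_ne_root e)
    · exact h.kirchhoff v (by simpa using hv)
  · rintro ⟨dy, a, h1, h2, h3, -, h4, h5⟩
    exact ⟨dy, ⟨h1, h2, fun e f h => by rw [(h4 e).2, (h4 f).1, h],
      fun v hv => h5 v (by simpa using hv)⟩, fun e he => by rw [(h4 e).1, he, h3 r (by simp)]⟩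

theorem mem_dirichletBranchSpace_iff (hG : G.IsTree) {l : ℝ} (hl : 0 < l)
    {q : Edge G r → ℝ → ℝ} {w : V} {z : ℂ} {y : Edge G r → ℝ → ℂ} :
    y ∈ dirichletBranchSpace G r l q w z ↔ IsTreeSolution l q (branch G r w) z y := by
  constructor
  · rintro ⟨⟨dy, h, h1⟩, h2⟩
    obtain ⟨a, har, ha⟩ := exists_vertexValues hG h.continuity h1
    refine ⟨dy, a, h.support, h.solution, fun v hv => ?_, h2, ha, fun v hv => ?_⟩
    · by_cases hvr : v = r
      · rw [hvr, har]
      · obtain ⟨e, rfl⟩ := exists_edge_to hG hvr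
        rw [← (ha e).2, h2 e hv]; rfl
    · exact h.kirchhoff v fun hvr => root_notMem_branch (hvr ▸ hv)
  · rintro ⟨dy, a, h1, h2, h3, h3', h4, h5⟩
    refine ⟨⟨dy, ⟨h1, h2, fun e f h => by rw [(h4 e).2, (h4 f).1, h], fun v hv => ?_⟩,
      fun e he => by rw [(h4 e).1, he, h3 r root_notMem_branch]⟩, h3'⟩
    by_cases hvS : v ∈ branch G r w
    · exact h5 v hvS
    -- A vertex outside the branch, other than the root, meets only edges outside the branch, on
    -- which the function and hence its derivative vanish.
    · have h6 : ∀ e : Edge G r, e.1.snd ∉ branch G r w → dy e l = 0 ∧ dy e 0 = 0 := fun e he => by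
        have := (h2 e).deriv_eq_zero hl (fun x _ => by rw [h3' e he]; rfl)
        exact ⟨this l ⟨hl.le, le_rfl⟩, this 0 ⟨le_rfl, hl.le⟩⟩
      unfold Kirchhoff
      rw [Finset.sum_eq_zero, Finset.sum_eq_zero]
      · intro e he
        have he := (Finset.mem_filter.mp he).2
        exact (h6 e fun h => hvS (he ▸ fst_mem_branch h (by rwa [he]))).2
      · intro e he
        have he := (Finset.mem_filter.mp he).2
        exact (h6 e (by rwa [he])).1

/-- Self-adjointness: in the sum of the Lagrange identities over the edges, the boundary terms are
grouped by vertices and cancel, by the Kirchhoff condition on S and by zero vertex values elsewhere.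
What remains is Im z ∑ ∫ |y|² = 0. -/
theorem IsTreeSolution.eq_zero_of_im_ne_zero {l : ℝ} (hl : 0 < l)
    {q : Edge G r → ℝ → ℝ} {S : Finset V} {z : ℂ} {y : Edge G r → ℝ → ℂ} (hz : z.im ≠ 0)
    (h : IsTreeSolution l q S z y) : y = 0 := by
  obtain ⟨dy, a, h1, h2, h3, h4, h5, h6⟩ := h
  have key : ∑ e, z.im * ∫ x in 0..l, Complex.normSq (y e x) = 0 := by
    rw [Finset.sum_congr rfl fun e _ => (h2 e).lagrange hl.le]
    simp only [h5]
    have h7 : ∀ f : Edge G r → ℝ, ∀ g : Edge G r → V,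
        ∑ e, f e = ∑ v, ∑ e with g e = v, f e := fun f g =>
      (Finset.sum_fiberwise _ _ _).symm
    rw [Finset.sum_sub_distrib, h7 _ fun e => e.1.fst,
      h7 (fun e => (starRingEnd ℂ (a e.1.snd) * dy e l).im) fun e => e.1.snd,
      ← Finset.sum_sub_distrib]
    refine Finset.sum_eq_zero fun v _ => ?_
    have h8 : ∑ e : Edge G r with e.1.fst = v, (starRingEnd ℂ (a e.1.fst) * dy e 0).im =
        (starRingEnd ℂ (a v) * ∑ e : Edge G r with e.1.fst = v, dy e 0).im := by
      rw [Finset.mul_sum, Complex.im_sum]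
      exact Finset.sum_congr rfl fun e he => by rw [(Finset.mem_filter.mp he).2]
    have h9 : ∑ e : Edge G r with e.1.snd = v, (starRingEnd ℂ (a e.1.snd) * dy e l).im =
        (starRingEnd ℂ (a v) * ∑ e : Edge G r with e.1.snd = v, dy e l).im := by
      rw [Finset.mul_sum, Complex.im_sum]
      exact Finset.sum_congr rfl fun e he => by rw [(Finset.mem_filter.mp he).2]
    rw [h8, h9]
    by_cases hv : v ∈ S
    · have := h6 v hv
      unfold Kirchhoff at this
      rw [this, sub_self]
    · rw [h3 v hv]; simp
  rw [← Finset.mul_sum] at key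
  have h0 := (mul_eq_zero.mp key).resolve_left hz
  rw [Finset.sum_eq_zero_iff_of_nonneg fun e _ => intervalIntegral.integral_nonneg hl.le
    fun x _ => Complex.normSq_nonneg _] at h0
  funext e x
  by_cases hx : x ∈ Icc 0 l
  · exact (h2 e).eq_zero_of_integral hl (h0 e (Finset.mem_univ e)) x hx
  · exact h1 e x hx

theorem filter_snd_eq (hG : G.IsTree) (e : Edge G r) :
    ({f : Edge G r | f.1.snd = e.1.snd} : Finset _) = {e} := by
  ext f
  simp only [Finset.mem_filter, Finset.mem_univ, true_and, Finset.mem_singleton]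
  exact ⟨fun h => edge_snd_injective hG h, fun h => by rw [h]⟩

theorem filter_snd_root : ({f : Edge G r | f.1.snd = r} : Finset _) = ∅ :=
  Finset.filter_eq_empty_iff.mpr fun e _ => edge_snd_ne_root e

/-- The multiplicity of a real eigenvalue. -/
theorem finrank_treeSolutions (hG : G.IsTree) (hr : ∃ e : Edge G r, e.1.fst = r) {l : ℝ}
    (hl : 0 < l) {q : Edge G r → ℝ → ℝ} (hq : ∀ e, MemLp (q e) 2 (volume.restrict (Ioo 0 l)))
    {S : Finset V} (hS : DescClosed G r S) {lam : ℝ} {E : Submodule ℂ (Edge G r → ℝ → ℂ)}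
    (hE : ∀ y, y ∈ E ↔ IsTreeSolution l q S lam y) :
    Module.Finite ℂ E ∧ Module.finrank ℂ E =
      amplitudeCount (edgePhase hG l q lam) (phase hG (transfer l q lam)) S := by
  classical
  set θ := phase hG (transfer l q lam)
  set ω := edgePhase hG l q lam
  have hθ : ∀ v, θ v = angleSum {e : Edge G r | e.1.fst = v} ω :=
    isVertexPhase_phase hG (transfer l q lam)
  -- The reference solution of an edge has the phase of the lower vertex at l and the phase ω e at
  -- 0. Solutions on the tree are its multiples by the amplitudes at the lower vertices.
  have hbase : ∀ e : Edge G r, ∃ y dy : ℝ → ℂ, ∃ c : ℝ, 0 < c ∧ IsSolution l (q e) lam y dy ∧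
      y l = Real.sin (θ e.1.snd) ∧ dy l = -Real.cos (θ e.1.snd) ∧
      y 0 = c * Real.sin (ω e) ∧ dy 0 = -(c * Real.cos (ω e)) := by
    intro e
    obtain ⟨y, dy, h1, h2, h3, c, hc, h4, h5⟩ :=
      exists_isSolution_edgeMap hl (hq e) (κ := 1) (lam := lam) one_pos (θ e.1.snd)
    simp only [div_one, Complex.ofReal_one, one_mul] at h3 h4 h5
    exact ⟨y, dy, c, hc, h1, h2, h3, h4, h5⟩
  choose Y dY c hc hY hYl hdYl hY0 hdY0 using hbase
  have hc' : ∀ e, (c e : ℂ) ≠ 0 := fun e => by exact_mod_cast (hc e).ne'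
  set Z : Edge G r → ℝ → ℂ := fun e x => if x ∈ Icc 0 l then Y e x else 0 with hZ
  have hZY : ∀ e, ∀ x ∈ Icc 0 l, Z e x = Y e x := fun e x hx => if_pos hx
  have h0 : (0 : ℝ) ∈ Icc 0 l := ⟨le_rfl, hl.le⟩
  have hll : l ∈ Icc 0 l := ⟨hl.le, le_rfl⟩
  have hmem : ∀ t ∈ amplitudeSpace ω c θ S, (fun e => t e.1.snd • Z e) ∈ E := by
    rintro t ⟨h1, h2, h3, h4⟩
    rw [hE]
    refine ⟨fun e => t e.1.snd • dY e, fun v => t v * Real.sin (θ v), fun e x hx => ?_,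
      fun e => ?_, fun v hv => by simp only [h1 v hv, zero_mul], fun e he => ?_, fun e => ⟨?_, ?_⟩,
      fun v hv => ?_⟩
    · simp only [Pi.smul_apply, hZ, if_neg hx, smul_zero]
    · exact ((hY e).congr (hZY e)).smul _
    · simp only [h1 _ he, zero_smul]
    · simp only [Pi.smul_apply, smul_eq_mul]
      rw [hZY e 0 h0, hY0, ← mul_assoc]
      by_cases hv : e.1.fst ∈ S
      · exact (h2 _ hv).1 e rfl
      · rw [mul_right_comm, h4 e hv, h1 _ hv, zero_mul, zero_mul]
    · simp only [Pi.smul_apply, smul_eq_mul]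
      rw [hZY e l hll, hYl]
    · unfold Kirchhoff
      have h5 : ∑ e : Edge G r with e.1.fst = v, (t e.1.snd • dY e) 0 =
          -(t v * Real.cos (θ v)) := by
        rw [← (h2 v hv).2, ← Finset.sum_neg_distrib]
        refine Finset.sum_congr rfl fun e _ => ?_
        simp only [Pi.smul_apply, smul_eq_mul, hdY0]
        ring
      rw [h5]
      by_cases hvr : v = r
      · rw [hvr, filter_snd_root, Finset.sum_empty, h3 (hvr ▸ hv), neg_zero]
      · obtain ⟨e, rfl⟩ := exists_edge_to hG hvr
        rw [filter_snd_eq hG, Finset.sum_singleton]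
        simp only [Pi.smul_apply, smul_eq_mul, hdYl]
        ring
  let Φ₀ : (V → ℂ) →ₗ[ℂ] (Edge G r → ℝ → ℂ) :=
    { toFun := fun t e => t e.1.snd • Z e
      map_add' := fun t t' => by funext e; simp [add_smul]
      map_smul' := fun k t => by funext e; simp [mul_smul] }
  let Φ : amplitudeSpace ω c θ S →ₗ[ℂ] E :=
    (Φ₀.comp (amplitudeSpace ω c θ S).subtype).codRestrict E fun t => hmem t t.2
  have hinj : Function.Injective Φ := by
    rw [← LinearMap.ker_eq_bot, LinearMap.ker_eq_bot']
    rintro ⟨t, ht⟩ h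
    have h' : ∀ e : Edge G r, t e.1.snd • Z e = 0 := fun e =>
      congrFun (congrArg Subtype.val h) e
    have hte : ∀ e : Edge G r, t e.1.snd = 0 := by
      intro e
      have hs := (hY e).smul (t e.1.snd)
      have a1 : ∀ x ∈ Icc 0 l, (t e.1.snd • Y e) x = 0 := fun x hx => by
        rw [Pi.smul_apply, ← hZY e x hx]; exact congrFun (h' e) x
      have a2 := hs.deriv_eq_zero hl a1 l hll
      have a1 := a1 l hll
      simp only [Pi.smul_apply, smul_eq_mul, hYl, hdYl] at a1 a2
      by_contra hne
      have b1 := (mul_eq_zero.mp a1).resolve_left hne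
      have b2 := (mul_eq_zero.mp a2).resolve_left hne
      exact cos_ne_zero_of_sin (by exact_mod_cast b1) (neg_eq_zero.mp b2)
    refine Subtype.ext (funext fun v => ?_)
    change t v = 0
    by_cases hv : v ∈ S
    swap
    · exact ht.1 v hv
    -- No edge ends at the root, so its amplitude needs an extra argument: an edge below gives t r
    -- sin (θ r) = 0, and the root condition gives t r cos (θ r) = 0.
    by_cases hvr : v = r
    · rw [hvr] at hv ⊢
      obtain ⟨e, he⟩ := hr
      have b1 := (ht.2.1 r hv).1 e he
      rw [hte, zero_mul, zero_mul] at b1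
      have b2 := ht.2.2.1 hv
      by_contra hne
      have b3 := (mul_eq_zero.mp b1.symm).resolve_left hne
      exact cos_ne_zero_of_sin (by exact_mod_cast b3) ((mul_eq_zero.mp b2).resolve_left hne)
    · obtain ⟨e, rfl⟩ := exists_edge_to hG hvr
      exact hte e
  have hsurj : Function.Surjective Φ := by
    rintro ⟨y, hy⟩
    obtain ⟨dy, a, h1, h2, h3, h4, h5, h6⟩ := (hE y).mp hy
    have hin : ∀ e : Edge G r, e.1.snd ∈ S → dy e l = ∑ f : Edge G r with f.1.fst = e.1.snd, dy f 0 :=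
      fun e he => by
        have := h6 _ he
        unfold Kirchhoff at this
        rwa [filter_snd_eq hG, Finset.sum_singleton] at this
    have hstep : ∀ (e : Edge G r) (x : ℂ), e.1.snd ∈ S → a e.1.snd = x * Real.sin (θ e.1.snd) →
        ∑ f : Edge G r with f.1.fst = e.1.snd, dy f 0 = -(x * Real.cos (θ e.1.snd)) →
        (∀ s ∈ Icc 0 l, y e s = x * Y e s ∧ dy e s = x * dY e s) := by
      intro e x he hx1 hx2 s hs
      have := (h2 e).eqOn hl.le (hq e) ((hY e).smul x) (by
        rw [(h5 e).2, hx1, Pi.smul_apply, smul_eq_mul, hYl]) (by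
        rw [hin e he, hx2, Pi.smul_apply, smul_eq_mul, hdYl]; ring) s hs
      simpa using this
    -- From the leaves upwards, the value and the sum of the outgoing derivatives at a vertex of S
    -- are a common multiple of sin θ and -cos θ; so one amplitude determines the solution on the
    -- edge above.
    have hex : ∀ v, ∃ x : ℂ, v ∈ S → a v = x * Real.sin (θ v) ∧
        ∑ f : Edge G r with f.1.fst = v, dy f 0 = -(x * Real.cos (θ v)) := by
      refine tree_induction hG (r := r) fun v ih => ?_
      by_cases hv : v ∈ S
      swap
      · exact ⟨0, fun h => absurd h hv⟩
      choose! x hx using ih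
      have hx' : ∀ e : Edge G r, e.1.fst = v →
          ∀ s ∈ Icc 0 l, y e s = x e * Y e s ∧ dy e s = x e * dY e s := fun e he => by
        have heS : e.1.snd ∈ S := hS e (by rwa [he])
        exact hstep e (x e) heS (hx e he heS).1 (hx e he heS).2
      obtain ⟨t, ht1, ht2⟩ := exists_amplitude (s := {e : Edge G r | e.1.fst = v}) (ω := ω)
        (τ := fun e => x e * c e) (A := a v) (fun e he => by
          have he := (Finset.mem_filter.mp he).2
          rw [← he, ← (h5 e).1, (hx' e he 0 h0).1, hY0, mul_assoc]) rfl
      rw [← hθ] at ht1 ht2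
      refine ⟨t, fun _ => ⟨ht1, ?_⟩⟩
      rw [← ht2, ← Finset.sum_neg_distrib]
      refine Finset.sum_congr rfl fun e he => ?_
      have he := (Finset.mem_filter.mp he).2
      rw [(hx' e he 0 h0).2, hdY0]
      ring
    choose x hx using hex
    set t : V → ℂ := fun v => if v ∈ S then x v else 0 with ht
    have htS : ∀ v ∈ S, t v = x v := fun v hv => if_pos hv
    have hyt : ∀ e : Edge G r, e.1.snd ∈ S → ∀ s ∈ Icc 0 l, y e s = t e.1.snd * Y e s ∧
        dy e s = t e.1.snd * dY e s := fun e he => by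
      rw [htS _ he]
      exact hstep e _ he (hx _ he).1 (hx _ he).2
    have htm : t ∈ amplitudeSpace ω c θ S := by
      refine ⟨fun v hv => if_neg hv, fun v hv => ⟨fun e he => ?_, ?_⟩, fun hrS => ?_,
        fun e he => ?_⟩
      · have heS : e.1.snd ∈ S := hS e (by rwa [he])
        rw [htS v hv, ← (hx v hv).1, ← he, ← (h5 e).1, (hyt e heS 0 h0).1, hY0, mul_assoc]
      · rw [htS v hv, ← neg_eq_iff_eq_neg.mpr (hx v hv).2, ← Finset.sum_neg_distrib]
        refine Finset.sum_congr rfl fun e he => ?_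
        have he := (Finset.mem_filter.mp he).2
        rw [(hyt e (hS e (by rwa [he])) 0 h0).2, hdY0]
        ring
      · have := h6 r hrS
        unfold Kirchhoff at this
        rw [filter_snd_root, Finset.sum_empty, (hx r hrS).2] at this
        rw [htS r hrS]
        exact neg_eq_zero.mp this.symm
      · by_cases heS : e.1.snd ∈ S
        · have := (hyt e heS 0 h0).1
          rw [(h5 e).1, h3 _ he, hY0] at this
          have h7 : t e.1.snd * Real.sin (ω e) * c e = 0 := by rw [this]; ring
          exact (mul_eq_zero.mp h7).resolve_right (hc' e)
        · simp [ht, heS]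
    refine ⟨⟨t, htm⟩, Subtype.ext (funext fun e => ?_)⟩
    change t e.1.snd • Z e = y e
    by_cases heS : e.1.snd ∈ S
    · funext s
      by_cases hs : s ∈ Icc 0 l
      · rw [Pi.smul_apply, hZY e s hs, smul_eq_mul, (hyt e heS s hs).1]
      · rw [h1 e s hs, Pi.smul_apply, show Z e s = 0 from if_neg hs, smul_zero]
    · rw [h4 e heS]; simp [ht, heS]
  let L := LinearEquiv.ofBijective Φ ⟨hinj, hsurj⟩
  obtain ⟨hfin, hrank⟩ := finrank_amplitudeSpace hG hc hθ hS
  exact ⟨Module.Finite.equiv L, by rw [← L.finrank_eq, hrank]⟩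

end TreeSolutions

/-! ### Determinants and kernels of definite symmetric pencils. -/

section SymmetricPencils

variable {n : Type*} [Fintype n] [DecidableEq n]

/-- The roots of the determinant of a definite symmetric pencil, with their multiplicities. -/
theorem exists_symmetric_pencil_roots (B : Matrix n n ℝ) (hB : B.IsHermitian) (d : n → ℝ)
    (hd : ∀ i, 0 < d i) : ∃ ev : n → ℝ,
      (-((X : ℝ[X]) • Matrix.diagonal fun i => C (d i)) + B.map C).det =
        C ((-1) ^ Fintype.card n * ∏ i, d i) * ∏ i, (X - C (ev i)) ∧
      ∀ z : ℝ, Module.finrank ℂ (LinearMap.ker (Matrix.mulVecLin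
        ((B - z • Matrix.diagonal d).map Complex.ofRealHom))) =
          (Finset.univ.filter fun i => ev i = z).card := by
  set s : n → ℝ := fun i => Real.sqrt (d i)
  have hs : ∀ i, s i ≠ 0 := fun i => (Real.sqrt_pos.mpr (hd i)).ne'
  have hss : ∀ i, s i * s i = d i := fun i => Real.mul_self_sqrt (hd i).le
  -- The symmetric matrix D^(-1/2) B D^(-1/2) turns the pencil into an ordinary eigenvalue problem.
  obtain ⟨N, hN⟩ : ∃ N : Matrix n n ℝ, ∀ i j, N i j = (s i)⁻¹ * B i j * (s j)⁻¹ :=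
    ⟨fun i j => (s i)⁻¹ * B i j * (s j)⁻¹, fun _ _ => rfl⟩
  have hNh : N.IsHermitian := by
    ext i j
    have := congrFun (congrFun hB i) j
    simp only [Matrix.conjTranspose_apply, star_trivial] at this
    rw [Matrix.conjTranspose_apply, star_trivial, hN, hN, this]
    ring
  set ev := hNh.eigenvalues
  refine ⟨ev, ?_, fun z => ?_⟩
  · have h1 : -((X : ℝ[X]) • Matrix.diagonal fun i => C (d i)) + B.map C =
        Matrix.diagonal (fun i => C (s i)) * (-N.charmatrix) * Matrix.diagonal fun i => C (s i) := by
      ext1 i j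
      rw [Matrix.mul_diagonal, Matrix.diagonal_mul]
      by_cases hij : i = j
      · subst hij
        simp only [Matrix.add_apply, Matrix.neg_apply, Matrix.smul_apply, Matrix.diagonal_apply_eq,
          Matrix.map_apply, Matrix.charmatrix_apply_eq, smul_eq_mul]
        rw [← hss i, show B i i = s i * N i i * s i by simp only [hN]; have := hs i; field_simp]
        simp only [map_mul]
        ring
      · simp only [Matrix.add_apply, Matrix.neg_apply, Matrix.smul_apply,
          Matrix.diagonal_apply_ne _ hij, Matrix.map_apply, Matrix.charmatrix_apply_ne _ _ _ hij,
          smul_eq_mul]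
        rw [show B i j = s i * N i j * s j by
          simp only [hN]; have := hs i; have := hs j; field_simp]
        simp only [map_mul]
        ring
    rw [h1, Matrix.det_mul, Matrix.det_mul, Matrix.det_neg, Matrix.det_diagonal]
    have h2 : N.charmatrix.det = ∏ i, (X - C (ev i)) := hNh.charpoly_eq
    rw [h2, ← Finset.prod_congr rfl fun i _ => hss i, Finset.prod_mul_distrib]
    simp only [map_mul, map_prod, map_pow, map_neg, map_one]
    ring
  · set P : Matrix n n ℝ := (hNh.eigenvectorUnitary : Matrix n n ℝ) with hP
    have hPP : P * star P = 1 := Unitary.coe_mul_star_self _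
    have hPP' : star P * P = 1 := Unitary.coe_star_mul_self _
    have hspec : N = P * Matrix.diagonal ev * star P := by
      have := hNh.spectral_theorem
      rw [Unitary.conjStarAlgAut_apply] at this
      exact this
    -- Up to invertible factors on both sides the pencil at z is the diagonal matrix of the ev i -
    -- z; this survives the passage to ℂ and gives the rank.
    have h1 : B - z • Matrix.diagonal d =
        (Matrix.diagonal s * P) * Matrix.diagonal (fun i => ev i - z) * (star P * Matrix.diagonal s) := by
      have h2 : P * Matrix.diagonal (fun i => ev i - z) * star P = N - z • 1 := by
        have : Matrix.diagonal (fun i => ev i - z) = Matrix.diagonal ev - z • (1 : Matrix n n ℝ) := by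
          rw [Matrix.smul_one_eq_diagonal, Matrix.diagonal_sub]
        rw [this, mul_sub, sub_mul, ← hspec, mul_smul_comm, mul_one, smul_mul_assoc, hPP]
      have h3 : (Matrix.diagonal s * P) * Matrix.diagonal (fun i => ev i - z) *
          (star P * Matrix.diagonal s) = Matrix.diagonal s * (N - z • 1) * Matrix.diagonal s := by
        rw [← h2]; simp only [mul_assoc]
      rw [h3]
      ext i j
      rw [Matrix.mul_diagonal, Matrix.diagonal_mul]
      by_cases hij : i = j
      · subst hij
        simp only [Matrix.sub_apply, Matrix.smul_apply, Matrix.diagonal_apply_eq, smul_eq_mul,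
          Matrix.one_apply_eq, hN, ← hss i]
        have := hs i
        field_simp
      · simp only [Matrix.sub_apply, Matrix.smul_apply, Matrix.diagonal_apply_ne _ hij, smul_eq_mul,
          Matrix.one_apply_ne hij, hN]
        have := hs i; have := hs j
        field_simp
        ring
    have hdet : IsUnit (Matrix.diagonal s * P).det := by
      rw [Matrix.det_mul, Matrix.det_diagonal]
      refine IsUnit.mul (isUnit_iff_ne_zero.mpr (Finset.prod_ne_zero_iff.mpr fun i _ => hs i)) ?_
      exact (Matrix.isUnit_iff_isUnit_det _).mp (IsUnit.of_mul_eq_one _ hPP)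
    have hdet' : IsUnit (star P * Matrix.diagonal s).det := by
      rw [Matrix.det_mul, Matrix.det_diagonal]
      refine IsUnit.mul ?_ (isUnit_iff_ne_zero.mpr (Finset.prod_ne_zero_iff.mpr fun i _ => hs i))
      exact (Matrix.isUnit_iff_isUnit_det _).mp (IsUnit.of_mul_eq_one _ hPP')
    have hrank : ((B - z • Matrix.diagonal d).map Complex.ofRealHom).rank =
        Fintype.card {i // ((ev i - z : ℝ) : ℂ) ≠ 0} := by
      rw [h1, Matrix.map_mul, Matrix.map_mul, Matrix.rank_mul_eq_left_of_isUnit_det,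
        Matrix.rank_mul_eq_right_of_isUnit_det, Matrix.diagonal_map (map_zero _),
        Matrix.rank_diagonal]
      · rfl
      · have := hdet.map Complex.ofRealHom
        rwa [RingHom.map_det] at this
      · have := hdet'.map Complex.ofRealHom
        rwa [RingHom.map_det] at this
    have hrn := LinearMap.finrank_range_add_finrank_ker (Matrix.mulVecLin
        ((B - z • Matrix.diagonal d).map Complex.ofRealHom))
    rw [Module.finrank_fintype_fun_eq_card] at hrn
    change Matrix.rank _ + _ = _ at hrn
    rw [hrank, Fintype.card_subtype] at hrn
    have hc := Finset.card_filter_add_card_filter_not (s := (Finset.univ : Finset n))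
      (fun i => ev i = z)
    have he : (Finset.univ.filter fun i => ((ev i - z : ℝ) : ℂ) ≠ 0) =
        Finset.univ.filter fun i => ¬ev i = z := by
      refine Finset.filter_congr fun i _ => ?_
      rw [Ne, Complex.ofReal_eq_zero, sub_eq_zero]
    rw [he] at hrn
    rw [Finset.card_univ] at hc
    omega

end SymmetricPencils

/-! ### Elimination on the tree and the denominators of the continued fraction. -/

section Continuants

set_option linter.unusedSectionVars false

variable {V : Type u} [Fintype V] [DecidableEq V]
variable {G : SimpleGraph V} [DecidableRel G.Adj] {r : V}
variable {K : Type*} [Field K]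

theorem isChild_iff {v u : V} : IsChild G r v u ↔ ∃ e : Edge G r, e.1.fst = v ∧ e.1.snd = u := by
  constructor
  · rintro ⟨h1, h2⟩
    exact ⟨⟨⟨(v, u), h1⟩, h2⟩, rfl, rfl⟩
  · rintro ⟨e, rfl, rfl⟩
    exact ⟨e.1.adj, e.2⟩

theorem IsChild.unique_parent (hG : G.IsTree) {v v' u : V} (h : IsChild G r v u)
    (h' : IsChild G r v' u) : v = v' := by
  obtain ⟨e, rfl, rfl⟩ := isChild_iff.mp h
  obtain ⟨f, rfl, hf⟩ := isChild_iff.mp h'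
  rw [edge_snd_injective hG hf]

/-- The block of `-z D + A` which belongs to `S`. -/
def evalPencil (G : SimpleGraph V) [DecidableRel G.Adj] (z : K) (S : Finset V) :
    Matrix {v // v ∈ S} {v // v ∈ S} K :=
  (-(z • G.degMatrix K) + G.adjMatrix K).submatrix Subtype.val Subtype.val

/-- The values of the denominators of the branched continued fraction. -/
def IsContinuant (r : V) (z : K) (Q : V → K) : Prop :=
  ∀ v, Q v = G.degree v * z - ∑ e : Edge G r with e.1.fst = v, 1 / Q e.1.snd

theorem exists_isContinuant (hG : G.IsTree) (z : K) :
    ∃ Q : V → K, IsContinuant (G := G) r z Q := by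
  have : Inhabited K := ⟨0⟩
  exact exists_tree_recursion hG (r := r)
    (fun v g => (G.degree v * z - ∑ e : Edge G r with e.1.fst = v, 1 / g e)) (by
      intro v g g' h
      congr 1
      exact Finset.sum_congr rfl fun e he => by rw [h e (Finset.mem_filter.mp he).2])

-- Elimination from the leaves creates no new entries on a tree: the pencil is Uᵀ diag(-Q) U, where
-- U is unipotent and its only off-diagonal entries are -1 / Q u, for u a child of v.
open Classical in
theorem det_evalPencil (hG : G.IsTree) {S : Finset V} (hS : DescClosed G r S) {z : K} {Q : V → K}
    (hQ : IsContinuant (G := G) r z Q) (h0 : ∀ v ∈ S, v ≠ r → Q v ≠ 0) :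
    (evalPencil G z S).det = ∏ v ∈ S, -Q v := by
  set U₀ : V → V → K := fun u v => if u = v then 1 else if IsChild G r v u then -(1 / Q u) else 0
  have hirr : ∀ u, ¬IsChild G r u u := fun u h => h.1.ne rfl
  have hUself : ∀ u, U₀ u u = 1 := fun u => if_pos rfl
  have hUchild : ∀ {u v}, IsChild G r v u → U₀ u v = -(1 / Q u) := fun {u v} h => by
    simp only [U₀]; rw [if_neg h.1.ne', if_pos h]
  have hU0 : ∀ {u v}, u ≠ v → ¬IsChild G r v u → U₀ u v = 0 := fun {u v} h h' => by
    simp only [U₀]; rw [if_neg h, if_neg h']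
  set U : Matrix {v // v ∈ S} {v // v ∈ S} K := fun u v => U₀ u v
  have hdet : U.det = 1 := by
    -- Off the diagonal, U only links a vertex to its children one level deeper; so it is triangular
    -- for the reversed depth, with identity matrices as diagonal blocks.
    have hb : U.BlockTriangular fun u => OrderDual.toDual (G.dist r u) := by
      intro u v huv
      have huv' : G.dist r u < G.dist r v := huv
      refine hU0 (fun h => ?_) fun h => ?_
      · rw [h] at huv'; exact lt_irrefl _ huv'
      · have := h.2; omega
    rw [hb.det]
    refine Finset.prod_eq_one fun k _ => ?_
    have : U.toSquareBlock (fun u => OrderDual.toDual (G.dist r u)) k = 1 := by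
      ext ⟨u, hu⟩ ⟨v, hv⟩
      rw [Matrix.one_apply]
      split_ifs with h
      · have h' : u = v := congrArg Subtype.val h
        subst h'
        exact hUself _
      · refine hU0 (fun h' => h (Subtype.ext (Subtype.ext h'))) fun h' => ?_
        have h1 : G.dist r u = G.dist r v + 1 := h'.2
        have h2 : G.dist r u = G.dist r v := congrArg OrderDual.ofDual (hu.trans hv.symm)
        omega
    rw [this, Matrix.det_one]
  have hfac : evalPencil G z S = U.transpose * Matrix.diagonal (fun v : {v // v ∈ S} => -Q v) * U := by
    ext v w
    rw [Matrix.mul_apply]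
    simp only [Matrix.mul_diagonal, Matrix.transpose_apply]
    have hsum : ∑ x : {v // v ∈ S}, U x v * -Q x * U x w = ∑ x ∈ S, U₀ x v * -Q x * U₀ x w :=
      Finset.sum_coe_sort S fun x => U₀ x v * -Q x * U₀ x w
    rw [hsum]
    obtain ⟨v, hv⟩ := v
    obtain ⟨w, hw⟩ := w
    simp only [evalPencil, Matrix.submatrix_apply, Matrix.add_apply, Matrix.neg_apply,
      Matrix.smul_apply, SimpleGraph.degMatrix, SimpleGraph.adjMatrix_apply, smul_eq_mul]
    have hchild : ∀ {x}, x ∈ S → ∀ {y}, IsChild G r x y → y ∈ S := fun {x} hx {y} hy => by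
      obtain ⟨e, rfl, rfl⟩ := isChild_iff.mp hy
      exact hS e hx
    have hne : ∀ {x y}, y ∈ S → IsChild G r x y → Q y ≠ 0 := fun {x y} hyS hy => by
      refine h0 y hyS ?_
      obtain ⟨e, rfl, rfl⟩ := isChild_iff.mp hy
      exact edge_snd_ne_root e
    -- Entry by entry: on the diagonal the recursion of Q leaves -d z; for parent and child one term
    -- remains and equals 1; all else vanishes, since a vertex has only one parent.
    by_cases hvw : v = w
    · subst hvw
      rw [Matrix.diagonal_apply_eq, if_neg (G.loopless.irrefl v), add_zero,
        ← Finset.add_sum_erase S _ hv, hUself]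
      have h1 : ∑ x ∈ S.erase v, U₀ x v * -Q x * U₀ x v =
          ∑ e : Edge G r with e.1.fst = v, -(1 / Q e.1.snd) := by
        have h2 : ∑ x ∈ S.erase v, U₀ x v * -Q x * U₀ x v =
            ∑ x ∈ ({e : Edge G r | e.1.fst = v} : Finset _).image (fun e => e.1.snd),
              U₀ x v * -Q x * U₀ x v := by
          symm
          refine Finset.sum_subset ?_ ?_
          · intro x hx
            obtain ⟨e, he, rfl⟩ := Finset.mem_image.mp hx
            have he := (Finset.mem_filter.mp he).2
            exact Finset.mem_erase.mpr ⟨fun h => e.1.adj.ne (he.trans h.symm), hS e (he ▸ hv)⟩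
          · intro x hx hx'
            rw [hU0 (Finset.mem_erase.mp hx).1, zero_mul, zero_mul]
            intro h
            obtain ⟨e, he, he'⟩ := isChild_iff.mp h
            exact hx' (Finset.mem_image.mpr ⟨e, by simpa using he, he'⟩)
        rw [h2, Finset.sum_image fun e _ f _ h => edge_snd_injective hG h]
        refine Finset.sum_congr rfl fun e he => ?_
        have he := (Finset.mem_filter.mp he).2
        have hc : IsChild G r v e.1.snd := isChild_iff.mpr ⟨e, he, rfl⟩
        have hq := hne (hchild hv hc) hc
        rw [hUchild hc]
        field_simp
      rw [h1, hQ v, Finset.sum_neg_distrib]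
      ring
    · rw [Matrix.diagonal_apply_ne _ hvw, mul_zero, neg_zero, zero_add]
      by_cases h1 : IsChild G r v w
      · have hq := hne hw h1
        rw [if_pos h1.1, Finset.sum_eq_single w, hUself, hUchild h1]
        · field_simp
        · intro x hx hxw
          by_cases hxv : x = v
          · rw [hU0 hxw, mul_zero]
            rw [hxv]; intro h2; have := h1.2; have := h2.2; omega
          · by_cases h3 : IsChild G r v x
            · rw [hU0 hxw, mul_zero]
              intro h2; exact hvw (h3.unique_parent hG h2)
            · rw [hU0 hxv h3, zero_mul, zero_mul]
        · exact fun h => absurd hw h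
      · by_cases h2 : IsChild G r w v
        · have hq := hne hv h2
          rw [if_pos h2.1.symm, Finset.sum_eq_single v, hUself, hUchild h2]
          · field_simp
          · intro x hx hxv
            by_cases hxw : x = w
            · rw [hU0 hxv, zero_mul, zero_mul]
              rw [hxw]; exact h1
            · by_cases h3 : IsChild G r w x
              · rw [hU0 hxv, zero_mul, zero_mul]
                intro h4; exact hvw (h4.unique_parent hG h3)
              · rw [hU0 hxw h3, mul_zero]
          · exact fun h => absurd hv h
        · rw [if_neg, Finset.sum_eq_zero]
          · intro x hx
            by_cases hxv : x = v
            · rw [hxv, hU0 hvw h2, mul_zero]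
            · by_cases h3 : IsChild G r v x
              · rw [hU0 (u := x) (v := w), mul_zero]
                · rintro rfl; exact h1 h3
                · intro h4; exact hvw (h3.unique_parent hG h4)
              · rw [hU0 hxv h3, zero_mul, zero_mul]
          · intro h
            rcases (adj_iff_edge hG (r := r)).mp h with he | he
            · exact h1 (isChild_iff.mpr he)
            · exact h2 (isChild_iff.mpr he)
  rw [hfac, Matrix.det_mul, Matrix.det_mul, Matrix.det_transpose, hdet, one_mul, mul_one,
    Matrix.det_diagonal]
  exact Finset.prod_coe_sort S fun v => -Q v

/-- The determinant of the block of the pencil which belongs to `S`. -/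
def psiOf (G : SimpleGraph V) [DecidableRel G.Adj] (S : Finset V) : ℝ[X] :=
  ((pencil G).submatrix (Subtype.val : {v // v ∈ S} → V) Subtype.val).det

theorem psi_eq_psiOf : psi G = psiOf G Finset.univ :=
  (Matrix.det_submatrix_equiv_self (Equiv.subtypeUnivEquiv fun v => Finset.mem_univ v) _).symm

theorem psiHat_eq_psiOf : psiHat G r = psiOf G (Finset.univ.erase r) := by
  have := Matrix.det_submatrix_equiv_self
    (Equiv.subtypeEquivRight (p := fun v => v ≠ r) (q := fun v => v ∈ Finset.univ.erase r)
      fun v => by simp) ((pencil G).submatrix (Subtype.val : {v // v ∈ Finset.univ.erase r} → V)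
        Subtype.val)
  exact this

theorem psiHatBranch_eq_psiOf {w : V} : psiHatBranch G r w = psiOf G (branch G r w) := rfl

/-- One polynomial serves for real and complex values of z and for the generic z in the field of
rational functions. -/
theorem map_psiOf (f : ℝ[X] →+* K) (S : Finset V) :
    f (psiOf G S) = (evalPencil G (f X) S).det := by
  rw [psiOf, RingHom.map_det]
  congr 1
  ext v w
  simp only [RingHom.mapMatrix_apply, Matrix.map_apply, Matrix.submatrix_apply, pencil, evalPencil,
    Matrix.add_apply, Matrix.neg_apply, Matrix.smul_apply, SimpleGraph.degMatrix,
    SimpleGraph.adjMatrix_apply, smul_eq_mul, map_add, map_neg, map_mul, Matrix.diagonal_apply]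
  split_ifs <;> simp

theorem degree_eq_card (hG : G.IsTree) (v : V) : G.degree v =
    ({e : Edge G r | e.1.fst = v} : Finset _).card + if v = r then 0 else 1 := by
  have := sum_neighbors hG (r := r) v fun _ => 1
  simp only [Finset.sum_const, smul_eq_mul, mul_one] at this
  rw [← SimpleGraph.card_neighborFinset_eq_degree, this]
  congr 1
  split_ifs with h
  · rw [h, filter_snd_root, Finset.card_empty]
  · obtain ⟨e, rfl⟩ := exists_edge_to hG h
    rw [filter_snd_eq hG, Finset.card_singleton]

-- At infinity Q v grows like its leading term d z: by induction the reciprocals at the children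
-- have valuation `exp (-1)` and cannot cancel it.
open WithZero in
theorem IsContinuant.ratFunc_ne_zero (hG : G.IsTree) (hd : ∀ v, 0 < G.degree v)
    {Q : V → RatFunc ℝ} (hQ : IsContinuant (G := G) r RatFunc.X Q) (v : V) : Q v ≠ 0 := by
  classical
  have key : ∀ v, RatFunc.inftyValuation ℝ (Q v) = exp 1 := by
    refine tree_induction hG (r := r) fun v ih => ?_
    rw [hQ v]
    have h1 : RatFunc.inftyValuation ℝ ((G.degree v : RatFunc ℝ) * RatFunc.X) = exp 1 := by
      rw [map_mul, RatFunc.inftyValuation.X]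
      have h2 : ((G.degree v : ℕ) : RatFunc ℝ) = RatFunc.C (G.degree v : ℝ) := by simp
      rw [h2, RatFunc.inftyValuation.C, one_mul]
      exact_mod_cast (hd v).ne'
    rw [Valuation.map_sub_eq_of_lt_left, h1]
    rw [h1]
    refine Valuation.map_sum_lt _ (by simp) fun e he => ?_
    rw [one_div, map_inv₀, ih e (Finset.mem_filter.mp he).2, ← exp_neg]
    exact exp_lt_exp.mpr (by norm_num)
  intro h
  have := key v
  rw [h, map_zero] at this
  exact exp_ne_zero this.symm

/-- The reciprocals at the children are at most 1 in absolute value, and there are d - 1 of them at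
a vertex other than the root, d at the root. This confines the roots to (-1, 1) for blocks without
the root and to [-1, 1] for the whole tree. -/
theorem IsContinuant.one_le_abs (hG : G.IsTree) {z : ℝ} (hz : 1 ≤ |z|) {Q : V → ℝ}
    (hQ : IsContinuant (G := G) r z Q) (v : V) :
    (v ≠ r → 1 ≤ |Q v|) ∧ G.degree v * (|z| - 1) ≤ |Q v| := by
  refine tree_induction hG (r := r)
    (P := fun v => (v ≠ r → 1 ≤ |Q v|) ∧ G.degree v * (|z| - 1) ≤ |Q v|) (fun v ih => ?_) v
  have h1 : |∑ e : Edge G r with e.1.fst = v, 1 / Q e.1.snd| ≤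
      ({e : Edge G r | e.1.fst = v} : Finset _).card := by
    refine (Finset.abs_sum_le_sum_abs _ _).trans ?_
    rw [← nsmul_one, ← Finset.sum_const]
    refine Finset.sum_le_sum fun e he => ?_
    rw [abs_div, abs_one]
    have := (ih e (Finset.mem_filter.mp he).2).1 (edge_snd_ne_root e)
    exact (div_le_one (by linarith)).mpr this
  have h2 : (G.degree v : ℝ) * |z| - ({e : Edge G r | e.1.fst = v} : Finset _).card ≤ |Q v| := by
    rw [hQ v]
    refine le_trans ?_ (abs_sub_abs_le_abs_sub _ _)
    rw [abs_mul, Nat.abs_cast]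
    linarith
  have h3 := degree_eq_card hG (r := r) v
  have h3' : (G.degree v : ℝ) = (({e : Edge G r | e.1.fst = v} : Finset _).card : ℝ) +
      ((if v = r then 0 else 1 : ℕ) : ℝ) := by exact_mod_cast h3
  have h4 : (G.degree v : ℝ) ≤ G.degree v * |z| := le_mul_of_one_le_right (by positivity) hz
  constructor
  · intro hv
    rw [if_neg hv] at h3'
    push_cast at h3'
    linarith
  · have : (0 : ℝ) ≤ ((if v = r then 0 else 1 : ℕ) : ℝ) := by positivity
    linarith

end Continuants

/-! ### Location and multiplicity of the roots of ψ and its blocks. -/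

section PencilRoots

set_option linter.unusedSectionVars false

variable {V : Type u} [Fintype V] [DecidableEq V]
variable {G : SimpleGraph V} [DecidableRel G.Adj] {r : V} {S : Finset V}

/-- The extension by zero. -/
def extendZero (u : {v // v ∈ S} → ℂ) (v : V) : ℂ := if h : v ∈ S then u ⟨v, h⟩ else 0

theorem extendZero_apply (u : {v // v ∈ S} → ℂ) (v : {v // v ∈ S}) : extendZero u v = u v := by
  simp [extendZero]

theorem extendZero_of_notMem (u : {v // v ∈ S} → ℂ) {v : V} (h : v ∉ S) : extendZero u v = 0 := by
  simp [extendZero, h]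

theorem extendZero_add (u u' : {v // v ∈ S} → ℂ) (v : V) :
    extendZero (u + u') v = extendZero u v + extendZero u' v := by
  simp only [extendZero]; split_ifs <;> simp

theorem extendZero_smul (k : ℂ) (u : {v // v ∈ S} → ℂ) (v : V) :
    extendZero (k • u) v = k * extendZero u v := by
  simp only [extendZero]; split_ifs <;> simp

theorem mem_ker_evalPencil {z : ℂ} {u : {v // v ∈ S} → ℂ} :
    u ∈ LinearMap.ker (Matrix.mulVecLin (evalPencil G z S)) ↔
      ∀ v ∈ S, ∑ w ∈ G.neighborFinset v, extendZero u w = G.degree v * z * extendZero u v := by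
  rw [LinearMap.mem_ker, Matrix.mulVecLin_apply, funext_iff]
  have h : ∀ v : {v // v ∈ S}, (evalPencil G z S).mulVec u v =
      ∑ w ∈ G.neighborFinset v, extendZero u w - G.degree v * z * extendZero u v := by
    intro v
    simp only [Matrix.mulVec, dotProduct, evalPencil, Matrix.submatrix_apply, Matrix.add_apply,
      Matrix.neg_apply, Matrix.smul_apply, SimpleGraph.degMatrix, SimpleGraph.adjMatrix_apply,
      smul_eq_mul, add_mul, Finset.sum_add_distrib]
    rw [add_comm, sub_eq_add_neg]
    congr 1
    · have h1 : ∀ w : {v // v ∈ S}, (if G.Adj v w then (1 : ℂ) else 0) * u w =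
          (fun w : V => if G.Adj v w then extendZero u w else 0) w := fun w => by
        simp only [extendZero_apply]; split_ifs <;> simp
      rw [Finset.sum_congr rfl fun w _ => h1 w,
        Finset.sum_coe_sort S (fun w : V => if G.Adj v w then extendZero u w else 0)]
      rw [Finset.sum_subset (Finset.subset_univ S) fun w _ hw => by
        rw [extendZero_of_notMem u hw, ite_self], ← Finset.sum_filter]
      refine Finset.sum_congr ?_ fun _ _ => rfl
      ext w; simp
    · rw [Finset.sum_eq_single v]
      · rw [Matrix.diagonal_apply_eq, extendZero_apply]; ring
      · intro w _ hw
        rw [Matrix.diagonal_apply_ne _ fun h => hw (Subtype.ext h.symm)]; simp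
      · simp
  simp only [h, Pi.zero_apply, sub_eq_zero]
  exact ⟨fun h v hv => h ⟨v, hv⟩, fun h v => h v v.2⟩

/-- With positive degrees the pencil is definite, hence diagonalizable: the order of a root is the
dimension of the kernel. -/
theorem psiOf_roots (hd : ∀ v, 0 < G.degree v) (S : Finset V) :
    ∃ R : Multiset ℝ, (psiOf G S).roots = R ∧ R.card = S.card ∧
      psiOf G S = C ((-1) ^ S.card * ∏ v ∈ S, (G.degree v : ℝ)) * (R.map fun x => X - C x).prod ∧
      ∀ z : ℝ, Module.finrank ℂ (LinearMap.ker (Matrix.mulVecLin (evalPencil G (z : ℂ) S))) =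
        R.count z := by
  classical
  obtain ⟨ev, h1, h2⟩ := exists_symmetric_pencil_roots (n := {v // v ∈ S})
    ((G.adjMatrix ℝ).submatrix Subtype.val Subtype.val)
    ((SimpleGraph.isHermitian_adjMatrix ℝ G).submatrix _) (fun v => (G.degree v : ℝ))
    (fun v => by exact_mod_cast hd v)
  have hpsi : psiOf G S = (-((X : ℝ[X]) • Matrix.diagonal fun i : {v // v ∈ S} =>
      C (G.degree (i : V) : ℝ)) +
      ((G.adjMatrix ℝ).submatrix Subtype.val Subtype.val).map C).det := by
    rw [psiOf]
    congr 1
    ext1 v w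
    simp only [Matrix.submatrix_apply, pencil, Matrix.map_apply,
      Matrix.add_apply, Matrix.neg_apply, Matrix.smul_apply, SimpleGraph.degMatrix,
      SimpleGraph.adjMatrix_apply, smul_eq_mul, Matrix.diagonal_apply, Subtype.ext_iff]
    split_ifs <;> simp
  have hprod : (∏ i : {v // v ∈ S}, (G.degree (i : V) : ℝ)) = ∏ v ∈ S, (G.degree v : ℝ) :=
    Finset.prod_coe_sort S fun v => (G.degree v : ℝ)
  rw [← hpsi, hprod, Fintype.card_coe] at h1
  have hc : ((-1 : ℝ) ^ S.card * ∏ v ∈ S, (G.degree v : ℝ)) ≠ 0 :=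
    mul_ne_zero (by simp) (Finset.prod_ne_zero_iff.mpr fun v _ => by exact_mod_cast (hd v).ne')
  refine ⟨Finset.univ.val.map ev, ?_,
    by rw [Multiset.card_map, ← Finset.card_def, Finset.card_univ, Fintype.card_coe], ?_,
    fun z => ?_⟩
  · rw [h1, roots_C_mul _ hc]
    rw [show ∏ i, (X - C (ev i)) = ((Finset.univ.val.map ev).map fun x => X - C x).prod by
      rw [Multiset.map_map]; rfl, roots_multiset_prod_X_sub_C]
  · rw [h1, Multiset.map_map]; rfl
  · have := h2 z
    rw [Multiset.count_map]
    have e : (((G.adjMatrix ℝ).submatrix Subtype.val Subtype.val -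
        z • Matrix.diagonal fun v : {v // v ∈ S} => (G.degree (v : V) : ℝ)).map
          Complex.ofRealHom) = evalPencil G (z : ℂ) S := by
      ext v w
      simp only [Matrix.map_apply, Matrix.submatrix_apply, evalPencil, Matrix.sub_apply,
        Matrix.add_apply, Matrix.neg_apply, Matrix.smul_apply, SimpleGraph.degMatrix,
        SimpleGraph.adjMatrix_apply, smul_eq_mul, Matrix.diagonal_apply, Subtype.ext_iff]
      split_ifs <;> (simp; try ring)
    rw [e] at this
    rw [this, Finset.card_def, Finset.filter_val]
    congr 1
    exact Multiset.filter_congr fun i _ => eq_comm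

theorem eval_psiOf (hG : G.IsTree) (hS : DescClosed G r S) {z : ℝ} (hz : 1 ≤ |z|) {Q : V → ℝ}
    (hQ : IsContinuant (G := G) r z Q) : (psiOf G S).eval z = ∏ v ∈ S, -Q v := by
  have h1 := map_psiOf (G := G) (evalRingHom z) S
  rw [coe_evalRingHom, eval_X] at h1
  rw [h1]
  refine det_evalPencil hG hS hQ fun v _ hv h => ?_
  have := (hQ.one_le_abs hG hz v).1 hv
  rw [h, abs_zero] at this
  linarith

theorem eval_psiOf_ne_zero (hG : G.IsTree) (hd : ∀ v, 0 < G.degree v) (hS : DescClosed G r S)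
    {z : ℝ} (hz : 1 ≤ |z|) (h : r ∉ S ∨ 1 < |z|) : (psiOf G S).eval z ≠ 0 := by
  obtain ⟨Q, hQ⟩ := exists_isContinuant hG (r := r) z
  rw [eval_psiOf hG hS hz hQ]
  refine Finset.prod_ne_zero_iff.mpr fun v hv => neg_ne_zero.mpr fun h0 => ?_
  have h1 := hQ.one_le_abs hG hz v
  rw [h0, abs_zero] at h1
  rcases h with h | h
  · have := h1.1 fun hvr => h (hvr ▸ hv)
    linarith
  · have : (0 : ℝ) < G.degree v := by exact_mod_cast hd v
    have := mul_pos this (sub_pos.mpr h)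
    linarith [h1.2]

theorem abs_lt_one_of_mem_roots (hG : G.IsTree) (hd : ∀ v, 0 < G.degree v)
    (hS : DescClosed G r S) (hr : r ∉ S) {z : ℝ} (h : z ∈ (psiOf G S).roots) : |z| < 1 := by
  by_contra! hz
  exact eval_psiOf_ne_zero hG hd hS hz (Or.inl hr) (isRoot_of_mem_roots h)

theorem abs_le_one_of_mem_roots (hG : G.IsTree) (hd : ∀ v, 0 < G.degree v)
    {z : ℝ} (h : z ∈ (psiOf G Finset.univ).roots) : |z| ≤ 1 := by
  obtain ⟨r⟩ := hG.connected.nonempty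
  by_contra! hz
  exact eval_psiOf_ne_zero hG hd (r := r) (fun _ _ => Finset.mem_univ _) hz.le (Or.inr hz)
    (isRoot_of_mem_roots h)

/-- As z² = 1, the vector z ^ dist lies in the kernel. A kernel vector that is zero at the root lies
in the kernel of the block without the root, which is invertible for |z| = 1; so the kernel is a
line. -/
theorem count_roots_psi (hG : G.IsTree) (hd : ∀ v, 0 < G.degree v) {z : ℝ} (hz : z = 1 ∨ z = -1) :
    (psiOf G Finset.univ).roots.count z = 1 := by
  obtain ⟨r⟩ := hG.connected.nonempty
  obtain ⟨R, hR, -, -, hR4⟩ := psiOf_roots (G := G) hd Finset.univ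
  have hz2 : z * z = 1 := by rcases hz with rfl | rfl <;> norm_num
  have hzabs : |z| = 1 := by rcases hz with rfl | rfl <;> simp
  have hz2' : (z : ℂ) * z = 1 := by exact_mod_cast hz2
  have hz0 : (z : ℂ) ≠ 0 := fun h => by rw [h] at hz2'; simp at hz2'
  rw [hR, ← hR4 z]
  set x : {v : V // v ∈ Finset.univ} → ℂ := fun v => (z : ℂ) ^ G.dist r v
  have hx' : ∀ v, extendZero x v = (z : ℂ) ^ G.dist r v := fun v =>
    extendZero_apply x ⟨v, Finset.mem_univ v⟩
  have hx : x ∈ LinearMap.ker (Matrix.mulVecLin (evalPencil G (z : ℂ) Finset.univ)) := by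
    rw [mem_ker_evalPencil]
    intro v _
    simp only [hx']
    rw [Finset.sum_congr rfl (g := fun _ => (z : ℂ) * (z : ℂ) ^ G.dist r v), Finset.sum_const,
      SimpleGraph.card_neighborFinset_eq_degree, nsmul_eq_mul, mul_assoc]
    intro u hu
    have hu : G.Adj v u := by simpa using hu
    rcases hG.dist_eq_dist_add_one_of_adj r hu with h | h
    · rw [h, pow_succ', ← mul_assoc, hz2', one_mul]
    · rw [h, pow_succ']
  have hx0 : (⟨x, hx⟩ : LinearMap.ker (Matrix.mulVecLin (evalPencil G (z : ℂ) Finset.univ))) ≠ 0 := by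
    intro h
    have := congrFun (congrArg Subtype.val h) ⟨r, Finset.mem_univ r⟩
    exact pow_ne_zero _ hz0 this
  refine (finrank_eq_one_iff_of_nonzero' _ hx0).mpr ?_
  rintro ⟨y, hy⟩
  have hker : ∀ y ∈ LinearMap.ker (Matrix.mulVecLin (evalPencil G (z : ℂ) Finset.univ)),
      y ⟨r, Finset.mem_univ r⟩ = 0 → y = 0 := by
    intro y hy hyr
    have hdet : (evalPencil G (z : ℂ) (Finset.univ.erase r)).det ≠ 0 := by
      have h1 := map_psiOf (G := G) (Complex.ofRealHom.comp (evalRingHom z)) (Finset.univ.erase r)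
      simp only [RingHom.comp_apply, coe_evalRingHom, eval_X, Complex.ofRealHom_eq_coe] at h1
      rw [← h1]
      exact_mod_cast eval_psiOf_ne_zero hG hd (r := r)
        (fun e _ => Finset.mem_erase.mpr ⟨edge_snd_ne_root e, Finset.mem_univ _⟩) hzabs.ge
        (Or.inl (by simp))
    set y' : {v // v ∈ Finset.univ.erase r} → ℂ := fun v => y ⟨v, Finset.mem_univ _⟩
    have hyy : ∀ v, extendZero y' v = extendZero y v := by
      intro v
      by_cases hv : v = r
      · rw [hv, extendZero_of_notMem _ (by simp)]
        exact ((extendZero_apply y ⟨r, Finset.mem_univ r⟩).trans hyr).symm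
      · exact (extendZero_apply y' ⟨v, by simpa using hv⟩).trans
          (extendZero_apply y ⟨v, Finset.mem_univ v⟩).symm
    have hy' : y' ∈ LinearMap.ker (Matrix.mulVecLin (evalPencil G (z : ℂ) (Finset.univ.erase r))) := by
      rw [mem_ker_evalPencil] at hy ⊢
      intro v _
      simp only [hyy]
      exact hy v (Finset.mem_univ v)
    have h0 := Matrix.eq_zero_of_mulVec_eq_zero hdet (LinearMap.mem_ker.mp hy')
    funext v
    rw [← extendZero_apply y, ← hyy, h0]
    simp [extendZero]
  refine ⟨y ⟨r, Finset.mem_univ r⟩ / x ⟨r, Finset.mem_univ r⟩, Subtype.ext ?_⟩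
  have h3 : x ⟨r, Finset.mem_univ r⟩ ≠ 0 := pow_ne_zero _ hz0
  have := hker _ (Submodule.sub_mem _ hy (Submodule.smul_mem _
    (y ⟨r, Finset.mem_univ r⟩ / x ⟨r, Finset.mem_univ r⟩) hx)) (by
      simp only [Pi.sub_apply, Pi.smul_apply, smul_eq_mul]
      field_simp
      simp)
  exact (sub_eq_zero.mp this).symm

end PencilRoots

/-! ### Zero potential: eigenfunctions as kernel vectors of the pencil. -/

section ZeroPotential

theorem isSolution_sin (l ρ φ : ℝ) : IsSolution l (fun _ => 0) ((ρ ^ 2 : ℝ) : ℂ)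
    (fun x => ((Real.sin (ρ * x + φ) : ℝ) : ℂ)) (fun x => ((ρ * Real.cos (ρ * x + φ) : ℝ) : ℂ)) where
  hasDeriv x _ := by
    have h := (((hasDerivAt_id x).const_mul ρ).add_const φ).sin
    refine HasDerivAt.hasDerivWithinAt ?_
    refine (HasDerivAt.ofReal_comp h).congr_deriv ?_
    push_cast; simp [mul_comm]
  absCont := by
    have h1 : AbsolutelyContinuousOnInterval (fun x : ℝ => x) 0 l :=
      (LipschitzWith.id.lipschitzOnWith (s := uIcc 0 l)).absolutelyContinuousOnInterval
    have h2 : ContDiff ℝ 1 fun x : ℝ => ρ * Real.cos (ρ * x + φ) := by fun_prop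
    exact absCont_ofReal (absolutelyContinuous_contDiff_comp h2 h1)
  equation := Eventually.of_forall fun x => by
    have h := ((((hasDerivAt_id x).const_mul ρ).add_const φ).cos).const_mul ρ
    refine (HasDerivAt.ofReal_comp h).congr_deriv ?_
    push_cast; simp; ring

/-- A solution that vanishes at l is a multiple of sin (ρ (x - l)), which is not zero at 0.
Consequently the end values determine a solution. -/
theorem IsSolution.eq_zero_of_dirichlet {l ρ : ℝ} (hl : 0 < l) (hρ : 0 < ρ)
    (hs : Real.sin (ρ * l) ≠ 0) {y dy : ℝ → ℂ}
    (h : IsSolution l (fun _ => 0) ((ρ ^ 2 : ℝ) : ℂ) y dy) (h0 : y 0 = 0) (h1 : y l = 0) :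
    ∀ x ∈ Icc 0 l, y x = 0 ∧ dy x = 0 := by
  have hρ' : (ρ : ℂ) ≠ 0 := by exact_mod_cast hρ.ne'
  have hq : MemLp (fun _ : ℝ => (0 : ℝ)) 2 (volume.restrict (Ioo 0 l)) := memLp_const 0
  have h2 := h.eqOn hl.le hq ((isSolution_sin l ρ (-(ρ * l))).smul (dy l / ρ))
    (by simp [h1]) (by simp [hρ'])
  have h3 := (h2 0 ⟨le_rfl, hl.le⟩).1
  rw [h0] at h3
  have h4 : dy l = 0 := by
    have hs' : (Real.sin (ρ * l) : ℂ) ≠ 0 := by exact_mod_cast hs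
    simp only [Pi.smul_apply, smul_eq_mul, mul_zero, zero_add, Real.sin_neg] at h3
    push_cast at h3 hs'
    have := (zero_eq_mul.mp h3).resolve_right (neg_ne_zero.mpr hs')
    simpa [hρ'] using this
  exact h.eq_zero hl.le hq h1 h4

set_option linter.unusedSectionVars false

variable {V : Type u} [Fintype V] [DecidableEq V]
variable {G : SimpleGraph V} [DecidableRel G.Adj] {r : V}

/-- A solution is given by its vertex values a, and the Kirchhoff condition at v becomes ∑ a w =
d(v) cos (ρ l) a v over all neighbours w (`hkir`), the direction of the edges dropping out. This is
the kernel equation of the pencil. -/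
theorem finrank_zero_potential (hG : G.IsTree) (hr : ∃ e : Edge G r, e.1.fst = r) {l ρ : ℝ}
    (hl : 0 < l) (hρ : 0 < ρ) (hs : Real.sin (ρ * l) ≠ 0) {S : Finset V} (hS : DescClosed G r S)
    {E : Submodule ℂ (Edge G r → ℝ → ℂ)}
    (hE : ∀ y, y ∈ E ↔ IsTreeSolution l (fun _ _ => 0) S ((ρ ^ 2 : ℝ) : ℂ) y) :
    Module.finrank ℂ E = Module.finrank ℂ
      (LinearMap.ker (Matrix.mulVecLin (evalPencil G (Real.cos (ρ * l) : ℂ) S))) := by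
  classical
  set K := LinearMap.ker (Matrix.mulVecLin (evalPencil G (Real.cos (ρ * l) : ℂ) S)) with hK
  set s : ℂ := ((Real.sin (ρ * l) : ℝ) : ℂ) with hsdef
  set co : ℂ := ((Real.cos (ρ * l) : ℝ) : ℂ) with hco
  have hs' : s ≠ 0 := Complex.ofReal_ne_zero.mpr hs
  have hρ' : (ρ : ℂ) ≠ 0 := by exact_mod_cast hρ.ne'
  have h0 : (0 : ℝ) ∈ Icc 0 l := ⟨le_rfl, hl.le⟩
  have hll : l ∈ Icc 0 l := ⟨hl.le, le_rfl⟩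
  -- Together with `Y` below, the basis of the solutions dual to the evaluations at 0 and l.
  obtain ⟨Z, dZ, hZ, hZ0, hZl, hdZ0, hdZl⟩ : ∃ Z dZ : ℝ → ℂ,
      IsSolution l (fun _ => 0) ((ρ ^ 2 : ℝ) : ℂ) Z dZ ∧ Z 0 = 1 ∧ Z l = 0 ∧
        dZ 0 = -(ρ * co / s) ∧ dZ l = -(ρ / s) := by
    refine ⟨_, _, (isSolution_sin l ρ (-(ρ * l))).smul (-s⁻¹), ?_, ?_, ?_, ?_⟩ <;>
      simp only [Pi.smul_apply, smul_eq_mul, mul_zero, zero_add, add_neg_cancel, Real.sin_neg,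
        Real.cos_neg, Real.sin_zero, Real.cos_zero, Complex.ofReal_neg, Complex.ofReal_mul,
        ← hsdef, ← hco] <;> field_simp <;> simp
  obtain ⟨Y, dY, hY, hY0, hYl, hdY0, hdYl⟩ : ∃ Y dY : ℝ → ℂ,
      IsSolution l (fun _ => 0) ((ρ ^ 2 : ℝ) : ℂ) Y dY ∧ Y 0 = 0 ∧ Y l = 1 ∧
        dY 0 = ρ / s ∧ dY l = ρ * co / s := by
    refine ⟨_, _, (isSolution_sin l ρ 0).smul (s⁻¹), ?_, ?_, ?_, ?_⟩ <;>
      simp only [Pi.smul_apply, smul_eq_mul, mul_zero, add_zero,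
        Real.sin_zero, Real.cos_zero, Complex.ofReal_mul, Complex.ofReal_zero,
        ← hsdef, ← hco] <;> field_simp <;> simp
  set cut : (ℝ → ℂ) → ℝ → ℂ := fun f x => if x ∈ Icc 0 l then f x else 0 with hcut
  have hcutin : ∀ f, ∀ x ∈ Icc 0 l, cut f x = f x := fun f x hx => if_pos hx
  set Ψ : (V → ℂ) → Edge G r → ℝ → ℂ := fun a e => cut (a e.1.fst • Z + a e.1.snd • Y) with hΨ
  set dΨ : (V → ℂ) → Edge G r → ℝ → ℂ := fun a e => a e.1.fst • dZ + a e.1.snd • dY with hdΨ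
  have hsol : ∀ a e, IsSolution l (fun _ => 0) ((ρ ^ 2 : ℝ) : ℂ) (Ψ a e) (dΨ a e) := fun a e =>
    ((hZ.smul _).add (hY.smul _)).congr (hcutin _)
  have hΨ0 : ∀ a e, Ψ a e 0 = a e.1.fst := fun a e => by
    simp only [hΨ, hcutin _ 0 h0]
    simp [hZ0, hY0]
  have hΨl : ∀ a e, Ψ a e l = a e.1.snd := fun a e => by
    simp only [hΨ, hcutin _ l hll]
    simp [hZl, hYl]
  have hdΨ0 : ∀ a e, dΨ a e 0 = ρ / s * (a e.1.snd - a e.1.fst * co) := fun a e => by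
    simp only [hdΨ, Pi.add_apply, Pi.smul_apply, smul_eq_mul, hdZ0, hdY0]
    ring
  have hdΨl : ∀ a e, dΨ a e l = ρ / s * (a e.1.snd * co - a e.1.fst) := fun a e => by
    simp only [hdΨ, Pi.add_apply, Pi.smul_apply, smul_eq_mul, hdZl, hdYl]
    ring
  have hkir : ∀ (a : V → ℂ) (v : V), Kirchhoff G r l (dΨ a) v ↔
      ∑ w ∈ G.neighborFinset v, a w = G.degree v * co * a v := by
    intro a v
    unfold Kirchhoff
    have e1 : ∑ e : Edge G r with e.1.snd = v, dΨ a e l = ρ / s *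
        (({e : Edge G r | e.1.snd = v} : Finset _).card * (a v * co) -
          ∑ e : Edge G r with e.1.snd = v, a e.1.fst) := by
      rw [← nsmul_eq_mul, ← Finset.sum_const, ← Finset.sum_sub_distrib, Finset.mul_sum]
      exact Finset.sum_congr rfl fun e he => by rw [hdΨl, (Finset.mem_filter.mp he).2]
    have e2 : ∑ e : Edge G r with e.1.fst = v, dΨ a e 0 = ρ / s *
        (∑ e : Edge G r with e.1.fst = v, a e.1.snd -
          ({e : Edge G r | e.1.fst = v} : Finset _).card * (a v * co)) := by
      rw [← nsmul_eq_mul, ← Finset.sum_const, ← Finset.sum_sub_distrib, Finset.mul_sum]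
      exact Finset.sum_congr rfl fun e he => by rw [hdΨ0, (Finset.mem_filter.mp he).2]
    have e3 : (G.degree v : ℂ) = ({e : Edge G r | e.1.fst = v} : Finset _).card +
        ({e : Edge G r | e.1.snd = v} : Finset _).card := by
      have := sum_neighbors hG (r := r) v fun _ => 1
      simp only [Finset.sum_const, smul_eq_mul, mul_one] at this
      rw [← SimpleGraph.card_neighborFinset_eq_degree, this]
      push_cast; ring
    rw [e1, e2, sum_neighbors hG (r := r), e3, mul_right_inj' (div_ne_zero hρ' hs')]
    constructor <;> intro h <;> linear_combination -h
  have hmem : ∀ u ∈ K, Ψ (extendZero u) ∈ E := by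
    intro u hu
    rw [hE]
    refine ⟨dΨ (extendZero u), extendZero u, fun e x hx => if_neg hx, hsol _,
      fun v hv => extendZero_of_notMem u hv, fun e he => ?_, fun e => ⟨hΨ0 _ e, hΨl _ e⟩,
      fun v hv => (hkir _ v).mpr (mem_ker_evalPencil.mp hu v hv)⟩
    simp only [hΨ]
    rw [extendZero_of_notMem u he, extendZero_of_notMem u fun h => he (hS e h)]
    funext x
    simp [hcut]
  let Φ : K →ₗ[ℂ] E :=
    { toFun := fun u => ⟨Ψ (extendZero u.1), hmem u u.2⟩
      map_add' := fun u u' => by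
        refine Subtype.ext (funext fun e => funext fun x => ?_)
        simp only [hΨ, hcut, Submodule.coe_add, extendZero_add, Pi.add_apply, Pi.smul_apply, smul_eq_mul]
        split_ifs <;> ring
      map_smul' := fun k u => by
        refine Subtype.ext (funext fun e => funext fun x => ?_)
        simp only [hΨ, hcut, Submodule.coe_smul, extendZero_smul, Pi.add_apply, Pi.smul_apply, smul_eq_mul,
          RingHom.id_apply]
        split_ifs <;> ring }
  have hinj : Function.Injective Φ := by
    rw [← LinearMap.ker_eq_bot, LinearMap.ker_eq_bot']
    rintro ⟨u, hu⟩ h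
    have h' : ∀ e, Ψ (extendZero u) e = 0 := fun e => congrFun (congrArg Subtype.val h) e
    refine Subtype.ext (funext fun v => ?_)
    change u v = 0
    rw [← extendZero_apply u v]
    by_cases hvr : v.1 = r
    · obtain ⟨e, he⟩ := hr
      rw [hvr, ← he, ← hΨ0 (extendZero u) e, h' e]; rfl
    · obtain ⟨e, he⟩ := exists_edge_to hG hvr
      rw [← he, ← hΨl (extendZero u) e, h' e]; rfl
  have hsurj : Function.Surjective Φ := by
    rintro ⟨y, hy⟩
    obtain ⟨dy, a, h1, h2, h3, h4, h5, h6⟩ := (hE y).mp hy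
    have hΨy : ∀ e, ∀ x ∈ Icc 0 l, y e x = Ψ a e x ∧ dy e x = dΨ a e x := fun e x hx => by
      have := ((h2 e).sub (hsol a e)).eq_zero_of_dirichlet hl hρ hs
        (by rw [Pi.sub_apply, hΨ0, (h5 e).1, sub_self])
        (by rw [Pi.sub_apply, hΨl, (h5 e).2, sub_self]) x hx
      simpa [sub_eq_zero] using this
    have hext : extendZero (fun v : {v // v ∈ S} => a v) = a := by
      funext v
      by_cases hv : v ∈ S
      · simp [extendZero, hv]
      · rw [extendZero_of_notMem _ hv, h3 v hv]
    have hu : (fun v : {v // v ∈ S} => a v) ∈ K := by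
      rw [hK, mem_ker_evalPencil]
      intro v hv
      rw [hext]
      refine (hkir a v).mp ?_
      have := h6 v hv
      unfold Kirchhoff at this ⊢
      rw [Finset.sum_congr rfl fun e _ => ((hΨy e l hll).2).symm, this]
      exact Finset.sum_congr rfl fun e _ => (hΨy e 0 h0).2
    refine ⟨⟨_, hu⟩, Subtype.ext (funext fun e => funext fun x => ?_)⟩
    change Ψ (extendZero _) e x = y e x
    rw [hext]
    by_cases hx : x ∈ Icc 0 l
    · exact (hΨy e x hx).1.symm
    · rw [h1 e x hx]; exact if_neg hx
  exact (LinearEquiv.ofBijective Φ ⟨hinj, hsurj⟩).finrank_eq.symm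

end ZeroPotential

/-! ### Multiplicities of the three spectra. -/

section Multiplicities

set_option linter.unusedSectionVars false

variable {V : Type u} [Fintype V] [DecidableEq V]
variable {G : SimpleGraph V} [DecidableRel G.Adj] {r : V}

theorem isDescendants_univ : IsDescendants (G := G) (r := r) Finset.univ none :=
  ⟨fun _ _ => Finset.mem_univ _, by simp, by simp⟩

theorem isDescendants_branch (hG : G.IsTree) {e : Edge G r} (he : e.1.fst = r) :
    IsDescendants (branch G r e.1.snd) (some e) := by
  have ha : G.Adj r e.1.snd := adj_of_fst_eq e he
  refine ⟨descClosed_branch _, ?_, fun f => ?_⟩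
  · simp [root_notMem_branch]
  · rw [Option.some_inj]
    constructor
    · rintro ⟨h1, h2⟩
      have h3 : f.1.fst = r := by
        by_contra h
        exact h2 (fst_mem_branch h1 h)
      exact (edge_snd_injective hG ((edge_fst_root_mem_branch hG ha h3).mp h1)).symm
    · rintro rfl
      exact ⟨mem_branch_self (edge_snd_ne_root e), by rw [he]; exact root_notMem_branch⟩

/-- Only the top terms differ in form. The quarter turn at the root turns the vanishing cosine into
a vanishing sine; otherwise exactly one edge enters S, namely the top edge. -/
theorem amplitudeCount_eq_eigenMult (hG : G.IsTree) {l lam : ℝ} {q : Edge G r → ℝ → ℝ}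
    {S : Finset V} {τ : Option (Edge G r)} (hS : IsDescendants S τ) :
    amplitudeCount (edgePhase hG l q lam) (phase hG (transfer l q lam)) S =
      eigenMult hG l q S τ lam := by
  classical
  unfold amplitudeCount eigenMult blocked
  congr 1
  cases τ with
  | none =>
    have h1 : r ∈ S := hS.2.1.mpr rfl
    have h2 : ({e : Edge G r | e.1.snd ∈ S ∧ e.1.fst ∉ S ∧
        Real.sin (edgePhase hG l q lam e) = 0} : Finset _) = ∅ := by
      refine Finset.filter_eq_empty_iff.mpr fun e _ h => ?_
      have := (hS.2.2 e).mp ⟨h.1, h.2.1⟩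
      simp at this
    rw [h2, Finset.card_empty, add_zero]
    simp only [h1, true_and, topPhase, Real.sin_add_pi_div_two]
  | some e =>
    have h1 : r ∉ S := fun h => by simpa using hS.2.1.mp h
    rw [if_neg fun h => h1 h.1, zero_add]
    have h2 : ({f : Edge G r | f.1.snd ∈ S ∧ f.1.fst ∉ S ∧
        Real.sin (edgePhase hG l q lam f) = 0} : Finset _) =
        if Real.sin (edgePhase hG l q lam e) = 0 then {e} else ∅ := by
      ext f
      have h3 := hS.2.2 f
      rw [Option.some_inj] at h3
      simp only [Finset.mem_filter, Finset.mem_univ, true_and, ← and_assoc, h3]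
      split_ifs with h
      · rw [Finset.mem_singleton]
        exact ⟨fun h4 => h4.1.symm, fun h4 => ⟨h4.symm, h4 ▸ h⟩⟩
      · simp only [Finset.notMem_empty, iff_false]
        rintro ⟨rfl, h4⟩
        exact h h4
    rw [h2]
    change _ = if Real.sin (edgePhase hG l q lam e) = 0 then 1 else 0
    split_ifs <;> simp

/-- With the root removed the branches do not interact, and each of them is entered by exactly one
edge from the root. -/
theorem amplitudeCount_erase_root (hG : G.IsTree) (ω : Edge G r → ℝ) (θ : V → ℝ) :
    amplitudeCount ω θ (Finset.univ.erase r) =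
      ∑ w ∈ G.neighborFinset r, amplitudeCount ω θ (branch G r w) := by
  classical
  unfold amplitudeCount
  rw [Finset.sum_add_distrib]
  congr 1
  · exact prod_branches (M := Multiplicative ℕ) hG fun v =>
      Multiplicative.ofAdd (({e : Edge G r | e.1.fst = v ∧ Real.sin (ω e) = 0} : Finset _).card - 1)
  · rw [if_neg (by simp), zero_add, Finset.card_eq_sum_card_fiberwise (f := fun e => e.1.snd)
      (t := G.neighborFinset r)]
    · refine Finset.sum_congr rfl fun w hw => ?_
      have hw : G.Adj r w := by simpa using hw
      rw [if_neg fun h => root_notMem_branch h.1, zero_add, Finset.filter_filter]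
      congr 1
      ext e
      simp only [Finset.mem_filter, Finset.mem_univ, true_and, Finset.mem_erase, and_true, not_not]
      constructor
      · rintro ⟨⟨-, h1, h2⟩, rfl⟩
        exact ⟨mem_branch_self hw.ne', by rw [h1]; exact root_notMem_branch, h2⟩
      · rintro ⟨h1, h2, h3⟩
        have h4 : e.1.fst = r := by
          by_contra h
          exact h2 (fst_mem_branch h1 h)
        exact ⟨⟨edge_snd_ne_root e, h4, h3⟩, (edge_fst_root_mem_branch hG hw h4).mp h1⟩
    · intro e he
      simp only [Finset.coe_filter, Finset.mem_univ, true_and, Finset.mem_erase, and_true, not_not,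
        mem_ofPred_eq] at he
      simpa using adj_of_fst_eq e he.2.1

/-- The spectrum is real, and `d` gives the multiplicities. -/
def HasMultiplicities {F : Type*} [AddCommGroup F] [Module ℂ F] (E : ℂ → Submodule ℂ F)
    (d : ℝ → ℕ) : Prop :=
  (∀ z, Module.Finite ℂ (E z)) ∧ (∀ z : ℂ, z.im ≠ 0 → Module.finrank ℂ (E z) = 0) ∧
    ∀ x : ℝ, Module.finrank ℂ (E x) = d x

theorem HasMultiplicities.listsSpectrum_iff {F : Type*} [AddCommGroup F] [Module ℂ F]
    {E : ℂ → Submodule ℂ F} {d : ℝ → ℕ} (h : HasMultiplicities E d) {ι : Type*} {S : Set ι}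
    {f : ι → ℝ} : ListsSpectrum E S f ↔ ∀ x, {i | i ∈ S ∧ f i = x}.encard = d x := by
  constructor
  · intro hL x
    have := (hL x).2
    rw [h.2.2] at this
    rw [← this]
    simp only [Complex.ofReal_inj]
  · intro hL z
    refine ⟨h.1 z, ?_⟩
    by_cases hz : z.im = 0
    · obtain ⟨x, rfl⟩ : ∃ x : ℝ, z = x := ⟨z.re, by simp [Complex.ext_iff, hz]⟩
      rw [h.2.2, ← hL x]
      simp only [Complex.ofReal_inj]
    · rw [h.2.1 z hz, Nat.cast_zero, encard_eq_zero, eq_empty_iff_forall_notMem]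
      rintro i ⟨-, rfl⟩
      exact hz (Complex.ofReal_im _)

theorem hasMultiplicities_of_treeSolution (hG : G.IsTree) (hr : ∃ e : Edge G r, e.1.fst = r) {l : ℝ}
    (hl : 0 < l) {q : Edge G r → ℝ → ℝ} (hq : ∀ e, MemLp (q e) 2 (volume.restrict (Ioo 0 l)))
    {S : Finset V} (hS : DescClosed G r S) {E : ℂ → Submodule ℂ (Edge G r → ℝ → ℂ)}
    (hE : ∀ z y, y ∈ E z ↔ IsTreeSolution l q S z y) :
    HasMultiplicities E fun lam =>
      amplitudeCount (edgePhase hG l q lam) (phase hG (transfer l q lam)) S := by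
  have h0 : ∀ z : ℂ, z.im ≠ 0 → E z = ⊥ := fun z hz => by
    rw [eq_bot_iff]
    exact fun y hy => ((hE z y).mp hy).eq_zero_of_im_ne_zero hl hz
  refine ⟨fun z => ?_, fun z hz => by rw [h0 z hz, finrank_bot], fun x =>
    (finrank_treeSolutions hG hr hl hq hS (hE x)).2⟩
  by_cases hz : z.im = 0
  · obtain ⟨x, rfl⟩ : ∃ x : ℝ, z = x := ⟨z.re, by simp [Complex.ext_iff, hz]⟩
    exact (finrank_treeSolutions hG hr hl hq hS (hE x)).1
  · rw [h0 z hz]; infer_instance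

variable {l : ℝ} {q : Edge G r → ℝ → ℝ}

theorem hasMultiplicities_neumann (hG : G.IsTree) (hr : ∃ e : Edge G r, e.1.fst = r)
    (hl : 0 < l) (hq : ∀ e, MemLp (q e) 2 (volume.restrict (Ioo 0 l))) :
    HasMultiplicities (neumannSpace G r l q) (eigenMult hG l q Finset.univ none) := by
  have := hasMultiplicities_of_treeSolution hG hr hl hq isDescendants_univ.1
    (E := neumannSpace G r l q) fun z y => mem_neumannSpace_iff hG
  simpa only [amplitudeCount_eq_eigenMult hG isDescendants_univ] using this

theorem hasMultiplicities_branch (hG : G.IsTree) {e : Edge G r} (he : e.1.fst = r)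
    (hl : 0 < l) (hq : ∀ e, MemLp (q e) 2 (volume.restrict (Ioo 0 l))) :
    HasMultiplicities (dirichletBranchSpace G r l q e.1.snd)
      (eigenMult hG l q (branch G r e.1.snd) (some e)) := by
  have := hasMultiplicities_of_treeSolution hG ⟨e, he⟩ hl hq (isDescendants_branch hG he).1
    (E := dirichletBranchSpace G r l q e.1.snd) fun z y => mem_dirichletBranchSpace_iff hG hl
  simpa only [amplitudeCount_eq_eigenMult hG (isDescendants_branch hG he)] using this

theorem hasMultiplicities_dirichlet (hG : G.IsTree) (hr : ∃ e : Edge G r, e.1.fst = r)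
    (hl : 0 < l) (hq : ∀ e, MemLp (q e) 2 (volume.restrict (Ioo 0 l)))
    {d : V → ℝ → ℕ}
    (hd : ∀ w ∈ G.neighborFinset r, HasMultiplicities (dirichletBranchSpace G r l q w) (d w)) :
    HasMultiplicities (dirichletSpace G r l q) fun x => ∑ w ∈ G.neighborFinset r, d w x := by
  have h1 := hasMultiplicities_of_treeSolution hG hr hl hq (S := Finset.univ.erase r)
    (fun e _ => Finset.mem_erase.mpr ⟨edge_snd_ne_root e, Finset.mem_univ _⟩)
    (E := dirichletSpace G r l q) fun z y => mem_dirichletSpace_iff hG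
  refine ⟨h1.1, h1.2.1, fun x => ?_⟩
  rw [h1.2.2]
  beta_reduce
  rw [amplitudeCount_erase_root hG]
  refine Finset.sum_congr rfl fun w hw => ?_
  rw [← (hd w hw).2.2 x]
  exact ((hasMultiplicities_of_treeSolution hG hr hl hq (descClosed_branch w)
    (E := dirichletBranchSpace G r l q w) fun z y => mem_dirichletBranchSpace_iff hG hl).2.2 x).symm

end Multiplicities

/-! ### Zero potential: multiplicities at all energies. -/

section ZeroPotentialMultiplicities

set_option linter.unusedSectionVars false

variable {V : Type u} [Fintype V] [DecidableEq V]
variable {G : SimpleGraph V} [DecidableRel G.Adj] {r : V}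

/-- A zero cosine is a zero slope; zero slopes add up to a zero slope, and no sine vanishes on the
way. -/
theorem cos_phase_eq_zero (hG : G.IsTree) {E : Edge G r → ℝ → ℝ}
    (hE : ∀ e t, Real.cos t = 0 → Real.cos (E e t) = 0) (v : V) : Real.cos (phase hG E v) = 0 := by
  refine tree_induction hG (r := r) (P := fun v => Real.cos (phase hG E v) = 0) (fun v ih => ?_) v
  have h : ∀ e ∈ ({e : Edge G r | e.1.fst = v} : Finset _),
      Real.cos (E e (phase hG E e.1.snd)) = 0 := fun e he =>
    hE e _ (ih e (Finset.mem_filter.mp he).2)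
  have h1 : ∀ e ∈ ({e : Edge G r | e.1.fst = v} : Finset _),
      Real.sin (E e (phase hG E e.1.snd)) ≠ 0 := fun e he h0 => by
    have := Real.sin_sq_add_cos_sq (E e (phase hG E e.1.snd))
    rw [h0, h e he] at this
    norm_num at this
  have h2 := slopeOf_angleSum h1
  rw [Finset.sum_eq_zero fun e he => by rw [slopeOf, h e he, zero_div, neg_zero]] at h2
  rw [← isVertexPhase_phase hG E v] at h2
  have h3 : Real.sin (phase hG E v) ≠ 0 := fun h0 => by
    rw [isVertexPhase_phase hG E v, sin_angleSum_eq_zero_iff] at h0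
    obtain ⟨e, he, he'⟩ := h0
    exact h1 e he he'
  rw [slopeOf, neg_eq_zero, div_eq_zero_iff] at h2
  exact h2.resolve_right h3

theorem sin_topPhase_of_cos (hG : G.IsTree) {E : Edge G r → ℝ → ℝ}
    (hE : ∀ e t, Real.cos t = 0 → Real.cos (E e t) = 0) (τ : Option (Edge G r)) :
    Real.sin (topPhase hG E τ) = 0 ↔ τ = none := by
  have h := cos_phase_eq_zero hG hE
  cases τ with
  | none => simp only [topPhase, Real.sin_add_pi_div_two, h r]
  | some e =>
    simp only [topPhase, reduceCtorEq, iff_false]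
    intro h0
    have := Real.sin_sq_add_cos_sq (E e (phase hG E e.1.snd))
    rw [h0, hE e _ (h _)] at this
    norm_num at this

theorem transfer_zero_zero {l : ℝ} (hl : 0 < l) (e : Edge G r) {t : ℝ} (ht : Real.cos t = 0) :
    transfer l (fun _ _ => 0) 0 e t = t := by
  have h : IsAngle l 1 (fun x => (0 : ℝ) - (fun _ => 0) x) fun _ => t :=
    { absCont := by
        have h : LipschitzOnWith 0 (fun _ : ℝ => t) (uIcc 0 l) :=
          (LipschitzWith.const t).lipschitzOnWith
        exact h.absolutelyContinuousOnInterval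
      equation := Eventually.of_forall fun x => by
        refine (hasDerivAt_const x t).congr_deriv ?_
        simp [ht] }
  exact edgeMap_eq hl one_pos ((memLp_const 0).sub (memLp_const 0)) h

/-- In the scale ρ an edge shifts the phase by ρ l, here a multiple of π, so zero cosines persist
from the leaves to the top. The scale degenerates at ρ = 0, where phases with zero cosine are
constant along the edges. -/
theorem sin_topPhase_zero_potential (hG : G.IsTree) {l ρ : ℝ} (hl : 0 < l) (hρ : 0 ≤ ρ)
    (hs : Real.sin (ρ * l) = 0) (τ : Option (Edge G r)) :
    Real.sin (topPhase hG (transfer l (fun _ _ => 0) (ρ ^ 2)) τ) = 0 ↔ τ = none := by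
  rcases hρ.eq_or_lt with rfl | hρ
  · refine sin_topPhase_of_cos hG (fun e t ht => ?_) τ
    rw [zero_pow two_ne_zero, transfer_zero_zero hl e ht, ht]
  · obtain ⟨κ', hκ', h⟩ := exists_sameSlope_topPhase hG hρ
      (E := transfer l (fun (_ : Edge G r) _ => 0) (ρ ^ 2))
      (E' := fun e t => edgeMap l ρ (fun x => (ρ ^ 2 - (fun _ => 0) x) / ρ) t)
      (fun e t t' ht => sameSlope_edgeMap hl (memLp_const 0) hρ ht) τ
    rw [← h.sin_eq_zero_iff]
    refine sin_topPhase_of_cos hG (fun e t ht => ?_) τ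
    have h1 := edgeMap_high hl (q := fun _ => 0) (memLp_const 0) hρ t
    simp only [abs_zero, intervalIntegral.integral_zero, zero_div] at h1
    have h2 := sub_eq_zero.mp (abs_eq_zero.mp (le_antisymm h1 (abs_nonneg _)))
    simp only [h2, Real.cos_add, ht, hs]
    ring

/-- These are the energies at which vertex values do not determine a solution and the pencil is of
no use. The phases show that no edge is blocked, so only the top condition can contribute. -/
theorem eigenMult_zero_of_sin_eq_zero (hG : G.IsTree) {l ρ : ℝ} (hl : 0 < l) (hρ : 0 ≤ ρ)
    (hs : Real.sin (ρ * l) = 0) (S : Finset V) (τ : Option (Edge G r)) :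
    eigenMult hG l (fun _ _ => 0) S τ (ρ ^ 2) = if τ = none then 1 else 0 := by
  classical
  have h := sin_topPhase_zero_potential (r := r) hG hl hρ hs
  unfold eigenMult
  rw [Finset.sum_eq_zero, zero_add]
  · simp only [h]
  · intro v _
    have : blocked (r := r) hG l (fun _ _ => 0) (ρ ^ 2) v = ∅ := by
      refine Finset.filter_eq_empty_iff.mpr fun e _ he => ?_
      have := (h (some e)).mp he.2
      simp at this
    rw [this, Finset.card_empty, Nat.zero_sub]

theorem eigenCount_zero_zero (hG : G.IsTree) {l : ℝ} (hl : 0 < l) (τ : Option (Edge G r)) :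
    eigenCount hG l (fun _ _ => 0) τ 0 = 0 := by
  refine le_antisymm ?_ (eigenCount_nonneg hG hl (fun _ => memLp_const 0) τ 0)
  have h2 := topPhase_le_pi hG (E := transfer l (fun (_ : Edge G r) _ => 0) 0) (fun e t ht => by
    have := transfer_le (q := fun (_ : Edge G r) _ => 0) hl (fun _ => memLp_const 0) (le_refl (0 : ℝ)) e t _ ht
    exact this.trans_eq (transfer_zero_zero hl e Real.cos_pi_div_two)) τ
  have h3 : phaseCount Real.pi = 0 := phaseCount_eq (by simp [Real.pi_pos]) (by simp)
  exact (phaseCount_mono h2).trans h3.le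

theorem eigenMult_zero_of_neg (hG : G.IsTree) (hr : ∃ e : Edge G r, e.1.fst = r) {l : ℝ}
    (hl : 0 < l) {S : Finset V} {τ : Option (Edge G r)} (hS : IsDescendants S τ) {μ : ℝ}
    (hμ : μ < 0) : eigenMult hG l (fun _ _ => 0) S τ μ = 0 := by
  obtain ⟨a, ha, hd⟩ := exists_eigenvalues hG hr hl (q := fun _ _ => 0) (fun _ => memLp_const 0) hS
  have h := hd μ
  have h0 : {n | a n = μ} = ∅ := by
    rw [eq_empty_iff_forall_notMem]
    intro n hn
    have h1 := (ha n 0).mp (by rw [eigenCount_zero_zero hG hl]; positivity)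
    rw [hn] at h1
    linarith
  rw [h0, encard_empty] at h
  exact_mod_cast h.symm

theorem eigenMult_zero_of_sin_ne_zero (hG : G.IsTree) (hr : ∃ e : Edge G r, e.1.fst = r)
    (hd : ∀ v, 0 < G.degree v) {l ρ : ℝ} (hl : 0 < l) (hρ : 0 < ρ) (hs : Real.sin (ρ * l) ≠ 0)
    {S : Finset V} {τ : Option (Edge G r)} (hS : IsDescendants S τ)
    {E : ℂ → Submodule ℂ (Edge G r → ℝ → ℂ)}
    (hE : ∀ z y, y ∈ E z ↔ IsTreeSolution l (fun _ _ => 0) S z y) :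
    eigenMult hG l (fun _ _ => 0) S τ (ρ ^ 2) = (psiOf G S).roots.count (Real.cos (ρ * l)) := by
  obtain ⟨R, hR, -, -, h⟩ := psiOf_roots (G := G) hd S
  rw [hR, ← h, ← finrank_zero_potential hG hr hl hρ hs hS.1 (hE _),
    (finrank_treeSolutions hG hr hl (fun _ => memLp_const 0) hS.1 (hE _)).2,
    amplitudeCount_eq_eigenMult hG hS]

end ZeroPotentialMultiplicities

/-! ### Comparison of the eigenvalues for q and for the zero potential. -/

section Transfer

set_option linter.unusedSectionVars false

variable {V : Type u} [Fintype V] [DecidableEq V]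
variable {G : SimpleGraph V} [DecidableRel G.Adj] {r : V}

theorem eventually_le_of_count {N : ℝ → ℤ} {a : ℕ → ℝ} (ha : ∀ (n : ℕ) x, N x ≤ n ↔ x ≤ a n)
    (B : ℝ) : ∀ᶠ n in atTop, B ≤ a n := by
  filter_upwards [eventually_ge_atTop (N B).toNat] with n hn
  refine (ha n B).mp ((Int.self_le_toNat _).trans ?_)
  exact_mod_cast hn

/-- The eigenvalues are close to the eigenvalues for the zero potential. -/
theorem sqrt_eigenvalues_close (hG : G.IsTree) {l : ℝ} (hl : 0 < l) {q : Edge G r → ℝ → ℝ}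
    (hq : ∀ e, MemLp (q e) 2 (volume.restrict (Ioo 0 l))) {τ : Option (Edge G r)} {a a₀ : ℕ → ℝ}
    (ha : ∀ (n : ℕ) x, eigenCount hG l q τ x ≤ n ↔ x ≤ a n)
    (ha₀ : ∀ (n : ℕ) x, eigenCount hG l (fun _ _ => 0) τ x ≤ n ↔ x ≤ a₀ n) :
    ∃ C, ∀ᶠ n in atTop, |Real.sqrt (a n) - Real.sqrt (a₀ n)| ≤ C / Real.sqrt (a₀ n) := by
  obtain ⟨C, hC0, hC⟩ := exists_integral_bound q l
  set c := C / l with hc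
  have hc0 : 0 ≤ c := div_nonneg hC0 hl.le
  refine ⟨c * (1 + c), ?_⟩
  filter_upwards [eventually_le_of_count ha 1, eventually_le_of_count ha₀ 1] with n h1 h1'
  set x := Real.sqrt (a n)
  set x₀ := Real.sqrt (a₀ n)
  have hx : 1 ≤ x := Real.one_le_sqrt.mpr h1
  have hx₀ : 1 ≤ x₀ := Real.one_le_sqrt.mpr h1'
  have hxx : x ^ 2 = a n := Real.sq_sqrt (by linarith)
  have hxx₀ : x₀ ^ 2 = a₀ n := Real.sq_sqrt (by linarith)
  -- At x² at most n eigenvalues are counted; the lower half of the sandwich carries this to the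
  -- zero potential at (x - c/x)².
  have b1 : x - c / x ≤ x₀ := by
    by_cases hσ : 0 < x - c / x
    · have h2 := (eigenCount_sandwich hG hl hq τ hC (by linarith : 0 < x)).1
      have h3 : (x - c / x) * l = x * l - C / x := by rw [hc]; field_simp
      rw [← h3, ← eigenCount_zero_potential hG hl τ hσ, hxx] at h2
      have h4 := (ha₀ n _).mp (h2.trans ((ha n _).mpr le_rfl))
      rw [← hxx₀] at h4
      exact le_of_sq_le_sq h4 (by linarith)
    · linarith
  -- Just above x² more than n eigenvalues are counted, and the upper half of the sandwich carries
  -- this over. The ε is needed because the count at x² itself is still at most n.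
  have b2 : x₀ ≤ x + c / x := by
    refine le_of_forall_pos_le_add fun ε hε => ?_
    have hρ : 0 < x + ε := by linarith
    have h2 := (eigenCount_sandwich hG hl hq τ hC hρ).2
    have h3 : (x + ε + c / (x + ε)) * l = (x + ε) * l + C / (x + ε) := by rw [hc]; field_simp
    have h4 : 0 < x + ε + c / (x + ε) := by positivity
    rw [← h3, ← eigenCount_zero_potential hG hl τ h4] at h2
    have h5 : ¬eigenCount hG l q τ ((x + ε) ^ 2) ≤ n := by
      rw [ha, not_le, ← hxx]
      nlinarith
    have h6 : ¬eigenCount hG l (fun _ _ => 0) τ ((x + ε + c / (x + ε)) ^ 2) ≤ n := fun h =>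
      h5 (h2.trans h)
    rw [ha₀, not_le, ← hxx₀] at h6
    have h7 := lt_of_pow_lt_pow_left₀ 2 h4.le h6
    have h8 : c / (x + ε) ≤ c / x := div_le_div_of_nonneg_left hc0 (by linarith) (by linarith)
    linarith
  have b3 : |x - x₀| ≤ c / x := abs_le.mpr ⟨by linarith, by linarith⟩
  refine b3.trans ?_
  rw [div_le_div_iff₀ (by linarith) (by linarith)]
  have b4 : c / x ≤ c := div_le_self hc0 hx
  have b5 : x₀ ≤ (1 + c) * x := by nlinarith
  nlinarith

theorem finite_fiber {δ γ : Type*} {U : Set δ} {h : δ → γ} {x : γ} {n : ℕ}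
    (hx : {i | i ∈ U ∧ h i = x}.encard = n) :
    Finite {i : U // h i = x} ∧ Nat.card {i : U // h i = x} = n := by
  have e : {i : U // h i = x} ≃ {i | i ∈ U ∧ h i = x} :=
    { toFun := fun i => ⟨i.1, i.1.2, i.2⟩
      invFun := fun i => ⟨⟨i.1, i.2.1⟩, i.2.2⟩
      left_inv := fun _ => rfl
      right_inv := fun _ => rfl }
  have hfin : {i | i ∈ U ∧ h i = x}.Finite := finite_of_encard_eq_coe hx
  have : Finite {i | i ∈ U ∧ h i = x} := hfin
  refine ⟨Finite.of_equiv _ e.symm, ?_⟩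
  rw [Nat.card_congr e, Nat.card_coe_set_eq, ncard_def, hx]
  rfl

/-- Functions whose fibres have the same finite cardinalities differ by a bijection. -/
theorem exists_equiv_of_fibers {α β γ : Type*} {S : Set α} {T : Set β} {f : α → γ} {g : β → γ}
    {d : γ → ℕ} (hf : ∀ x, {i | i ∈ S ∧ f i = x}.encard = d x)
    (hg : ∀ x, {i | i ∈ T ∧ g i = x}.encard = d x) : ∃ e : S ≃ T, ∀ i, g (e i) = f i := by
  have hex : ∀ x, Nonempty ({i : S // f i = x} ≃ {i : T // g i = x}) := fun x => by
    obtain ⟨h1, h2⟩ := finite_fiber (hf x)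
    obtain ⟨h3, h4⟩ := finite_fiber (hg x)
    exact ⟨(Finite.equivFinOfCardEq h2).trans (Finite.equivFinOfCardEq h4).symm⟩
  let E := (Equiv.sigmaFiberEquiv fun i : S => f i).symm.trans
    ((Equiv.sigmaCongrRight fun x => (hex x).some).trans (Equiv.sigmaFiberEquiv fun i : T => g i))
  refine ⟨E, fun i => ?_⟩
  exact ((hex (f i)).some ⟨i, rfl⟩).2

/-- A listing of the eigenvalues for the zero potential yields a listing for all potentials. -/
theorem exists_listing (hG : G.IsTree) (hr : ∃ e : Edge G r, e.1.fst = r) {l : ℝ} (hl : 0 < l)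
    {q : Edge G r → ℝ → ℝ} (hq : ∀ e, MemLp (q e) 2 (volume.restrict (Ioo 0 l)))
    {S : Finset V} {τ : Option (Edge G r)} (hS : IsDescendants S τ) {ι : Type*} {I : Set ι}
    {f₀ : ι → ℝ}
    (hf₀ : ∀ x, {i | i ∈ I ∧ f₀ i = x}.encard = eigenMult hG l (fun _ _ => 0) S τ x) :
    ∃ f : ι → ℝ, (∀ x, {i | i ∈ I ∧ f i = x}.encard = eigenMult hG l q S τ x) ∧
      ∃ C, {i | i ∈ I ∧ ¬|Real.sqrt (f i) - Real.sqrt (f₀ i)| ≤ C / Real.sqrt (f₀ i)}.Finite := by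
  classical
  obtain ⟨a, ha, hd⟩ := exists_eigenvalues hG hr hl hq hS
  obtain ⟨a₀, ha₀, hd₀⟩ := exists_eigenvalues hG hr hl (q := fun _ _ => 0) (fun _ => memLp_const 0) hS
  obtain ⟨E, hE⟩ := exists_equiv_of_fibers (S := I) (T := univ) (g := a₀) hf₀
    (fun x => by simpa using hd₀ x)
  obtain ⟨C, hC⟩ := sqrt_eigenvalues_close hG hl hq ha ha₀
  -- An index of the n-th eigenvalue for the zero potential receives the n-th eigenvalue for q.
  set f : ι → ℝ := fun i => if h : i ∈ I then a (E ⟨i, h⟩) else 0 with hf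
  have hfI : ∀ i (h : i ∈ I), f i = a (E ⟨i, h⟩) := fun i h => dif_pos h
  refine ⟨f, fun x => ?_, C, ?_⟩
  · rw [← hd x]
    have h1 : {i | i ∈ I ∧ f i = x} = (fun n => ((E.symm ⟨n, mem_univ n⟩ : I) : ι)) '' {n | a n = x} := by
      ext i
      constructor
      · rintro ⟨hi, hx⟩
        refine ⟨E ⟨i, hi⟩, ?_, ?_⟩
        · rw [mem_ofPred_eq, ← hfI i hi, hx]
        · simp
      · rintro ⟨n, hn, rfl⟩
        refine ⟨Subtype.coe_prop _, ?_⟩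
        rw [hfI _ (Subtype.coe_prop _)]
        simpa using hn
    rw [h1, Function.Injective.encard_image]
    intro n m hnm
    have := E.symm.injective (Subtype.ext hnm)
    exact congrArg Subtype.val this
  · obtain ⟨n₀, hn₀⟩ := eventually_atTop.mp hC
    refine ((finite_lt_nat n₀).image (fun n => ((E.symm ⟨n, mem_univ n⟩ : I) : ι))).subset ?_
    rintro i ⟨hi, hbad⟩
    refine ⟨E ⟨i, hi⟩, ?_, by simp⟩
    by_contra hn
    refine hbad ?_
    have := hn₀ (E ⟨i, hi⟩) (not_lt.mp hn)
    rwa [hE ⟨i, hi⟩, ← hfI i hi] at this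

end Transfer

/-! ### Counting the members of asymptotic progressions in windows. -/

section Modes

/-- The number of terms of the progression `c + h m`, `m ∈ ℤ`, at `s`. -/
def matchCount (h c s : ℝ) : ℕ :=
  open Classical in if ∃ m : ℤ, s = c + h * m then 1 else 0

theorem encard_prod {ι κ : Type*} (A : Finset ι) (P : ι → κ → Prop) :
    {x : ι × κ | x.1 ∈ A ∧ P x.1 x.2}.encard = ∑ i ∈ A, {k | P i k}.encard := by
  classical
  induction A using Finset.induction_on with
  | empty => simp
  | insert a A ha ih =>
    rw [Finset.sum_insert ha, ← ih]
    have h1 : {x : ι × κ | x.1 ∈ insert a A ∧ P x.1 x.2} =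
        Prod.mk a '' {k | P a k} ∪ {x : ι × κ | x.1 ∈ A ∧ P x.1 x.2} := by
      ext ⟨i, k⟩
      simp only [Finset.mem_insert, mem_ofPred_eq, mem_union, mem_image, Prod.mk.injEq]
      constructor
      · rintro ⟨rfl | h, h2⟩
        · exact Or.inl ⟨k, h2, rfl, rfl⟩
        · exact Or.inr ⟨h, h2⟩
      · rintro (⟨k', h2, rfl, rfl⟩ | ⟨h, h2⟩)
        · exact ⟨Or.inl rfl, h2⟩
        · exact ⟨Or.inr h, h2⟩
    rw [h1, encard_union_eq, Function.Injective.encard_image (Prod.mk_right_injective a)]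
    rw [Set.disjoint_left]
    rintro _ ⟨k, -, rfl⟩ h
    exact ha h.1

/-- By the bounds on c and s, a term c + h m equal to s has m ≥ 0, so it is caught by an index k = m
+ 1 ≥ 1. -/
theorem encard_progression {h c s : ℝ} (hc : 0 ≤ c) (hch : c < h) (hs : 0 ≤ s) :
    {k : ℕ | 1 ≤ k ∧ h * ((k : ℝ) - 1) + c = s}.encard = matchCount h c s := by
  have hh : 0 < h := hc.trans_lt hch
  unfold matchCount
  split_ifs with H
  · obtain ⟨m, hm⟩ := H
    have h1 : (-1 : ℝ) < m := by
      by_contra h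
      nlinarith [not_lt.mp h]
    have h2 : 0 ≤ m := by
      have : (-1 : ℤ) < m := by exact_mod_cast h1
      omega
    obtain ⟨n, rfl⟩ := Int.eq_ofNat_of_zero_le h2
    rw [Nat.cast_one, encard_eq_one]
    refine ⟨n + 1, ?_⟩
    ext k
    simp only [mem_ofPred_eq, mem_singleton_iff]
    constructor
    · rintro ⟨-, h3⟩
      have h4 : h * ((k : ℝ) - 1) = h * n := by
        push_cast at hm
        linarith
      have h5 := mul_left_cancel₀ hh.ne' h4
      have : (k : ℝ) = (n + 1 : ℕ) := by push_cast; linarith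
      exact_mod_cast this
    · rintro rfl
      refine ⟨by omega, ?_⟩
      push_cast at hm ⊢
      rw [hm]; ring
  · rw [Nat.cast_zero, encard_eq_zero, eq_empty_iff_forall_notMem]
    rintro k ⟨-, hk⟩
    exact H ⟨(k : ℤ) - 1, by push_cast; linarith⟩

theorem SqrtAsymp.tendsto {l : ℝ} (hl : 0 < l) {s a : ℕ → ℝ} (h : SqrtAsymp s fun k => a k / l) :
    Tendsto (fun k => Real.sqrt (s k) * l - a k) atTop (𝓝 0) := by
  have h1 := (h.trans_tendsto tendsto_one_div_atTop_nhds_zero_nat).mul_const l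
  rw [zero_mul] at h1
  refine h1.congr fun k => ?_
  rw [sub_mul, div_mul_cancel₀ _ hl.ne']

/-- As N h = 2π, the progression c + h m is invariant under translation by 2πK. For large K only
large indices reach the window, where the sequence is close to the progression, so a narrow window
sees just the term equal to its centre, if there is one. -/
theorem encard_window {h c l : ℝ} {N : ℕ} (hh : 0 < h) (hN : N * h = 2 * Real.pi)
    {s : ℕ → ℝ} (hs : Tendsto (fun k => Real.sqrt (s k) * l - (h * ((k : ℝ) - 1) + c)) atTop (𝓝 0))
    (φ : ℝ) : ∀ᶠ ε in 𝓝[>] (0 : ℝ), ∀ᶠ K : ℕ in atTop,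
      {k : ℕ | 1 ≤ k ∧ |Real.sqrt (s k) * l - (2 * Real.pi * K + φ)| < ε}.encard =
        matchCount h c φ := by
  have hN0 : 0 < N := Nat.pos_of_ne_zero fun h0 => by
    rw [h0, Nat.cast_zero, zero_mul] at hN
    linarith [Real.pi_pos]
  have hN1 : (1 : ℝ) ≤ N := by exact_mod_cast hN0
  have far : ∀ ε k₁, ∀ᶠ K : ℕ in atTop, ∀ k,
      |Real.sqrt (s k) * l - (2 * Real.pi * K + φ)| < ε → k₁ ≤ k := fun ε k₁ => by
    obtain ⟨B, hB⟩ := ((finite_lt_nat k₁).image fun k => Real.sqrt (s k) * l).bddAbove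
    have h1 : Tendsto (fun K : ℕ => 2 * Real.pi * (K : ℝ)) atTop atTop :=
      tendsto_natCast_atTop_atTop.const_mul_atTop (by positivity)
    filter_upwards [h1.eventually_ge_atTop (B + ε - φ)] with K hK k hk
    by_contra hlt
    have := hB ⟨k, not_le.mp hlt, rfl⟩
    have h2 := (abs_lt.mp hk).1
    simp only at this
    linarith
  have near : ∀ ε > 0, ∃ k₁, ∀ k ≥ k₁,
      |Real.sqrt (s k) * l - (h * ((k : ℝ) - 1) + c)| < ε := fun ε hε => by
    have := hs.eventually (Metric.ball_mem_nhds 0 hε)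
    obtain ⟨k₁, hk₁⟩ := eventually_atTop.mp this
    exact ⟨k₁, fun k hk => by simpa [Real.dist_eq] using hk₁ k hk⟩
  unfold matchCount
  split_ifs with H
  · obtain ⟨m, rfl⟩ := H
    -- An index in the window has its progression term within 2ε < h of the centre, hence is the
    -- index k₀ of the centre.
    filter_upwards [Ioo_mem_nhdsGT (show (0 : ℝ) < h / 4 by positivity)] with ε hε
    obtain ⟨k₁, hk₁⟩ := near ε hε.1
    filter_upwards [far ε k₁, eventually_ge_atTop (k₁ + m.natAbs)] with K hK hKm
    have hNK : K ≤ N * K := Nat.le_mul_of_pos_left K hN0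
    obtain ⟨k₀, hk₀⟩ : ∃ k₀ : ℕ, (k₀ : ℤ) = N * K + m + 1 := by
      refine ⟨((N : ℤ) * K + m + 1).toNat, Int.toNat_of_nonneg ?_⟩
      zify at hKm hNK
      have := neg_abs_le m
      omega
    have hk₀' : (k₀ : ℝ) = N * K + m + 1 := by exact_mod_cast hk₀
    have hk₀1 : k₁ ≤ k₀ ∧ 1 ≤ k₀ := by
      zify at hKm hNK ⊢
      have := neg_abs_le m
      constructor <;> omega
    have hφ : 2 * Real.pi * K + (c + h * m) = h * ((k₀ : ℝ) - 1) + c := by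
      rw [hk₀', ← hN]; ring
    rw [Nat.cast_one, encard_eq_one]
    refine ⟨k₀, ?_⟩
    ext k
    simp only [mem_ofPred_eq, mem_singleton_iff, hφ]
    constructor
    · rintro ⟨-, h1⟩
      have h2 := hk₁ k (hK k (by rw [hφ]; exact h1))
      by_contra hne
      have h3 : (1 : ℝ) ≤ |(k : ℝ) - k₀| := by
        have : (1 : ℤ) ≤ |(k : ℤ) - k₀| := Int.one_le_abs (by omega)
        exact_mod_cast this
      have h4 : |h * ((k : ℝ) - 1) + c - (h * ((k₀ : ℝ) - 1) + c)| = h * |(k : ℝ) - k₀| := by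
        rw [show h * ((k : ℝ) - 1) + c - (h * ((k₀ : ℝ) - 1) + c) = h * ((k : ℝ) - k₀) by ring,
          abs_mul, abs_of_pos hh]
      have h5 := abs_sub_le (h * ((k : ℝ) - 1) + c) (Real.sqrt (s k) * l) (h * ((k₀ : ℝ) - 1) + c)
      rw [h4, abs_sub_comm (h * ((k : ℝ) - 1) + c)] at h5
      have := hε.2
      nlinarith
    · rintro rfl
      exact ⟨hk₀1.2, hk₁ k hk₀1.1⟩
  -- The distance from φ to the progression is h |t - round t|, positive here; windows of less than
  -- half that radius are eventually empty.
  · set t := (φ - c) / h with ht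
    have hδ : 0 < h * |t - round t| := by
      refine mul_pos hh (abs_pos.mpr fun h0 => H ⟨round t, ?_⟩)
      have : φ - c = h * t := by rw [ht]; field_simp
      rw [sub_eq_zero] at h0
      rw [← h0]; linarith
    filter_upwards [Ioo_mem_nhdsGT (half_pos hδ)] with ε hε
    obtain ⟨k₁, hk₁⟩ := near ε hε.1
    filter_upwards [far ε k₁] with K hK
    rw [Nat.cast_zero, encard_eq_zero, eq_empty_iff_forall_notMem]
    rintro k ⟨-, hk⟩
    have h2 := hk₁ k (hK k hk)
    have h4 : 2 * Real.pi * K + φ - (h * ((k : ℝ) - 1) + c) =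
        h * (t - ((k - 1 - N * K : ℤ) : ℝ)) := by
      rw [ht, ← hN]; push_cast; field_simp; ring
    have h5 := abs_sub_le (2 * Real.pi * K + φ) (Real.sqrt (s k) * l) (h * ((k : ℝ) - 1) + c)
    rw [h4, abs_mul, abs_of_pos hh, abs_sub_comm (2 * Real.pi * K + φ)] at h5
    have h6 := round_le t (k - 1 - N * K : ℤ)
    have h7 := mul_le_mul_of_nonneg_left h6 hh.le
    linarith [hε.2]

/-- For the numbers `x` with multiplicities `d x`: near `2 π K + φ` there are, for large `K`,
exactly `n φ` of the numbers `√x l`. -/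
def HasModes (l : ℝ) (d : ℝ → ℕ) (n : ℝ → ℕ) : Prop :=
  ∀ φ, ∀ᶠ ε in 𝓝[>] (0 : ℝ), ∀ᶠ K : ℕ in atTop,
    {x : ℝ × ℕ | x.2 < d x.1 ∧ |Real.sqrt x.1 * l - (2 * Real.pi * K + φ)| < ε}.encard = n φ

theorem HasModes.unique {l : ℝ} {d n n' : ℝ → ℕ} (h : HasModes l d n) (h' : HasModes l d n') :
    n = n' := by
  ext φ
  obtain ⟨ε, h1, h2⟩ := ((h φ).and (h' φ)).exists
  obtain ⟨K, h3, h4⟩ := (h1.and h2).exists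
  exact_mod_cast h3.symm.trans h4

theorem encard_eq_of_fibers {α : Type*} {S : Set α} {f : α → ℝ} {d : ℝ → ℕ}
    (hf : ∀ x, {i | i ∈ S ∧ f i = x}.encard = d x) (P : ℝ → Prop) :
    {i | i ∈ S ∧ P (f i)}.encard = {x : ℝ × ℕ | x.2 < d x.1 ∧ P x.1}.encard := by
  obtain ⟨e, he⟩ := exists_equiv_of_fibers (T := {x : ℝ × ℕ | x.2 < d x.1}) (g := Prod.fst) hf
    fun x => by
      have : {i : ℝ × ℕ | i ∈ {x : ℝ × ℕ | x.2 < d x.1} ∧ i.1 = x} =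
          Prod.mk x '' (Finset.range (d x) : Set ℕ) := by
        ext ⟨y, k⟩
        simp only [mem_ofPred_eq, Finset.coe_range, mem_image, mem_Iio, Prod.mk.injEq]
        constructor
        · rintro ⟨h, rfl⟩; exact ⟨k, h, rfl, rfl⟩
        · rintro ⟨k', h, rfl, rfl⟩; exact ⟨h, rfl⟩
      rw [this, Function.Injective.encard_image (Prod.mk_right_injective x),
        encard_coe_eq_coe_finsetCard, Finset.card_range]
  refine Set.encard_congr
    { toFun := fun i => ⟨e ⟨i.1, i.2.1⟩, (e ⟨i.1, i.2.1⟩).2, by rw [he]; exact i.2.2⟩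
      invFun := fun x => ⟨e.symm ⟨x.1, x.2.1⟩, (e.symm ⟨x.1, x.2.1⟩).2, by
        rw [← he]; simpa using x.2.2⟩
      left_inv := fun i => by simp
      right_inv := fun x => by simp }

theorem hasModes_of_listing {ι : Type*} {A : Finset ι} {f : ι → ℕ → ℝ} {h c : ι → ℝ} {d : ℝ → ℕ}
    {l : ℝ} (hl : 0 < l)
    (hf : ∀ x, {i : ι × ℕ | (i.1 ∈ A ∧ 1 ≤ i.2) ∧ f i.1 i.2 = x}.encard = d x)
    (hh : ∀ i ∈ A, 0 < h i ∧ ∃ N : ℕ, N * h i = 2 * Real.pi)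
    (hc : ∀ i ∈ A, SqrtAsymp (f i) fun k => (h i * ((k : ℝ) - 1) + c i) / l) :
    HasModes l d fun φ => ∑ i ∈ A, matchCount (h i) (c i) φ := by
  intro φ
  have h1 : ∀ i ∈ A, _ := fun i hi =>
    encard_window (hh i hi).1 (hh i hi).2.choose_spec ((hc i hi).tendsto hl) φ
  filter_upwards [(Finset.eventually_all A).mpr h1] with ε hε
  filter_upwards [(Finset.eventually_all A).mpr hε] with K hK
  rw [← encard_eq_of_fibers (S := {i : ι × ℕ | i.1 ∈ A ∧ 1 ≤ i.2}) (f := fun i => f i.1 i.2) hf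
    fun x => |Real.sqrt x * l - (2 * Real.pi * K + φ)| < ε]
  simp only [mem_ofPred_eq, and_assoc]
  rw [encard_prod A fun i k => 1 ≤ k ∧ |Real.sqrt (f i k) * l - (2 * Real.pi * K + φ)| < ε]
  push_cast
  exact Finset.sum_congr rfl hK

/-- The number of modes at `φ` which belong to the constants in `M` (the two progressions
`± arccos` for each of them), and, `b`-fold, to the progression `π m`. -/
def modeCount (b : ℕ) (M : Multiset ℝ) (φ : ℝ) : ℕ :=
  if Real.sin φ = 0 then b + 2 * M.count (Real.cos φ) else M.count (Real.cos φ)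

/-- The mode count at φ = arccos x gives back the multiplicity of x, and the bounds make every
element a cosine. -/
theorem modeCount_injective {b : ℕ} {M M' : Multiset ℝ} (hM : ∀ x ∈ M, |x| ≤ 1)
    (hM' : ∀ x ∈ M', |x| ≤ 1) (h : modeCount b M = modeCount b M') : M = M' := by
  ext x
  by_cases hx : |x| ≤ 1
  · have h1 := congrFun h (Real.arccos x)
    unfold modeCount at h1
    rw [Real.cos_arccos (abs_le.mp hx).1 (abs_le.mp hx).2] at h1
    split_ifs at h1 <;> omega
  · rw [Multiset.count_eq_zero.mpr fun h => hx (hM x h),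
      Multiset.count_eq_zero.mpr fun h => hx (hM' x h)]

theorem matchCount_pi (φ : ℝ) :
    matchCount Real.pi 0 φ = if Real.sin φ = 0 then 1 else 0 := by
  have h : (∃ m : ℤ, φ = 0 + Real.pi * m) ↔ Real.sin φ = 0 := by
    rw [Real.sin_eq_zero_iff]
    exact exists_congr fun m => by rw [zero_add, mul_comm]; exact eq_comm
  unfold matchCount
  split_ifs <;> tauto

/-- cos φ = γ means that φ lies in one of the two progressions; it then lies in both of them exactly
when sin φ = 0. -/
theorem matchCount_arccos {γ : ℝ} (hγ : |γ| ≤ 1) (φ : ℝ) :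
    matchCount (2 * Real.pi) (Real.arccos γ) φ +
      matchCount (2 * Real.pi) (2 * Real.pi - Real.arccos γ) φ =
      if γ = Real.cos φ then if Real.sin φ = 0 then 2 else 1 else 0 := by
  have hc := Real.cos_arccos (abs_le.mp hγ).1 (abs_le.mp hγ).2
  set a := Real.arccos γ
  have h1 : γ = Real.cos φ ↔ (∃ m : ℤ, φ = a + 2 * Real.pi * m) ∨
      ∃ m : ℤ, φ = 2 * Real.pi - a + 2 * Real.pi * m := by
    rw [← hc, Real.cos_eq_cos_iff, exists_or]
    refine or_congr (exists_congr fun m => ?_) ?_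
    · constructor <;> intro h <;> linarith
    · constructor
      · rintro ⟨m, h⟩; exact ⟨m - 1, by push_cast; linarith⟩
      · rintro ⟨m, h⟩; exact ⟨m + 1, by push_cast; linarith⟩
  have h2 : ∀ m : ℤ, φ = a + 2 * Real.pi * m →
      (Real.sin φ = 0 ↔ ∃ m : ℤ, φ = 2 * Real.pi - a + 2 * Real.pi * m) := fun m hm => by
    constructor
    · intro h
      obtain ⟨n, hn⟩ := Real.sin_eq_zero_iff.mp h
      exact ⟨n - m - 1, by push_cast; linarith⟩
    · rintro ⟨n, hn⟩
      exact Real.sin_eq_zero_iff.mpr ⟨1 + m + n, by push_cast; linarith⟩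
  have h3 : ∀ m : ℤ, φ = 2 * Real.pi - a + 2 * Real.pi * m →
      (Real.sin φ = 0 ↔ ∃ m : ℤ, φ = a + 2 * Real.pi * m) := fun m hm => by
    constructor
    · intro h
      obtain ⟨n, hn⟩ := Real.sin_eq_zero_iff.mp h
      exact ⟨n - m - 1, by push_cast; linarith⟩
    · rintro ⟨n, hn⟩
      exact Real.sin_eq_zero_iff.mpr ⟨1 + m + n, by push_cast; linarith⟩
  unfold matchCount
  by_cases hp : ∃ m : ℤ, φ = a + 2 * Real.pi * m <;>
    by_cases hm : ∃ m : ℤ, φ = 2 * Real.pi - a + 2 * Real.pi * m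
  · rw [if_pos hp, if_pos hm, if_pos (h1.mpr (Or.inl hp)), if_pos ((h2 _ hp.choose_spec).mpr hm)]
  · rw [if_pos hp, if_neg hm, if_pos (h1.mpr (Or.inl hp)),
      if_neg fun h => hm ((h2 _ hp.choose_spec).mp h)]
  · rw [if_neg hp, if_pos hm, if_pos (h1.mpr (Or.inr hm)),
      if_neg fun h => hp ((h3 _ hm.choose_spec).mp h)]
  · rw [if_neg hp, if_neg hm, if_neg fun h => (h1.mp h).elim hp hm]

theorem sum_matchCount_arccos {ι : Type*} {A : Finset ι} {γ : ι → ℝ} (hγ : ∀ i ∈ A, |γ i| ≤ 1)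
    (φ : ℝ) : ∑ i ∈ A, (matchCount (2 * Real.pi) (Real.arccos (γ i)) φ +
      matchCount (2 * Real.pi) (2 * Real.pi - Real.arccos (γ i)) φ) =
      modeCount 0 (A.val.map γ) φ := by
  rw [Finset.sum_congr rfl fun i hi => matchCount_arccos (hγ i hi) φ]
  have h1 : (A.val.map γ).count (Real.cos φ) = ∑ i ∈ A, if γ i = Real.cos φ then 1 else 0 := by
    rw [Multiset.count_map, ← Finset.card_filter]
    simp only [eq_comm]
    rfl
  unfold modeCount
  rw [h1]
  split_ifs <;> simp only [zero_add, Finset.mul_sum, mul_ite, mul_one, mul_zero]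

theorem sum_Icc_two_mul {M : Type*} [AddCommMonoid M] (m : ℕ) (g : ℕ → M) :
    ∑ i ∈ Finset.Icc 1 (2 * m), g i = ∑ j ∈ Finset.Icc 1 m, (g j + g (j + m)) := by
  have h : ∀ n, Finset.Icc 1 n = Finset.Ico 1 (n + 1) := fun n => by
    ext; simp only [Finset.mem_Icc, Finset.mem_Ico]; omega
  rw [h, h, Finset.sum_add_distrib, Finset.sum_Ico_add' g 1 (m + 1) m, Nat.add_comm 1 m,
    show m + 1 + m = 2 * m + 1 by ring,
    Finset.sum_Ico_consecutive g (by omega) (by omega)]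

theorem sum_Icc_succ {M : Type*} [AddCommMonoid M] (n : ℕ) (g : ℕ → M) :
    ∑ i ∈ Finset.Icc 1 (n + 1), g i = g 1 + ∑ i ∈ Finset.Icc 1 n, g (i + 1) := by
  have h : ∀ n, Finset.Icc 1 n = Finset.Ico 1 (n + 1) := fun n => by
    ext; simp only [Finset.mem_Icc, Finset.mem_Ico]; omega
  rw [h, h, Finset.sum_eq_sum_Ico_succ_bot (by omega), Finset.sum_Ico_add' g 1 (n + 1) 1]

end Modes

/-! ### Listings with prescribed asymptotics for arbitrary potentials. -/

section ExistenceOfListings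

set_option linter.unusedSectionVars false

variable {V : Type u} [Fintype V] [DecidableEq V]
variable {G : SimpleGraph V} [DecidableRel G.Adj] {r : V}

/-- By `h0` the square roots of the eigenvalues for the zero potential fill the progressions
exactly. `exists_listing` moves them to q with an error O(1/a), and a grows linearly in k. -/
theorem exists_listing_of_modes (hG : G.IsTree) (hr : ∃ e : Edge G r, e.1.fst = r) {l : ℝ}
    (hl : 0 < l) {q : Edge G r → ℝ → ℝ} (hq : ∀ e, MemLp (q e) 2 (volume.restrict (Ioo 0 l)))
    {S : Finset V} {τ : Option (Edge G r)} (hS : IsDescendants S τ) {ι : Type*} {A : Finset ι}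
    {h c : ι → ℝ} (hc : ∀ i ∈ A, 0 ≤ c i ∧ c i < h i)
    (h0 : ∀ ρ : ℝ, 0 ≤ ρ → eigenMult hG l (fun _ _ => 0) S τ (ρ ^ 2) =
      ∑ i ∈ A, matchCount (h i) (c i) (ρ * l)) :
    ∃ f : ι → ℕ → ℝ,
      (∀ x, {i : ι × ℕ | (i.1 ∈ A ∧ 1 ≤ i.2) ∧ f i.1 i.2 = x}.encard = eigenMult hG l q S τ x) ∧
      ∀ i ∈ A, SqrtAsymp (f i) fun k => (h i * ((k : ℝ) - 1) + c i) / l := by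
  set a : ι → ℕ → ℝ := fun i k => (h i * ((k : ℝ) - 1) + c i) / l with ha
  have ha0 : ∀ i ∈ A, ∀ k, 1 ≤ k → 0 ≤ a i k := fun i hi k hk => by
    have h1 : (1 : ℝ) ≤ k := by exact_mod_cast hk
    have := hc i hi
    exact div_nonneg (add_nonneg (mul_nonneg (by linarith) (by linarith)) this.1) hl.le
  obtain ⟨f, hf, C, hC⟩ := exists_listing hG hr hl hq hS (I := {i : ι × ℕ | i.1 ∈ A ∧ 1 ≤ i.2})
    (f₀ := fun i => a i.1 i.2 ^ 2) fun x => by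
      rcases lt_or_ge x 0 with hx | hx
      · rw [eigenMult_zero_of_neg hG hr hl hS hx, Nat.cast_zero, encard_eq_zero,
          eq_empty_iff_forall_notMem]
        rintro i ⟨-, hi⟩
        rw [← hi] at hx
        exact absurd hx (not_lt.mpr (sq_nonneg _))
      · obtain ⟨ρ, hρ, rfl⟩ : ∃ ρ : ℝ, 0 ≤ ρ ∧ x = ρ ^ 2 :=
          ⟨_, Real.sqrt_nonneg x, (Real.sq_sqrt hx).symm⟩
        rw [h0 ρ hρ]
        simp only [mem_ofPred_eq, and_assoc]
        rw [encard_prod A fun i k => 1 ≤ k ∧ a i k ^ 2 = ρ ^ 2]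
        push_cast
        refine Finset.sum_congr rfl fun i hi => ?_
        rw [← encard_progression (hc i hi).1 (hc i hi).2 (mul_nonneg hρ hl.le)]
        congr 1
        ext k
        refine and_congr_right fun hk => ?_
        rw [sq_eq_sq₀ (ha0 i hi k hk) hρ, div_eq_iff hl.ne']
  refine ⟨fun i k => f (i, k), hf, fun i hi => ?_⟩
  have hfin : {k | 1 ≤ k ∧ ¬|Real.sqrt (f (i, k)) - a i k| ≤ C / a i k}.Finite := by
    refine (hC.preimage (Prod.mk_right_injective i).injOn).subset ?_
    rintro k ⟨hk, hbad⟩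
    refine ⟨⟨hi, hk⟩, ?_⟩
    rwa [Real.sqrt_sq (ha0 i hi k hk)]
  obtain ⟨B, hB⟩ := hfin.bddAbove
  have hh : 0 < h i := (hc i hi).1.trans_lt (hc i hi).2
  refine Asymptotics.IsBigO.of_bound (|C| * (2 * l) / h i) ?_
  filter_upwards [eventually_gt_atTop B, eventually_ge_atTop 2] with k hkB hk2
  have hk1 : (2 : ℝ) ≤ k := by exact_mod_cast hk2
  have h1 : |Real.sqrt (f (i, k)) - a i k| ≤ C / a i k := by
    by_contra h
    exact absurd (hB ⟨by omega, h⟩) (not_le.mpr hkB)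
  -- For k ≥ 2 one has k - 1 ≥ k/2, which turns 1/a into a multiple of 1/k.
  have h2 : h i * k / (2 * l) ≤ a i k := by
    rw [ha, div_le_div_iff₀ (by positivity) hl]
    have h3 : h i * k ≤ 2 * (h i * ((k : ℝ) - 1) + c i) := by nlinarith [(hc i hi).1]
    nlinarith
  have h3 : 0 < h i * k / (2 * l) := by positivity
  rw [Real.norm_eq_abs, Real.norm_eq_abs, abs_of_nonneg (by positivity : (0 : ℝ) ≤ 1 / k)]
  calc _ ≤ C / a i k := h1
    _ ≤ |C| / a i k := div_le_div_of_nonneg_right (le_abs_self C) (h3.le.trans h2)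
    _ ≤ |C| / (h i * k / (2 * l)) := div_le_div_of_nonneg_left (abs_nonneg C) h3 h2
    _ = _ := by field_simp

end ExistenceOfListings

/-! ### Pairs of progressions belonging to given constants. -/

section Shifts

/-- The shifts of the `2 m` progressions which belong to the constants `γ 1, …, γ m`. -/
def pairShift (m : ℕ) (γ : ℕ → ℝ) (i : ℕ) : ℝ :=
  if i ≤ m then Real.arccos (γ i) else 2 * Real.pi - Real.arccos (γ (i - m))

theorem sum_matchCount_pairShift {m : ℕ} {γ : ℕ → ℝ} (hγ : ∀ j ∈ Finset.Icc 1 m, |γ j| ≤ 1)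
    (φ : ℝ) : ∑ i ∈ Finset.Icc 1 (2 * m), matchCount (2 * Real.pi) (pairShift m γ i) φ =
      modeCount 0 ((Finset.Icc 1 m).val.map γ) φ := by
  rw [sum_Icc_two_mul, ← sum_matchCount_arccos hγ]
  refine Finset.sum_congr rfl fun j hj => ?_
  rw [Finset.mem_Icc] at hj
  rw [pairShift, if_pos hj.2, pairShift, if_neg (by omega), Nat.add_sub_cancel]

/-- γ < 1 keeps 2π - arccos γ strictly below the period, so that indexing from k = 1 loses no term
and adds none. -/
theorem pairShift_mem {m : ℕ} {γ : ℕ → ℝ} (hγ : ∀ j ∈ Finset.Icc 1 m, |γ j| < 1) {i : ℕ}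
    (hi : i ∈ Finset.Icc 1 (2 * m)) : 0 ≤ pairShift m γ i ∧ pairShift m γ i < 2 * Real.pi := by
  rw [Finset.mem_Icc] at hi
  unfold pairShift
  have hpi := Real.pi_pos
  split_ifs with h
  · exact ⟨Real.arccos_nonneg _, by linarith [Real.arccos_le_pi (γ i)]⟩
  · have h1 := hγ (i - m) (Finset.mem_Icc.mpr ⟨by omega, by omega⟩)
    exact ⟨by linarith [Real.arccos_le_pi (γ (i - m))],
      by linarith [Real.arccos_pos.mpr (abs_lt.mp h1).2]⟩

theorem sqrtAsymp_pairShift_iff {m : ℕ} {l : ℝ} {γ : ℕ → ℝ} {s : ℕ → ℕ → ℝ} :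
    (∀ i ∈ Finset.Icc 1 (2 * m),
      SqrtAsymp (s i) fun k => (2 * Real.pi * ((k : ℝ) - 1) + pairShift m γ i) / l) ↔
    ∀ j ∈ Finset.Icc 1 m,
      (SqrtAsymp (s j) fun k =>
        2 * Real.pi * ((k : ℝ) - 1) / l + 1 / l * Real.arccos (γ j)) ∧
      SqrtAsymp (s (j + m)) fun k =>
        2 * Real.pi * (k : ℝ) / l - 1 / l * Real.arccos (γ j) := by
  have h1 : ∀ j ≤ m, (fun k : ℕ => (2 * Real.pi * ((k : ℝ) - 1) + pairShift m γ j) / l) =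
      fun k : ℕ => 2 * Real.pi * ((k : ℝ) - 1) / l + 1 / l * Real.arccos (γ j) := fun j hj => by
    funext k
    rw [pairShift, if_pos hj]
    ring
  have h2 : ∀ j, 1 ≤ j →
      (fun k : ℕ => (2 * Real.pi * ((k : ℝ) - 1) + pairShift m γ (j + m)) / l) =
      fun k : ℕ => 2 * Real.pi * (k : ℝ) / l - 1 / l * Real.arccos (γ j) := fun j hj => by
    funext k
    rw [pairShift, if_neg (by omega), Nat.add_sub_cancel]
    ring
  constructor
  · intro h j hj
    rw [Finset.mem_Icc] at hj
    rw [← h1 j hj.2, ← h2 j hj.1]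
    exact ⟨h j (Finset.mem_Icc.mpr ⟨hj.1, by omega⟩),
      h (j + m) (Finset.mem_Icc.mpr ⟨by omega, by omega⟩)⟩
  · intro h i hi
    rw [Finset.mem_Icc] at hi
    by_cases him : i ≤ m
    · rw [h1 i him]
      exact (h i (Finset.mem_Icc.mpr ⟨hi.1, him⟩)).1
    · obtain ⟨j, rfl⟩ := Nat.exists_eq_add_of_le' (not_le.mp him).le
      rw [h2 j (by omega)]
      exact (h j (Finset.mem_Icc.mpr ⟨by omega, by omega⟩)).2

theorem exists_enumeration_of_card {M : Multiset ℝ} {m : ℕ} (hM : M.card = m) :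
    ∃ γ : ℕ → ℝ, (Finset.Icc 1 m).val.map γ = M ∧ MonotoneOn γ (Icc 1 m) := by
  have hlen : (M.sort (· ≤ ·)).length = m := by rw [Multiset.length_sort, hM]
  refine ⟨fun j => (M.sort (· ≤ ·)).getD (j - 1) 0, ?_, fun i hi j hj hij => ?_⟩
  · have h1 : (Finset.Icc 1 m).val = (Multiset.range m).map (· + 1) := by
      have : Finset.Icc 1 m = (Finset.range m).map ⟨(· + 1), add_left_injective 1⟩ := by
        ext i
        simp only [Finset.mem_Icc, Finset.mem_map, Finset.mem_range, Function.Embedding.coeFn_mk]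
        exact ⟨fun h => ⟨i - 1, by omega, by omega⟩, by rintro ⟨a, h, rfl⟩; omega⟩
      rw [this]
      rfl
    rw [h1, Multiset.map_map]
    conv_rhs => rw [← Multiset.sort_eq M (· ≤ ·)]
    rw [Multiset.range, Multiset.map_coe]
    congr 1
    refine List.ext_getElem (by simp [hM]) fun n h1 h2 => ?_
    simp only [List.getElem_map, List.getElem_range, Function.comp_apply, Nat.add_sub_cancel]
    exact List.getD_eq_getElem _ _ h2
  · have hs := Multiset.pairwise_sort M (· ≤ ·)
    simp only
    rw [List.getD_eq_getElem _ _ (by rw [hlen]; have := hi.1; have := hi.2; omega),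
      List.getD_eq_getElem _ _ (by rw [hlen]; have := hj.1; have := hj.2; omega)]
    exact hs.sortedLE.monotone_get (by simpa using Nat.sub_le_sub_right hij 1)

end Shifts

/-! ### The Neumann spectrum: uniqueness of the constants and existence. -/

section NeumannListings

set_option linter.unusedSectionVars false

theorem mem_neumannIndex_iff {m : ℕ} {x : ℕ × ℕ} :
    x ∈ neumannIndex (m + 2) ↔ x.1 ∈ Finset.Icc 1 (2 * m + 1) ∧ 1 ≤ x.2 := by
  rw [Finset.mem_Icc, and_assoc]
  change _ ∧ x.1 ≤ 2 * (m + 2) - 3 ∧ _ ↔ _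
  rw [show 2 * (m + 2) - 3 = 2 * m + 1 by omega]

theorem map_Icc_add_two {m : ℕ} (α : ℕ → ℝ) : (Finset.Icc 1 (m + 2)).val.map α =
    α 1 ::ₘ α (m + 2) ::ₘ (Finset.Icc 1 m).val.map fun j => α (j + 1) := by
  have h : ∀ (s : Finset ℕ) (g : ℕ → ℝ), s.val.map g = ∑ i ∈ s, ({g i} : Multiset ℝ) := fun s g => by
    change _ = (s.val.map ((fun x => ({x} : Multiset ℝ)) ∘ g)).sum
    rw [← Multiset.map_map,
      Multiset.sum_map_singleton]
  rw [h, h, sum_Icc_succ, Finset.sum_Icc_succ_top (by omega),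
    Multiset.singleton_add, add_comm, Multiset.singleton_add]

theorem NeumannAsymptotics.abs_le_one {p : ℕ} {l : ℝ} {α : ℕ → ℝ} {lam : ℕ → ℕ → ℝ} (hp : 2 ≤ p)
    (h : NeumannAsymptotics p l α lam) {i : ℕ} (hi : i ∈ Icc 1 p) : |α i| ≤ 1 := by
  have h1 := h.mono (left_mem_Icc.mpr (by omega)) hi hi.1
  have h2 := h.mono hi (right_mem_Icc.mpr (by omega)) hi.2
  rw [h.first] at h1
  rw [h.last] at h2
  exact abs_le.mpr ⟨h1, h2⟩

/-- The lengths of the steps and the shifts of the progressions for the Neumann problem. -/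
def neumannStep (i : ℕ) : ℝ := if i = 1 then Real.pi else 2 * Real.pi

/-- The shifts of the progressions for the Neumann problem. -/
def neumannShift (m : ℕ) (α : ℕ → ℝ) (i : ℕ) : ℝ :=
  if i = 1 then 0 else pairShift m (fun j => α (j + 1)) (i - 1)

theorem sqrtAsymp_neumann_iff {m : ℕ} {l : ℝ} {α : ℕ → ℝ} {s : ℕ → ℕ → ℝ} :
    (∀ i ∈ Finset.Icc 1 (2 * m + 1),
      SqrtAsymp (s i) fun k => (neumannStep i * ((k : ℝ) - 1) + neumannShift m α i) / l) ↔
    (SqrtAsymp (s 1) fun k => Real.pi * ((k : ℝ) - 1) / l) ∧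
    ∀ j ∈ Finset.Icc 1 m,
      (SqrtAsymp (s (j + 1)) fun k =>
        2 * Real.pi * ((k : ℝ) - 1) / l + 1 / l * Real.arccos (α (j + 1))) ∧
      SqrtAsymp (s (j + m + 1)) fun k =>
        2 * Real.pi * (k : ℝ) / l - 1 / l * Real.arccos (α (j + 1)) := by
  rw [← sqrtAsymp_pairShift_iff (s := fun i => s (i + 1)) (γ := fun j => α (j + 1))]
  have h1 : (fun k : ℕ => (neumannStep 1 * ((k : ℝ) - 1) + neumannShift m α 1) / l) =
      fun k : ℕ => Real.pi * ((k : ℝ) - 1) / l := by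
    funext k
    rw [neumannStep, neumannShift, if_pos rfl, if_pos rfl, add_zero]
  have h2 : ∀ i, 1 ≤ i →
      (fun k : ℕ => (neumannStep (i + 1) * ((k : ℝ) - 1) + neumannShift m α (i + 1)) / l) =
      fun k : ℕ => (2 * Real.pi * ((k : ℝ) - 1) + pairShift m (fun j => α (j + 1)) i) / l :=
    fun i hi => by
      funext k
      rw [neumannStep, neumannShift, if_neg (by omega), if_neg (by omega), Nat.add_sub_cancel]
  constructor
  · intro h
    refine ⟨h1 ▸ h 1 (Finset.mem_Icc.mpr ⟨le_rfl, by omega⟩), fun i hi => ?_⟩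
    rw [Finset.mem_Icc] at hi
    rw [← h2 i hi.1]
    exact h (i + 1) (Finset.mem_Icc.mpr ⟨by omega, by omega⟩)
  · rintro ⟨h3, h4⟩ i hi
    rw [Finset.mem_Icc] at hi
    rcases hi.1.eq_or_lt with rfl | hi1
    · rw [h1]; exact h3
    · obtain ⟨j, rfl⟩ := Nat.exists_eq_add_of_le' hi.1
      rw [h2 j (by omega)]
      exact h4 j (Finset.mem_Icc.mpr ⟨by omega, by omega⟩)

theorem sum_matchCount_neumann {m : ℕ} {α : ℕ → ℝ} (hα : ∀ j ∈ Finset.Icc 1 m, |α (j + 1)| ≤ 1)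
    (φ : ℝ) : ∑ i ∈ Finset.Icc 1 (2 * m + 1), matchCount (neumannStep i) (neumannShift m α i) φ =
      modeCount 1 ((Finset.Icc 1 m).val.map fun j => α (j + 1)) φ := by
  rw [sum_Icc_succ]
  have h2 : ∑ i ∈ Finset.Icc 1 (2 * m), matchCount (neumannStep (i + 1)) (neumannShift m α (i + 1)) φ
      = ∑ i ∈ Finset.Icc 1 (2 * m), matchCount (2 * Real.pi) (pairShift m (fun j => α (j + 1)) i) φ :=
    Finset.sum_congr rfl fun i hi => by
      have := (Finset.mem_Icc.mp hi).1
      rw [neumannStep, neumannShift, if_neg (by omega), if_neg (by omega), Nat.add_sub_cancel]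
  rw [h2, sum_matchCount_pairShift (γ := fun j => α (j + 1)) hα, neumannStep, neumannShift,
    if_pos rfl, if_pos rfl, matchCount_pi, modeCount, modeCount]
  split_ifs <;> omega

/-- The end constants ±1 have no pairs of their own: both are represented by the first sequence,
with step π, whence b = 1 and the shift to j + 1. -/
theorem hasModes_of_neumannAsymptotics {F : Type*} [AddCommGroup F] [Module ℂ F]
    {E : ℂ → Submodule ℂ F} {d : ℝ → ℕ} (hE : HasMultiplicities E d) {m : ℕ} {l : ℝ} (hl : 0 < l)
    {α : ℕ → ℝ} {lam : ℕ → ℕ → ℝ}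
    (hL : ListsSpectrum E (neumannIndex (m + 2)) fun x => lam x.1 x.2)
    (hA : NeumannAsymptotics (m + 2) l α lam) :
    HasModes l d (modeCount 1 ((Finset.Icc 1 m).val.map fun j => α (j + 1))) := by
  have hα : ∀ j ∈ Finset.Icc 1 m, |α (j + 1)| ≤ 1 := fun j hj => by
    rw [Finset.mem_Icc] at hj
    exact hA.abs_le_one (by omega) ⟨by omega, by omega⟩
  rw [hE.listsSpectrum_iff] at hL
  simp only [mem_neumannIndex_iff] at hL
  have h := hasModes_of_listing hl hL (h := neumannStep) (c := neumannShift m α) (fun i _ => ?_)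
    (sqrtAsymp_neumann_iff.mpr ⟨hA.base, fun j hj => ?_⟩)
  · simpa only [sum_matchCount_neumann hα] using h
  · unfold neumannStep
    split_ifs
    · exact ⟨Real.pi_pos, 2, by norm_num⟩
    · exact ⟨by positivity, 1, by norm_num⟩
  · rw [Finset.mem_Icc] at hj
    refine ⟨hA.plus (j + 1) (by omega) (by omega), ?_⟩
    have := hA.minus (j + 1) (by omega) (by omega)
    rwa [show j + 1 + (m + 2 - 2) = j + m + 1 by omega] at this

/-- The constants in the asymptotics of the Neumann spectrum are determined by the spectrum. -/
theorem neumann_constants_unique {F F' : Type*} [AddCommGroup F] [Module ℂ F] [AddCommGroup F']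
    [Module ℂ F'] {E : ℂ → Submodule ℂ F} {E' : ℂ → Submodule ℂ F'} {d : ℝ → ℕ}
    (hE : HasMultiplicities E d) (hE' : HasMultiplicities E' d) {p p' : ℕ} (hp : 2 ≤ p)
    (hp' : 2 ≤ p') {l : ℝ} (hl : 0 < l)
    {α α' : ℕ → ℝ} {lam lam' : ℕ → ℕ → ℝ}
    (hL : ListsSpectrum E (neumannIndex p) fun x => lam x.1 x.2)
    (hA : NeumannAsymptotics p l α lam)
    (hL' : ListsSpectrum E' (neumannIndex p') fun x => lam' x.1 x.2)
    (hA' : NeumannAsymptotics p' l α' lam') :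
    (Finset.Icc 1 p).val.map α = (Finset.Icc 1 p').val.map α' := by
  obtain ⟨m, rfl⟩ := Nat.exists_eq_add_of_le' hp
  obtain ⟨m', rfl⟩ := Nat.exists_eq_add_of_le' hp'
  rw [map_Icc_add_two, map_Icc_add_two, hA.first, hA'.first, hA.last, hA'.last,
    modeCount_injective (fun x hx => ?_) (fun x hx => ?_)
      ((hasModes_of_neumannAsymptotics hE hl hL hA).unique
        (hasModes_of_neumannAsymptotics hE' hl hL' hA'))]
  · obtain ⟨j, hj, rfl⟩ := Multiset.mem_map.mp hx
    have hj := Finset.mem_Icc.mp (Finset.mem_val.mp hj)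
    exact hA.abs_le_one (by omega) ⟨by omega, by omega⟩
  · obtain ⟨j, hj, rfl⟩ := Multiset.mem_map.mp hx
    have hj := Finset.mem_Icc.mp (Finset.mem_val.mp hj)
    exact hA'.abs_le_one (by omega) ⟨by omega, by omega⟩

variable {V : Type u} [Fintype V] [DecidableEq V]
variable {G : SimpleGraph V} [DecidableRel G.Adj] {r : V}

/-- All roots lie in [-1, 1] and both ends are simple, so removing them leaves only roots in the
open interval. -/
theorem roots_psi_eq (hG : G.IsTree) (hd : ∀ v, 0 < G.degree v) {m : ℕ}
    (hm : Fintype.card V = m + 2) : ∃ M : Multiset ℝ, M.card = m ∧ (∀ x ∈ M, |x| < 1) ∧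
      (psi G).roots = -1 ::ₘ 1 ::ₘ M := by
  obtain ⟨R, hR, hc, -, -⟩ := psiOf_roots (G := G) hd Finset.univ
  have h1 := count_roots_psi hG hd (z := 1) (Or.inl rfl)
  have h2 := count_roots_psi hG hd (z := -1) (Or.inr rfl)
  rw [psi_eq_psiOf]
  have hle := fun x (hx : x ∈ (psiOf G Finset.univ).roots) => abs_le_one_of_mem_roots hG hd hx
  rw [hR] at h1 h2 hle ⊢
  have h3 : (-1 : ℝ) ∈ R := Multiset.count_pos.mp (by omega)
  have h5 : (1 : ℝ) ∈ R.erase (-1) :=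
    (Multiset.mem_erase_of_ne (by norm_num)).mpr (Multiset.count_pos.mp (by omega))
  have h4 : R = -1 ::ₘ 1 ::ₘ (R.erase (-1)).erase 1 := by
    rw [Multiset.cons_erase h5, Multiset.cons_erase h3]
  refine ⟨(R.erase (-1)).erase 1, ?_, fun x hx => ?_, h4⟩
  · rw [Multiset.card_erase_of_mem h5, Multiset.card_erase_of_mem h3, hc, Finset.card_univ, hm]
    rfl
  · refine lt_of_le_of_ne (hle x (Multiset.mem_of_mem_erase (Multiset.mem_of_mem_erase hx)))
      fun h => ?_
    have hx0 := Multiset.count_pos.mpr hx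
    rcases eq_or_eq_neg_of_abs_eq h with rfl | rfl
    · rw [Multiset.count_erase_self, Multiset.count_erase_of_ne (by norm_num)] at hx0
      omega
    · rw [Multiset.count_erase_of_ne (by norm_num), Multiset.count_erase_self] at hx0
      omega

theorem exists_neumann_listing (hG : G.IsTree) (hr : ∃ e : Edge G r, e.1.fst = r)
    (hd : ∀ v, 0 < G.degree v) (hV : 2 ≤ Fintype.card V) {l : ℝ} (hl : 0 < l)
    {q : Edge G r → ℝ → ℝ} (hq : ∀ e, MemLp (q e) 2 (volume.restrict (Ioo 0 l))) :
    ∃ (α : ℕ → ℝ) (lam : ℕ → ℕ → ℝ),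
      ListsSpectrum (neumannSpace G r l q) (neumannIndex (Fintype.card V))
        (fun x => lam x.1 x.2) ∧
      NeumannAsymptotics (Fintype.card V) l α lam ∧
      (psi G).roots = (Finset.Icc 1 (Fintype.card V)).val.map α := by
  obtain ⟨m, hm⟩ := Nat.exists_eq_add_of_le' hV
  obtain ⟨M, hMc, hM, hR⟩ := roots_psi_eq hG hd hm
  obtain ⟨γ, hγ, hmono⟩ := exists_enumeration_of_card hMc
  have hγ1 : ∀ j ∈ Finset.Icc 1 m, |γ j| < 1 := fun j hj =>
    hM _ (hγ ▸ Multiset.mem_map_of_mem γ hj)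
  set α : ℕ → ℝ := fun i => if i = 1 then -1 else if i ≤ m + 1 then γ (i - 1) else 1 with hα
  have hαγ : ∀ j ∈ Finset.Icc 1 m, α (j + 1) = γ j := fun j hj => by
    rw [Finset.mem_Icc] at hj
    simp only [hα]
    rw [if_neg (by omega), if_pos (by omega), Nat.add_sub_cancel]
  have hα1 : α 1 = -1 := if_pos rfl
  have hα2 : α (m + 2) = 1 := by
    simp only [hα]
    rw [if_neg (by omega), if_neg (by omega)]
  have hα3 : ∀ j ∈ Finset.Icc 1 m, |α (j + 1)| < 1 := fun j hj => by rw [hαγ j hj]; exact hγ1 j hj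
  have hMα : ((Finset.Icc 1 m).val.map fun j => α (j + 1)) = M := by
    rw [← hγ]
    exact Multiset.map_congr rfl fun j hj => hαγ j hj
  -- If sin (ρ l) = 0, the cosine is ±1 and not in `M`, and the single mode is that of the step π.
  -- Otherwise the multiplicity is the order of the root cos (ρ l) of ψ, which is not ±1 and so is
  -- counted in `M`.
  have hmult : ∀ ρ : ℝ, 0 ≤ ρ → eigenMult hG l (fun (_ : Edge G r) _ => 0) Finset.univ none (ρ ^ 2) =
      ∑ i ∈ Finset.Icc 1 (2 * m + 1), matchCount (neumannStep i) (neumannShift m α i) (ρ * l) := by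
    intro ρ hρ
    rw [sum_matchCount_neumann fun j hj => (hα3 j hj).le, hMα, modeCount]
    split_ifs with hs
    · rw [eigenMult_zero_of_sin_eq_zero hG hl hρ hs, if_pos rfl,
        Multiset.count_eq_zero.mpr fun h => ?_]
      have h1 := hM _ h
      have h2 := Real.sin_sq_add_cos_sq (ρ * l)
      have h3 := abs_lt.mp h1
      rw [hs] at h2
      nlinarith
    · have hρ0 : 0 < ρ := hρ.lt_of_ne fun h => hs (by rw [← h, zero_mul, Real.sin_zero])
      rw [eigenMult_zero_of_sin_ne_zero hG hr hd hl hρ0 hs isDescendants_univ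
        (E := neumannSpace G r l fun _ _ => 0) (fun z y => mem_neumannSpace_iff hG),
        ← psi_eq_psiOf, hR, Multiset.count_cons_of_ne, Multiset.count_cons_of_ne]
      · intro h
        refine hs (pow_eq_zero_iff two_ne_zero |>.mp ?_)
        rw [Real.sin_sq, h]; norm_num
      · intro h
        refine hs (pow_eq_zero_iff two_ne_zero |>.mp ?_)
        rw [Real.sin_sq, h]; norm_num
  have hshift : ∀ i ∈ Finset.Icc 1 (2 * m + 1),
      0 ≤ neumannShift m α i ∧ neumannShift m α i < neumannStep i := fun i hi => by
    rw [Finset.mem_Icc] at hi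
    unfold neumannStep neumannShift
    split_ifs with h
    · exact ⟨le_rfl, Real.pi_pos⟩
    · exact pairShift_mem hα3 (Finset.mem_Icc.mpr ⟨by omega, by omega⟩)
  obtain ⟨lam, hlam, hasymp⟩ := exists_listing_of_modes hG hr hl hq isDescendants_univ
    hshift hmult
  rw [sqrtAsymp_neumann_iff] at hasymp
  refine ⟨α, lam, ?_, ⟨hα1, ?_, ?_, hasymp.1, fun i h2 hi => ?_, fun i h2 hi => ?_⟩, ?_⟩
  · rw [(hasMultiplicities_neumann hG hr hl hq).listsSpectrum_iff, hm]
    simp only [mem_neumannIndex_iff]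
    exact hlam
  · rw [hm]; exact hα2
  · rw [hm]
    intro i hi j hj hij
    rcases hi.1.eq_or_lt with rfl | hi1
    · rw [hα1]
      rcases hj.1.eq_or_lt with rfl | hj1
      · rw [hα1]
      rcases hj.2.eq_or_lt with rfl | hj2
      · rw [hα2]; norm_num
      obtain ⟨j, rfl⟩ := Nat.exists_eq_add_of_le' hj.1
      exact (abs_lt.mp (hα3 j (Finset.mem_Icc.mpr ⟨by omega, by omega⟩))).1.le
    rcases hj.2.eq_or_lt with rfl | hj2
    · rw [hα2]
      rcases hi.2.eq_or_lt with rfl | hi2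
      · rw [hα2]
      obtain ⟨i, rfl⟩ := Nat.exists_eq_add_of_le' hi.1
      exact (abs_lt.mp (hα3 i (Finset.mem_Icc.mpr ⟨by omega, by omega⟩))).2.le
    obtain ⟨i, rfl⟩ := Nat.exists_eq_add_of_le' hi.1
    obtain ⟨j, rfl⟩ := Nat.exists_eq_add_of_le' hj.1
    rw [hαγ i (Finset.mem_Icc.mpr ⟨by omega, by omega⟩),
      hαγ j (Finset.mem_Icc.mpr ⟨by omega, by omega⟩)]
    exact hmono ⟨by omega, by omega⟩ ⟨by omega, by omega⟩ (by omega)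
  · obtain ⟨j, rfl⟩ := Nat.exists_eq_add_of_le' (show 1 ≤ i by omega)
    exact (hasymp.2 j (Finset.mem_Icc.mpr ⟨by omega, by omega⟩)).1
  · obtain ⟨j, rfl⟩ := Nat.exists_eq_add_of_le' (show 1 ≤ i by omega)
    rw [show j + 1 + (Fintype.card V - 2) = j + m + 1 by omega]
    exact (hasymp.2 j (Finset.mem_Icc.mpr ⟨by omega, by omega⟩)).2
  · rw [hm, map_Icc_add_two, hα1, hα2, hMα, hR]

end NeumannListings

/-! ### The Dirichlet spectra of the branches and of the whole tree. -/

section DirichletListings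

set_option linter.unusedSectionVars false

theorem mem_branchIndex_iff {m : ℕ} {x : ℕ × ℕ} :
    x ∈ branchIndex m ↔ x.1 ∈ Finset.Icc 1 (2 * m) ∧ 1 ≤ x.2 := by
  rw [Finset.mem_Icc, and_assoc]
  rfl

theorem DirichletAsymptotics.sqrtAsymp {m : ℕ} {l : ℝ} {β : ℕ → ℝ} {nu : ℕ → ℕ → ℝ}
    (h : DirichletAsymptotics m l β nu) : ∀ i ∈ Finset.Icc 1 (2 * m),
      SqrtAsymp (nu i) fun k => (2 * Real.pi * ((k : ℝ) - 1) + pairShift m β i) / l := by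
  rw [sqrtAsymp_pairShift_iff]
  intro j hj
  rw [Finset.mem_Icc] at hj
  exact ⟨h.plus j hj.1 hj.2, h.minus j hj.1 hj.2⟩

theorem DirichletAsymptotics.abs_le_one {m : ℕ} {l : ℝ} {β : ℕ → ℝ} {nu : ℕ → ℕ → ℝ}
    (h : DirichletAsymptotics m l β nu) : ∀ j ∈ Finset.Icc 1 m, |β j| ≤ 1 := fun j hj => by
  rw [Finset.mem_Icc] at hj
  exact abs_le.mpr (h.range j hj.1 hj.2)

theorem modeCount_sum {ι : Type*} (A : Finset ι) (M : ι → Multiset ℝ) (φ : ℝ) :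
    modeCount 0 (∑ i ∈ A, M i) φ = ∑ i ∈ A, modeCount 0 (M i) φ := by
  unfold modeCount
  rw [Multiset.count_sum']
  split_ifs <;> simp only [zero_add, Finset.mul_sum]

/-- All branches together form one family of progressions, so a splitting of the union need not list
each branch separately. -/
theorem hasModes_of_dirichletAsymptotics {ι : Type*} {A : Finset ι} {m : ι → ℕ} {l : ℝ}
    (hl : 0 < l) {β : ι → ℕ → ℝ} {nu : ι → ℕ → ℕ → ℝ} {d : ℝ → ℕ}
    (hL : ∀ x, {y : ι × ℕ × ℕ | (y.1 ∈ A ∧ y.2 ∈ branchIndex (m y.1)) ∧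
      nu y.1 y.2.1 y.2.2 = x}.encard = d x)
    (hA : ∀ w ∈ A, DirichletAsymptotics (m w) l (β w) (nu w)) :
    HasModes l d (modeCount 0 (∑ w ∈ A, (Finset.Icc 1 (m w)).val.map (β w))) := by
  have h := hasModes_of_listing (ι := Σ _ : ι, ℕ) (A := A.sigma fun w => Finset.Icc 1 (2 * m w))
    (f := fun i => nu i.1 i.2) (h := fun _ => 2 * Real.pi)
    (c := fun i => pairShift (m i.1) (β i.1) i.2) (d := d) hl (fun x => ?_)
    (fun _ _ => ⟨by positivity, 1, by norm_num⟩)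
    (fun i hi => (hA i.1 (Finset.mem_sigma.mp hi).1).sqrtAsymp i.2 (Finset.mem_sigma.mp hi).2)
  · convert h using 1
    funext φ
    rw [modeCount_sum, Finset.sum_sigma]
    exact Finset.sum_congr rfl fun w hw => (sum_matchCount_pairShift (hA w hw).abs_le_one φ).symm
  · rw [← hL x]
    refine Set.encard_congr
      { toFun := fun i => ⟨(i.1.1.1, i.1.1.2, i.1.2), ?_⟩
        invFun := fun y => ⟨(⟨y.1.1, y.1.2.1⟩, y.1.2.2), ?_⟩
        left_inv := fun i => rfl
        right_inv := fun y => rfl }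
    · obtain ⟨⟨h1, h2⟩, h3⟩ := i.2
      rw [Finset.mem_sigma] at h1
      exact ⟨⟨h1.1, mem_branchIndex_iff.mpr ⟨h1.2, h2⟩⟩, h3⟩
    · obtain ⟨⟨h1, h2⟩, h3⟩ := y.2
      rw [mem_branchIndex_iff] at h2
      exact ⟨⟨Finset.mem_sigma.mpr ⟨h1, h2.1⟩, h2.2⟩, h3⟩

/-- The constants in the asymptotics of the Dirichlet spectrum are determined by the spectrum. -/
theorem dirichlet_constants_unique {ι κ : Type*} {A : Finset ι} {B : Finset κ} {m : ι → ℕ}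
    {n : κ → ℕ} {l : ℝ}
    (hl : 0 < l) {β : ι → ℕ → ℝ} {nu : ι → ℕ → ℕ → ℝ} {β' : κ → ℕ → ℝ} {nu' : κ → ℕ → ℕ → ℝ}
    {d : ℝ → ℕ}
    (hL : ∀ x, {y : ι × ℕ × ℕ | (y.1 ∈ A ∧ y.2 ∈ branchIndex (m y.1)) ∧
      nu y.1 y.2.1 y.2.2 = x}.encard = d x)
    (hA : ∀ w ∈ A, DirichletAsymptotics (m w) l (β w) (nu w))
    (hL' : ∀ x, {y : κ × ℕ × ℕ | (y.1 ∈ B ∧ y.2 ∈ branchIndex (n y.1)) ∧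
      nu' y.1 y.2.1 y.2.2 = x}.encard = d x)
    (hB : ∀ w ∈ B, DirichletAsymptotics (n w) l (β' w) (nu' w)) :
    ∑ w ∈ A, (Finset.Icc 1 (m w)).val.map (β w) =
      ∑ w ∈ B, (Finset.Icc 1 (n w)).val.map (β' w) := by
  refine modeCount_injective (fun x hx => ?_) (fun x hx => ?_)
    ((hasModes_of_dirichletAsymptotics hl hL hA).unique
      (hasModes_of_dirichletAsymptotics hl hL' hB))
  · obtain ⟨w, hw, hx⟩ := Multiset.mem_sum.mp hx
    obtain ⟨j, hj, rfl⟩ := Multiset.mem_map.mp hx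
    exact (hA w hw).abs_le_one j (Finset.mem_val.mp hj)
  · obtain ⟨w, hw, hx⟩ := Multiset.mem_sum.mp hx
    obtain ⟨j, hj, rfl⟩ := Multiset.mem_map.mp hx
    exact (hB w hw).abs_le_one j (Finset.mem_val.mp hj)

theorem dirichlet_branch_constants_unique {m : ℕ} {l : ℝ} (hl : 0 < l) {β β' : ℕ → ℝ}
    {nu nu' : ℕ → ℕ → ℝ} {d : ℝ → ℕ}
    (hL : ∀ x, {y | y ∈ branchIndex m ∧ nu y.1 y.2 = x}.encard = d x)
    (hA : DirichletAsymptotics m l β nu)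
    (hL' : ∀ x, {y | y ∈ branchIndex m ∧ nu' y.1 y.2 = x}.encard = d x)
    (hA' : DirichletAsymptotics m l β' nu') :
    (Finset.Icc 1 m).val.map β = (Finset.Icc 1 m).val.map β' := by
  have key : ∀ {nu : ℕ → ℕ → ℝ}, (∀ x, {y | y ∈ branchIndex m ∧ nu y.1 y.2 = x}.encard = d x) →
      ∀ x, {y : Unit × ℕ × ℕ | (y.1 ∈ (Finset.univ : Finset Unit) ∧ y.2 ∈ branchIndex m) ∧
        nu y.2.1 y.2.2 = x}.encard = d x := fun {nu} h x => by
    simp only [and_assoc]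
    rw [encard_prod Finset.univ fun _ y => y ∈ branchIndex m ∧ nu y.1 y.2 = x, ← h x]
    simp
  have h := dirichlet_constants_unique (A := Finset.univ) (B := Finset.univ) (m := fun _ => m)
    (n := fun _ => m) (β := fun _ => β) (β' := fun _ => β') (nu := fun _ => nu)
    (nu' := fun _ => nu') (d := d) hl
    (key hL) (fun _ _ => hA) (key hL') (fun _ _ => hA')
  simpa using h

variable {V : Type u} [Fintype V] [DecidableEq V]
variable {G : SimpleGraph V} [DecidableRel G.Adj] {r : V}

/-- Unlike in the Neumann case, the zero potential has no eigenvalue with sin (ρ l) = 0, and all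
roots lie in (-1, 1), so the pairs exhaust the spectrum. -/
theorem exists_branch_listing (hG : G.IsTree) {e : Edge G r} (he : e.1.fst = r)
    (hd : ∀ v, 0 < G.degree v) {l : ℝ} (hl : 0 < l)
    {q : Edge G r → ℝ → ℝ} (hq : ∀ e, MemLp (q e) 2 (volume.restrict (Ioo 0 l))) :
    ∃ (β : ℕ → ℝ) (nu : ℕ → ℕ → ℝ),
      ListsSpectrum (dirichletBranchSpace G r l q e.1.snd) (branchIndex (branch G r e.1.snd).card)
        (fun x => nu x.1 x.2) ∧
      DirichletAsymptotics (branch G r e.1.snd).card l β nu ∧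
      (psiHatBranch G r e.1.snd).roots = (Finset.Icc 1 (branch G r e.1.snd).card).val.map β := by
  have hS := isDescendants_branch hG he
  obtain ⟨R, hR, hc, -, -⟩ := psiOf_roots (G := G) hd (branch G r e.1.snd)
  have hlt : ∀ x ∈ R, |x| < 1 := fun x hx =>
    abs_lt_one_of_mem_roots hG hd hS.1 root_notMem_branch (hR ▸ hx)
  obtain ⟨β, hβ, -⟩ := exists_enumeration_of_card hc
  have hβ1 : ∀ j ∈ Finset.Icc 1 (branch G r e.1.snd).card, |β j| < 1 := fun j hj =>
    hlt _ (hβ ▸ Multiset.mem_map_of_mem β hj)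
  have hmult : ∀ ρ : ℝ, 0 ≤ ρ →
      eigenMult hG l (fun (_ : Edge G r) _ => 0) (branch G r e.1.snd) (some e) (ρ ^ 2) =
      ∑ i ∈ Finset.Icc 1 (2 * (branch G r e.1.snd).card),
        matchCount (2 * Real.pi) (pairShift (branch G r e.1.snd).card β i) (ρ * l) := by
    intro ρ hρ
    rw [sum_matchCount_pairShift fun j hj => (hβ1 j hj).le, hβ, modeCount]
    split_ifs with hs
    · rw [eigenMult_zero_of_sin_eq_zero hG hl hρ hs, if_neg (by simp),
        Multiset.count_eq_zero.mpr fun h => ?_]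
      have h2 := Real.sin_sq_add_cos_sq (ρ * l)
      have h3 := abs_lt.mp (hlt _ h)
      rw [hs] at h2
      nlinarith
    · have hρ0 : 0 < ρ := hρ.lt_of_ne fun h => hs (by rw [← h, zero_mul, Real.sin_zero])
      rw [eigenMult_zero_of_sin_ne_zero hG ⟨e, he⟩ hd hl hρ0 hs hS
        (E := dirichletBranchSpace G r l (fun _ _ => 0) e.1.snd)
        (fun z y => mem_dirichletBranchSpace_iff hG hl), hR]
  obtain ⟨nu, hnu, hasymp⟩ := exists_listing_of_modes hG ⟨e, he⟩ hl hq hS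
    (fun i hi => pairShift_mem hβ1 hi) hmult
  rw [sqrtAsymp_pairShift_iff] at hasymp
  refine ⟨β, nu, ?_, ⟨fun j h1 h2 => ?_, fun j h1 h2 => ?_, fun j h1 h2 => ?_⟩, ?_⟩
  · rw [(hasMultiplicities_branch hG he hl hq).listsSpectrum_iff]
    simp only [mem_branchIndex_iff]
    exact hnu
  · exact abs_le.mp (hβ1 j (Finset.mem_Icc.mpr ⟨h1, h2⟩)).le
  · exact (hasymp j (Finset.mem_Icc.mpr ⟨h1, h2⟩)).1
  · exact (hasymp j (Finset.mem_Icc.mpr ⟨h1, h2⟩)).2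
  · rw [psiHatBranch_eq_psiOf, hR, hβ]

theorem exists_edge_of_mem_neighborFinset {w : V} (hw : w ∈ G.neighborFinset r) :
    ∃ e : Edge G r, e.1.fst = r ∧ e.1.snd = w := by
  have h : G.Adj r w := by simpa using hw
  exact isChild_iff.mp ⟨h, by rw [SimpleGraph.dist_self, SimpleGraph.dist_eq_one_iff_adj.mpr h]⟩

theorem exists_dirichlet_listing (hG : G.IsTree) (hd : ∀ v, 0 < G.degree v) {l : ℝ} (hl : 0 < l)
    {q : Edge G r → ℝ → ℝ} (hq : ∀ e, MemLp (q e) 2 (volume.restrict (Ioo 0 l))) :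
    ∃ (d : V → ℝ → ℕ) (β : V → ℕ → ℝ) (nu : V → ℕ → ℕ → ℝ), ∀ w ∈ G.neighborFinset r,
      HasMultiplicities (dirichletBranchSpace G r l q w) (d w) ∧
      ListsSpectrum (dirichletBranchSpace G r l q w) (branchIndex (branch G r w).card)
        (fun x => nu w x.1 x.2) ∧
      DirichletAsymptotics (branch G r w).card l (β w) (nu w) ∧
      (psiHatBranch G r w).roots = (Finset.Icc 1 (branch G r w).card).val.map (β w) := by
  have h : ∀ w, ∃ (d : ℝ → ℕ) (β : ℕ → ℝ) (nu : ℕ → ℕ → ℝ), w ∈ G.neighborFinset r →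
      HasMultiplicities (dirichletBranchSpace G r l q w) d ∧
      ListsSpectrum (dirichletBranchSpace G r l q w) (branchIndex (branch G r w).card)
        (fun x => nu x.1 x.2) ∧
      DirichletAsymptotics (branch G r w).card l β nu ∧
      (psiHatBranch G r w).roots = (Finset.Icc 1 (branch G r w).card).val.map β := fun w => by
    by_cases hw : w ∈ G.neighborFinset r
    · obtain ⟨e, he, rfl⟩ := exists_edge_of_mem_neighborFinset hw
      obtain ⟨β, nu, h⟩ := exists_branch_listing hG he hd hl hq
      exact ⟨_, β, nu, fun _ => ⟨hasMultiplicities_branch hG he hl hq, h⟩⟩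
    · exact ⟨0, 0, 0, fun h => absurd h hw⟩
  choose d β nu h using h
  exact ⟨d, β, nu, h⟩

theorem encard_dirichletIndex {d : V → ℝ → ℕ} {nu : V → ℕ → ℕ → ℝ}
    (h : ∀ w ∈ G.neighborFinset r, ∀ x,
      {y | y ∈ branchIndex (branch G r w).card ∧ nu w y.1 y.2 = x}.encard = d w x) (x : ℝ) :
    {y | y ∈ dirichletIndex G r ∧ nu y.1 y.2.1 y.2.2 = x}.encard =
      (∑ w ∈ G.neighborFinset r, d w x : ℕ) := by
  simp only [dirichletIndex, mem_ofPred_eq, and_assoc]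
  rw [encard_prod (G.neighborFinset r)
    fun w y => y ∈ branchIndex (branch G r w).card ∧ nu w y.1 y.2 = x]
  push_cast
  exact Finset.sum_congr rfl fun w hw => h w hw x

end DirichletListings

/-! ### The ratio in terms of the roots and of the elimination. -/

section Ratio

set_option linter.unusedSectionVars false

variable {V : Type u} [Fintype V] [DecidableEq V]
variable {G : SimpleGraph V} [DecidableRel G.Adj] {r : V}

theorem algebraMap_psiOf (hG : G.IsTree) (hd : ∀ v, 0 < G.degree v) {S : Finset V}
    (hS : DescClosed G r S) {Q : V → RatFunc ℝ} (hQ : IsContinuant (G := G) r RatFunc.X Q) :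
    algebraMap ℝ[X] (RatFunc ℝ) (psiOf G S) = ∏ v ∈ S, -Q v := by
  rw [map_psiOf, RatFunc.algebraMap_X,
    det_evalPencil hG hS hQ fun v _ _ => hQ.ratFunc_ne_zero hG hd v]

theorem descClosed_erase_root : DescClosed G r (Finset.univ.erase r) := fun e _ =>
  Finset.mem_erase.mpr ⟨edge_snd_ne_root e, Finset.mem_univ _⟩

/-- In the field of rational functions both sides are the product of -Q v over the vertices other
than the root. -/
theorem psiHat_eq_prod (hG : G.IsTree) (hd : ∀ v, 0 < G.degree v) :
    psiHat G r = ∏ w ∈ G.neighborFinset r, psiHatBranch G r w := by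
  obtain ⟨Q, hQ⟩ := exists_isContinuant (r := r) hG (RatFunc.X : RatFunc ℝ)
  refine RatFunc.algebraMap_injective ℝ ?_
  rw [psiHat_eq_psiOf, algebraMap_psiOf hG hd descClosed_erase_root hQ, prod_branches hG, map_prod]
  refine Finset.prod_congr rfl fun w _ => ?_
  rw [psiHatBranch_eq_psiOf, algebraMap_psiOf hG hd (descClosed_branch w) hQ]

theorem psiHat_ne_zero (hG : G.IsTree) (hd : ∀ v, 0 < G.degree v) : psiHat G r ≠ 0 := by
  obtain ⟨Q, hQ⟩ := exists_isContinuant (r := r) hG (RatFunc.X : RatFunc ℝ)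
  intro h
  have h1 := algebraMap_psiOf hG hd descClosed_erase_root hQ
  rw [← psiHat_eq_psiOf, h, map_zero] at h1
  obtain ⟨v, -, hv⟩ := Finset.prod_eq_zero_iff.mp h1.symm
  exact hQ.ratFunc_ne_zero hG hd v (neg_eq_zero.mp hv)

theorem roots_psiHat (hG : G.IsTree) (hd : ∀ v, 0 < G.degree v) :
    (psiHat G r).roots = ∑ w ∈ G.neighborFinset r, (psiHatBranch G r w).roots := by
  have h := psiHat_eq_prod (r := r) hG hd
  rw [h, roots_prod _ _ (h ▸ psiHat_ne_zero hG hd)]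
  rfl

/-- The products of -Q v for ψ and ψ̂ differ only by the factor of the root. -/
theorem ratio_eq_neg (hG : G.IsTree) (hd : ∀ v, 0 < G.degree v) {Q : V → RatFunc ℝ}
    (hQ : IsContinuant (G := G) r RatFunc.X Q) : ratio G r = -Q r := by
  rw [ratio, psi_eq_psiOf, psiHat_eq_psiOf, algebraMap_psiOf hG hd descClosed_erase_root hQ,
    algebraMap_psiOf hG hd (r := r) (fun _ _ => Finset.mem_univ _) hQ,
    ← Finset.mul_prod_erase _ _ (Finset.mem_univ r), mul_div_cancel_right₀]
  exact Finset.prod_ne_zero_iff.mpr fun v _ => neg_ne_zero.mpr (hQ.ratFunc_ne_zero hG hd v)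

/-- The sign of the leading coefficient is absorbed into the factors -z + a, one for each vertex of
S. -/
theorem algebraMap_psiOf_eq_roots (hd : ∀ v, 0 < G.degree v) (S : Finset V) :
    algebraMap ℝ[X] (RatFunc ℝ) (psiOf G S) = (∏ v ∈ S, (G.degree v : RatFunc ℝ)) *
      ((psiOf G S).roots.map fun a => -RatFunc.X + RatFunc.C a).prod := by
  obtain ⟨R, hR, hc, h, -⟩ := psiOf_roots (G := G) hd S
  have h1 : (R.map fun a => -RatFunc.X + RatFunc.C a).prod =
      (-1) ^ R.card * (R.map fun a : ℝ => (RatFunc.X - RatFunc.C a : RatFunc ℝ)).prod := by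
    rw [← Multiset.card_map (fun a : ℝ => (RatFunc.X - RatFunc.C a : RatFunc ℝ)) R,
      ← Multiset.prod_map_neg, Multiset.map_map]
    congr 1
    refine Multiset.map_congr rfl fun a _ => ?_
    simp only [Function.comp_apply]
    ring
  rw [hR, h1, hc, h, map_mul, RatFunc.algebraMap_C, map_multiset_prod, Multiset.map_map]
  have h2 : (algebraMap ℝ[X] (RatFunc ℝ)) ∘ (fun x => X - C x) =
      fun a : ℝ => (RatFunc.X - RatFunc.C a : RatFunc ℝ) := by
    funext a
    simp
  rw [h2, map_mul, map_pow, map_neg, map_one, map_prod]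
  simp only [map_natCast]
  ring

theorem ratio_eq_roots (hd : ∀ v, 0 < G.degree v) : ratio G r = (G.degree r : RatFunc ℝ) *
    (((psi G).roots.map fun a => -RatFunc.X + RatFunc.C a).prod /
      ((psiHat G r).roots.map fun a => -RatFunc.X + RatFunc.C a).prod) := by
  rw [ratio, psi_eq_psiOf, psiHat_eq_psiOf, algebraMap_psiOf_eq_roots hd,
    algebraMap_psiOf_eq_roots hd, ← Finset.mul_prod_erase _ _ (Finset.mem_univ r), mul_assoc,
    mul_div_assoc, mul_div_mul_left]
  exact Finset.prod_ne_zero_iff.mpr fun v _ => Nat.cast_ne_zero.mpr (hd v).ne'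

end Ratio

/-! ### The branched continued fraction determines the rooted tree. -/

section ContinuedFraction

set_option linter.unusedSectionVars false

variable {V : Type u} [Fintype V] [DecidableEq V]
variable {G : SimpleGraph V} [DecidableRel G.Adj] {r : V}

theorem exists_hasShape (hG : G.IsTree) (v : V) : ∃ t, HasShape G r v t := by
  classical
  refine tree_induction hG (r := r) (P := fun v => ∃ t, HasShape G r v t) (fun v ih => ?_) v
  have h : ∀ x : {x : V // IsChild G r v x}, ∃ t, HasShape G r x t := fun x => by
    obtain ⟨e, he, hx⟩ := isChild_iff.mp x.2
    rw [← hx]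
    exact ih e he
  choose t ht using h
  exact ⟨_, .node v _ (Fintype.equivFin {x : V // IsChild G r v x}).symm (fun i => t _)
    fun i => ht _⟩

theorem sum_children {M : Type*} [AddCommMonoid M] (hG : G.IsTree) (v : V) {n : ℕ}
    (c : Fin n ≃ {x : V // IsChild G r v x}) (f : V → M) :
    ∑ i, f (c i) = ∑ e : Edge G r with e.1.fst = v, f e.1.snd := by
  symm
  refine Finset.sum_bij
    (fun e he => c.symm ⟨e.1.snd, isChild_iff.mpr ⟨e, (Finset.mem_filter.mp he).2, rfl⟩⟩)
    (fun _ _ => Finset.mem_univ _) (fun e he e' he' h => ?_) (fun i _ => ?_) (fun e he => ?_)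
  · exact edge_snd_injective hG (congrArg Subtype.val (c.symm.injective h))
  · obtain ⟨e, he, hx⟩ := isChild_iff.mp (c i).2
    refine ⟨e, Finset.mem_filter.mpr ⟨Finset.mem_univ _, he⟩, ?_⟩
    rw [Equiv.symm_apply_eq]
    exact Subtype.ext hx
  · rw [Equiv.apply_symm_apply]

theorem HasShape.value_eq (hG : G.IsTree) (hd : ∀ v, 0 < G.degree v) {Q : V → RatFunc ℝ}
    (hQ : IsContinuant (G := G) r RatFunc.X Q) {v : V} {t : BranchedFraction}
    (h : HasShape G r v t) : t.value = Q v ∧ t.Proper := by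
  induction h with
  | node v n c t _ ih =>
    refine ⟨?_, fun i => ⟨?_, (ih i).2⟩⟩
    · rw [BranchedFraction.value, hQ v, ← sum_children hG v c fun u => 1 / Q u]
      simp only [(ih _).1]
    · rw [(ih i).1]
      exact hQ.ratFunc_ne_zero hG hd _

theorem HasShape.exists_children {v : V} {t : BranchedFraction} (h : HasShape G r v t) :
    ∃ (n : ℕ) (c : Fin n ≃ {x : V // IsChild G r v x}) (s : Fin n → BranchedFraction),
      t = .node (G.degree v) n s ∧ ∀ i, HasShape G r (c i) (s i) := by
  cases h with
  | node _ n c s h => exact ⟨n, c, s, rfl, h⟩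

variable {W : Type w} [Fintype W] [DecidableEq W]
variable {H : SimpleGraph W} [DecidableRel H.Adj] {s : W}

/-- The constructor is injective, so both enumerations of children have the same length, and
children with the same number have the same subfraction. -/
theorem HasShape.exists_equiv_children {v : V} {x : W} {t : BranchedFraction}
    (h : HasShape G r v t) (h' : HasShape H s x t) :
    ∃ σ : {u : V // IsChild G r v u} ≃ {y : W // IsChild H s x y},
      ∀ u : {u : V // IsChild G r v u}, ∃ t, HasShape G r u t ∧ HasShape H s (σ u) t := by
  obtain ⟨n, c, a, rfl, ha⟩ := h.exists_children
  obtain ⟨n', c', a', heq, ha'⟩ := h'.exists_children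
  rw [BranchedFraction.node.injEq] at heq
  obtain ⟨-, rfl, heq⟩ := heq
  obtain rfl := eq_of_heq heq
  refine ⟨c.symm.trans c', fun u => ⟨a (c.symm u), ?_, ha' _⟩⟩
  have := ha (c.symm u)
  rwa [Equiv.apply_symm_apply] at this

theorem not_isChild_root {v : V} : ¬IsChild G r v r := fun h => by
  have := h.2
  rw [SimpleGraph.dist_self] at this
  omega

/-- A rooted tree is determined, up to isomorphism, by its shape. -/
theorem exists_iso_of_hasShape (hG : G.IsTree) (hH : H.IsTree) {t : BranchedFraction}
    (h : HasShape G r r t) (h' : HasShape H s s t) : ∃ f : G ≃g H, f r = s := by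
  classical
  -- For vertices of a common shape, σ matches their children, again with common shapes; in all
  -- other cases its value is irrelevant. The map f follows these matchings down from the root.
  have hσ : ∀ v x, ∃ σ : V → W, (∃ t, HasShape G r v t ∧ HasShape H s x t) →
      (∀ u, IsChild G r v u → IsChild H s x (σ u) ∧ ∃ t, HasShape G r u t ∧ HasShape H s (σ u) t) ∧
      (∀ u u', IsChild G r v u → IsChild G r v u' → σ u = σ u' → u = u') ∧
      ∀ y, IsChild H s x y → ∃ u, IsChild G r v u ∧ σ u = y := fun v x => by
    by_cases hex : ∃ t, HasShape G r v t ∧ HasShape H s x t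
    · obtain ⟨t, h1, h2⟩ := hex
      obtain ⟨σ, hσ⟩ := h1.exists_equiv_children h2
      refine ⟨fun u => if hu : IsChild G r v u then σ ⟨u, hu⟩ else s, fun _ =>
        ⟨fun u hu => ?_, fun u u' hu hu' heq => ?_, fun y hy => ?_⟩⟩
      · simp only [dif_pos hu]
        exact ⟨(σ ⟨u, hu⟩).2, hσ ⟨u, hu⟩⟩
      · simp only [dif_pos hu, dif_pos hu'] at heq
        exact congrArg Subtype.val (σ.injective (Subtype.ext heq))
      · refine ⟨σ.symm ⟨y, hy⟩, (σ.symm ⟨y, hy⟩).2, ?_⟩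
        simp only [dif_pos (σ.symm ⟨y, hy⟩).2]
        simp
    · exact ⟨fun _ => s, fun h => absurd h hex⟩
  choose σ hσ using hσ
  obtain ⟨f, hfr, hf⟩ := exists_root_recursion (r := r) hG s fun e x => σ e.1.fst x e.1.snd
  have hshape : ∀ v, ∃ t, HasShape G r v t ∧ HasShape H s (f v) t :=
    root_induction hG (r := r) ⟨t, h, hfr ▸ h'⟩ fun e ih => by
      rw [hf e]
      exact ((hσ _ _ ih).1 _ (isChild_iff.mpr ⟨e, rfl, rfl⟩)).2
  have hfc : ∀ {v u}, IsChild G r v u → f u = σ v (f v) u := fun {v u} hu => by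
    obtain ⟨e, rfl, rfl⟩ := isChild_iff.mp hu
    exact hf e
  have hchild : ∀ {v u}, IsChild G r v u → IsChild H s (f v) (f u) := fun {v u} hu => by
    rw [hfc hu]
    exact ((hσ _ _ (hshape v)).1 u hu).1
  have hparent : ∀ u, u = r ∨ ∃ v, IsChild G r v u := fun u => by
    by_cases hu : u = r
    · exact Or.inl hu
    · obtain ⟨e, he⟩ := exists_edge_to hG hu
      exact Or.inr ⟨_, isChild_iff.mpr ⟨e, rfl, he⟩⟩
  -- By induction from the root: equal images have the same parent in H, so the parents in G agree
  -- by induction, and σ is injective on the children of a vertex.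
  have hinj : ∀ u u', f u = f u' → u = u' := by
    refine root_induction hG (r := r) (fun u' hu => ?_) fun e ih u' hu => ?_
    · rcases hparent u' with rfl | ⟨v', hv'⟩
      · rfl
      · have := hchild hv'
        rw [← hu, hfr] at this
        exact absurd this not_isChild_root
    · have he : IsChild G r e.1.fst e.1.snd := isChild_iff.mpr ⟨e, rfl, rfl⟩
      rcases hparent u' with rfl | ⟨v', hv'⟩
      · have := hchild he
        rw [hu, hfr] at this
        exact absurd this not_isChild_root
      · have h2 := hchild hv'
        rw [← hu] at h2
        obtain rfl := ih v' (IsChild.unique_parent hH (hchild he) h2)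
        refine (hσ _ _ (hshape _)).2.1 _ _ he hv' ?_
        rw [← hfc he, ← hfc hv', hu]
  have hinj' : Function.Injective f := fun u u' => hinj u u'
  have hsurj : ∀ y, ∃ u, f u = y :=
    root_induction hH (r := s) ⟨r, hfr⟩ fun e ih => by
      obtain ⟨v, hv⟩ := ih
      obtain ⟨u, hu, hy⟩ := (hσ v (f v) (hshape v)).2.2 e.1.snd (isChild_iff.mpr ⟨e, hv.symm, rfl⟩)
      exact ⟨u, by rw [hfc hu, hy]⟩
  have hiff : ∀ v u, IsChild H s (f v) (f u) ↔ IsChild G r v u := fun v u => by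
    refine ⟨fun hc => ?_, hchild⟩
    rcases hparent u with rfl | ⟨v', hv'⟩
    · rw [hfr] at hc
      exact absurd hc not_isChild_root
    · rwa [hinj v v' (IsChild.unique_parent hH hc (hchild hv'))]
  refine ⟨⟨Equiv.ofBijective f ⟨hinj', hsurj⟩, fun {v u} => ?_⟩, hfr⟩
  change H.Adj (f v) (f u) ↔ G.Adj v u
  rw [adj_iff_edge hG (r := r), adj_iff_edge hH (r := s)]
  simp only [← isChild_iff, hiff]

end ContinuedFraction

/-! ### Recovery of the roots and of the ratio from the spectra. -/

section Recovery

set_option linter.unusedSectionVars false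

variable {V : Type u} [Fintype V] [DecidableEq V]
variable {G : SimpleGraph V} [DecidableRel G.Adj] {r : V}

theorem HasMultiplicities.of_finrank_eq {F F' : Type*} [AddCommGroup F] [Module ℂ F]
    [AddCommGroup F'] [Module ℂ F'] {E : ℂ → Submodule ℂ F} {E' : ℂ → Submodule ℂ F'} {d d' : ℝ → ℕ}
    (hE : HasMultiplicities E d) (hE' : HasMultiplicities E' d')
    (h : ∀ z, Module.finrank ℂ (E' z) = Module.finrank ℂ (E z)) : HasMultiplicities E' d :=
  ⟨hE'.1, hE'.2.1, fun x => (h x).trans (hE.2.2 x)⟩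

theorem prod_map_sum {ι M : Type*} [CommMonoid M] (A : Finset ι) (m : ι → Multiset ℝ)
    (f : ℝ → M) : ((∑ i ∈ A, m i).map f).prod = ∏ i ∈ A, ((m i).map f).prod := by
  rw [← Multiset.coe_mapAddMonoidHom, map_sum, Multiset.prod_sum]

theorem exists_root_edge (hd : ∀ v, 0 < G.degree v) : ∃ e : Edge G r, e.1.fst = r := by
  obtain ⟨w, hw⟩ := Finset.card_pos.mp (hd r)
  obtain ⟨e, he, -⟩ := exists_edge_of_mem_neighborFinset hw
  exact ⟨e, he⟩

variable {l : ℝ} {q : Edge G r → ℝ → ℝ}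

/-- The listing may belong to any problem with the same multiplicities, with its own p. So the lemma
serves both for the tree itself and for a second tree with the same spectrum. -/
theorem roots_psi_of_listing (hG : G.IsTree) (hd : ∀ v, 0 < G.degree v) (hV : 2 ≤ Fintype.card V)
    (hl : 0 < l) (hq : ∀ e, MemLp (q e) 2 (volume.restrict (Ioo 0 l)))
    {F : Type*} [AddCommGroup F] [Module ℂ F] {E : ℂ → Submodule ℂ F} {d : ℝ → ℕ}
    (hE : HasMultiplicities E d) (h : HasMultiplicities (neumannSpace G r l q) d)
    {p : ℕ} (hp : 2 ≤ p) {α : ℕ → ℝ} {lam : ℕ → ℕ → ℝ}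
    (hL : ListsSpectrum E (neumannIndex p) fun x => lam x.1 x.2)
    (hA : NeumannAsymptotics p l α lam) : (psi G).roots = (Finset.Icc 1 p).val.map α := by
  obtain ⟨α', lam', hL', hA', hR⟩ := exists_neumann_listing hG (exists_root_edge hd) hd hV hl hq
  rw [hR, neumann_constants_unique hE h hp hV hl hL hA hL' hA']

theorem roots_psiHatBranch_of_listing (hG : G.IsTree) (hd : ∀ v, 0 < G.degree v)
    (hl : 0 < l) (hq : ∀ e, MemLp (q e) 2 (volume.restrict (Ioo 0 l))) {w : V}
    (hw : w ∈ G.neighborFinset r) {β : ℕ → ℝ} {nu : ℕ → ℕ → ℝ}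
    (hL : ListsSpectrum (dirichletBranchSpace G r l q w) (branchIndex (branch G r w).card)
      fun x => nu x.1 x.2)
    (hA : DirichletAsymptotics (branch G r w).card l β nu) :
    (psiHatBranch G r w).roots = (Finset.Icc 1 (branch G r w).card).val.map β := by
  obtain ⟨d, β', nu', h⟩ := exists_dirichlet_listing (r := r) hG hd hl hq
  obtain ⟨h1, h2, h3, h4⟩ := h w hw
  rw [h4]
  exact dirichlet_branch_constants_unique hl (h1.listsSpectrum_iff.mp h2) h3
    (h1.listsSpectrum_iff.mp hL) hA

theorem exists_hasMultiplicities_dirichlet (hG : G.IsTree) (hd : ∀ v, 0 < G.degree v)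
    (hl : 0 < l) (hq : ∀ e, MemLp (q e) 2 (volume.restrict (Ioo 0 l))) :
    ∃ d, HasMultiplicities (dirichletSpace G r l q) d := by
  obtain ⟨d, β, nu, h⟩ := exists_dirichlet_listing (r := r) hG hd hl hq
  exact ⟨_, hasMultiplicities_dirichlet hG (exists_root_edge hd) hl hq fun w hw => (h w hw).1⟩

theorem exists_dirichlet_splitting (hG : G.IsTree) (hd : ∀ v, 0 < G.degree v)
    (hl : 0 < l) (hq : ∀ e, MemLp (q e) 2 (volume.restrict (Ioo 0 l))) :
    ∃ (β : V → ℕ → ℝ) (nu : V → ℕ → ℕ → ℝ),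
      ListsSpectrum (dirichletSpace G r l q) (dirichletIndex G r)
        (fun x => nu x.1 x.2.1 x.2.2) ∧
      (∀ w ∈ G.neighborFinset r,
        ListsSpectrum (dirichletBranchSpace G r l q w) (branchIndex (branch G r w).card)
          (fun x => nu w x.1 x.2) ∧
        DirichletAsymptotics (branch G r w).card l (β w) (nu w)) ∧
      (psiHat G r).roots =
        ∑ w ∈ G.neighborFinset r, (Finset.Icc 1 (branch G r w).card).val.map (β w) := by
  obtain ⟨d, β, nu, h⟩ := exists_dirichlet_listing (r := r) hG hd hl hq
  refine ⟨β, nu, ?_, fun w hw => ⟨(h w hw).2.1, (h w hw).2.2.1⟩, ?_⟩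
  · rw [(hasMultiplicities_dirichlet hG (exists_root_edge hd) hl hq
      fun w hw => (h w hw).1).listsSpectrum_iff]
    exact encard_dirichletIndex fun w hw => (h w hw).1.listsSpectrum_iff.mp (h w hw).2.1
  · rw [roots_psiHat hG hd]
    exact Finset.sum_congr rfl fun w hw => (h w hw).2.2.2

/-- The listing may come from another tree with other branches: the spectrum determines the union of
the constants over the branches, and ψ̂ needs no more. -/
theorem roots_psiHat_of_listing (hG : G.IsTree) (hd : ∀ v, 0 < G.degree v)
    (hl : 0 < l) (hq : ∀ e, MemLp (q e) 2 (volume.restrict (Ioo 0 l)))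
    {W : Type w} [Fintype W] [DecidableEq W] {H : SimpleGraph W} [DecidableRel H.Adj] {s : W}
    {F : Type*} [AddCommGroup F] [Module ℂ F] {E : ℂ → Submodule ℂ F} {d : ℝ → ℕ}
    (hE : HasMultiplicities E d) (h : HasMultiplicities (dirichletSpace G r l q) d)
    {β : W → ℕ → ℝ} {nu : W → ℕ → ℕ → ℝ}
    (hL : ListsSpectrum E (dirichletIndex H s) fun x => nu x.1 x.2.1 x.2.2)
    (hA : ∀ w ∈ H.neighborFinset s, DirichletAsymptotics (branch H s w).card l (β w) (nu w)) :
    (psiHat G r).roots =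
      ∑ w ∈ H.neighborFinset s, (Finset.Icc 1 (branch H s w).card).val.map (β w) := by
  obtain ⟨β', nu', hL', hA', hR⟩ := exists_dirichlet_splitting (r := r) hG hd hl hq
  rw [hR]
  exact dirichlet_constants_unique hl (h.listsSpectrum_iff.mp hL') (fun w hw => (hA' w hw).2)
    (hE.listsSpectrum_iff.mp hL) hA

/-- The two spectra and the degree of the root determine the ratio. -/
theorem ratio_eq_of_finrank_eq (hG : G.IsTree) (hd : ∀ v, 0 < G.degree v)
    (hV : 2 ≤ Fintype.card V) (hl : 0 < l) (hq : ∀ e, MemLp (q e) 2 (volume.restrict (Ioo 0 l)))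
    {W : Type w} [Fintype W] [DecidableEq W] {H : SimpleGraph W} [DecidableRel H.Adj] {s : W}
    {q' : Edge H s → ℝ → ℝ} (hH : H.IsTree) (hd' : ∀ v, 0 < H.degree v) (hW : 2 ≤ Fintype.card W)
    (hq' : ∀ e, MemLp (q' e) 2 (volume.restrict (Ioo 0 l))) (hr : H.degree s = G.degree r)
    (hN : ∀ z, Module.finrank ℂ (neumannSpace H s l q' z) =
      Module.finrank ℂ (neumannSpace G r l q z))
    (hD : ∀ z, Module.finrank ℂ (dirichletSpace H s l q' z) =
      Module.finrank ℂ (dirichletSpace G r l q z)) : ratio H s = ratio G r := by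
  have hNG := hasMultiplicities_neumann hG (exists_root_edge hd) hl hq
  have hNH := hNG.of_finrank_eq (hasMultiplicities_neumann hH (exists_root_edge hd') hl hq') hN
  obtain ⟨d, hDG⟩ := exists_hasMultiplicities_dirichlet (r := r) hG hd hl hq
  obtain ⟨d', hDH'⟩ := exists_hasMultiplicities_dirichlet (r := s) hH hd' hl hq'
  have hDH := hDG.of_finrank_eq hDH' hD
  obtain ⟨α, lam, hL, hA, hR⟩ := exists_neumann_listing hG (exists_root_edge hd) hd hV hl hq
  obtain ⟨β, nu, hL', hA', hR'⟩ := exists_dirichlet_splitting (r := r) hG hd hl hq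
  -- The listings for G also list the spectra of H, so the roots for both trees are expressed by the
  -- same constants.
  rw [ratio_eq_roots hd, ratio_eq_roots hd', hr, hR, hR',
    roots_psi_of_listing hH hd' hW hl hq' hNG hNH hV hL hA,
    roots_psiHat_of_listing hH hd' hl hq' hDG hDH hL' fun w hw => (hA' w hw).2]

end Recovery

end

end QuantumTree

open QuantumTree

theorem theorem4p1 {V : Type u} [Fintype V] [DecidableEq V] [Nontrivial V]
    (G : SimpleGraph V) [DecidableRel G.Adj] (hG : G.IsTree) (r : V)
    (l : ℝ) (hl : 0 < l) (q : Edge G r → ℝ → ℝ)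
    (hq : ∀ e, MemLp (q e) 2 (volume.restrict (Ioo 0 l))) :
    -- the Neumann spectrum splits into subsequences with the asymptotics
    (∃ (α : ℕ → ℝ) (lam : ℕ → ℕ → ℝ),
      ListsSpectrum (neumannSpace G r l q) (neumannIndex (Fintype.card V))
        (fun x => lam x.1 x.2) ∧
      NeumannAsymptotics (Fintype.card V) l α lam) ∧
    -- for every such splitting the constants are the zeros of `ψ`, with multiplicities
    (∀ (α : ℕ → ℝ) (lam : ℕ → ℕ → ℝ),
      ListsSpectrum (neumannSpace G r l q) (neumannIndex (Fintype.card V))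
        (fun x => lam x.1 x.2) →
      NeumannAsymptotics (Fintype.card V) l α lam →
      (psi G).roots = (Finset.Icc 1 (Fintype.card V)).val.map α) ∧
    -- the Dirichlet spectrum is the union of the spectra of the subtrees at the root, which split
    -- into subsequences with the asymptotics
    (∃ (β : V → ℕ → ℝ) (nu : V → ℕ → ℕ → ℝ),
      ListsSpectrum (dirichletSpace G r l q) (dirichletIndex G r)
        (fun x => nu x.1 x.2.1 x.2.2) ∧
      ∀ w ∈ G.neighborFinset r,
        ListsSpectrum (dirichletBranchSpace G r l q w) (branchIndex (branch G r w).card)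
          (fun x => nu w x.1 x.2) ∧
        DirichletAsymptotics (branch G r w).card l (β w) (nu w)) ∧
    -- for every such splitting the constants are the zeros of the factors of `ψ̂`
    (∀ w ∈ G.neighborFinset r, ∀ (β : ℕ → ℝ) (nu : ℕ → ℕ → ℝ),
      ListsSpectrum (dirichletBranchSpace G r l q w) (branchIndex (branch G r w).card)
        (fun x => nu x.1 x.2) →
      DirichletAsymptotics (branch G r w).card l β nu →
      (psiHatBranch G r w).roots = (Finset.Icc 1 (branch G r w).card).val.map β) ∧
    psiHat G r = ∏ w ∈ G.neighborFinset r, psiHatBranch G r w ∧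
    psiHat G r ≠ 0 ∧
    -- the formula for the ratio, for all constants in the asymptotics of the two spectra
    (∀ (α : ℕ → ℝ) (lam : ℕ → ℕ → ℝ) (β : V → ℕ → ℝ) (nu : V → ℕ → ℕ → ℝ),
      ListsSpectrum (neumannSpace G r l q) (neumannIndex (Fintype.card V))
        (fun x => lam x.1 x.2) →
      NeumannAsymptotics (Fintype.card V) l α lam →
      ListsSpectrum (dirichletSpace G r l q) (dirichletIndex G r)
        (fun x => nu x.1 x.2.1 x.2.2) →
      (∀ w ∈ G.neighborFinset r,
        DirichletAsymptotics (branch G r w).card l (β w) (nu w)) →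
      ratio G r = (G.degree r : RatFunc ℝ) *
        ((∏ i ∈ Finset.Icc 1 (Fintype.card V), (-RatFunc.X + RatFunc.C (α i))) /
          ∏ w ∈ G.neighborFinset r, ∏ j ∈ Finset.Icc 1 (branch G r w).card,
            (-RatFunc.X + RatFunc.C (β w j)))) ∧
    -- the two spectra and the degree of the root determine the ratio
    (∀ (W : Type w) [Fintype W] [DecidableEq W] [Nontrivial W]
      (H : SimpleGraph W) [DecidableRel H.Adj] (s : W) (q' : Edge H s → ℝ → ℝ),
      H.IsTree → (∀ e, MemLp (q' e) 2 (volume.restrict (Ioo 0 l))) →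
      H.degree s = G.degree r →
      (∀ z, Module.finrank ℂ (neumannSpace H s l q' z) =
        Module.finrank ℂ (neumannSpace G r l q z)) →
      (∀ z, Module.finrank ℂ (dirichletSpace H s l q' z) =
        Module.finrank ℂ (dirichletSpace G r l q z)) →
      ratio H s = ratio G r) ∧
    -- the ratio is expanded into a branched continued fraction of the shape of the tree, and the
    -- rooted tree can be read off from this expansion
    (∃ t, HasShape G r r t) ∧
    (∀ t, HasShape G r r t →
      t.Proper ∧ ratio G r = -t.value ∧
      ∀ (W : Type w) [Fintype W] (H : SimpleGraph W) [DecidableRel H.Adj] (s : W),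
        H.IsTree → HasShape H s s t → ∃ f : G ≃g H, f r = s) := by
  have hd : ∀ v, 0 < G.degree v := fun v =>
    hG.connected.preconnected.degree_pos_of_nontrivial v
  have hr : ∃ e : Edge G r, e.1.fst = r := exists_root_edge hd
  have hV : 2 ≤ Fintype.card V := Fintype.one_lt_card
  have hN := hasMultiplicities_neumann hG hr hl hq
  obtain ⟨d, hD⟩ := exists_hasMultiplicities_dirichlet (r := r) hG hd hl hq
  refine ⟨?_, fun α lam hL hA => roots_psi_of_listing hG hd hV hl hq hN hN hV hL hA, ?_,
    fun w hw β nu hL hA => roots_psiHatBranch_of_listing hG hd hl hq hw hL hA,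
    psiHat_eq_prod hG hd, psiHat_ne_zero hG hd, ?_, ?_, exists_hasShape hG r, ?_⟩
  · obtain ⟨α, lam, hL, hA, -⟩ := exists_neumann_listing hG hr hd hV hl hq
    exact ⟨α, lam, hL, hA⟩
  · obtain ⟨β, nu, hL, hA, -⟩ := exists_dirichlet_splitting (r := r) hG hd hl hq
    exact ⟨β, nu, hL, hA⟩
  · intro α lam β nu hL hA hL' hA'
    rw [ratio_eq_roots hd, roots_psi_of_listing hG hd hV hl hq hN hN hV hL hA,
      roots_psiHat_of_listing hG hd hl hq hD hD hL' hA', prod_map_sum]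
    simp only [Multiset.map_map]
    rfl
  · intro W _ _ _ H _ s q' hH hq' hs hN' hD'
    exact ratio_eq_of_finrank_eq hG hd hV hl hq hH
      (fun v => hH.connected.preconnected.degree_pos_of_nontrivial v) Fintype.one_lt_card hq' hs hN' hD'
  · intro t ht
    obtain ⟨Q, hQ⟩ := exists_isContinuant (r := r) hG (RatFunc.X : RatFunc ℝ)
    obtain ⟨hv, hP⟩ := ht.value_eq hG hd hQ
    refine ⟨hP, by rw [ratio_eq_neg hG hd hQ, hv], fun W _ H _ s hH ht' => ?_⟩
    classical
    exact exists_iso_of_hasShape hG hH ht ht'
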